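/- Conventions. Two-forms of an almost complex structure $I$ are $\omega=g(I\cdot,\cdot)$; $\mathfrak L$ is the Lie derivative. A triple $(\sigma_1,\sigma_2,\sigma_3)$ of closed 2-forms on a manifold $M$ is a \emph{hyperkähler triple} if there are a Riemannian metric $g_M$ and integrable almost complex structures $I_1,I_2,I_3$ on $M$, orthogonal for $g_M$ and satisfying the quaternion relations ($I_iI_j=I_k=-I_jI_i$ for $(i,j,k)$ cyclic), such that $\sigma_i=g_M(I_i\cdot,\cdot)$. Let $(\bar N^{4n},\bar g)$, $n\ge 1$, be a quaternion-Kähler (QK) manifold of negative scalar curvature: its rank-3 bundle $\mathcal G\subset \mathrm{End}(T\bar N)$, locally spanned by orthogonal almost complex structures $\bar I_1,\bar I_2,\bar I_3$ satisfying the quaternion relations, is parallel for the Levi-Civita connection $\nabla$ (equivalently for $n\ge2$, the 4-form $\bar\Omega=\frac12\sum_i\bar\omega_i\wedge\bar\omega_i$ is parallel); if $n=1$, $\bar g$ is moreover Einstein and its Weyl curvature annihilates the 2-forms belonging to $\mathcal G$. The metric is scaled so that $\mathrm{scal}(\bar g)=-16n(n+2)$. Let $Z$ be a Killing field on $\bar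 N$, $Z^\flat=\bar g(Z,\cdot)$, such that the $\mathfrak{sp}(1)$-component $(dZ^\flat)^{\mathfrak{sp}(1)}$ (the projection of $dZ^\flat$ to $\langle\bar\omega_1,\bar\omega_2,\bar\omega_3\rangle$) vanishes nowhere, and put $$\bar\omega_1=(2n)^{1/2}\,(dZ^\flat)^{\mathfrak{sp}(1)}/\|(dZ^\flat)^{\mathfrak{sp}(1)}\|.$$ Suppose that $\bar N$ is covered by open sets $U$ over which $\bar\omega_1$ is completed to a quaternionic frame $(\bar\omega_1,\bar\omega_2,\bar\omega_3)$ with $\mathfrak L_Z\bar\omega_2=\mathfrak L_Z\bar\omega_3=0$ (so $Z$ preserves $\mathcal G$ and $\bar\Omega$). Let $\beta,\alpha_2,\alpha_3$ be the connection 1-forms of this frame: $$\nabla\bar\omega_1=-\alpha_2\otimes\bar\omega_2+\alpha_3\otimes\bar\omega_3,\quad \nabla\bar\omega_2=\alpha_2\otimes\bar\omega_1+\beta\otimes\bar\omega_3,\quad \nabla\bar\omega_3=-\alpha_3\otimes\bar\omega_1-\beta\otimes\bar\omega_2 ,$$ and assume $\beta(Z)>2\|Z\|$ on each $U$. Integrality: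 assume that there is a principal $S^1$-bundle $\pi:P\to\bar N$ with fibre coordinates $x$ (mod $2\pi$) over the sets $U$, changing to $x+s$ under the action of $e^{is}$, such that, with $f=\cos(2x)$ and $h=\sin(2x)$, the 2-forms $h\bar\omega_2+f\bar\omega_3$ and $h\bar\omega_3-f\bar\omega_2$ on $P$ do not depend on the choice of $U$. (Then $\xi_X=dx+2\beta(Z)^{-1}Z^\flat-\frac12\beta$ is a globally defined connection form on $P$; if $\bar\omega_2,\bar\omega_3$ are global, one may take $P=\bar N\times S^1$.) Let $\tilde Z$ be the lift of $Z$ to $P$ with $dx(\tilde Z)=0$, and suppose that the space of orbits of the (local) flow of $\tilde Z$ is a manifold $M^{4n}$, i.e. that there is a smooth surjective submersion $q:P\to M$ onto a manifold whose fibres are exactly these orbits. Theorem. The 2-forms $$\sigma_1=-d\big(\beta(Z)^{-1}(2\,dx-\beta)\big),\quad \sigma_2=-d\big(\beta(Z)^{-1}(h\,\alpha_3+f\,\alpha_2)\big),\quad \sigma_3=-d\big(\beta(Z)^{-1}(h\,\alpha_2-f\,\alpha_3)\big)$$ on $P$ descend to $M$ (they are pullbacks by $q$ of 2-forms on $M$,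 denoted in the same way) and define a hyperkähler triple on $M$. Moreover the circle action on $P$ generated by $\partial_x$ induces a smooth $S^1$-action on $M$ that preserves $\sigma_1$ and rotates $\sigma_2,\sigma_3$: $e^{is}$ pulls back $\sigma_2$ to $\cos(2s)\sigma_2-\sin(2s)\sigma_3$ and $\sigma_3$ to $\sin(2s)\sigma_2+\cos(2s)\sigma_3$. -/

import Mathlib

open Bundle
open scoped Manifold ContDiff Topology InnerProductSpace

noncomputable section

namespace HKQK

/-! ## Tensor fields and differential forms on a smooth manifold -/

section Forms

variable {m m' k : ℕ}
  {X : Type*} [TopologicalSpace X] [ChartedSpace (EuclideanSpace ℝ (Fin m)) X]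
  {Y : Type*} [TopologicalSpace Y] [ChartedSpace (EuclideanSpace ℝ (Fin m')) Y]

variable (m X) in
/-- Vector fields on the `m`-manifold `X` (no regularity imposed). -/
abbrev VectField : Type _ := Π p : X, TangentSpace (𝓡 m) p

variable (m X) in
/-- Fields of covectors on `X`. -/
abbrev Covect : Type _ := Π p : X, TangentSpace (𝓡 m) p →L[ℝ] ℝ

variable (m X) in
/-- Fields of endomorphisms of the tangent bundle of `X`. -/
abbrev EndoField : Type _ :=
  Π p : X, TangentSpace (𝓡 m) p →L[ℝ] TangentSpace (𝓡 m) p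

/-- Fields of alternating `k`-forms on `X`. -/
abbrev DForm (m : ℕ) (X : Type*) [TopologicalSpace X]
    [ChartedSpace (EuclideanSpace ℝ (Fin m)) X] (k : ℕ) : Type _ :=
  Π p : X, TangentSpace (𝓡 m) p [⋀^Fin k]→L[ℝ] ℝ

/-- A field of covectors as a differential `1`-form. -/
def toForm (θ : Covect m X) : DForm m X 1 :=
  fun p ↦ ContinuousAlternatingMap.ofSubsingleton ℝ (TangentSpace (𝓡 m) p) ℝ (0 : Fin 1) (θ p)

/-- The pullback of a differential form by a map of manifolds. -/
def pullback (f : X → Y) (η : DForm m' Y k) : DForm m X k :=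
  fun p ↦ (η (f p)).compContinuousLinearMap (mfderiv (𝓡 m) (𝓡 m') f p)

/-- The form `η` written in the chart of `X` around `p`. -/
def inChart (η : DForm m X k) (p : X) :
    EuclideanSpace ℝ (Fin m) → EuclideanSpace ℝ (Fin m) [⋀^Fin k]→L[ℝ] ℝ :=
  fun y ↦ (η ((extChartAt (𝓡 m) p).symm y)).compContinuousLinearMap
    (mfderiv (𝓡 m) (𝓡 m) (extChartAt (𝓡 m) p).symm y)

/-- Smoothness of a form on an open set `U`: all its chart expressions are smooth. -/
def SmoothFormOn (η : DForm m X k) (U : Set X) : Prop :=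
  ∀ p : X, ContDiffOn ℝ ∞ (inChart η p)
    ((extChartAt (𝓡 m) p).target ∩ (extChartAt (𝓡 m) p).symm ⁻¹' U)

/-- The exterior derivative, computed in the chart around each point. -/
def d (η : DForm m X k) : DForm m X (k + 1) :=
  fun p ↦ (extDeriv (inChart η p) (extChartAt (𝓡 m) p p)).compContinuousLinearMap
    (mfderiv (𝓡 m) (𝓡 m) (extChartAt (𝓡 m) p) p)

variable [IsManifold (𝓡 m) ∞ X]

/-- `L_Z B = 0` on `U`, for a field `B` of bilinear forms:
`Z(B(V, W)) = B([Z, V], W) + B(V, [Z, W])`. -/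
def IsLieInvariantOn (Z : VectField m X)
    (B : Π p : X, TangentSpace (𝓡 m) p → TangentSpace (𝓡 m) p → ℝ) (U : Set X) : Prop :=
  ∀ p ∈ U, ∀ V W : VectField m X,
    MDifferentiableAt (𝓡 m) (𝓡 m).tangent
      (fun y ↦ (⟨y, V y⟩ : TangentBundle (𝓡 m) X)) p →
    MDifferentiableAt (𝓡 m) (𝓡 m).tangent
      (fun y ↦ (⟨y, W y⟩ : TangentBundle (𝓡 m) X)) p →
    mvfderiv (𝓡 m) (fun y ↦ B y (V y) (W y)) p (Z p) =
      B p (VectorField.mlieBracket (𝓡 m) Z V p) (W p) +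
        B p (V p) (VectorField.mlieBracket (𝓡 m) Z W p)

/-- The `1`-form `dx` of a circle-valued function `c = e^{ix}`, that is `dx = Im (c̄ dc)`. -/
def dAngle (c : X → Circle) : Covect m X := fun p ↦
  Complex.imCLM ∘L
    ((ContinuousLinearMap.mul ℝ ℂ (starRingEnd ℂ (c p : ℂ))) ∘L
      (mvfderiv (𝓡 m) (fun y ↦ (c y : ℂ)) p))

/-- `cos (2x)` for `c = e^{ix}`. -/
def cosTwo (c : Circle) : ℝ := ((c : ℂ) ^ 2).re

/-- `sin (2x)` for `c = e^{ix}`. -/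
def sinTwo (c : Circle) : ℝ := ((c : ℂ) ^ 2).im

/-- `p` and `p'` lie on one orbit of the (local) flow of the vector field `V`. -/
def SameOrbit (V : VectField m X) (p p' : X) : Prop :=
  ∃ (γ : ℝ → X) (s : Set ℝ), IsOpen s ∧ s.OrdConnected ∧
    IsMIntegralCurveOn (I := 𝓡 m) γ V s ∧ (∃ t ∈ s, γ t = p) ∧ ∃ t ∈ s, γ t = p'

/-- The quaternion relations for three endomorphisms `J 0 = I₁`, `J 1 = I₂`, `J 2 = I₃`. -/
structure QuaternionRelations {V : Type*} [AddCommGroup V] [TopologicalSpace V]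
    [IsTopologicalAddGroup V] [Module ℝ V] (J : Fin 3 → V →L[ℝ] V) : Prop where
  sq : ∀ a v, J a (J a v) = -v
  mul : ∀ a v, J a (J (a + 1) v) = J (a + 2) v
  anti : ∀ a v, J (a + 1) (J a v) = -J (a + 2) v

/-- Smoothness of a vector field. -/
def SmoothVectField (V : VectField m X) : Prop :=
  ContMDiff (𝓡 m) (𝓡 m).tangent ∞ (fun y ↦ (⟨y, V y⟩ : TangentBundle (𝓡 m) X))

/-- Smoothness on `U` of a field of endomorphisms. -/
def SmoothEndoOn (J : EndoField m X) (U : Set X) : Prop :=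
  ContMDiffOn (𝓡 m)
    ((𝓡 m).prod 𝓘(ℝ, EuclideanSpace ℝ (Fin m) →L[ℝ] EuclideanSpace ℝ (Fin m))) ∞
    (fun p ↦ TotalSpace.mk' (EuclideanSpace ℝ (Fin m) →L[ℝ] EuclideanSpace ℝ (Fin m))
      (E := fun p : X ↦ TangentSpace (𝓡 m) p →L[ℝ] TangentSpace (𝓡 m) p) p (J p)) U

/-- Vanishing of the Nijenhuis tensor: the almost complex structure `J` is integrable. -/
def NijenhuisVanishes (J : EndoField m X) : Prop :=
  ∀ (p : X) (V W : VectField m X),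
    MDifferentiableAt (𝓡 m) (𝓡 m).tangent
      (fun y ↦ (⟨y, V y⟩ : TangentBundle (𝓡 m) X)) p →
    MDifferentiableAt (𝓡 m) (𝓡 m).tangent
      (fun y ↦ (⟨y, W y⟩ : TangentBundle (𝓡 m) X)) p →
    VectorField.mlieBracket (𝓡 m) (fun y ↦ J y (V y)) (fun y ↦ J y (W y)) p
      - J p (VectorField.mlieBracket (𝓡 m) (fun y ↦ J y (V y)) W p)
      - J p (VectorField.mlieBracket (𝓡 m) V (fun y ↦ J y (W y)) p)
      - VectorField.mlieBracket (𝓡 m) V W p = 0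

/-- `(τ 0, τ 1, τ 2) = (σ₁, σ₂, σ₃)` is a hyperkähler triple: there are a Riemannian metric `g` and
integrable almost complex structures `I₁, I₂, I₃` satisfying the quaternion relations, `g` is
Hermitian for each of them, `σₐ = g(Iₐ ·, ·)`, and the `σₐ` are closed. -/
def IsHyperkahlerTriple (τ : Fin 3 → DForm m X 2) : Prop :=
  ∃ (g : ContMDiffRiemannianMetric (𝓡 m) ∞ (EuclideanSpace ℝ (Fin m))
      (fun p : X ↦ TangentSpace (𝓡 m) p)) (I : Fin 3 → EndoField m X),
    (∀ a, SmoothEndoOn (I a) Set.univ) ∧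
    (∀ p, QuaternionRelations (fun a ↦ I a p)) ∧
    (∀ a, NijenhuisVanishes (I a)) ∧
    (∀ a p v w, g.inner p (I a p v) (I a p w) = g.inner p v w) ∧
    (∀ a p v w, τ a p ![v, w] = g.inner p (I a p v) w) ∧
    (∀ a, SmoothFormOn (τ a) Set.univ) ∧
    (∀ a, d (τ a) = 0)

end Forms

/-! ## Levi-Civita connection and curvature -/

section Curvature

variable {m : ℕ}
  {X : Type*} [TopologicalSpace X] [ChartedSpace (EuclideanSpace ℝ (Fin m)) X]
  [IsManifold (𝓡 m) ∞ X]

variable (m X) in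
/-- Affine connections on `X`; `D W p v` is `∇_v W` at `p`. -/
abbrev AffineConnection : Type _ :=
  CovariantDerivative (𝓡 m) (EuclideanSpace ℝ (Fin m)) (fun p : X ↦ TangentSpace (𝓡 m) p)

/-- The curvature `R(u, v) w = ∇_u ∇_v w - ∇_v ∇_u w - ∇_[u, v] w` of a connection, computed on
local extensions of the tangent vectors `u, v, w` at `p`. -/
def curv (D : AffineConnection m X) (p : X) (u v w : TangentSpace (𝓡 m) p) :
    TangentSpace (𝓡 m) p :=
  let U : VectField m X := FiberBundle.extend (EuclideanSpace ℝ (Fin m)) u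
  let V : VectField m X := FiberBundle.extend (EuclideanSpace ℝ (Fin m)) v
  let W : VectField m X := FiberBundle.extend (EuclideanSpace ℝ (Fin m)) w
  D (fun y ↦ D W y (V y)) p u - D (fun y ↦ D W y (U y)) p v
    - D W p (VectorField.mlieBracket (𝓡 m) U V p)

/-- The covariant derivative `(∇_v J) W` of a field of endomorphisms. -/
def covEndo (D : AffineConnection m X) (J : EndoField m X) (p : X)
    (v : TangentSpace (𝓡 m) p) (W : VectField m X) : TangentSpace (𝓡 m) p :=
  D (fun y ↦ J y (W y)) p v - J p (D W p v)

variable [RiemannianBundle (fun p : X ↦ TangentSpace (𝓡 m) p)]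

/-- `D` is the Levi-Civita connection of the Riemannian metric: smooth, metric and torsion free. -/
structure IsLeviCivita (D : AffineConnection m X) : Prop where
  smooth : CovariantDerivative.ContMDiffCovariantDerivative D ∞
  metric : ∀ (p : X) (V W : VectField m X) (v : TangentSpace (𝓡 m) p),
    MDifferentiableAt (𝓡 m) (𝓡 m).tangent
      (fun y ↦ (⟨y, V y⟩ : TangentBundle (𝓡 m) X)) p →
    MDifferentiableAt (𝓡 m) (𝓡 m).tangent
      (fun y ↦ (⟨y, W y⟩ : TangentBundle (𝓡 m) X)) p →
    mvfderiv (𝓡 m) (fun y ↦ ⟪V y, W y⟫_ℝ) p v = ⟪D V p v, W p⟫_ℝ + ⟪V p, D W p v⟫_ℝ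
  torsion_free : ∀ (p : X) (V W : VectField m X),
    MDifferentiableAt (𝓡 m) (𝓡 m).tangent
      (fun y ↦ (⟨y, V y⟩ : TangentBundle (𝓡 m) X)) p →
    MDifferentiableAt (𝓡 m) (𝓡 m).tangent
      (fun y ↦ (⟨y, W y⟩ : TangentBundle (𝓡 m) X)) p →
    D W p (V p) - D V p (W p) = VectorField.mlieBracket (𝓡 m) V W p

/-- An orthonormal basis of the tangent space at `p`. -/
def onb (p : X) :
    OrthonormalBasis (Fin (Module.finrank ℝ (TangentSpace (𝓡 m) p))) ℝ (TangentSpace (𝓡 m) p) :=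
  haveI : FiniteDimensional ℝ (TangentSpace (𝓡 m) p) :=
    inferInstanceAs (FiniteDimensional ℝ (EuclideanSpace ℝ (Fin m)))
  stdOrthonormalBasis ℝ (TangentSpace (𝓡 m) p)

/-- The Ricci tensor. -/
def ricci (D : AffineConnection m X) (p : X) (v w : TangentSpace (𝓡 m) p) : ℝ :=
  ∑ i, ⟪curv D p (onb p i) v w, onb p i⟫_ℝ

/-- The scalar curvature. -/
def scal (D : AffineConnection m X) (p : X) : ℝ := ∑ i, ricci D p (onb p i) (onb p i)

/-- The Weyl curvature in dimension four. -/
def weyl₄ (D : AffineConnection m X) (p : X) (u v w z : TangentSpace (𝓡 m) p) : ℝ :=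
  ⟪curv D p u v w, z⟫_ℝ
    - (1 / 2) * (ricci D p v w * ⟪u, z⟫_ℝ - ricci D p u w * ⟪v, z⟫_ℝ
        + ⟪v, w⟫_ℝ * ricci D p u z - ⟪u, w⟫_ℝ * ricci D p v z)
    + (scal D p / 6) * (⟪v, w⟫_ℝ * ⟪u, z⟫_ℝ - ⟪u, w⟫_ℝ * ⟪v, z⟫_ℝ)

/-- A smooth local quaternionic frame `(I₁, I₂, I₃) = (J 0, J 1, J 2)` over `U`, orthogonal for the
Riemannian metric. Its `2`-forms are `ωₐ(v, w) = ⟪Iₐ v, w⟫`. -/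
structure IsQuaternionicFrameOn (J : Fin 3 → EndoField m X) (U : Set X) : Prop where
  smooth : ∀ a, SmoothEndoOn (J a) U
  relations : ∀ p ∈ U, QuaternionRelations (fun a ↦ J a p)
  orthogonal : ∀ p ∈ U, ∀ a v w, ⟪J a p v, J a p w⟫_ℝ = ⟪v, w⟫_ℝ

end Curvature

/-! ## Quaternion-Kähler manifolds -/

section QK

variable {n : ℕ}
  {N : Type*} [TopologicalSpace N] [ChartedSpace (EuclideanSpace ℝ (Fin (4 * n))) N]
  [IsManifold (𝓡 (4 * n)) ∞ N]
  [RiemannianBundle (fun p : N ↦ TangentSpace (𝓡 (4 * n)) p)]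

/-- A quaternion-Kähler manifold of dimension `4n` and of negative scalar curvature, normalised by
`scal = -16 n (n + 2)`; `D` is the Levi-Civita connection and `G ⊆ End(TN)` is the rank three
bundle locally spanned by `I₁, I₂, I₃`.
For `n ≥ 2` the condition is that `G` is parallel (the holonomy lies in `Sp(n)Sp(1)`, equivalently
`½ ∑ ωₐ ∧ ωₐ` is parallel). In dimension four, where this holds automatically, one asks instead
that the metric is Einstein and half conformally flat, i.e. that the Weyl curvature annihilates
the `2`-forms belonging to `G`. -/
structure IsNegativeQK (D : AffineConnection (4 * n) N)
    (G : Π p : N, Submodule ℝ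
      (TangentSpace (𝓡 (4 * n)) p →L[ℝ] TangentSpace (𝓡 (4 * n)) p)) : Prop where
  leviCivita : IsLeviCivita D
  local_frame : ∀ p : N, ∃ (U : Set N) (J : Fin 3 → EndoField (4 * n) N),
    IsOpen U ∧ p ∈ U ∧ IsQuaternionicFrameOn J U ∧
      ∀ y ∈ U, G y = Submodule.span ℝ (Set.range fun a ↦ J a y)
  parallel : ∀ (U : Set N) (J : EndoField (4 * n) N), IsOpen U → SmoothEndoOn J U →
    (∀ y ∈ U, J y ∈ G y) → ∀ p ∈ U, ∀ v : TangentSpace (𝓡 (4 * n)) p,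
      ∃ A ∈ G p, ∀ W : VectField (4 * n) N,
        MDifferentiableAt (𝓡 (4 * n)) (𝓡 (4 * n)).tangent
          (fun y ↦ (⟨y, W y⟩ : TangentBundle (𝓡 (4 * n)) N)) p →
        covEndo D J p v W = A (W p)
  dim_four : n = 1 →
    (∃ c : ℝ, ∀ p v w, ricci D p v w = c * ⟪v, w⟫_ℝ) ∧
    ∀ p, ∀ A ∈ G p, ∀ w z, ∑ i, weyl₄ D p (onb p i) (A (onb p i)) w z = 0
  scal_eq : ∀ p, scal D p = -16 * (n : ℝ) * ((n : ℝ) + 2)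

/-- `β, α₂, α₃` are the connection forms of `D` on `G` in the frame `J` over `U`:
`∇I₁ = -α₂ I₂ + α₃ I₃`, `∇I₂ = α₂ I₁ + β I₃`, `∇I₃ = -α₃ I₁ - β I₂`
(so that `dω₁ = -α₂ ∧ ω₂ + α₃ ∧ ω₃`, and so on). -/
def AreConnectionForms (D : AffineConnection (4 * n) N) (J : Fin 3 → EndoField (4 * n) N)
    (β α₂ α₃ : Covect (4 * n) N) (U : Set N) : Prop :=
  ∀ p ∈ U, ∀ (v : TangentSpace (𝓡 (4 * n)) p) (W : VectField (4 * n) N),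
    MDifferentiableAt (𝓡 (4 * n)) (𝓡 (4 * n)).tangent
      (fun y ↦ (⟨y, W y⟩ : TangentBundle (𝓡 (4 * n)) N)) p →
    covEndo D (J 0) p v W = -(α₂ p v) • J 1 p (W p) + α₃ p v • J 2 p (W p) ∧
    covEndo D (J 1) p v W = α₂ p v • J 0 p (W p) + β p v • J 2 p (W p) ∧
    covEndo D (J 2) p v W = -(α₃ p v) • J 0 p (W p) - β p v • J 1 p (W p)

/-- The metric dual `Z♭ = ⟪Z, ·⟫`. -/
def flat (Z : VectField (4 * n) N) : Covect (4 * n) N := fun p ↦ innerSL ℝ (Z p)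

/-- The coefficient `⟨φ, ω⟩ / ‖ω‖²` of a `2`-form `φ` at `p` along `ω = ⟪A ·, ·⟫`, where `A` is an
orthogonal complex structure (so `‖ω‖² = 2n` and `⟨φ, ω⟩ = ½ ∑ φ(eᵢ, A eᵢ)`). -/
def coeffAlong (p : N) (φ : TangentSpace (𝓡 (4 * n)) p [⋀^Fin 2]→L[ℝ] ℝ)
    (A : TangentSpace (𝓡 (4 * n)) p →L[ℝ] TangentSpace (𝓡 (4 * n)) p) : ℝ :=
  (1 / (4 * (n : ℝ))) * ∑ i, φ ![onb p i, A (onb p i)]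

/-- The `sp(1)`-component of the `2`-form `φ` at `p`, written as an endomorphism `∑ cₐ Jₐ(p)`
(which represents the `2`-form `∑ cₐ ωₐ`). -/
def sp1Part (J : Fin 3 → EndoField (4 * n) N) (p : N)
    (φ : TangentSpace (𝓡 (4 * n)) p [⋀^Fin 2]→L[ℝ] ℝ) :
    TangentSpace (𝓡 (4 * n)) p →L[ℝ] TangentSpace (𝓡 (4 * n)) p :=
  ∑ a, coeffAlong p φ (J a p) • J a p

end QK

/-! ## Circle bundles, gauges and the forms of the correspondence -/

section Correspondence

variable {n : ℕ}
  {N : Type*} [TopologicalSpace N] [ChartedSpace (EuclideanSpace ℝ (Fin (4 * n))) N]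
  {P : Type*} [TopologicalSpace P] [ChartedSpace (EuclideanSpace ℝ (Fin (4 * n + 1))) P]

variable (n) in
/-- `pr : P → N` is a smooth principal circle bundle. -/
structure IsPrincipalCircleBundle [MulAction Circle P] (pr : P → N) : Prop where
  smooth_action : ContMDiff ((𝓡 1).prod (𝓡 (4 * n + 1))) (𝓡 (4 * n + 1)) ∞
    (fun zp : Circle × P ↦ zp.1 • zp.2)
  smooth : ContMDiff (𝓡 (4 * n + 1)) (𝓡 (4 * n)) ∞ pr
  surjective : Function.Surjective pr
  submersion : ∀ p, Function.Surjective (mfderiv (𝓡 (4 * n + 1)) (𝓡 (4 * n)) pr p)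
  free : ∀ (z : Circle) (p : P), z • p = p → z = 1
  fibre : ∀ p p' : P, pr p = pr p' ↔ ∃ z : Circle, z • p = p'

variable (n N P) in
/-- A gauge: a local quaternionic frame over `U ⊆ N`, its connection forms, and a fibre coordinate
`c = e^{ix}` of the circle bundle over `U`. Values outside `U` (or its preimage) are irrelevant. -/
structure Gauge where
  U : Set N
  J : Fin 3 → EndoField (4 * n) N
  β : Covect (4 * n) N
  α₂ : Covect (4 * n) N
  α₃ : Covect (4 * n) N
  c : P → Circle

/-- The function `β(Z)` on the total space. -/
def Gauge.u (𝔤 : Gauge n N P) (pr : P → N) (Z : VectField (4 * n) N) (p : P) : ℝ :=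
  𝔤.β (pr p) (Z (pr p))

/-- The covector field `pr^*θ` on the total space. -/
def pullCovect (pr : P → N) (θ : Covect (4 * n) N) : Covect (4 * n + 1) P :=
  fun p ↦ (θ (pr p)).comp (mfderiv (𝓡 (4 * n + 1)) (𝓡 (4 * n)) pr p)

/-- The forms
`σ₁ = -d(β(Z)⁻¹ (2 dx - β))`, `σ₂ = -d(β(Z)⁻¹ (h α₃ + f α₂))`, `σ₃ = -d(β(Z)⁻¹ (h α₂ - f α₃))`
with `f = cos 2x` and `h = sin 2x`, on the part of the total space lying over `U`. -/
def Gauge.σ (𝔤 : Gauge n N P) (pr : P → N) (Z : VectField (4 * n) N) :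
    Fin 3 → DForm (4 * n + 1) P 2 :=
  ![-d (toForm fun p ↦ (𝔤.u pr Z p)⁻¹ •
        ((2 : ℝ) • dAngle 𝔤.c p - pullCovect pr 𝔤.β p)),
    -d (toForm fun p ↦ (𝔤.u pr Z p)⁻¹ •
        (sinTwo (𝔤.c p) • pullCovect pr 𝔤.α₃ p + cosTwo (𝔤.c p) • pullCovect pr 𝔤.α₂ p)),
    -d (toForm fun p ↦ (𝔤.u pr Z p)⁻¹ •
        (sinTwo (𝔤.c p) • pullCovect pr 𝔤.α₂ p - cosTwo (𝔤.c p) • pullCovect pr 𝔤.α₃ p))]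

/-- Two gauges are compatible if on the overlap the `2`-forms `h ω₂ + f ω₃` and `h ω₃ - f ω₂` on the
total space agree: changing the frame `(ω₂, ω₃)` by a rotation changes the fibre
coordinate `x` by half the angle of rotation. -/
def Gauge.Compatible (𝔤 𝔤' : Gauge n N P) (pr : P → N) : Prop :=
  ∀ p : P, pr p ∈ 𝔤.U → pr p ∈ 𝔤'.U →
    sinTwo (𝔤.c p) • 𝔤.J 1 (pr p) + cosTwo (𝔤.c p) • 𝔤.J 2 (pr p) =
      sinTwo (𝔤'.c p) • 𝔤'.J 1 (pr p) + cosTwo (𝔤'.c p) • 𝔤'.J 2 (pr p) ∧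
    sinTwo (𝔤.c p) • 𝔤.J 2 (pr p) - cosTwo (𝔤.c p) • 𝔤.J 1 (pr p) =
      sinTwo (𝔤'.c p) • 𝔤'.J 2 (pr p) - cosTwo (𝔤'.c p) • 𝔤'.J 1 (pr p)

variable [IsManifold (𝓡 (4 * n)) ∞ N]
  [RiemannianBundle (fun p : N ↦ TangentSpace (𝓡 (4 * n)) p)]

/-- The gauge `𝔤` is adapted to the Killing field `Z`: over the open set `U`, the frame belongs to
`G`, the forms `ω₂` and `ω₃` are `Z`-invariant, `ω₁` is the normalised `sp(1)`-component of `dZ♭`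
(as `‖ω₁‖ = √(2n)`, this says that the component is a positive multiple of `ω₁`),
`β, α₂, α₃` are the connection forms, and `x` is a fibre coordinate, i.e. rotation in the fibre by
the angle `s` changes `x` to `x + s`. -/
structure Gauge.IsAdapted [MulAction Circle P] (𝔤 : Gauge n N P) (pr : P → N)
    (D : AffineConnection (4 * n) N)
    (G : Π p : N, Submodule ℝ
      (TangentSpace (𝓡 (4 * n)) p →L[ℝ] TangentSpace (𝓡 (4 * n)) p))
    (Z : VectField (4 * n) N) : Prop where
  isOpen : IsOpen 𝔤.U
  frame : IsQuaternionicFrameOn 𝔤.J 𝔤.U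
  frame_mem : ∀ a, ∀ p ∈ 𝔤.U, 𝔤.J a p ∈ G p
  invariant₂ : IsLieInvariantOn Z (fun p v w ↦ ⟪𝔤.J 1 p v, w⟫_ℝ) 𝔤.U
  invariant₃ : IsLieInvariantOn Z (fun p v w ↦ ⟪𝔤.J 2 p v, w⟫_ℝ) 𝔤.U
  normalised : ∀ p ∈ 𝔤.U, ∃ r : ℝ, 0 < r ∧ sp1Part 𝔤.J p (d (toForm (flat Z)) p) = r • 𝔤.J 0 p
  smooth_β : SmoothFormOn (toForm 𝔤.β) 𝔤.U
  smooth_α₂ : SmoothFormOn (toForm 𝔤.α₂) 𝔤.U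
  smooth_α₃ : SmoothFormOn (toForm 𝔤.α₃) 𝔤.U
  connection : AreConnectionForms D 𝔤.J 𝔤.β 𝔤.α₂ 𝔤.α₃ 𝔤.U
  smooth_c : ContMDiffOn (𝓡 (4 * n + 1)) (𝓡 1) ∞ 𝔤.c (pr ⁻¹' 𝔤.U)
  equivariant : ∀ (z : Circle) (p : P), pr p ∈ 𝔤.U → 𝔤.c (z • p) = z * 𝔤.c p

end Correspondence

end HKQK

end

set_option linter.unusedSectionVars false

open Bundle Filter Set
open scoped Manifold ContDiff Topology InnerProductSpace

noncomputable section

namespace HKQK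

/-! ### Differential forms read in charts: smoothness, pullback, exterior derivative -/

section ChartForms

variable {m m' k : ℕ}
  {X : Type*} [TopologicalSpace X] [ChartedSpace (EuclideanSpace ℝ (Fin m)) X]
  {Y : Type*} [TopologicalSpace Y] [ChartedSpace (EuclideanSpace ℝ (Fin m')) Y]

/-! Write u = β(Z), and let I₁, I₂, I₃ be `J 0`, `J 1`, `J 2`.

Curvature. The scaling scal = -16n(n+2) makes the curvature forms of the bundle G equal to 4ωₐ, for
instance dβ = α₂∧α₃ + 4ω₁. For n ≥ 2 this follows from the Bianchi identity by taking traces against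
the Iₐ, which also yields the Einstein property (`gamma_eq_of_two_le`). For n = 1 the Einstein and
Weyl conditions are what is needed (`gamma_eq_of_weyl`).

Killing field. Invariance of ω₂ and ω₃ means [∇Z, Iₐ] = ∇_Z Iₐ for a = 2, 3. The choice of ω₁ says
that dZ♭, which is 2⟨∇Z ·, ·⟩, has no component along ω₂, ω₃, and a trace argument turns this into
α₂(Z) = α₃(Z) = 0 (`alpha_Z`). Hence [∇Z, I₂] = u I₃ and [∇Z, I₃] = -u I₂. Differentiating these
relations, with Kostant's formula ∇_v∇Z = R(v, Z) and the known curvature forms, gives the moment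
equations du = -4ω₁(Z,·), uα₂ = 4ω₂(Z,·), uα₃ = -4ω₃(Z,·) (`killing`, `structureAt`).

Forms on P. Put A = 2dx - β, B = hα₃ + fα₂, C = hα₂ - fα₃, and K = (I₁, hI₂ + fI₃, hI₃ - fI₂). The
structure and moment equations bring all three forms to one cyclic shape (`σ_apply`): σ_b = 4u⁻²
A∧(K_b Z)♭ - 16u⁻³ (K_{b+1} Z)♭∧(K_{b+2} Z)♭ + 4u⁻¹ ⟨K_b ·, ·⟩. Only u, A and K enter. Compatibility
of gauges fixes K, then u through [∇Z, K₁] = u K₂, then A through ∇K₁ = -A K₂ + C K₀, so the forms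
are global (`σ_eq`). They annihilate the lift of Z because A takes the value -u on it (`σ_lift`).

Descent. A closed form that kills the vertical vectors of a submersion is locally constant along the
fibres. The fibres here are orbits, hence connected, so the form descends through local sections
(`exists_descended_form`).

Hyperkähler structure. The hyperplane A = -4u⁻¹Z♭, that is the kernel of ξ_X, is transverse to the
lift of Z and projects isomorphically to the tangent spaces of both N and M. On it σ_b becomes
g_u(K_b ·, ·) with g_u = 4u⁻¹g - 16u⁻³(Z♭² + Σ(K_a Z)♭²). This metric is K-Hermitian, and Bessel's
inequality with u > 2‖Z‖ makes it positive (`exists_quotient_structure`). Smoothness and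
integrability are consequences of σ_{a+1}(Iₐ ·, ·) = -σ_{a+2}: this equation determines Iₐ smoothly
from the forms, and closedness of the two forms kills the Nijenhuis tensor
(`nijenhuis_eq_zero_of_closed`, `isHyperkahlerTriple_of_pointwise`).

Circle action. It preserves the lift of Z, hence permutes its orbits. It fixes u, A and the αₐ and
rotates (f, h) by 2s, which gives the stated action on the forms. -/

theorem inChart_apply (η : DForm m X k) (p : X) (y : EuclideanSpace ℝ (Fin m))
    (v : Fin k → EuclideanSpace ℝ (Fin m)) :
    inChart η p y v = η ((extChartAt (𝓡 m) p).symm y)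
      (fun i ↦ mfderiv (𝓡 m) (𝓡 m) (extChartAt (𝓡 m) p).symm y (v i)) := rfl

theorem pullback_apply (f : X → Y) (η : DForm m' Y k) (p : X)
    (v : Fin k → TangentSpace (𝓡 m) p) :
    pullback f η p v = η (f p) (fun i ↦ mfderiv (𝓡 m) (𝓡 m') f p (v i)) := rfl

theorem pullback_comp {m'' : ℕ} {W : Type*} [TopologicalSpace W]
    [ChartedSpace (EuclideanSpace ℝ (Fin m'')) W] {f : X → Y} {g : Y → W} (η : DForm m'' W k)
    {p : X} (hg : MDifferentiableAt (𝓡 m') (𝓡 m'') g (f p))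
    (hf : MDifferentiableAt (𝓡 m) (𝓡 m') f p) :
    pullback (m := m) (m' := m'') (g ∘ f) η p =
      pullback (m := m) (m' := m') f (pullback (m := m') (m' := m'') g η) p := by
  ext v
  simp only [pullback_apply, mfderiv_comp p hg hf]
  rfl

theorem inChart_model (η : DForm m (EuclideanSpace ℝ (Fin m)) k)
    (p : EuclideanSpace ℝ (Fin m)) : inChart η p = η := by
  funext y
  ext v
  rw [inChart_apply]
  have h : (extChartAt (𝓡 m) p).symm = (PartialEquiv.refl (EuclideanSpace ℝ (Fin m))) := by
    rw [extChartAt_model_space_eq_id]; rfl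
  rw [h]
  change η y (fun i ↦ mfderiv (𝓡 m) (𝓡 m) id y (v i)) = _
  rw [mfderiv_id]
  rfl

variable [IsManifold (𝓡 m) ∞ X] [IsManifold (𝓡 m') ∞ Y]

theorem contMDiffAt_chart_symm (p : X) {y : EuclideanSpace ℝ (Fin m)}
    (hy : y ∈ (extChartAt (𝓡 m) p).target) :
    ContMDiffAt (𝓡 m) (𝓡 m) ∞ (extChartAt (𝓡 m) p).symm y :=
  (contMDiffOn_extChartAt_symm p).contMDiffAt ((isOpen_extChartAt_target p).mem_nhds hy)

theorem mdifferentiableAt_chart_symm (p : X) {y : EuclideanSpace ℝ (Fin m)}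
    (hy : y ∈ (extChartAt (𝓡 m) p).target) :
    MDifferentiableAt (𝓡 m) (𝓡 m) (extChartAt (𝓡 m) p).symm y :=
  (contMDiffAt_chart_symm p hy).mdifferentiableAt (by simp)

theorem contMDiffAt_chart (p : X) {x : X} (hx : x ∈ (extChartAt (𝓡 m) p).source) :
    ContMDiffAt (𝓡 m) (𝓡 m) ∞ (extChartAt (𝓡 m) p) x :=
  contMDiffAt_extChartAt' (by simpa using hx)

theorem mdifferentiableAt_chart (p : X) {x : X} (hx : x ∈ (extChartAt (𝓡 m) p).source) :
    MDifferentiableAt (𝓡 m) (𝓡 m) (extChartAt (𝓡 m) p) x :=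
  (contMDiffAt_chart p hx).mdifferentiableAt (by simp)

theorem mfderiv_chart_comp_symm (p : X) {y : EuclideanSpace ℝ (Fin m)}
    (hy : y ∈ (extChartAt (𝓡 m) p).target) (v : EuclideanSpace ℝ (Fin m)) :
    mfderiv (𝓡 m) (𝓡 m) (extChartAt (𝓡 m) p) ((extChartAt (𝓡 m) p).symm y)
      (mfderiv (𝓡 m) (𝓡 m) (extChartAt (𝓡 m) p).symm y v) = v := by
  have h := mfderiv_comp y (mdifferentiableAt_chart p ((extChartAt (𝓡 m) p).map_target hy))
    (mdifferentiableAt_chart_symm p hy)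
  have h2 : (extChartAt (𝓡 m) p) ∘ (extChartAt (𝓡 m) p).symm =ᶠ[𝓝 y] id := by
    filter_upwards [(isOpen_extChartAt_target (I := 𝓡 m) p).mem_nhds hy] with z hz
    exact (extChartAt (𝓡 m) p).right_inv hz
  rw [h2.mfderiv_eq, mfderiv_id] at h
  exact (congrArg (fun A ↦ A v) h).symm

theorem mfderiv_symm_comp_chart (p : X) {x : X} (hx : x ∈ (extChartAt (𝓡 m) p).source)
    (v : TangentSpace (𝓡 m) x) :
    mfderiv (𝓡 m) (𝓡 m) (extChartAt (𝓡 m) p).symm (extChartAt (𝓡 m) p x)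
      (mfderiv (𝓡 m) (𝓡 m) (extChartAt (𝓡 m) p) x v) = v := by
  have h := mfderiv_comp x (mdifferentiableAt_chart_symm p ((extChartAt (𝓡 m) p).map_source hx))
    (mdifferentiableAt_chart p hx)
  have h2 : (extChartAt (𝓡 m) p).symm ∘ (extChartAt (𝓡 m) p) =ᶠ[𝓝 x] id := by
    filter_upwards [(isOpen_extChartAt_source (I := 𝓡 m) p).mem_nhds hx] with z hz
    exact (extChartAt (𝓡 m) p).left_inv hz
  rw [h2.mfderiv_eq, mfderiv_id] at h
  exact (congrArg (fun A ↦ A v) h).symm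

/-- The chart expression of a pullback, for arbitrary charts. -/
theorem inChart_pullback (F : X → Y) (η : DForm m' Y k) (p : X) (p' : Y)
    {y : EuclideanSpace ℝ (Fin m)} (hy : y ∈ (extChartAt (𝓡 m) p).target)
    (hF : MDifferentiableAt (𝓡 m) (𝓡 m') F ((extChartAt (𝓡 m) p).symm y))
    (hp' : F ((extChartAt (𝓡 m) p).symm y) ∈ (extChartAt (𝓡 m') p').source) :
    inChart (pullback F η) p y =
      (inChart η p' (extChartAt (𝓡 m') p' (F ((extChartAt (𝓡 m) p).symm y)))).compContinuousLinearMap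
        (fderiv ℝ (fun z ↦ extChartAt (𝓡 m') p' (F ((extChartAt (𝓡 m) p).symm z))) y) := by
  ext v
  simp only [inChart_apply, pullback_apply, ContinuousAlternatingMap.compContinuousLinearMap_apply,
    Function.comp_def]
  rw [(extChartAt (𝓡 m') p').left_inv hp']
  congr 1
  funext i
  rw [← mfderiv_eq_fderiv]
  have h := mfderiv_comp y (mdifferentiableAt_chart p' hp')
    (MDifferentiableAt.comp y hF (mdifferentiableAt_chart_symm p hy))
  have h3 := mfderiv_comp y hF (mdifferentiableAt_chart_symm p hy)
  simp only [Function.comp_def] at h h3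
  rw [h, h3]
  exact (mfderiv_symm_comp_chart p' hp' _).symm

/-- Smoothness of a form at a point, in the chart around that point. -/
def SmoothFormAt (η : DForm m X k) (p : X) : Prop :=
  ContDiffAt ℝ ∞ (inChart η p) (extChartAt (𝓡 m) p p)


theorem two_le_infty : (2 : WithTop ℕ∞) ≤ ∞ := by
  norm_cast

/-- Evaluation on all tuples of basis vectors is an injective linear map out of the
finite-dimensional space of forms, so it has a linear left inverse, which recovers the form smoothly
from finitely many coefficients. -/
theorem contDiffAt_form_iff {E F : Type*} [NormedAddCommGroup E] [NormedSpace ℝ E]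
    [FiniteDimensional ℝ E] [NormedAddCommGroup F] [NormedSpace ℝ F] {w : F → E [⋀^Fin k]→L[ℝ] ℝ}
    {x : F} {n : WithTop ℕ∞} :
    ContDiffAt ℝ n w x ↔ ∀ v, ContDiffAt ℝ n (fun y ↦ w y v) x := by
  constructor
  · intro h v
    exact (ContinuousAlternatingMap.apply ℝ E ℝ v).contDiff.contDiffAt.comp x h
  · intro h
    let b := Module.finBasis ℝ E
    let ev : (E [⋀^Fin k]→L[ℝ] ℝ) →ₗ[ℝ] ((Fin k → Fin (Module.finrank ℝ E)) → ℝ) :=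
      LinearMap.pi fun j ↦ (ContinuousAlternatingMap.apply ℝ E ℝ (fun i ↦ b (j i))).toLinearMap
    have hev : LinearMap.ker ev = ⊥ := by
      rw [LinearMap.ker_eq_bot]
      intro w₁ w₂ h12
      apply ContinuousAlternatingMap.toAlternatingMap_injective
      refine Module.Basis.ext_alternating b fun j _ ↦ ?_
      exact congrFun h12 j
    obtain ⟨g, hg⟩ := ev.exists_leftInverse_of_injective hev
    have h1 : w = fun y ↦ LinearMap.toContinuousLinearMap g (ev (w y)) := by
      funext y
      exact (LinearMap.congr_fun hg (w y)).symm
    rw [h1]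
    refine (LinearMap.toContinuousLinearMap g).contDiff.contDiffAt.comp x ?_
    exact contDiffAt_pi.2 fun j ↦ h _

/-- Precomposition of a multilinear map with `A` in every slot is itself multilinear in the tuple
`(A, ..., A)`, hence smooth in `A`. -/
theorem contDiffAt_compContinuousLinearMap {E E' F : Type*} [NormedAddCommGroup E]
    [NormedSpace ℝ E] [FiniteDimensional ℝ E] [NormedAddCommGroup F] [NormedSpace ℝ F]
    [NormedAddCommGroup E'] [NormedSpace ℝ E']
    {w : F → E' [⋀^Fin k]→L[ℝ] ℝ} {A : F → E →L[ℝ] E'} {x : F} {n : WithTop ℕ∞}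
    (hw : ContDiffAt ℝ n w x) (hA : ContDiffAt ℝ n A x) :
    ContDiffAt ℝ n (fun y ↦ (w y).compContinuousLinearMap (A y)) x := by
  rw [contDiffAt_form_iff]
  intro v
  have h0 : ContDiff ℝ n (fun f : Fin k → E →L[ℝ] E' ↦
      ContinuousMultilinearMap.compContinuousLinearMapContinuousMultilinear ℝ
        (fun _ : Fin k ↦ E) (fun _ : Fin k ↦ E') ℝ f) :=
    ContinuousMultilinearMap.contDiff (F := (E' [×k]→L[ℝ] ℝ) →L[ℝ] (E [×k]→L[ℝ] ℝ)) _
  have h1 := h0.contDiffAt.comp x (contDiffAt_pi.2 fun _ : Fin k ↦ hA)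
  have h2 := (ContinuousAlternatingMap.toContinuousMultilinearMapCLM (𝕜 := ℝ) (E := E')
    (ι := Fin k) (F := ℝ) ℝ).contDiff.contDiffAt.comp x hw
  have h3 := h1.clm_apply h2
  exact (ContinuousMultilinearMap.apply ℝ (fun _ : Fin k ↦ E) ℝ v).contDiff.contDiffAt.comp x h3

theorem contDiffAt_writtenInCharts {F : X → Y} {p : X} {p' : Y} {x : X}
    (hx : x ∈ (extChartAt (𝓡 m) p).source) (hF : ContMDiffAt (𝓡 m) (𝓡 m') ∞ F x)
    (hp' : F x ∈ (extChartAt (𝓡 m') p').source) :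
    ContDiffAt ℝ ∞ (fun z ↦ extChartAt (𝓡 m') p' (F ((extChartAt (𝓡 m) p).symm z)))
      (extChartAt (𝓡 m) p x) := by
  rw [← contMDiffAt_iff_contDiffAt]
  have h1 := (extChartAt (𝓡 m) p).left_inv hx
  refine ContMDiffAt.comp (I' := 𝓡 m') _ (contMDiffAt_chart p' (by rwa [h1])) ?_
  refine ContMDiffAt.comp (I' := 𝓡 m) _ (by rwa [h1])
    (contMDiffAt_chart_symm p ((extChartAt (𝓡 m) p).map_source hx))

theorem inChart_pullback_eventuallyEq {F : X → Y} (η : DForm m' Y k) {p : X} {p' : Y} {x : X}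
    (hx : x ∈ (extChartAt (𝓡 m) p).source) (hF : ContMDiffAt (𝓡 m) (𝓡 m') ∞ F x)
    (hp' : F x ∈ (extChartAt (𝓡 m') p').source) :
    inChart (pullback (m := m) (m' := m') F η) p =ᶠ[𝓝 (extChartAt (𝓡 m) p x)] fun y ↦
      (inChart η p' (extChartAt (𝓡 m') p' (F ((extChartAt (𝓡 m) p).symm y)))).compContinuousLinearMap
        (fderiv ℝ (fun z ↦ extChartAt (𝓡 m') p' (F ((extChartAt (𝓡 m) p).symm z))) y) := by
  -- Order `∞` at a point does not spread to a neighbourhood, but every finite order does; order 1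
  -- is enough to differentiate nearby.
  have h0 : ContMDiffAt (𝓡 m) (𝓡 m') 1 F x := hF.of_le (by norm_cast)
  have h1 : ∀ᶠ z in 𝓝 x, ContMDiffAt (𝓡 m) (𝓡 m') 1 F z := contMDiffAt_iff_contMDiffAt_nhds (by simp) |>.1 h0
  have h2 : ∀ᶠ z in 𝓝 x, F z ∈ (extChartAt (𝓡 m') p').source :=
    hF.continuousAt.eventually ((isOpen_extChartAt_source p').mem_nhds hp')
  have hc : Tendsto (extChartAt (𝓡 m) p).symm (𝓝 (extChartAt (𝓡 m) p x)) (𝓝 x) := by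
    have := (contMDiffAt_chart_symm (m := m) p ((extChartAt (𝓡 m) p).map_source hx)).continuousAt
    rwa [ContinuousAt, (extChartAt (𝓡 m) p).left_inv hx] at this
  filter_upwards [hc.eventually h1, hc.eventually h2, (isOpen_extChartAt_target
    (I := 𝓡 m) p).mem_nhds ((extChartAt (𝓡 m) p).map_source hx)] with y hy1 hy2 hy3
  exact inChart_pullback F η p p' hy3 (hy1.mdifferentiableAt (by simp)) hy2

theorem contDiffAt_inChart_pullback {F : X → Y} {η : DForm m' Y k} {p : X} {p' : Y} {x : X}
    (hx : x ∈ (extChartAt (𝓡 m) p).source) (hF : ContMDiffAt (𝓡 m) (𝓡 m') ∞ F x)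
    (hp' : F x ∈ (extChartAt (𝓡 m') p').source)
    (hη : ContDiffAt ℝ ∞ (inChart η p') (extChartAt (𝓡 m') p' (F x))) :
    ContDiffAt ℝ ∞ (inChart (pullback (m := m) (m' := m') F η) p) (extChartAt (𝓡 m) p x) := by
  refine ContDiffAt.congr_of_eventuallyEq ?_ (inChart_pullback_eventuallyEq η hx hF hp')
  have hs := contDiffAt_writtenInCharts hx hF hp'
  refine contDiffAt_compContinuousLinearMap (ContDiffAt.fun_comp _ (g := inChart η p') ?_ hs) (hs.fderiv_right (by simp))
  simpa only [(extChartAt (𝓡 m) p).left_inv hx] using hη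

theorem SmoothFormAt.pullback {F : X → Y} {η : DForm m' Y k} {x : X}
    (hη : SmoothFormAt η (F x)) (hF : ContMDiffAt (𝓡 m) (𝓡 m') ∞ F x) :
    SmoothFormAt (pullback (m := m) (m' := m') F η) x :=
  contDiffAt_inChart_pullback (mem_extChartAt_source x) hF (mem_extChartAt_source _) hη

omit [IsManifold (𝓡 m) ∞ X] in
theorem pullback_id (η : DForm m X k) : pullback (m := m) (m' := m) (id : X → X) η = η := by
  funext p
  ext v
  simp only [pullback_apply, mfderiv_id]
  rfl

/-- A change of chart is the pullback by the identity, read in two different charts. -/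
theorem SmoothFormAt.contDiffAt_inChart {η : DForm m X k} {x p : X} (h : SmoothFormAt η x)
    (hx : x ∈ (extChartAt (𝓡 m) p).source) :
    ContDiffAt ℝ ∞ (inChart η p) (extChartAt (𝓡 m) p x) := by
  have := contDiffAt_inChart_pullback (p := p) hx contMDiffAt_id (mem_extChartAt_source x) h
  rwa [pullback_id] at this

theorem smoothFormOn_univ {η : DForm m X k} (h : ∀ x, SmoothFormAt η x) :
    SmoothFormOn η Set.univ := by
  intro p y hy
  have h1 := (h ((extChartAt (𝓡 m) p).symm y)).contDiffAt_inChart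
    ((extChartAt (𝓡 m) p).map_target hy.1)
  rw [(extChartAt (𝓡 m) p).right_inv hy.1] at h1
  exact h1.contDiffWithinAt

theorem SmoothFormOn.smoothFormAt {η : DForm m X k} {U : Set X} (h : SmoothFormOn η U)
    (hU : IsOpen U) {x : X} (hx : x ∈ U) : SmoothFormAt η x := by
  refine (h x).contDiffAt (Filter.inter_mem (extChartAt_target_mem_nhds x) ?_)
  have hc := (contMDiffAt_chart_symm (m := m) x (mem_extChartAt_target x)).continuousAt
  refine hc.preimage_mem_nhds ?_
  rw [(extChartAt (𝓡 m) x).left_inv (mem_extChartAt_source x)]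
  exact hU.mem_nhds hx

theorem inChart_congr {η η' : DForm m X k} {x p : X} (h : ∀ᶠ y in 𝓝 x, η y = η' y)
    (hx : x ∈ (extChartAt (𝓡 m) p).source) :
    inChart η p =ᶠ[𝓝 (extChartAt (𝓡 m) p x)] inChart η' p := by
  have hc : Tendsto (extChartAt (𝓡 m) p).symm (𝓝 (extChartAt (𝓡 m) p x)) (𝓝 x) := by
    have := (contMDiffAt_chart_symm (m := m) p ((extChartAt (𝓡 m) p).map_source hx)).continuousAt
    rwa [ContinuousAt, (extChartAt (𝓡 m) p).left_inv hx] at this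
  filter_upwards [hc.eventually h] with y hy
  ext v
  rw [inChart_apply, inChart_apply, hy]

theorem SmoothFormAt.congr {η η' : DForm m X k} {x : X} (hη : SmoothFormAt η x)
    (h : ∀ᶠ y in 𝓝 x, η y = η' y) : SmoothFormAt η' x :=
  ContDiffAt.congr_of_eventuallyEq hη (inChart_congr (h.mono fun _ hy ↦ hy.symm) (mem_extChartAt_source x))

theorem d_congr {η η' : DForm m X k} {x : X} (h : ∀ᶠ y in 𝓝 x, η y = η' y) : d η x = d η' x := by
  unfold d
  rw [(inChart_congr h (mem_extChartAt_source x)).extDeriv_eq]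

/-- In the charts around `x` and `F x` this is naturality of `extDeriv` for a map of vector spaces;
the chain rule identifies the two ways of composing the derivative of `F` with those of the charts.
-/
theorem d_pullback {F : X → Y} {η : DForm m' Y k} {x : X}
    (hη : SmoothFormAt η (F x)) (hF : ContMDiffAt (𝓡 m) (𝓡 m') ∞ F x) :
    d (pullback (m := m) (m' := m') F η) x = pullback (m := m) (m' := m') F (d η) x := by
  have hs := contDiffAt_writtenInCharts (mem_extChartAt_source x) hF (mem_extChartAt_source _)
  have h1 := inChart_pullback_eventuallyEq η (mem_extChartAt_source x) hF (mem_extChartAt_source _)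
  have hx := (extChartAt (𝓡 m) x).left_inv (mem_extChartAt_source x)
  unfold d
  have hd : DifferentiableAt ℝ (inChart η (F x))
      ((fun z ↦ extChartAt (𝓡 m') (F x) (F ((extChartAt (𝓡 m) x).symm z)))
        (extChartAt (𝓡 m) x x)) := by
    simp only [hx]
    exact ContDiffAt.differentiableAt hη (by simp)
  have h2 := extDeriv_pullback (f := fun z ↦ extChartAt (𝓡 m') (F x)
    (F ((extChartAt (𝓡 m) x).symm z))) hd hs (by simpa using two_le_infty)
  rw [h1.extDeriv_eq, h2]
  · ext v
    rw [hx]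
    change extDeriv (inChart η (F x)) (extChartAt (𝓡 m') (F x) (F x)) (fun i ↦
      fderiv ℝ (fun z ↦ extChartAt (𝓡 m') (F x) (F ((extChartAt (𝓡 m) x).symm z)))
        (extChartAt (𝓡 m) x x) (mfderiv (𝓡 m) (𝓡 m) (extChartAt (𝓡 m) x) x (v i))) =
      extDeriv (inChart η (F x)) (extChartAt (𝓡 m') (F x) (F x)) (fun i ↦
        mfderiv (𝓡 m') (𝓡 m') (extChartAt (𝓡 m') (F x)) (F x) (mfderiv (𝓡 m) (𝓡 m') F x (v i)))
    congr 1
    funext i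
    rw [← mfderiv_eq_fderiv]
    have hF' := hF.mdifferentiableAt (by simp)
    have e1 : (fun z ↦ extChartAt (𝓡 m') (F x) (F ((extChartAt (𝓡 m) x).symm
        (extChartAt (𝓡 m) x z)))) =ᶠ[𝓝 x] fun z ↦ extChartAt (𝓡 m') (F x) (F z) := by
      filter_upwards [(isOpen_extChartAt_source (I := 𝓡 m) x).mem_nhds (mem_extChartAt_source x)]
        with z hz
      rw [(extChartAt (𝓡 m) x).left_inv hz]
    have h3 := mfderiv_comp x (g := fun z ↦ extChartAt (𝓡 m') (F x) (F ((extChartAt (𝓡 m) x).symm z)))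
      (contMDiffAt_iff_contDiffAt.2 hs |>.mdifferentiableAt (by simp))
      (mdifferentiableAt_chart x (mem_extChartAt_source x))
    have h4 := mfderiv_comp x (mdifferentiableAt_chart (F x) (mem_extChartAt_source (F x))) hF'
    simp only [Function.comp_def] at h3 h4
    rw [e1.mfderiv_eq, h4] at h3
    exact (congrArg (fun A ↦ A (v i)) h3).symm

theorem d_model (η : DForm m (EuclideanSpace ℝ (Fin m)) k) (y : EuclideanSpace ℝ (Fin m)) :
    d η y = extDeriv η y := by
  have h : ⇑(extChartAt (𝓡 m) y) = id := by
    rw [extChartAt_model_space_eq_id]; rfl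
  unfold d
  rw [inChart_model, h, mfderiv_id]
  rfl

/-- `d` is defined pointwise, with a chart that varies with the point. Naturality under the inverse
of one fixed chart shows that any chart computes it, which is what makes `d η` a form that can be
differentiated again. -/
theorem inChart_d {η : DForm m X k} {p x : X} (hx : x ∈ (extChartAt (𝓡 m) p).source)
    (h : SmoothFormAt η x) :
    inChart (d η) p (extChartAt (𝓡 m) p x) =
      extDeriv (inChart η p) (extChartAt (𝓡 m) p x) := by
  have hx' := (extChartAt (𝓡 m) p).map_source hx
  have h1 := d_pullback (x := extChartAt (𝓡 m) p x) (m := m) (m' := m) (F := (extChartAt (𝓡 m) p).symm) (η := η)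
    (by rwa [(extChartAt (𝓡 m) p).left_inv hx]) (contMDiffAt_chart_symm p hx')
  rw [d_model] at h1
  exact h1.symm

theorem inChart_d_eventuallyEq {η : DForm m X k} {x : X} (h : ∀ᶠ y in 𝓝 x, SmoothFormAt η y) :
    inChart (d η) x =ᶠ[𝓝 (extChartAt (𝓡 m) x x)] extDeriv (inChart η x) := by
  have hc : Tendsto (extChartAt (𝓡 m) x).symm (𝓝 (extChartAt (𝓡 m) x x)) (𝓝 x) := by
    have := (contMDiffAt_chart_symm (m := m) x (mem_extChartAt_target x)).continuousAt
    rwa [ContinuousAt, (extChartAt (𝓡 m) x).left_inv (mem_extChartAt_source x)] at this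
  filter_upwards [hc.eventually h, extChartAt_target_mem_nhds x] with y hy hyt
  have h1 := inChart_d ((extChartAt (𝓡 m) x).map_target hyt) hy
  rwa [(extChartAt (𝓡 m) x).right_inv hyt] at h1

theorem SmoothFormAt.extd {η : DForm m X k} {x : X} (h : ∀ᶠ y in 𝓝 x, SmoothFormAt η y) :
    SmoothFormAt (d η) x := by
  refine ContDiffAt.congr_of_eventuallyEq ?_ (inChart_d_eventuallyEq h)
  have h1 : ContDiffAt ℝ ∞ (fderiv ℝ (inChart η x)) (extChartAt (𝓡 m) x x) :=
    ContDiffAt.fderiv_right h.self_of_nhds (by simp)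
  exact (ContinuousAlternatingMap.alternatizeUncurryFinCLM ℝ (EuclideanSpace ℝ (Fin m)) ℝ
    ).contDiff.contDiffAt.comp _ h1

theorem d_d {η : DForm m X k} {x : X} (h : ∀ᶠ y in 𝓝 x, SmoothFormAt η y) :
    d (d η) x = 0 := by
  change (extDeriv (inChart (d η) x) _).compContinuousLinearMap _ = 0
  rw [(inChart_d_eventuallyEq h).extDeriv_eq, extDeriv_extDeriv_apply (r := ∞) h.self_of_nhds
    (by simpa using two_le_infty)]
  rfl

end ChartForms

/-! ### Calculus of covector-valued functions on a vector space -/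

section Calculus

theorem contDiffAt_clm_iff {E F G : Type*} [NormedAddCommGroup E] [NormedSpace ℝ E]
    [FiniteDimensional ℝ E] [NormedAddCommGroup F] [NormedSpace ℝ F] [NormedAddCommGroup G]
    [NormedSpace ℝ G] {A : F → E →L[ℝ] G} {x : F} {n : WithTop ℕ∞} :
    ContDiffAt ℝ n A x ↔ ∀ v, ContDiffAt ℝ n (fun y ↦ A y v) x := by
  constructor
  · exact fun h v ↦ h.clm_apply contDiffAt_const
  · intro h
    let b := Module.finBasis ℝ E
    have e : A = fun y ↦ ∑ i, ContinuousLinearMap.smulRightL ℝ E G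
        (LinearMap.toContinuousLinearMap (b.coord i)) (A y (b i)) := by
      funext y
      ext v
      conv_lhs => rw [← b.sum_repr v]
      simp only [map_sum, map_smul]
      simp
    rw [e]
    exact ContDiffAt.sum fun i _ ↦ (ContinuousLinearMap.contDiff _).contDiffAt.comp x (h _)

theorem extDeriv_ofSubsingleton {E : Type*} [NormedAddCommGroup E] [NormedSpace ℝ E]
    {θ : E → E →L[ℝ] ℝ} {x : E} (hθ : DifferentiableAt ℝ θ x) (v w : E) :
    extDeriv (fun y ↦ ContinuousAlternatingMap.ofSubsingleton ℝ E ℝ (0 : Fin 1) (θ y)) x ![v, w] =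
      fderiv ℝ θ x v w - fderiv ℝ θ x w v := by
  have hd : DifferentiableAt ℝ
      (fun y ↦ ContinuousAlternatingMap.ofSubsingleton ℝ E ℝ (0 : Fin 1) (θ y)) x :=
    (ContinuousAlternatingMap.ofSubsingletonLIE (𝕜 := ℝ) (ι := Fin 1) (E := E) (F := ℝ) (0 : Fin 1)
      ).toContinuousLinearEquiv.differentiableAt.comp x hθ
  rw [extDeriv_apply hd, Fin.sum_univ_two]
  simp only [ContinuousAlternatingMap.ofSubsingleton_apply_apply]
  have e : ∀ z : E, fderiv ℝ (fun y ↦ θ y z) x = (fderiv ℝ θ x).flip z := by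
    intro z
    ext u
    rw [fderiv_clm_apply hθ (differentiableAt_const z)]
    simp
  simp [Fin.removeNth, e]
  ring

end Calculus

/-! ### One-forms on a manifold and their exterior derivatives -/

section OneForms

variable {m m' k : ℕ}
  {X : Type*} [TopologicalSpace X] [ChartedSpace (EuclideanSpace ℝ (Fin m)) X]
  {Y : Type*} [TopologicalSpace Y] [ChartedSpace (EuclideanSpace ℝ (Fin m')) Y]

/-- A field of covectors read in the chart around `p`. -/
def covChart (θ : Covect m X) (p : X) (y : EuclideanSpace ℝ (Fin m)) :
    EuclideanSpace ℝ (Fin m) →L[ℝ] ℝ :=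
  (θ ((extChartAt (𝓡 m) p).symm y)).comp (mfderiv (𝓡 m) (𝓡 m) (extChartAt (𝓡 m) p).symm y)

theorem inChart_toForm (θ : Covect m X) (p : X) :
    inChart (toForm θ) p = fun y ↦ ContinuousAlternatingMap.ofSubsingleton ℝ
      (EuclideanSpace ℝ (Fin m)) ℝ (0 : Fin 1) (covChart θ p y) := rfl

theorem smoothFormAt_toForm_iff {θ : Covect m X} {p : X} :
    SmoothFormAt (toForm θ) p ↔ ContDiffAt ℝ ∞ (covChart θ p) (extChartAt (𝓡 m) p p) := by
  unfold SmoothFormAt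
  rw [inChart_toForm, contDiffAt_form_iff]
  constructor
  · intro h
    rw [contDiffAt_clm_iff]
    intro v
    exact h (fun _ ↦ v)
  · intro h v
    exact (contDiffAt_clm_iff.1 h) (v 0)

variable [IsManifold (𝓡 m) ∞ X] [IsManifold (𝓡 m') ∞ Y]

/-- The tangent space at `p` is the model space by way of the preferred chart at `p`, so that chart
has the identity as its derivative there. At the centre of a chart no conversion between vectors and
coordinates is needed. -/
theorem mfderiv_chart_self (p : X) (v : TangentSpace (𝓡 m) p) :
    mfderiv (𝓡 m) (𝓡 m) (extChartAt (𝓡 m) p) p v = v := by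
  rw [(mdifferentiableAt_chart p (mem_extChartAt_source p)).mfderiv]
  have h : writtenInExtChartAt (𝓡 m) (𝓡 m) p (extChartAt (𝓡 m) p) =ᶠ[𝓝 (extChartAt (𝓡 m) p p)]
      id := by
    filter_upwards [extChartAt_target_mem_nhds p] with y hy
    simp only [writtenInExtChartAt, extChartAt_model_space_eq_id, Function.comp_apply]
    exact (extChartAt (𝓡 m) p).right_inv hy
  have hr : range (𝓡 m) = univ := by simp
  rw [hr, fderivWithin_univ, h.fderiv_eq, fderiv_id]
  rfl

theorem mfderiv_chart_symm_self (p : X) (v : EuclideanSpace ℝ (Fin m)) :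
    mfderiv (𝓡 m) (𝓡 m) (extChartAt (𝓡 m) p).symm (extChartAt (𝓡 m) p p) v = v := by
  have h := mfderiv_symm_comp_chart p (mem_extChartAt_source p) v
  have h2 := mfderiv_chart_self p v
  exact (congrArg _ h2.symm).trans h

theorem covChart_self (θ : Covect m X) (p : X) (v : EuclideanSpace ℝ (Fin m)) :
    covChart θ p (extChartAt (𝓡 m) p p) v = θ p v := by
  change θ ((extChartAt (𝓡 m) p).symm (extChartAt (𝓡 m) p p))
    (mfderiv (𝓡 m) (𝓡 m) (extChartAt (𝓡 m) p).symm (extChartAt (𝓡 m) p p) v) = _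
  rw [mfderiv_chart_symm_self, (extChartAt (𝓡 m) p).left_inv (mem_extChartAt_source p)]

omit [IsManifold (𝓡 m) ∞ X] in
theorem mvfderiv_eq_fderiv_chart {V : Type*} [NormedAddCommGroup V] [NormedSpace ℝ V]
    {f : X → V} {p : X} (hf : MDifferentiableAt (𝓡 m) 𝓘(ℝ, V) f p) (v : TangentSpace (𝓡 m) p) :
    mvfderiv (𝓡 m) f p v =
      fderiv ℝ (fun y ↦ f ((extChartAt (𝓡 m) p).symm y)) (extChartAt (𝓡 m) p p) v := by
  rw [hf.mvfderiv]
  have hr : range (𝓡 m) = univ := by simp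
  rw [hr, fderivWithin_univ]
  rfl

theorem mvfderiv_chart_symm {V : Type*} [NormedAddCommGroup V] [NormedSpace ℝ V]
    {f : X → V} {p : X} {y : EuclideanSpace ℝ (Fin m)} (hy : y ∈ (extChartAt (𝓡 m) p).target)
    (hf : MDifferentiableAt (𝓡 m) 𝓘(ℝ, V) f ((extChartAt (𝓡 m) p).symm y))
    (v : EuclideanSpace ℝ (Fin m)) :
    mvfderiv (𝓡 m) f ((extChartAt (𝓡 m) p).symm y)
        (mfderiv (𝓡 m) (𝓡 m) (extChartAt (𝓡 m) p).symm y v) =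
      fderiv ℝ (fun y ↦ f ((extChartAt (𝓡 m) p).symm y)) y v := by
  have h := mfderiv_comp y hf (mdifferentiableAt_chart_symm p hy)
  rw [mfderiv_eq_fderiv] at h
  exact (congrArg (fun A ↦ A v) h).symm

theorem fun_comp_chart_symm {V : Type*} [NormedAddCommGroup V] [NormedSpace ℝ V]
    {f : X → V} {p x : X} (hx : x ∈ (extChartAt (𝓡 m) p).source)
    (hf : ContMDiffAt (𝓡 m) 𝓘(ℝ, V) ∞ f x) :
    ContDiffAt ℝ ∞ (fun y ↦ f ((extChartAt (𝓡 m) p).symm y)) (extChartAt (𝓡 m) p x) := by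
  rw [← contMDiffAt_iff_contDiffAt]
  refine ContMDiffAt.comp (I' := 𝓡 m) _ ?_
    (contMDiffAt_chart_symm p ((extChartAt (𝓡 m) p).map_source hx))
  rwa [(extChartAt (𝓡 m) p).left_inv hx]

theorem d_toForm_apply {θ : Covect m X} {p : X} (hθ : SmoothFormAt (toForm θ) p)
    (v w : TangentSpace (𝓡 m) p) :
    d (toForm θ) p ![v, w] =
      fderiv ℝ (covChart θ p) (extChartAt (𝓡 m) p p) v w -
        fderiv ℝ (covChart θ p) (extChartAt (𝓡 m) p p) w v := by
  have h := (smoothFormAt_toForm_iff.1 hθ).differentiableAt (by simp)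
  rw [← extDeriv_ofSubsingleton h v w, ← inChart_toForm]
  change extDeriv (inChart (toForm θ) p) _ (fun i ↦ mfderiv (𝓡 m) (𝓡 m) _ p _) = _
  congr 1
  funext i
  fin_cases i
  · exact mfderiv_chart_self p v
  · exact mfderiv_chart_self p w


theorem smoothFormAt_smul {f : X → ℝ} {θ : Covect m X} {p : X}
    (hf : ContMDiffAt (𝓡 m) 𝓘(ℝ, ℝ) ∞ f p) (hθ : SmoothFormAt (toForm θ) p) :
    SmoothFormAt (toForm fun x ↦ f x • θ x) p := by
  rw [smoothFormAt_toForm_iff] at hθ ⊢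
  exact (fun_comp_chart_symm (mem_extChartAt_source p) hf).smul hθ

omit [IsManifold (𝓡 m) ∞ X] in
theorem smoothFormAt_add {θ θ' : Covect m X} {p : X}
    (hθ : SmoothFormAt (toForm θ) p) (hθ' : SmoothFormAt (toForm θ') p) :
    SmoothFormAt (toForm fun x ↦ θ x + θ' x) p := by
  rw [smoothFormAt_toForm_iff] at hθ hθ' ⊢
  exact hθ.add hθ'

omit [IsManifold (𝓡 m) ∞ X] in
theorem smoothFormAt_sub {θ θ' : Covect m X} {p : X}
    (hθ : SmoothFormAt (toForm θ) p) (hθ' : SmoothFormAt (toForm θ') p) :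
    SmoothFormAt (toForm fun x ↦ θ x - θ' x) p := by
  rw [smoothFormAt_toForm_iff] at hθ hθ' ⊢
  exact hθ.sub hθ'

theorem d_smul {f : X → ℝ} {θ : Covect m X} {p : X}
    (hf : ContMDiffAt (𝓡 m) 𝓘(ℝ, ℝ) ∞ f p) (hθ : SmoothFormAt (toForm θ) p)
    (v w : TangentSpace (𝓡 m) p) :
    d (toForm fun x ↦ f x • θ x) p ![v, w] =
      mvfderiv (𝓡 m) f p v * θ p w - mvfderiv (𝓡 m) f p w * θ p v +
        f p * d (toForm θ) p ![v, w] := by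
  have h1 := (fun_comp_chart_symm (mem_extChartAt_source p) hf).differentiableAt (by simp)
  have h2 := (smoothFormAt_toForm_iff.1 hθ).differentiableAt (by simp)
  have hf' := hf.mdifferentiableAt (by simp)
  rw [d_toForm_apply (smoothFormAt_smul hf hθ), d_toForm_apply hθ, mvfderiv_eq_fderiv_chart hf',
    mvfderiv_eq_fderiv_chart hf']
  have e : covChart (fun x ↦ f x • θ x) p =
      fun y ↦ f ((extChartAt (𝓡 m) p).symm y) • covChart θ p y := rfl
  rw [e, fderiv_fun_smul h1 h2]
  have key : ∀ (F : ℝ) (A : EuclideanSpace ℝ (Fin m) →L[ℝ] EuclideanSpace ℝ (Fin m) →L[ℝ] ℝ)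
      (B C : EuclideanSpace ℝ (Fin m) →L[ℝ] ℝ) (v w : EuclideanSpace ℝ (Fin m)),
      (F • A + B.smulRight C) v w - (F • A + B.smulRight C) w v =
        B v * C w - B w * C v + F * (A v w - A w v) := by
    intro F A B C v w
    simp only [add_apply, smul_apply, ContinuousLinearMap.smulRight_apply, smul_eq_mul]
    ring
  rw [← covChart_self θ p v, ← covChart_self θ p w]
  refine (key _ _ _ _ v w).trans ?_
  rw [(extChartAt (𝓡 m) p).left_inv (mem_extChartAt_source p)]

theorem d_add {θ θ' : Covect m X} {p : X}
    (hθ : SmoothFormAt (toForm θ) p) (hθ' : SmoothFormAt (toForm θ') p)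
    (v w : TangentSpace (𝓡 m) p) :
    d (toForm fun x ↦ θ x + θ' x) p ![v, w] =
      d (toForm θ) p ![v, w] + d (toForm θ') p ![v, w] := by
  have h1 := (smoothFormAt_toForm_iff.1 hθ).differentiableAt (by simp)
  have h2 := (smoothFormAt_toForm_iff.1 hθ').differentiableAt (by simp)
  rw [d_toForm_apply (smoothFormAt_add hθ hθ'), d_toForm_apply hθ, d_toForm_apply hθ']
  have e : covChart (fun x ↦ θ x + θ' x) p = fun y ↦ covChart θ p y + covChart θ' p y := by
    funext y
    ext v
    rfl
  rw [e, fderiv_fun_add h1 h2]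
  have key : ∀ (A B : EuclideanSpace ℝ (Fin m) →L[ℝ] EuclideanSpace ℝ (Fin m) →L[ℝ] ℝ)
      (v w : EuclideanSpace ℝ (Fin m)),
      (A + B) v w - (A + B) w v = (A v w - A w v) + (B v w - B w v) := by
    intro A B v w
    simp only [add_apply]
    ring
  exact key _ _ v w

theorem d_sub {θ θ' : Covect m X} {p : X}
    (hθ : SmoothFormAt (toForm θ) p) (hθ' : SmoothFormAt (toForm θ') p)
    (v w : TangentSpace (𝓡 m) p) :
    d (toForm fun x ↦ θ x - θ' x) p ![v, w] =
      d (toForm θ) p ![v, w] - d (toForm θ') p ![v, w] := by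
  have h1 := (smoothFormAt_toForm_iff.1 hθ).differentiableAt (by simp)
  have h2 := (smoothFormAt_toForm_iff.1 hθ').differentiableAt (by simp)
  rw [d_toForm_apply (smoothFormAt_sub hθ hθ'), d_toForm_apply hθ, d_toForm_apply hθ']
  have e : covChart (fun x ↦ θ x - θ' x) p = fun y ↦ covChart θ p y - covChart θ' p y := by
    funext y
    ext v
    rfl
  rw [e, fderiv_fun_sub h1 h2]
  have key : ∀ (A B : EuclideanSpace ℝ (Fin m) →L[ℝ] EuclideanSpace ℝ (Fin m) →L[ℝ] ℝ)
      (v w : EuclideanSpace ℝ (Fin m)),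
      (A - B) v w - (A - B) w v = (A v w - A w v) - (B v w - B w v) := by
    intro A B v w
    simp only [sub_apply]
    ring
  exact key _ _ v w

theorem covChart_mvfderiv {f : X → ℝ} {p : X} (hf : ContMDiffAt (𝓡 m) 𝓘(ℝ, ℝ) ∞ f p) :
    covChart (mvfderiv (𝓡 m) f) p =ᶠ[𝓝 (extChartAt (𝓡 m) p p)]
      fderiv ℝ (fun y ↦ f ((extChartAt (𝓡 m) p).symm y)) := by
  have h0 : ContMDiffAt (𝓡 m) 𝓘(ℝ, ℝ) 1 f p := hf.of_le (by norm_cast)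
  have h1 : ∀ᶠ z in 𝓝 p, ContMDiffAt (𝓡 m) 𝓘(ℝ, ℝ) 1 f z :=
    contMDiffAt_iff_contMDiffAt_nhds (by simp) |>.1 h0
  have hc : Tendsto (extChartAt (𝓡 m) p).symm (𝓝 (extChartAt (𝓡 m) p p)) (𝓝 p) := by
    have := (contMDiffAt_chart_symm (m := m) p (mem_extChartAt_target p)).continuousAt
    rwa [ContinuousAt, (extChartAt (𝓡 m) p).left_inv (mem_extChartAt_source p)] at this
  filter_upwards [hc.eventually h1, extChartAt_target_mem_nhds p] with y hy hyt
  ext v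
  exact mvfderiv_chart_symm hyt (hy.mdifferentiableAt (by simp)) v

theorem smoothFormAt_mvfderiv {f : X → ℝ} {p : X} (hf : ContMDiffAt (𝓡 m) 𝓘(ℝ, ℝ) ∞ f p) :
    SmoothFormAt (toForm (mvfderiv (𝓡 m) f)) p := by
  rw [smoothFormAt_toForm_iff]
  refine ContDiffAt.congr_of_eventuallyEq ?_ (covChart_mvfderiv hf)
  exact (fun_comp_chart_symm (mem_extChartAt_source p) hf).fderiv_right (by simp)

/-- In a chart this is the symmetry of the second derivative. -/
theorem d_mvfderiv {f : X → ℝ} {p : X} (hf : ContMDiffAt (𝓡 m) 𝓘(ℝ, ℝ) ∞ f p)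
    (v w : TangentSpace (𝓡 m) p) : d (toForm (mvfderiv (𝓡 m) f)) p ![v, w] = 0 := by
  rw [d_toForm_apply (smoothFormAt_mvfderiv hf), (covChart_mvfderiv hf).fderiv_eq]
  have h := (fun_comp_chart_symm (mem_extChartAt_source p) hf).isSymmSndFDerivAt
    (by simpa using two_le_infty)
  exact sub_eq_zero.2 (h.eq v w)

end OneForms

/-! ### The angle form of a circle-valued function -/

section AngleForm

variable {m : ℕ} {X : Type*} [TopologicalSpace X] [ChartedSpace (EuclideanSpace ℝ (Fin m)) X]

theorem contMDiff_circle_coe : ContMDiff (𝓡 1) 𝓘(ℝ, ℂ) ∞ (fun z : Circle ↦ (z : ℂ)) :=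
  haveI : Fact (Module.finrank ℝ ℂ = 1 + 1) := ⟨Complex.finrank_real_complex⟩
  contMDiff_coe_sphere

variable {c : X → Circle} {p : X}

theorem contMDiffAt_coe_circle (hc : ContMDiffAt (𝓡 m) (𝓡 1) ∞ c p) :
    ContMDiffAt (𝓡 m) 𝓘(ℝ, ℂ) ∞ (fun y ↦ (c y : ℂ)) p :=
  contMDiff_circle_coe.contMDiffAt.comp p hc

theorem contMDiffAt_circle_re (hc : ContMDiffAt (𝓡 m) (𝓡 1) ∞ c p) :
    ContMDiffAt (𝓡 m) 𝓘(ℝ, ℝ) ∞ (fun y ↦ (c y : ℂ).re) p :=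
  Complex.reCLM.contMDiff.contMDiffAt.comp p (contMDiffAt_coe_circle hc)

theorem contMDiffAt_circle_im (hc : ContMDiffAt (𝓡 m) (𝓡 1) ∞ c p) :
    ContMDiffAt (𝓡 m) 𝓘(ℝ, ℝ) ∞ (fun y ↦ (c y : ℂ).im) p :=
  Complex.imCLM.contMDiff.contMDiffAt.comp p (contMDiffAt_coe_circle hc)

theorem mvfderiv_clm_comp {V W : Type*} [NormedAddCommGroup V] [NormedSpace ℝ V]
    [NormedAddCommGroup W] [NormedSpace ℝ W] (A : V →L[ℝ] W) {f : X → V}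
    (hf : MDifferentiableAt (𝓡 m) 𝓘(ℝ, V) f p) (v : TangentSpace (𝓡 m) p) :
    mvfderiv (𝓡 m) (fun y ↦ A (f y)) p v = A (mvfderiv (𝓡 m) f p v) := by
  have h := mfderiv_comp p (g := A) A.mdifferentiableAt hf
  rw [mfderiv_eq_fderiv, A.fderiv] at h
  exact congrArg (fun B ↦ B v) h

theorem dAngle_apply (hc : ContMDiffAt (𝓡 m) (𝓡 1) ∞ c p) (v : TangentSpace (𝓡 m) p) :
    dAngle c p v = (c p : ℂ).re * mvfderiv (𝓡 m) (fun y ↦ (c y : ℂ).im) p v -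
      (c p : ℂ).im * mvfderiv (𝓡 m) (fun y ↦ (c y : ℂ).re) p v := by
  have h := (contMDiffAt_coe_circle hc).mdifferentiableAt (by simp)
  have h1 := mvfderiv_clm_comp Complex.reCLM h v
  have h2 := mvfderiv_clm_comp Complex.imCLM h v
  simp only [Complex.reCLM_apply, Complex.imCLM_apply] at h1 h2
  rw [h1, h2]
  simp only [dAngle, ContinuousLinearMap.comp_apply, ContinuousLinearMap.mul_apply',
    Complex.imCLM_apply, Complex.mul_im, Complex.conj_re, Complex.conj_im]
  ring

theorem re_sq_add_im_sq (z : Circle) : (z : ℂ).re ^ 2 + (z : ℂ).im ^ 2 = 1 := by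
  have := Circle.normSq_coe z
  rw [Complex.normSq_apply] at this
  nlinarith

theorem re_mul_mvfderiv_add (hc : ContMDiffAt (𝓡 m) (𝓡 1) ∞ c p) (v : TangentSpace (𝓡 m) p) :
    (c p : ℂ).re * mvfderiv (𝓡 m) (fun y ↦ (c y : ℂ).re) p v +
      (c p : ℂ).im * mvfderiv (𝓡 m) (fun y ↦ (c y : ℂ).im) p v = 0 := by
  have h1 := (contMDiffAt_circle_re hc).mdifferentiableAt (by simp)
  have h2 := (contMDiffAt_circle_im hc).mdifferentiableAt (by simp)
  have h : (fun y ↦ (c y : ℂ).re * (c y : ℂ).re + (c y : ℂ).im * (c y : ℂ).im) =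
      fun _ : X ↦ (1 : ℝ) := by
    funext y
    nlinarith [re_sq_add_im_sq (c y)]
  have h3 := congrArg (fun f : X → ℝ ↦ mvfderiv (𝓡 m) f p v) h
  simp only [mvfderiv_const] at h3
  have hm1 : MDifferentiableAt (𝓡 m) 𝓘(ℝ, ℝ) (fun y ↦ (c y : ℂ).re * (c y : ℂ).re) p := h1.mul h1
  have hm2 : MDifferentiableAt (𝓡 m) 𝓘(ℝ, ℝ) (fun y ↦ (c y : ℂ).im * (c y : ℂ).im) p := h2.mul h2
  rw [mvfderiv_fun_add hm1 hm2, mvfderiv_fun_mul h1 h1, mvfderiv_fun_mul h2 h2] at h3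
  simp only [add_apply, smul_apply, smul_eq_mul,
    zero_apply] at h3
  linarith

/-- Real part of dc = i c dx. The definition of `dAngle` gives one linear equation for the
derivatives of the real and imaginary parts, and the derivative of |c|² = 1 gives the other. -/
theorem mvfderiv_re (hc : ContMDiffAt (𝓡 m) (𝓡 1) ∞ c p) (v : TangentSpace (𝓡 m) p) :
    mvfderiv (𝓡 m) (fun y ↦ (c y : ℂ).re) p v = -(c p : ℂ).im * dAngle c p v := by
  rw [dAngle_apply hc]
  linear_combination (c p : ℂ).re * re_mul_mvfderiv_add hc v -
    mvfderiv (𝓡 m) (fun y ↦ (c y : ℂ).re) p v * re_sq_add_im_sq (c p)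

theorem mvfderiv_im (hc : ContMDiffAt (𝓡 m) (𝓡 1) ∞ c p) (v : TangentSpace (𝓡 m) p) :
    mvfderiv (𝓡 m) (fun y ↦ (c y : ℂ).im) p v = (c p : ℂ).re * dAngle c p v := by
  rw [dAngle_apply hc]
  linear_combination (c p : ℂ).im * re_mul_mvfderiv_add hc v -
    mvfderiv (𝓡 m) (fun y ↦ (c y : ℂ).im) p v * re_sq_add_im_sq (c p)

theorem cosTwo_eq (z : Circle) : cosTwo z = (z : ℂ).re * (z : ℂ).re - (z : ℂ).im * (z : ℂ).im := by
  simp [cosTwo, pow_two]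

theorem sinTwo_eq (z : Circle) : sinTwo z = (z : ℂ).re * (z : ℂ).im + (z : ℂ).im * (z : ℂ).re := by
  simp [sinTwo, pow_two]

theorem cosTwo_sq_add_sinTwo_sq (z : Circle) : cosTwo z ^ 2 + sinTwo z ^ 2 = 1 := by
  rw [cosTwo_eq, sinTwo_eq]
  linear_combination ((z : ℂ).re ^ 2 + (z : ℂ).im ^ 2 + 1) * re_sq_add_im_sq z

theorem cosTwo_mul (z w : Circle) :
    cosTwo (z * w) = cosTwo z * cosTwo w - sinTwo z * sinTwo w := by
  simp only [cosTwo_eq, sinTwo_eq, Circle.coe_mul, Complex.mul_re, Complex.mul_im]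
  ring

theorem sinTwo_mul (z w : Circle) :
    sinTwo (z * w) = sinTwo z * cosTwo w + cosTwo z * sinTwo w := by
  simp only [cosTwo_eq, sinTwo_eq, Circle.coe_mul, Complex.mul_re, Complex.mul_im]
  ring

theorem contMDiffAt_cosTwo (hc : ContMDiffAt (𝓡 m) (𝓡 1) ∞ c p) :
    ContMDiffAt (𝓡 m) 𝓘(ℝ, ℝ) ∞ (fun y ↦ cosTwo (c y)) p := by
  simp only [cosTwo_eq]
  have h1 := contMDiffAt_circle_re hc
  have h2 := contMDiffAt_circle_im hc
  exact (h1.mul h1).sub (h2.mul h2)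

theorem contMDiffAt_sinTwo (hc : ContMDiffAt (𝓡 m) (𝓡 1) ∞ c p) :
    ContMDiffAt (𝓡 m) 𝓘(ℝ, ℝ) ∞ (fun y ↦ sinTwo (c y)) p := by
  simp only [sinTwo_eq]
  have h1 := contMDiffAt_circle_re hc
  have h2 := contMDiffAt_circle_im hc
  exact (h1.mul h2).add (h2.mul h1)

theorem mvfderiv_cosTwo (hc : ContMDiffAt (𝓡 m) (𝓡 1) ∞ c p) (v : TangentSpace (𝓡 m) p) :
    mvfderiv (𝓡 m) (fun y ↦ cosTwo (c y)) p v = -2 * sinTwo (c p) * dAngle c p v := by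
  simp only [cosTwo_eq, sinTwo_eq]
  have h1 := (contMDiffAt_circle_re hc).mdifferentiableAt (by simp)
  have h2 := (contMDiffAt_circle_im hc).mdifferentiableAt (by simp)
  have hm1 : MDifferentiableAt (𝓡 m) 𝓘(ℝ, ℝ) (fun y ↦ (c y : ℂ).re * (c y : ℂ).re) p := h1.mul h1
  have hm2 : MDifferentiableAt (𝓡 m) 𝓘(ℝ, ℝ) (fun y ↦ (c y : ℂ).im * (c y : ℂ).im) p := h2.mul h2
  rw [mvfderiv_fun_sub hm1 hm2, mvfderiv_fun_mul h1 h1, mvfderiv_fun_mul h2 h2]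
  simp only [add_apply, smul_apply, smul_eq_mul,
    sub_apply, mvfderiv_re hc, mvfderiv_im hc]
  ring

theorem mvfderiv_sinTwo (hc : ContMDiffAt (𝓡 m) (𝓡 1) ∞ c p) (v : TangentSpace (𝓡 m) p) :
    mvfderiv (𝓡 m) (fun y ↦ sinTwo (c y)) p v = 2 * cosTwo (c p) * dAngle c p v := by
  simp only [cosTwo_eq, sinTwo_eq]
  have h1 := (contMDiffAt_circle_re hc).mdifferentiableAt (by simp)
  have h2 := (contMDiffAt_circle_im hc).mdifferentiableAt (by simp)
  have hm1 : MDifferentiableAt (𝓡 m) 𝓘(ℝ, ℝ) (fun y ↦ (c y : ℂ).re * (c y : ℂ).im) p := h1.mul h2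
  have hm2 : MDifferentiableAt (𝓡 m) 𝓘(ℝ, ℝ) (fun y ↦ (c y : ℂ).im * (c y : ℂ).re) p := h2.mul h1
  rw [mvfderiv_fun_add hm1 hm2, mvfderiv_fun_mul h1 h2, mvfderiv_fun_mul h2 h1]
  simp only [add_apply, smul_apply, smul_eq_mul,
    mvfderiv_re hc, mvfderiv_im hc]
  ring

variable [IsManifold (𝓡 m) ∞ X]

omit [IsManifold (𝓡 m) ∞ X] in
theorem dAngle_eventuallyEq (hc : ∀ᶠ y in 𝓝 p, ContMDiffAt (𝓡 m) (𝓡 1) ∞ c y) :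
    ∀ᶠ y in 𝓝 p, toForm (dAngle c) y = toForm (fun y ↦
      (c y : ℂ).re • mvfderiv (𝓡 m) (fun y ↦ (c y : ℂ).im) y -
        (c y : ℂ).im • mvfderiv (𝓡 m) (fun y ↦ (c y : ℂ).re) y) y := by
  filter_upwards [hc] with y hy
  ext v
  exact dAngle_apply hy (v 0)

theorem smoothFormAt_dAngle (hc : ∀ᶠ y in 𝓝 p, ContMDiffAt (𝓡 m) (𝓡 1) ∞ c y) :
    SmoothFormAt (toForm (m := m) (dAngle c)) p := by
  have h : ContMDiffAt (𝓡 m) (𝓡 1) ∞ c p := hc.self_of_nhds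
  refine SmoothFormAt.congr (m := m) ?_ ((dAngle_eventuallyEq (m := m) hc).mono fun _ hy ↦ hy.symm)
  exact smoothFormAt_sub (m := m)
    (smoothFormAt_smul (contMDiffAt_circle_re h) (smoothFormAt_mvfderiv (contMDiffAt_circle_im h)))
    (smoothFormAt_smul (contMDiffAt_circle_im h) (smoothFormAt_mvfderiv (contMDiffAt_circle_re h)))

/-- With c = a + ib near `p`, dx = a db - b da, so d(dx) = 2 da∧db; this vanishes because da and db
are both multiples of dx. -/
theorem d_dAngle (hc : ∀ᶠ y in 𝓝 p, ContMDiffAt (𝓡 m) (𝓡 1) ∞ c y)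
    (v w : TangentSpace (𝓡 m) p) : d (toForm (dAngle c)) p ![v, w] = 0 := by
  have h := hc.self_of_nhds
  have hr := contMDiffAt_circle_re h
  have hi := contMDiffAt_circle_im h
  rw [d_congr (dAngle_eventuallyEq (m := m) hc), d_sub
    (smoothFormAt_smul hr (smoothFormAt_mvfderiv hi)) (smoothFormAt_smul hi (smoothFormAt_mvfderiv hr)),
    d_smul hr (smoothFormAt_mvfderiv hi), d_smul hi (smoothFormAt_mvfderiv hr), d_mvfderiv hi,
    d_mvfderiv hr]
  simp only [mvfderiv_re h, mvfderiv_im h]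
  ring

end AngleForm

/-! ### Algebra of curvature tensors compatible with a quaternionic triple -/

section CurvatureAlgebra

variable {V : Type*} [NormedAddCommGroup V] [InnerProductSpace ℝ V]

/-- A quaternionic triple of skew endomorphisms of a Euclidean vector space. -/
structure IsQuatTriple (J₁ J₂ J₃ : V →ₗ[ℝ] V) : Prop where
  sq₁ : ∀ v, J₁ (J₁ v) = -v
  sq₂ : ∀ v, J₂ (J₂ v) = -v
  sq₃ : ∀ v, J₃ (J₃ v) = -v
  mul₁₂ : ∀ v, J₁ (J₂ v) = J₃ v
  mul₂₃ : ∀ v, J₂ (J₃ v) = J₁ v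
  mul₃₁ : ∀ v, J₃ (J₁ v) = J₂ v
  mul₂₁ : ∀ v, J₂ (J₁ v) = -J₃ v
  mul₃₂ : ∀ v, J₃ (J₂ v) = -J₁ v
  mul₁₃ : ∀ v, J₁ (J₃ v) = -J₂ v
  skew₁ : ∀ v w, ⟪J₁ v, w⟫_ℝ = -⟪v, J₁ w⟫_ℝ
  skew₂ : ∀ v w, ⟪J₂ v, w⟫_ℝ = -⟪v, J₂ w⟫_ℝ
  skew₃ : ∀ v w, ⟪J₃ v, w⟫_ℝ = -⟪v, J₃ w⟫_ℝ

theorem IsQuatTriple.cycle {J₁ J₂ J₃ : V →ₗ[ℝ] V} (h : IsQuatTriple J₁ J₂ J₃) :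
    IsQuatTriple J₂ J₃ J₁ :=
  ⟨h.sq₂, h.sq₃, h.sq₁, h.mul₂₃, h.mul₃₁, h.mul₁₂, h.mul₃₂, h.mul₁₃, h.mul₂₁,
    h.skew₂, h.skew₃, h.skew₁⟩

/-- An algebraic curvature tensor whose commutators with a quaternionic triple are given by
`so(3)`-curvature forms `γₐ`. -/
structure IsQuatCurvature (R : V →ₗ[ℝ] V →ₗ[ℝ] V →ₗ[ℝ] V) (J₁ J₂ J₃ : V →ₗ[ℝ] V)
    (γ₁ γ₂ γ₃ : V →ₗ[ℝ] V →ₗ[ℝ] ℝ) : Prop where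
  triple : IsQuatTriple J₁ J₂ J₃
  antisymm : ∀ x y z, R x y z = -R y x z
  skew : ∀ x y z w, ⟪R x y z, w⟫_ℝ = -⟪z, R x y w⟫_ℝ
  bianchi : ∀ x y z, R x y z + R y z x + R z x y = 0
  alt₁ : ∀ x y, γ₁ x y = -γ₁ y x
  alt₂ : ∀ x y, γ₂ x y = -γ₂ y x
  alt₃ : ∀ x y, γ₃ x y = -γ₃ y x
  comm₁ : ∀ x y z, R x y (J₁ z) - J₁ (R x y z) = γ₃ x y • J₂ z - γ₂ x y • J₃ z
  comm₂ : ∀ x y z, R x y (J₂ z) - J₂ (R x y z) = γ₁ x y • J₃ z - γ₃ x y • J₁ z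
  comm₃ : ∀ x y z, R x y (J₃ z) - J₃ (R x y z) = γ₂ x y • J₁ z - γ₁ x y • J₂ z

namespace IsQuatCurvature

variable {R : V →ₗ[ℝ] V →ₗ[ℝ] V →ₗ[ℝ] V} {J₁ J₂ J₃ : V →ₗ[ℝ] V}
  {γ₁ γ₂ γ₃ : V →ₗ[ℝ] V →ₗ[ℝ] ℝ} {ι : Type*} [Fintype ι] (b : OrthonormalBasis ι ℝ V)

theorem cycle (h : IsQuatCurvature R J₁ J₂ J₃ γ₁ γ₂ γ₃) :
    IsQuatCurvature R J₂ J₃ J₁ γ₂ γ₃ γ₁ :=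
  ⟨h.triple.cycle, h.antisymm, h.skew, h.bianchi, h.alt₂, h.alt₃, h.alt₁, h.comm₂, h.comm₃,
    h.comm₁⟩

/-- The classical octahedron argument: a signed sum of four Bianchi identities, with the skewness in
each pair of arguments. -/
theorem pair_symm (h : IsQuatCurvature R J₁ J₂ J₃ γ₁ γ₂ γ₃) (x y z w : V) :
    ⟪R x y z, w⟫_ℝ = ⟪R z w x, y⟫_ℝ := by
  have a : ∀ x y z w, ⟪R x y z, w⟫_ℝ = -⟪R y x z, w⟫_ℝ := fun x y z w ↦ by
    rw [h.antisymm x y, inner_neg_left]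
  have s : ∀ x y z w, ⟪R x y z, w⟫_ℝ = -⟪R x y w, z⟫_ℝ := fun x y z w ↦ by
    rw [h.skew, real_inner_comm]
  have B : ∀ x y z w, ⟪R x y z, w⟫_ℝ + ⟪R y z x, w⟫_ℝ + ⟪R z x y, w⟫_ℝ = 0 := fun x y z w ↦ by
    rw [← inner_add_left, ← inner_add_left, h.bianchi, inner_zero_left]
  linarith [B x y z w, B y z w x, B z w x y, B w x y z, a x y z w, s x y z w, a y z x w, s y z x w,
    a z x y w, s z x y w, a z w x y, s z w x y, a w x y z, s w x y z, a y z w x, s y z w x,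
    a w y z x, s w y z x, a x z w y, s x z w y, a z w y x, s z w y x, a w x z y, s w x z y,
    a x y w z, s x y w z, a y w x z, s y w x z, a x w y z, s x w y z, a z x w y, s z x w y,
    a w y x z, s w y x z]

/-- The sum over an orthonormal basis computing the trace. -/
theorem trace_comm (A B : V →ₗ[ℝ] V) :
    ∑ i, ⟪A (B (b i)), b i⟫_ℝ = ∑ i, ⟪B (A (b i)), b i⟫_ℝ := by
  have : FiniteDimensional ℝ V := b.toBasis.finiteDimensional_of_finite
  have h := LinearMap.trace_mul_comm ℝ A B
  rw [LinearMap.trace_eq_sum_inner _ b, LinearMap.trace_eq_sum_inner _ b] at h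
  simp only [real_inner_comm (b _)]
  simpa using h

theorem sum_skew_eq_zero {J : V →ₗ[ℝ] V} (hJ : ∀ v w, ⟪J v, w⟫_ℝ = -⟪v, J w⟫_ℝ) :
    ∑ i, ⟪J (b i), b i⟫_ℝ = 0 := by
  refine Finset.sum_eq_zero fun i _ ↦ ?_
  have := hJ (b i) (b i)
  rw [real_inner_comm (J (b i))] at this
  linarith

variable {b} {n : ℕ}

/-- Applying J₃ to the commutator [R(x,y), J₂] gives J₃RJ₂ + J₁R = -γ₁ - γ₃J₂. Cyclicity of the
trace and J₂J₃ = J₁ make the two traces on the left equal, while J₂ is traceless. -/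
theorem trace_J_comp (h : IsQuatCurvature R J₁ J₂ J₃ γ₁ γ₂ γ₃) (hn : Fintype.card ι = 4 * n)
    (x y : V) : ∑ i, ⟪J₁ (R x y (b i)), b i⟫_ℝ = -(2 * n) * γ₁ x y := by
  have h1 : ∀ i, ⟪J₃ (R x y (J₂ (b i))), b i⟫_ℝ + ⟪J₁ (R x y (b i)), b i⟫_ℝ =
      -γ₁ x y - γ₃ x y * ⟪J₂ (b i), b i⟫_ℝ := by
    intro i
    have e := congrArg (fun v ↦ ⟪J₃ v, b i⟫_ℝ) (h.comm₂ x y (b i))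
    simp only [map_sub, map_smul, h.triple.mul₃₂, h.triple.sq₃, h.triple.mul₃₁, inner_sub_left,
      inner_neg_left, inner_smul_left, smul_neg] at e
    have hb : ⟪b i, b i⟫_ℝ = 1 := by simp
    simp only [RCLike.conj_to_real, hb] at e
    linarith
  have h2 := Finset.sum_congr (rfl : (Finset.univ : Finset ι) = Finset.univ) (fun i _ ↦ h1 i)
  have h3 : ∑ i, ⟪J₃ (R x y (J₂ (b i))), b i⟫_ℝ = ∑ i, ⟪J₁ (R x y (b i)), b i⟫_ℝ := by
    have := trace_comm b (J₃ ∘ₗ R x y) J₂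
    simpa [h.triple.mul₂₃] using this
  rw [Finset.sum_add_distrib, h3, Finset.sum_sub_distrib, ← Finset.mul_sum,
    sum_skew_eq_zero b h.triple.skew₂, Finset.sum_const, Finset.card_univ, hn] at h2
  simp only [nsmul_eq_mul, Nat.cast_mul, Nat.cast_ofNat] at h2
  linarith

theorem trace_J_swap (h : IsQuatCurvature R J₁ J₂ J₃ γ₁ γ₂ γ₃) (x y : V) :
    ∑ i, ⟪J₁ (R (b i) y x), b i⟫_ℝ = -∑ i, ⟪J₁ (R (b i) x y), b i⟫_ℝ := by
  have h1 : ∀ e, ⟪J₁ (R e y x), e⟫_ℝ = -⟪R (J₁ e) x y, e⟫_ℝ := by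
    intro e
    rw [h.triple.skew₁, h.pair_symm, h.antisymm x (J₁ e), inner_neg_left, h.skew,
      neg_neg, real_inner_comm]
  simp only [h1, Finset.sum_neg_distrib]
  have := trace_comm b (R.flip x |>.flip y) J₁
  simpa using this

/-- The Bianchi identity rewrites tr J₁R(x,y) as a difference of two contractions, which are
opposite by `trace_J_swap`. Moving J₁ inside R with `comm₁` leaves the Ricci tensor at (x, J₁y) and
two contracted curvature forms. -/
theorem card_mul_gamma (h : IsQuatCurvature R J₁ J₂ J₃ γ₁ γ₂ γ₃) (hn : Fintype.card ι = 4 * n)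
    (x y : V) : n * γ₁ x y = ∑ i, ⟪R (b i) x (J₁ y), b i⟫_ℝ + γ₃ x (J₂ y) - γ₂ x (J₃ y) := by
  have h1 := h.trace_J_comp (b := b) hn x y
  have h2 : ∑ i, ⟪J₁ (R x y (b i)), b i⟫_ℝ = ∑ i, ⟪J₁ (R (b i) y x), b i⟫_ℝ -
      ∑ i, ⟪J₁ (R (b i) x y), b i⟫_ℝ := by
    rw [← Finset.sum_sub_distrib]
    refine Finset.sum_congr rfl fun i _ ↦ ?_
    rw [← inner_sub_left, ← map_sub]
    congr 2
    have := h.bianchi x y (b i)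
    rw [h.antisymm y (b i)] at this
    rw [eq_comm, ← sub_eq_zero, ← neg_eq_zero, ← this]
    abel
  rw [h.trace_J_swap] at h2
  have h3 : ∀ i, ⟪J₁ (R (b i) x y), b i⟫_ℝ = ⟪R (b i) x (J₁ y), b i⟫_ℝ -
      γ₃ (b i) x * ⟪J₂ y, b i⟫_ℝ + γ₂ (b i) x * ⟪J₃ y, b i⟫_ℝ := by
    intro i
    have e := congrArg (fun v ↦ ⟪v, b i⟫_ℝ) (h.comm₁ (b i) x y)
    simp only [inner_sub_left, inner_smul_left, RCLike.conj_to_real] at e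
    linarith
  have h4 : ∀ (γ : V →ₗ[ℝ] V →ₗ[ℝ] ℝ) (v : V), ∑ i, γ (b i) x * ⟪v, b i⟫_ℝ = γ v x := by
    intro γ v
    conv_rhs => rw [← b.sum_repr' v]
    simp only [map_sum, map_smul, LinearMap.sum_apply, LinearMap.smul_apply, smul_eq_mul]
    exact Finset.sum_congr rfl fun i _ ↦ by rw [mul_comm, real_inner_comm]
  simp only [h3, Finset.sum_add_distrib, Finset.sum_sub_distrib, h4] at h2
  have := h.alt₃ (J₂ y) x
  have := h.alt₂ (J₃ y) x
  linarith

theorem ricci_symm (h : IsQuatCurvature R J₁ J₂ J₃ γ₁ γ₂ γ₃) (x y : V) :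
    ∑ i, ⟪R (b i) x y, b i⟫_ℝ = ∑ i, ⟪R (b i) y x, b i⟫_ℝ := by
  refine Finset.sum_congr rfl fun i _ ↦ ?_
  rw [h.pair_symm, h.antisymm, inner_neg_left, h.skew, real_inner_comm, neg_neg]

/-- Put aᵢ = γᵢ(x, Jᵢy). The three cyclic versions of `card_mul_gamma` read (n - 1)aᵢ = -Ric(x,y) -
(a₁ + a₂ + a₃). For n ≥ 2 they force a₁ = a₂ = a₃, whence the factor n + 2. For n = 1 they do not
compare the aᵢ, which is why dimension four needs a separate hypothesis. -/
theorem gamma_eq_ricci (h : IsQuatCurvature R J₁ J₂ J₃ γ₁ γ₂ γ₃) (hn : Fintype.card ι = 4 * n)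
    (h2 : 2 ≤ n) (x y : V) : ((n : ℝ) + 2) * γ₁ x (J₁ y) = -∑ i, ⟪R (b i) x y, b i⟫_ℝ := by
  have e1 := h.card_mul_gamma (b := b) hn x (J₁ y)
  have e2 := h.cycle.card_mul_gamma (b := b) hn x (J₂ y)
  have e3 := h.cycle.cycle.card_mul_gamma (b := b) hn x (J₃ y)
  simp only [h.triple.sq₁, h.triple.sq₂, h.triple.sq₃, h.triple.mul₂₁, h.triple.mul₃₁,
    h.triple.mul₃₂, h.triple.mul₁₂, h.triple.mul₁₃, h.triple.mul₂₃, map_neg, inner_neg_left,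
    Finset.sum_neg_distrib] at e1 e2 e3
  have hn' : (2 : ℝ) ≤ n := by exact_mod_cast h2
  have h12 : γ₁ x (J₁ y) = γ₂ x (J₂ y) := by
    refine mul_left_cancel₀ (sub_ne_zero.2 (by linarith : (n : ℝ) ≠ 1)) ?_
    linarith
  have h13 : γ₁ x (J₁ y) = γ₃ x (J₃ y) := by
    refine mul_left_cancel₀ (sub_ne_zero.2 (by linarith : (n : ℝ) ≠ 1)) ?_
    linarith
  linarith

/-- An irreducible-type argument: the Ricci form is a multiple of the metric. -/
theorem einstein (h : IsQuatCurvature R J₁ J₂ J₃ γ₁ γ₂ γ₃) {S : V → V → ℝ}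
    (h₁ : ∀ x y, γ₁ x (J₁ y) = -S x y)
    (h₂ : ∀ x y, γ₂ x (J₂ y) = -S x y) (x z : V) :
    S x x * ⟪z, z⟫_ℝ = S z z * ⟪x, x⟫_ℝ := by
  have h₁' : ∀ x y, γ₁ x y = S x (J₁ y) := fun x y ↦ by
    have := h₁ x (J₁ y)
    rw [h.triple.sq₁, map_neg] at this
    linarith
  have hS₂ : ∀ x, S (J₂ x) (J₂ x) = S x x := fun x ↦ by
    have e1 := h₂ (J₂ x) x
    have e2 := h₂ x (J₂ x)
    have e3 := h.alt₂ x (J₂ (J₂ x))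
    have e4 := h₂ x x
    have e5 := h.alt₂ x (J₂ x)
    have e6 := h₂ (J₂ x) (J₂ x)
    rw [h.triple.sq₂] at e6
    simp only [map_neg] at e6
    linarith
  -- The commutator of R(x, J₁x) with J₂, applied to z and paired with J₃z: a sum of two values of
  -- ⟨R(x, J₁x)·, J₁·⟩ is determined by S(x,x) alone.
  have hF : ∀ x z, ⟪R x (J₁ x) z, J₁ z⟫_ℝ + ⟪R x (J₁ x) (J₂ z), J₁ (J₂ z)⟫_ℝ =
      -(S x x * ⟪z, z⟫_ℝ) := by
    intro x z
    have e := congrArg (fun v ↦ ⟪v, J₃ z⟫_ℝ) (h.comm₂ x (J₁ x) z)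
    simp only [inner_sub_left, inner_smul_left, RCLike.conj_to_real, h₁] at e
    have e1 : ⟪J₂ (R x (J₁ x) z), J₃ z⟫_ℝ = -⟪R x (J₁ x) z, J₁ z⟫_ℝ := by
      rw [h.triple.skew₂, h.triple.mul₂₃]
    have e2 : ⟪J₁ z, J₃ z⟫_ℝ = 0 := by
      have a := h.triple.skew₁ z (J₃ z)
      have c := h.triple.skew₂ z z
      rw [h.triple.mul₁₃, inner_neg_right] at a
      rw [real_inner_comm] at c
      linarith
    have e3 : ⟪J₃ z, J₃ z⟫_ℝ = ⟪z, z⟫_ℝ := by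
      rw [h.triple.skew₃, h.triple.sq₃, inner_neg_right, neg_neg]
    rw [h.triple.mul₁₂]
    rw [e1, e2, e3] at e
    linarith
  have hsym : ∀ x z, ⟪R x (J₁ x) z, J₁ z⟫_ℝ = ⟪R z (J₁ z) x, J₁ x⟫_ℝ := fun x z ↦
    h.pair_symm _ _ _ _
  -- Averaging over x and J₂x, with S(J₂x, J₂x) = S(x,x), gives a four-term sum equal to
  -- -2S(x,x)‖z‖². By pair symmetry the same sum is -2S(z,z)‖x‖².
  have a1 := hF x z
  have a2 := hF (J₂ x) z
  have a3 := hF z x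
  have a4 := hF (J₂ z) x
  rw [hS₂] at a2 a4
  linarith [hsym x z, hsym (J₂ x) z, hsym x (J₂ z), hsym (J₂ x) (J₂ z)]

/-- With S = Ric/(n+2), `einstein` makes S a multiple of the metric. Its trace is scal/(n+2) = -16n
in dimension 4n, so the multiple is -4; polarisation and γ₁(x, J₁y) = -S(x,y) then give the factor
4. -/
theorem gamma_eq_of_two_le (h : IsQuatCurvature R J₁ J₂ J₃ γ₁ γ₂ γ₃)
    (hn : Fintype.card ι = 4 * n) (h2 : 2 ≤ n)
    (hscal : ∑ j, ∑ i, ⟪R (b i) (b j) (b j), b i⟫_ℝ = -16 * (n : ℝ) * ((n : ℝ) + 2)) (x y : V) :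
    γ₁ x y = 4 * ⟪J₁ x, y⟫_ℝ := by
  have hn0 : (0 : ℝ) < n := by exact_mod_cast (by omega : 0 < n)
  set S : V → V → ℝ := fun x y ↦ ((n : ℝ) + 2)⁻¹ * ∑ i, ⟪R (b i) x y, b i⟫_ℝ with hSdef
  have hS : ∀ x y, S x y = S y x := fun x y ↦ by simp only [hSdef, h.ricci_symm x y]
  have hγ : ∀ {γ : ℝ} {x y : V}, ((n : ℝ) + 2) * γ = -∑ i, ⟪R (b i) x y, b i⟫_ℝ → γ = -S x y := by
    intro γ x y e
    simp only [hSdef]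
    field_simp
    linarith
  have h₁ : ∀ x y, γ₁ x (J₁ y) = -S x y := fun x y ↦ hγ (h.gamma_eq_ricci hn h2 x y)
  have h₂ : ∀ x y, γ₂ x (J₂ y) = -S x y := fun x y ↦ hγ (h.cycle.gamma_eq_ricci hn h2 x y)
  have hE := h.einstein h₁ h₂
  have htr : ∑ j, S (b j) (b j) = -16 * n := by
    simp only [hSdef, ← Finset.mul_sum, hscal]
    field_simp
  have hd : ∀ z, S z z = -4 * ⟪z, z⟫_ℝ := by
    intro z
    have e : ∑ j, S (b j) (b j) * ⟪z, z⟫_ℝ = ∑ j, S z z * ⟪b j, b j⟫_ℝ :=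
      Finset.sum_congr rfl fun j _ ↦ hE _ _
    rw [← Finset.sum_mul, htr] at e
    simp only [real_inner_self_eq_norm_sq, b.norm_eq_one, Finset.sum_const, Finset.card_univ, hn] at e
    simp only [one_pow, nsmul_eq_mul, mul_one, Nat.cast_mul,
      Nat.cast_ofNat] at e
    rw [real_inner_self_eq_norm_sq]
    refine mul_left_cancel₀ (by positivity : (4 * n : ℝ) ≠ 0) ?_
    linarith
  have hadd : ∀ x y z, S (x + y) z = S x z + S y z := by
    intro x y z
    simp only [hSdef, map_add, LinearMap.add_apply, inner_add_left, Finset.sum_add_distrib]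
    ring
  have hpol : S x (J₁ y) = -4 * ⟪x, J₁ y⟫_ℝ := by
    have e := hd (x + J₁ y)
    rw [hadd, hS x, hS (J₁ y), hadd, hadd, inner_add_left, inner_add_right, inner_add_right,
      hd, hd, hS (J₁ y) x, real_inner_comm x (J₁ y)] at e
    linarith
  have := h₁ x (J₁ y)
  rw [h.triple.sq₁, map_neg] at this
  rw [h.triple.skew₁]
  linarith

/-- By pair symmetry the contraction in `hw` is -tr J₁R(x,y), which is 2γ₁(x,y) by `trace_J_comp`
with n = 1. -/
theorem gamma_eq_of_weyl (h : IsQuatCurvature R J₁ J₂ J₃ γ₁ γ₂ γ₃)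
    (hn : Fintype.card ι = 4) (x y : V)
    (hw : ∑ i, ⟪R (b i) (J₁ (b i)) x, y⟫_ℝ = 8 * ⟪J₁ x, y⟫_ℝ) :
    γ₁ x y = 4 * ⟪J₁ x, y⟫_ℝ := by
  have h1 := h.trace_J_comp (b := b) (n := 1) (by omega) x y
  have h2 : ∑ i, ⟪R (b i) (J₁ (b i)) x, y⟫_ℝ = -∑ i, ⟪J₁ (R x y (b i)), b i⟫_ℝ := by
    rw [← Finset.sum_neg_distrib]
    refine Finset.sum_congr rfl fun i _ ↦ ?_
    rw [h.pair_symm, h.triple.skew₁, neg_neg]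
  simp only [Nat.cast_one, mul_one] at h1
  linarith

end IsQuatCurvature

end CurvatureAlgebra

/-! ### Connections, curvature and Killing fields on an open piece of a vector space -/

section ChartGeometry

variable {E F G : Type*} [NormedAddCommGroup E] [NormedSpace ℝ E]
  [NormedAddCommGroup F] [NormedSpace ℝ F] [NormedAddCommGroup G] [NormedSpace ℝ G]

theorem fderiv_eval {A : E → F →L[ℝ] G} {f : E → F} {x : E} (hA : DifferentiableAt ℝ A x)
    (hf : DifferentiableAt ℝ f x) (u : E) :
    fderiv ℝ (fun y ↦ A y (f y)) x u = A x (fderiv ℝ f x u) + fderiv ℝ A x u (f x) := by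
  rw [fderiv_clm_apply hA hf]
  rfl

theorem fderiv_eval_const {A : E → F →L[ℝ] G} {x : E} (hA : DifferentiableAt ℝ A x)
    (f : F) (u : E) : fderiv ℝ (fun y ↦ A y f) x u = fderiv ℝ A x u f := by
  rw [fderiv_eval hA (differentiableAt_const f)]
  simp

theorem differentiableAt_eval {A : E → F →L[ℝ] G} {f : E → F} {x : E}
    (hA : DifferentiableAt ℝ A x) (hf : DifferentiableAt ℝ f x) :
    DifferentiableAt ℝ (fun y ↦ A y (f y)) x := hA.clm_apply hf

theorem differentiableAt_eval_const {A : E → F →L[ℝ] G} {x : E}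
    (hA : DifferentiableAt ℝ A x) (f : F) :
    DifferentiableAt ℝ (fun y ↦ A y f) x := hA.clm_apply (differentiableAt_const f)

theorem fderiv_fderiv_symm {f : E → F} {x : E} (hf : ContDiffAt ℝ ∞ f x) (u v : E) :
    fderiv ℝ (fderiv ℝ f) x u v = fderiv ℝ (fderiv ℝ f) x v u :=
  (hf.isSymmSndFDerivAt (by simpa using two_le_infty)).eq u v

theorem differentiableAt_fderiv {f : E → F} {x : E} (hf : ContDiffAt ℝ ∞ f x) :
    DifferentiableAt ℝ (fderiv ℝ f) x :=
  (hf.fderiv_right (m := 1) (by norm_cast)).differentiableAt (by simp)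

/-- The curvature of the connection `∇ = D + Γ` on the trivial bundle `E` over `E`. -/
def chartCurv (Γ : E → E →L[ℝ] E →L[ℝ] E) (x u v w : E) : E :=
  fderiv ℝ Γ x u v w - fderiv ℝ Γ x v u w + Γ x u (Γ x v w) - Γ x v (Γ x u w)

theorem chartCurv_antisymm (Γ : E → E →L[ℝ] E →L[ℝ] E) (x u v w : E) :
    chartCurv Γ x u v w = -chartCurv Γ x v u w := by
  unfold chartCurv
  abel

variable {Γ : E → E →L[ℝ] E →L[ℝ] E} {g : E → E →L[ℝ] E →L[ℝ] ℝ} {x : E}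

theorem fderiv_christoffel_symm (hΓ : ContDiffAt ℝ ∞ Γ x)
    (hsymm : ∀ᶠ y in 𝓝 x, ∀ v w, Γ y v w = Γ y w v) (u v w : E) :
    fderiv ℝ Γ x u v w = fderiv ℝ Γ x u w v := by
  have hd : DifferentiableAt ℝ Γ x := hΓ.differentiableAt (by simp)
  have h1 : (fun y ↦ Γ y v w) =ᶠ[𝓝 x] fun y ↦ Γ y w v := hsymm.mono fun y hy ↦ hy v w
  have h2 := congrArg (fun A : E →L[ℝ] E ↦ A u) h1.fderiv_eq
  simp only [fderiv_eval_const (differentiableAt_eval_const hd _), fderiv_eval_const hd] at h2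
  exact h2

theorem chartCurv_bianchi (hΓ : ContDiffAt ℝ ∞ Γ x)
    (hsymm : ∀ᶠ y in 𝓝 x, ∀ v w, Γ y v w = Γ y w v) (u v w : E) :
    chartCurv Γ x u v w + chartCurv Γ x v w u + chartCurv Γ x w u v = 0 := by
  have h := fderiv_christoffel_symm hΓ hsymm
  have h' := hsymm.self_of_nhds
  unfold chartCurv
  rw [h u v w, h v u w, h w u v, h' v w, h' w u, h' u v]
  abel

/-- The second derivative of g(w, z), for constant w and z, is computed from the metric condition;
the terms antisymmetric in u and v assemble to the curvature, and they must cancel because second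
derivatives commute. -/
theorem chartCurv_skew (hΓ : ContDiffAt ℝ ∞ Γ x) (hg : ContDiffAt ℝ ∞ g x)
    (hmetric : ∀ᶠ y in 𝓝 x, ∀ u v w, fderiv ℝ g y u v w = g y (Γ y u v) w + g y v (Γ y u w))
    (u v w z : E) :
    g x (chartCurv Γ x u v w) z = -g x w (chartCurv Γ x u v z) := by
  have hdΓ : DifferentiableAt ℝ Γ x := hΓ.differentiableAt (by simp)
  have hdg : DifferentiableAt ℝ g x := hg.differentiableAt (by simp)
  have hm := hmetric.self_of_nhds
  set f : E → ℝ := fun y ↦ g y w z with hf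
  have hfs : ContDiffAt ℝ ∞ f x := (hg.clm_apply contDiffAt_const).clm_apply contDiffAt_const
  have hgn : ∀ᶠ y in 𝓝 x, ContDiffAt ℝ 1 g y :=
    (hg.of_le (by norm_cast)).eventually (by simp)
  have key : ∀ u v, fderiv ℝ (fderiv ℝ f) x u v =
      g x (Γ x u (Γ x v w)) z + g x (Γ x v w) (Γ x u z) + g x (fderiv ℝ Γ x u v w) z +
      (g x (Γ x u w) (Γ x v z) + g x w (Γ x u (Γ x v z)) + g x w (fderiv ℝ Γ x u v z)) := by
    intro u v
    have h1 : (fun y ↦ fderiv ℝ f y v) =ᶠ[𝓝 x] fun y ↦ g y (Γ y v w) z + g y w (Γ y v z) := by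
      filter_upwards [hmetric, hgn] with y hy hy'
      have hd := hy'.differentiableAt (by simp)
      rw [← hy v w z, hf, fderiv_eval_const (differentiableAt_eval_const hd w),
        fderiv_eval_const hd]
    have h2 := congrArg (fun A : E →L[ℝ] ℝ ↦ A u) h1.fderiv_eq
    have d1 := differentiableAt_fderiv hfs
    have d2 : ∀ a, DifferentiableAt ℝ (fun y ↦ Γ y v a) x := fun a ↦
      differentiableAt_eval_const (differentiableAt_eval_const hdΓ v) a
    have d3 : DifferentiableAt ℝ (fun y ↦ g y (Γ y v w)) x := differentiableAt_eval hdg (d2 w)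
    have d4 : DifferentiableAt ℝ (fun y ↦ g y w) x := differentiableAt_eval_const hdg w
    beta_reduce at h2
    rw [fderiv_fun_add (differentiableAt_eval_const d3 z) (differentiableAt_eval d4 (d2 z)),
      fderiv_eval_const d1, add_apply,
      fderiv_eval_const d3, fderiv_eval hdg (d2 w), fderiv_eval d4 (d2 z), fderiv_eval_const hdg,
      fderiv_eval_const (differentiableAt_eval_const hdΓ v), fderiv_eval_const hdΓ,
      fderiv_eval_const (differentiableAt_eval_const hdΓ v), fderiv_eval_const hdΓ, add_apply] at h2
    rw [h2, hm, hm]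
    ring
  have h' := fderiv_fderiv_symm hfs u v
  rw [key, key] at h'
  unfold chartCurv
  simp only [map_add, map_sub, add_apply, sub_apply]
  linarith

/-- The curvature acting on a parallel family of endomorphisms. -/
theorem chartCurv_comm {ι : Type*} [Fintype ι] {J : ι → E → E →L[ℝ] E} {c : ι → ι → E → E →L[ℝ] ℝ}
    (hΓ : ContDiffAt ℝ ∞ Γ x) (hJ : ∀ a, ContDiffAt ℝ ∞ (J a) x)
    (hc : ∀ a b, ContDiffAt ℝ ∞ (c a b) x)
    (hconn : ∀ᶠ y in 𝓝 x, ∀ a v w, fderiv ℝ (J a) y v w =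
      J a y (Γ y v w) - Γ y v (J a y w) + ∑ b, c a b y v • J b y w) (a : ι) (u v w : E) :
    chartCurv Γ x u v (J a x w) - J a x (chartCurv Γ x u v w) =
      ∑ b, (fderiv ℝ (c a b) x u v - fderiv ℝ (c a b) x v u) • J b x w +
      ∑ b, ∑ e, (c a b x v * c b e x u - c a b x u * c b e x v) • J e x w := by
  have hdΓ : DifferentiableAt ℝ Γ x := hΓ.differentiableAt (by simp)
  have hdJ : ∀ b, DifferentiableAt ℝ (J b) x := fun b ↦ (hJ b).differentiableAt (by simp)
  have hdc : ∀ a b, DifferentiableAt ℝ (c a b) x := fun a b ↦ (hc a b).differentiableAt (by simp)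
  have hm := hconn.self_of_nhds
  -- Differentiate the first-order equation `hconn` once more. Equality of mixed second derivatives
  -- of `J a` is then the commutator formula.
  have key : ∀ u v, fderiv ℝ (fderiv ℝ (J a)) x u v w =
      J a x (fderiv ℝ Γ x u v w) + fderiv ℝ (J a) x u (Γ x v w) -
      (Γ x v (fderiv ℝ (J a) x u w) + fderiv ℝ Γ x u v (J a x w)) +
      ∑ b, (c a b x v • fderiv ℝ (J b) x u w + fderiv ℝ (c a b) x u v • J b x w) := by
    intro u v
    have h1 : (fun y ↦ fderiv ℝ (J a) y v w) =ᶠ[𝓝 x]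
        fun y ↦ J a y (Γ y v w) - Γ y v (J a y w) + ∑ b, c a b y v • J b y w :=
      hconn.mono fun y hy ↦ hy a v w
    have h2 := congrArg (fun A : E →L[ℝ] E ↦ A u) h1.fderiv_eq
    have d1 := differentiableAt_fderiv (hJ a)
    have d2 : DifferentiableAt ℝ (fun y ↦ Γ y v) x := differentiableAt_eval_const hdΓ v
    have d3 : DifferentiableAt ℝ (fun y ↦ Γ y v w) x := differentiableAt_eval_const d2 w
    have d4 : ∀ b, DifferentiableAt ℝ (fun y ↦ J b y w) x := fun b ↦
      differentiableAt_eval_const (hdJ b) w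
    have d5 : ∀ b, DifferentiableAt ℝ (fun y ↦ c a b y v) x := fun b ↦
      differentiableAt_eval_const (hdc a b) v
    have d6 : ∀ b, DifferentiableAt ℝ (fun y ↦ c a b y v • J b y w) x := fun b ↦
      (d5 b).fun_smul (d4 b)
    beta_reduce at h2
    rw [fderiv_fun_add ((differentiableAt_eval (hdJ a) d3).fun_sub (differentiableAt_eval d2 (d4 a)))
        (DifferentiableAt.fun_sum fun b _ ↦ d6 b), fderiv_fun_sub (differentiableAt_eval (hdJ a) d3)
        (differentiableAt_eval d2 (d4 a)), fderiv_fun_sum (fun b _ ↦ d6 b),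
      fderiv_eval_const (differentiableAt_eval_const d1 v) w, fderiv_eval_const d1, add_apply,
      sub_apply, fderiv_eval (hdJ a) d3, fderiv_eval d2 (d4 a), fderiv_eval_const d2,
      fderiv_eval_const hdΓ, fderiv_eval_const (hdJ a)] at h2
    rw [h2, sum_apply]
    congr 1
    refine Finset.sum_congr rfl fun b _ ↦ ?_
    rw [fderiv_fun_smul (d5 b) (d4 b)]
    simp only [add_apply, smul_apply, ContinuousLinearMap.smulRight_apply, fderiv_eval_const (hdJ b),
      fderiv_eval_const (hdc a b)]
  have h' : fderiv ℝ (fderiv ℝ (J a)) x u v w = fderiv ℝ (fderiv ℝ (J a)) x v u w := by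
    rw [fderiv_fderiv_symm (hJ a) u v]
  rw [key, key] at h'
  simp only [hm, map_add, map_sub, map_sum, map_smul, Finset.sum_add_distrib,
    smul_add, smul_sub, Finset.smul_sum, smul_smul] at h'
  unfold chartCurv
  simp only [map_add, map_sub, sub_smul, Finset.sum_sub_distrib] at h' ⊢
  rw [← sub_eq_zero] at h' ⊢
  rw [← neg_eq_zero, ← h']
  simp only [mul_comm (c a _ x v)]
  abel

/-- The endomorphism `∇Z`. -/
def nablaField (Γ : E → E →L[ℝ] E →L[ℝ] E) (Z : E → E) (y : E) : E →L[ℝ] E :=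
  fderiv ℝ Z y + (Γ y).flip (Z y)

theorem nablaField_apply (Z : E → E) (y v : E) :
    nablaField Γ Z y v = fderiv ℝ Z y v + Γ y v (Z y) := rfl

theorem contDiffAt_nablaField {Z : E → E} (hΓ : ContDiffAt ℝ ∞ Γ x) (hZ : ContDiffAt ℝ ∞ Z x) :
    ContDiffAt ℝ ∞ (nablaField Γ Z) x := by
  refine (hZ.fderiv_right (by simp)).add (ContDiffAt.clm_apply ?_ hZ)
  exact (ContinuousLinearMap.flipₗᵢ ℝ E E E).toContinuousLinearEquiv.contDiff.contDiffAt.comp x hΓ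

/-- The covariant derivative of a field of endomorphisms. -/
def nablaEndo (Γ : E → E →L[ℝ] E →L[ℝ] E) (T : E → E →L[ℝ] E) (x u v : E) : E :=
  fderiv ℝ T x u v + Γ x u (T x v) - T x (Γ x u v)

/-- The Ricci identity: antisymmetrising the second covariant derivative of Z leaves the curvature,
since there is no torsion. -/
theorem nablaEndo_nablaField {Z : E → E} (hΓ : ContDiffAt ℝ ∞ Γ x) (hZ : ContDiffAt ℝ ∞ Z x)
    (hsymm : ∀ᶠ y in 𝓝 x, ∀ v w, Γ y v w = Γ y w v) (u v : E) :
    nablaEndo Γ (nablaField Γ Z) x u v - nablaEndo Γ (nablaField Γ Z) x v u =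
      chartCurv Γ x u v (Z x) := by
  have hdΓ : DifferentiableAt ℝ Γ x := hΓ.differentiableAt (by simp)
  have hdZ : DifferentiableAt ℝ Z x := hZ.differentiableAt (by simp)
  have hT : DifferentiableAt ℝ (nablaField Γ Z) x :=
    (contDiffAt_nablaField hΓ hZ).differentiableAt (by simp)
  have key : ∀ u v, fderiv ℝ (nablaField Γ Z) x u v =
      fderiv ℝ (fderiv ℝ Z) x u v + (Γ x v (fderiv ℝ Z x u) + fderiv ℝ Γ x u v (Z x)) := by
    intro u v
    rw [← fderiv_eval_const hT]
    simp only [nablaField_apply]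
    have d1 := differentiableAt_fderiv hZ
    have d2 := differentiableAt_eval_const hdΓ v
    rw [fderiv_fun_add (differentiableAt_eval_const d1 v) (differentiableAt_eval d2 hdZ), add_apply,
      fderiv_eval_const d1, fderiv_eval d2 hdZ, fderiv_eval_const hdΓ]
  simp only [nablaEndo, key, chartCurv, nablaField_apply, map_add, hsymm.self_of_nhds v u]
  rw [fderiv_fderiv_symm hZ u v]
  abel

theorem nablaEndo_skew {T : E → E →L[ℝ] E} (hg : DifferentiableAt ℝ g x)
    (hT : DifferentiableAt ℝ T x)
    (hmetric : ∀ u v w, fderiv ℝ g x u v w = g x (Γ x u v) w + g x v (Γ x u w))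
    (hskew : ∀ᶠ y in 𝓝 x, ∀ v w, g y (T y v) w + g y v (T y w) = 0) (u v w : E) :
    g x (nablaEndo Γ T x u v) w = -g x v (nablaEndo Γ T x u w) := by
  have h1 : (fun y ↦ g y (T y v) w + g y v (T y w)) =ᶠ[𝓝 x] fun _ ↦ (0 : ℝ) :=
    hskew.mono fun y hy ↦ hy v w
  have h2 := congrArg (fun A : E →L[ℝ] ℝ ↦ A u) h1.fderiv_eq
  beta_reduce at h2
  have d1 := fun a ↦ differentiableAt_eval_const hT a
  have d2 := differentiableAt_eval hg (d1 v)
  have d3 := differentiableAt_eval_const hg v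
  rw [fderiv_fun_add (differentiableAt_eval_const d2 w) (differentiableAt_eval d3 (d1 w)), add_apply,
    fderiv_eval_const d2, fderiv_eval hg (d1 v), fderiv_eval d3 (d1 w), fderiv_eval_const hT,
    fderiv_eval_const hT, fderiv_eval_const hg, fderiv_fun_const, add_apply, hmetric, hmetric] at h2
  simp only [Pi.zero_apply, zero_apply] at h2
  have e1 := hskew.self_of_nhds (Γ x u v) w
  have e2 := hskew.self_of_nhds v (Γ x u w)
  simp only [nablaEndo, map_add, map_sub, add_apply, sub_apply]
  linarith

/-- Kostant's formula `∇_u ∇Z = R(u, Z)` for a Killing field `Z`. -/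
theorem nablaEndo_killing {Z : E → E} (hΓ : ContDiffAt ℝ ∞ Γ x) (hg : ContDiffAt ℝ ∞ g x)
    (hZ : ContDiffAt ℝ ∞ Z x) (hsymm : ∀ᶠ y in 𝓝 x, ∀ v w, Γ y v w = Γ y w v)
    (hmetric : ∀ᶠ y in 𝓝 x, ∀ u v w, fderiv ℝ g y u v w = g y (Γ y u v) w + g y v (Γ y u w))
    (hskew : ∀ᶠ y in 𝓝 x, ∀ v w,
      g y (nablaField Γ Z y v) w + g y v (nablaField Γ Z y w) = 0)
    (hgs : ∀ v w, g x v w = g x w v) (hgp : ∀ v, g x v v = 0 → v = 0) (u v : E) :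
    nablaEndo Γ (nablaField Γ Z) x u v = chartCurv Γ x u (Z x) v := by
  set S : E → E → E := fun u v ↦
    nablaEndo Γ (nablaField Γ Z) x u v - chartCurv Γ x u (Z x) v with hS
  have hSs : ∀ u v, S u v = S v u := by
    intro u v
    have h1 := nablaEndo_nablaField hΓ hZ hsymm u v
    have h2 := chartCurv_bianchi hΓ hsymm u v (Z x)
    rw [chartCurv_antisymm Γ x (Z x)] at h2
    simp only [hS]
    rw [chartCurv_antisymm Γ x v (Z x)] at h2 ⊢
    rw [← h1] at h2
    rw [← sub_eq_zero, ← h2]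
    abel
  have hSk : ∀ u v w, g x (S u v) w = -g x (S u w) v := by
    intro u v w
    have h1 := nablaEndo_skew (hg.differentiableAt (by simp))
      ((contDiffAt_nablaField hΓ hZ).differentiableAt (by simp)) hmetric.self_of_nhds hskew u v w
    have h2 := chartCurv_skew hΓ hg hmetric u (Z x) v w
    simp only [hS, map_sub, sub_apply]
    rw [h1, h2, hgs v, hgs v]
    ring
  -- The trilinear form g(S(u,v),w) is symmetric in u, v (Ricci and Bianchi identities) and skew in
  -- v, w (∇Z and R are skew). Alternating the two rules around a cycle forces it to vanish.
  have h0 : ∀ u v w, g x (S u v) w = 0 := by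
    intro u v w
    have e1 := hSk u v w
    have e2 := hSk w u v
    have e3 := hSk v w u
    rw [hSs w u] at e2
    rw [hSs v w, hSs v u] at e3
    linarith
  exact sub_eq_zero.1 (hgp _ (h0 u v _))

/-- The covariant derivative of a commutation relation. -/
theorem nablaEndo_comm {ι : Type*} [Fintype ι] {J : ι → E → E →L[ℝ] E} {c : ι → ι → E →L[ℝ] ℝ}
    {T : E → E →L[ℝ] E} {f : E → ℝ} (hT : DifferentiableAt ℝ T x)
    (hJ : ∀ a, DifferentiableAt ℝ (J a) x) (hf : DifferentiableAt ℝ f x)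
    (hconn : ∀ a v w, fderiv ℝ (J a) x v w =
      J a x (Γ x v w) - Γ x v (J a x w) + ∑ b, c a b v • J b x w) (a b : ι)
    (hcomm : ∀ᶠ y in 𝓝 x, ∀ v, T y (J a y v) - J a y (T y v) = f y • J b y v) (u v : E) :
    nablaEndo Γ T x u (J a x v) - J a x (nablaEndo Γ T x u v) +
        ∑ e, c a e u • (T x (J e x v) - J e x (T x v)) =
      fderiv ℝ f x u • J b x v + f x • ∑ e, c b e u • J e x v := by
  have h1 : (fun y ↦ T y (J a y v) - J a y (T y v)) =ᶠ[𝓝 x] fun y ↦ f y • J b y v :=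
    hcomm.mono fun y hy ↦ hy v
  have h2 := congrArg (fun A : E →L[ℝ] E ↦ A u) h1.fderiv_eq
  beta_reduce at h2
  have d1 := fun a ↦ differentiableAt_eval_const (hJ a) v
  have d2 := differentiableAt_eval_const hT v
  rw [fderiv_fun_sub (differentiableAt_eval hT (d1 a)) (differentiableAt_eval (hJ a) d2), sub_apply,
    fderiv_eval hT (d1 a), fderiv_eval (hJ a) d2, fderiv_fun_smul hf (d1 b), add_apply, smul_apply,
    ContinuousLinearMap.smulRight_apply, fderiv_eval_const (hJ a), fderiv_eval_const (hJ b),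
    fderiv_eval_const hT, hconn, hconn, hconn] at h2
  have h3 := hcomm.self_of_nhds (Γ x u v)
  simp only [nablaEndo, map_add, map_sub, map_sum, map_smul, smul_sub, smul_add,
    Finset.sum_sub_distrib] at h2 ⊢
  have e1 : Γ x u (f x • J b x v) = Γ x u (T x (J a x v)) - Γ x u (J a x (T x v)) := by
    rw [← hcomm.self_of_nhds v, map_sub]
  rw [map_smul] at e1
  rw [← h3, e1] at h2
  rw [← sub_eq_zero] at h2 ⊢
  rw [← h2]
  abel

end ChartGeometry

/-! ### Vector fields, endomorphism fields and Lie brackets in charts -/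

section ChartFields

variable {m : ℕ} {X : Type*} [TopologicalSpace X] [ChartedSpace (EuclideanSpace ℝ (Fin m)) X]
  [IsManifold (𝓡 m) ∞ X]

/-- A vector field read in the chart around `p`. -/
def fieldChart (W : VectField m X) (p : X) (y : EuclideanSpace ℝ (Fin m)) :
    EuclideanSpace ℝ (Fin m) :=
  mfderiv (𝓡 m) (𝓡 m) (extChartAt (𝓡 m) p) ((extChartAt (𝓡 m) p).symm y)
    (W ((extChartAt (𝓡 m) p).symm y))

/-- A field of endomorphisms read in the chart around `p`. -/
def endoChart (J : EndoField m X) (p : X) (y : EuclideanSpace ℝ (Fin m)) :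
    EuclideanSpace ℝ (Fin m) →L[ℝ] EuclideanSpace ℝ (Fin m) :=
  (mfderiv (𝓡 m) (𝓡 m) (extChartAt (𝓡 m) p) ((extChartAt (𝓡 m) p).symm y)).comp
    ((J ((extChartAt (𝓡 m) p).symm y)).comp
      (mfderiv (𝓡 m) (𝓡 m) (extChartAt (𝓡 m) p).symm y))

theorem trivializationAt_snd (p : X) {x : X} (hx : x ∈ (extChartAt (𝓡 m) p).source)
    (v : TangentSpace (𝓡 m) x) :
    (trivializationAt (EuclideanSpace ℝ (Fin m)) (TangentSpace (𝓡 m)) p ⟨x, v⟩).2 =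
      mfderiv (𝓡 m) (𝓡 m) (extChartAt (𝓡 m) p) x v := by
  have hx' : x ∈ (chartAt (EuclideanSpace ℝ (Fin m)) p).source := by simpa using hx
  have hb : x ∈ (trivializationAt (EuclideanSpace ℝ (Fin m)) (TangentSpace (𝓡 m)) p).baseSet := by
    simpa using hx'
  have h := TangentBundle.continuousLinearMapAt_trivializationAt (I := 𝓡 m) hx'
  have h2 := congrArg (fun A ↦ A v) ((trivializationAt (EuclideanSpace ℝ (Fin m))
    (TangentSpace (𝓡 m)) p).coe_linearMapAt_of_mem (R := ℝ) hb)
  exact h2.symm.trans (congrArg (fun A ↦ A v) h)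

/-- The canonical extension of a tangent vector at `p` is constant in the trivialisation at `p`,
which is the chart trivialisation. So `curv`, defined with these extensions, is computed on
coordinate vector fields. -/
theorem frameField_eq (p : X) {x : X} (hx : x ∈ (extChartAt (𝓡 m) p).source)
    (w : TangentSpace (𝓡 m) p) :
    FiberBundle.extend (E := TangentSpace (𝓡 m)) (EuclideanSpace ℝ (Fin m)) w x =
      mfderiv (𝓡 m) (𝓡 m) (extChartAt (𝓡 m) p).symm (extChartAt (𝓡 m) p x) w := by
  have hx' : x ∈ (chartAt (EuclideanSpace ℝ (Fin m)) p).source := by simpa using hx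
  have h := TangentBundle.symmL_trivializationAt (I := 𝓡 m) hx'
  have hr : range (𝓡 m) = univ := by simp
  rw [hr, mfderivWithin_univ] at h
  have h2 := (trivializationAt_snd p (mem_extChartAt_source p) w).trans (mfderiv_chart_self p w)
  have h3 : FiberBundle.extend (E := TangentSpace (𝓡 m)) (EuclideanSpace ℝ (Fin m)) w x =
      (trivializationAt (EuclideanSpace ℝ (Fin m)) (TangentSpace (𝓡 m)) p).symm x w :=
    congrArg (fun v ↦ (trivializationAt (EuclideanSpace ℝ (Fin m))
      (TangentSpace (𝓡 m)) p).symm x v) h2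
  exact h3.trans (((trivializationAt (EuclideanSpace ℝ (Fin m))
    (TangentSpace (𝓡 m)) p).symmL_apply (R := ℝ) (by simpa using hx') w).symm.trans (congrArg (fun A ↦ A w) h))

theorem fieldChart_frameField (p : X) {y : EuclideanSpace ℝ (Fin m)}
    (hy : y ∈ (extChartAt (𝓡 m) p).target) (w : TangentSpace (𝓡 m) p) :
    fieldChart (FiberBundle.extend (E := TangentSpace (𝓡 m)) (EuclideanSpace ℝ (Fin m)) w) p y =
      w := by
  unfold fieldChart
  rw [frameField_eq p ((extChartAt (𝓡 m) p).map_target hy), (extChartAt (𝓡 m) p).right_inv hy]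
  exact mfderiv_chart_comp_symm p hy w

omit [IsManifold (𝓡 m) ∞ X] in
theorem fieldChart_apply_chart (W : VectField m X) (p : X) {x : X}
    (hx : x ∈ (extChartAt (𝓡 m) p).source) :
    fieldChart W p (extChartAt (𝓡 m) p x) =
      mfderiv (𝓡 m) (𝓡 m) (extChartAt (𝓡 m) p) x (W x) := by
  unfold fieldChart
  rw [(extChartAt (𝓡 m) p).left_inv hx]

theorem mfderiv_symm_fieldChart (W : VectField m X) (p : X) {y : EuclideanSpace ℝ (Fin m)}
    (hy : y ∈ (extChartAt (𝓡 m) p).target) :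
    mfderiv (𝓡 m) (𝓡 m) (extChartAt (𝓡 m) p).symm y (fieldChart W p y) =
      W ((extChartAt (𝓡 m) p).symm y) := by
  have h := mfderiv_symm_comp_chart p ((extChartAt (𝓡 m) p).map_target hy)
    (W ((extChartAt (𝓡 m) p).symm y))
  rw [(extChartAt (𝓡 m) p).right_inv hy] at h
  exact h

theorem fieldChart_self (W : VectField m X) (p : X) :
    fieldChart W p (extChartAt (𝓡 m) p p) = W p := by
  rw [fieldChart_apply_chart W p (mem_extChartAt_source p), mfderiv_chart_self]

theorem tendsto_chart_symm (p : X) {x : X} (hx : x ∈ (extChartAt (𝓡 m) p).source) :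
    Tendsto (extChartAt (𝓡 m) p).symm (𝓝 (extChartAt (𝓡 m) p x)) (𝓝 x) := by
  have := (contMDiffAt_chart_symm (m := m) p ((extChartAt (𝓡 m) p).map_source hx)).continuousAt
  rwa [ContinuousAt, (extChartAt (𝓡 m) p).left_inv hx] at this

theorem eventually_chart_iff (p : X) {Q : X → Prop} {x : X}
    (hx : x ∈ (extChartAt (𝓡 m) p).source) :
    (∀ᶠ y in 𝓝 (extChartAt (𝓡 m) p x), Q ((extChartAt (𝓡 m) p).symm y)) ↔ ∀ᶠ z in 𝓝 x, Q z := by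
  constructor
  · intro h
    have hc := (contMDiffAt_chart (m := m) p hx).continuousAt
    filter_upwards [hc.eventually h, (isOpen_extChartAt_source (I := 𝓡 m) p).mem_nhds hx] with z h1 h2
    rwa [(extChartAt (𝓡 m) p).left_inv h2] at h1
  · exact fun h ↦ (tendsto_chart_symm p hx).eventually h

theorem contMDiffAt_field_iff {W : VectField m X} {p x : X}
    (hx : x ∈ (extChartAt (𝓡 m) p).source) :
    ContMDiffAt (𝓡 m) (𝓡 m).tangent ∞ (fun y ↦ (⟨y, W y⟩ : TangentBundle (𝓡 m) X)) x ↔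
      ContDiffAt ℝ ∞ (fieldChart W p) (extChartAt (𝓡 m) p x) := by
  have hb : x ∈ (trivializationAt (EuclideanSpace ℝ (Fin m)) (TangentSpace (𝓡 m)) p).baseSet := by
    simpa using hx
  have h1 := (trivializationAt (EuclideanSpace ℝ (Fin m))
    (TangentSpace (𝓡 m)) p).contMDiffAt_section_iff (IB := 𝓡 m) (n := ∞) (s := W) hb
  rw [show (𝓡 m).tangent = (𝓡 m).prod 𝓘(ℝ, EuclideanSpace ℝ (Fin m)) from rfl, h1,
    ← contMDiffAt_iff_contDiffAt]
  have e1 : (fun x ↦ (trivializationAt (EuclideanSpace ℝ (Fin m)) (TangentSpace (𝓡 m)) p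
      ⟨x, W x⟩).2) =ᶠ[𝓝 x] fun x ↦ fieldChart W p (extChartAt (𝓡 m) p x) := by
    filter_upwards [(isOpen_extChartAt_source (I := 𝓡 m) p).mem_nhds hx] with z hz
    rw [fieldChart_apply_chart W p hz, trivializationAt_snd p hz]
  rw [e1.contMDiffAt_iff]
  constructor
  · intro h
    have h2 := ContMDiffAt.comp (I' := 𝓡 m) (extChartAt (𝓡 m) p x)
      (by rwa [(extChartAt (𝓡 m) p).left_inv hx])
      (contMDiffAt_chart_symm p ((extChartAt (𝓡 m) p).map_source hx))
    refine h2.congr_of_eventuallyEq ?_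
    filter_upwards [(isOpen_extChartAt_target (I := 𝓡 m) p).mem_nhds
      ((extChartAt (𝓡 m) p).map_source hx)] with y hy
    simp only [Function.comp_apply, (extChartAt (𝓡 m) p).right_inv hy]
  · intro h
    exact h.comp (I' := 𝓡 m) x (contMDiffAt_chart p hx)

theorem mdifferentiableAt_field_iff {W : VectField m X} {p x : X}
    (hx : x ∈ (extChartAt (𝓡 m) p).source) :
    MDifferentiableAt (𝓡 m) (𝓡 m).tangent (fun y ↦ (⟨y, W y⟩ : TangentBundle (𝓡 m) X)) x ↔
      DifferentiableAt ℝ (fieldChart W p) (extChartAt (𝓡 m) p x) := by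
  have hb : x ∈ (trivializationAt (EuclideanSpace ℝ (Fin m)) (TangentSpace (𝓡 m)) p).baseSet := by
    simpa using hx
  have h1 := (trivializationAt (EuclideanSpace ℝ (Fin m))
    (TangentSpace (𝓡 m)) p).mdifferentiableAt_section_iff (𝓡 m) W hb
  rw [show (𝓡 m).tangent = (𝓡 m).prod 𝓘(ℝ, EuclideanSpace ℝ (Fin m)) from rfl, h1,
    ← mdifferentiableAt_iff_differentiableAt]
  have e1 : (fun x ↦ (trivializationAt (EuclideanSpace ℝ (Fin m)) (TangentSpace (𝓡 m)) p
      ⟨x, W x⟩).2) =ᶠ[𝓝 x] fun x ↦ fieldChart W p (extChartAt (𝓡 m) p x) := by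
    filter_upwards [(isOpen_extChartAt_source (I := 𝓡 m) p).mem_nhds hx] with z hz
    rw [fieldChart_apply_chart W p hz, trivializationAt_snd p hz]
  rw [e1.mdifferentiableAt_iff]
  constructor
  · intro h
    have h2 := MDifferentiableAt.comp (I' := 𝓡 m) (extChartAt (𝓡 m) p x)
      (by rwa [(extChartAt (𝓡 m) p).left_inv hx])
      (mdifferentiableAt_chart_symm p ((extChartAt (𝓡 m) p).map_source hx))
    refine h2.congr_of_eventuallyEq ?_
    filter_upwards [(isOpen_extChartAt_target (I := 𝓡 m) p).mem_nhds
      ((extChartAt (𝓡 m) p).map_source hx)] with y hy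
    simp only [Function.comp_apply, (extChartAt (𝓡 m) p).right_inv hy]
  · intro h
    exact h.comp (I' := 𝓡 m) x (mdifferentiableAt_chart p hx)

theorem fieldChart_endo (J : EndoField m X) (V : VectField m X) (p : X)
    {y : EuclideanSpace ℝ (Fin m)} (hy : y ∈ (extChartAt (𝓡 m) p).target) :
    fieldChart (fun z ↦ J z (V z)) p y = endoChart J p y (fieldChart V p y) := by
  change mfderiv (𝓡 m) (𝓡 m) (extChartAt (𝓡 m) p) ((extChartAt (𝓡 m) p).symm y) _ =
    mfderiv (𝓡 m) (𝓡 m) (extChartAt (𝓡 m) p) ((extChartAt (𝓡 m) p).symm y)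
      (J ((extChartAt (𝓡 m) p).symm y) (mfderiv (𝓡 m) (𝓡 m) (extChartAt (𝓡 m) p).symm y
        (fieldChart V p y)))
  rw [mfderiv_symm_fieldChart V p hy]

theorem endoChart_self (J : EndoField m X) (p : X) (v : TangentSpace (𝓡 m) p) :
    endoChart J p (extChartAt (𝓡 m) p p) v = J p v := by
  let V : VectField m X := FiberBundle.extend (EuclideanSpace ℝ (Fin m)) v
  have hV : V p = v := FiberBundle.extend_apply_self (F := EuclideanSpace ℝ (Fin m)) v
  have h1 := fieldChart_endo J V p (mem_extChartAt_target p)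
  have h2 : fieldChart V p (extChartAt (𝓡 m) p p) = v := (fieldChart_self V p).trans hV
  have h3 := fieldChart_self (fun z ↦ J z (V z)) p
  rw [h2] at h1
  exact h1.symm.trans (h3.trans (congrArg (J p) hV))

/-- Smoothness of a field of endomorphisms at a point, in the chart around that point. -/
theorem contMDiffAt_endo_iff {J : EndoField m X} {p : X} :
    ContMDiffAt (𝓡 m)
      ((𝓡 m).prod 𝓘(ℝ, EuclideanSpace ℝ (Fin m) →L[ℝ] EuclideanSpace ℝ (Fin m))) ∞
      (fun p ↦ TotalSpace.mk' (EuclideanSpace ℝ (Fin m) →L[ℝ] EuclideanSpace ℝ (Fin m))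
        (E := fun p : X ↦ TangentSpace (𝓡 m) p →L[ℝ] TangentSpace (𝓡 m) p) p (J p)) p ↔
      ContDiffAt ℝ ∞ (endoChart J p) (extChartAt (𝓡 m) p p) := by
  have h1 := contMDiffAt_hom_bundle (IB := 𝓡 m) (n := ∞) (F₁ := EuclideanSpace ℝ (Fin m))
    (E₁ := TangentSpace (𝓡 m) (M := X)) (F₂ := EuclideanSpace ℝ (Fin m))
    (E₂ := TangentSpace (𝓡 m) (M := X)) (IM := 𝓡 m) (x₀ := p)
    (fun p ↦ TotalSpace.mk' (EuclideanSpace ℝ (Fin m) →L[ℝ] EuclideanSpace ℝ (Fin m))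
        (E := fun p : X ↦ TangentSpace (𝓡 m) p →L[ℝ] TangentSpace (𝓡 m) p) p (J p))
  have e1 : (fun x ↦ ContinuousLinearMap.inCoordinates (EuclideanSpace ℝ (Fin m))
      (TangentSpace (𝓡 m) (M := X)) (EuclideanSpace ℝ (Fin m)) (TangentSpace (𝓡 m) (M := X))
      p x p x (J x)) =ᶠ[𝓝 p] fun x ↦ endoChart J p (extChartAt (𝓡 m) p x) := by
    filter_upwards [(isOpen_extChartAt_source (I := 𝓡 m) p).mem_nhds (mem_extChartAt_source p)]
      with z hz
    have hz' : z ∈ (chartAt (EuclideanSpace ℝ (Fin m)) p).source := by simpa using hz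
    have h2 := TangentBundle.continuousLinearMapAt_trivializationAt (I := 𝓡 m) hz'
    have h3 := TangentBundle.symmL_trivializationAt (I := 𝓡 m) hz'
    have hr : range (𝓡 m) = univ := by simp
    rw [hr, mfderivWithin_univ] at h3
    unfold ContinuousLinearMap.inCoordinates endoChart
    rw [h2, h3, (extChartAt (𝓡 m) p).left_inv hz]
    rfl
  have h4 : ContMDiffAt (𝓡 m) (𝓡 m) ∞ (fun x : X ↦ x) p := contMDiffAt_id
  refine h1.trans ⟨fun h ↦ ?_, fun h ↦ ⟨h4, ?_⟩⟩
  · rw [← contMDiffAt_iff_contDiffAt]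
    have h5 := e1.contMDiffAt_iff.1 h.2
    have h2 := ContMDiffAt.comp (I' := 𝓡 m) (extChartAt (𝓡 m) p p)
      (by rwa [(extChartAt (𝓡 m) p).left_inv (mem_extChartAt_source p)])
      (contMDiffAt_chart_symm p (mem_extChartAt_target p))
    refine h2.congr_of_eventuallyEq ?_
    filter_upwards [extChartAt_target_mem_nhds p] with y hy
    simp only [Function.comp_apply, (extChartAt (𝓡 m) p).right_inv hy]
  · exact e1.contMDiffAt_iff.2 ((contMDiffAt_iff_contDiffAt.2 h).comp (I' := 𝓡 m) p
      (contMDiffAt_chart p (mem_extChartAt_source p)))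

/-- Identifies the chart expression with a pullback of vector fields, so that naturality of the Lie
bracket under pullback applies. -/
theorem mpullback_chart_symm (W : VectField m X) (p : X) {y : EuclideanSpace ℝ (Fin m)}
    (hy : y ∈ (extChartAt (𝓡 m) p).target) :
    VectorField.mpullback (𝓡 m) (𝓡 m) (extChartAt (𝓡 m) p).symm W y = fieldChart W p y := by
  rw [VectorField.mpullback_apply]
  have h := ContinuousLinearMap.inverse_eq
    (f := mfderiv (𝓡 m) (𝓡 m) (extChartAt (𝓡 m) p).symm y)
    (g := mfderiv (𝓡 m) (𝓡 m) (extChartAt (𝓡 m) p) ((extChartAt (𝓡 m) p).symm y))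
    (by
      ext1 v
      have h := mfderiv_symm_comp_chart p ((extChartAt (𝓡 m) p).map_target hy) v
      rw [(extChartAt (𝓡 m) p).right_inv hy] at h
      exact h)
    (by
      ext1 v
      exact mfderiv_chart_comp_symm p hy v)
  rw [h]
  rfl

/-- The Lie bracket in a chart. -/
theorem mfderiv_chart_mlieBracket {V W : VectField m X} {p x : X}
    (hx : x ∈ (extChartAt (𝓡 m) p).source)
    (hV : MDifferentiableAt (𝓡 m) (𝓡 m).tangent (fun y ↦ (⟨y, V y⟩ : TangentBundle (𝓡 m) X)) x)
    (hW : MDifferentiableAt (𝓡 m) (𝓡 m).tangent (fun y ↦ (⟨y, W y⟩ : TangentBundle (𝓡 m) X)) x) :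
    mfderiv (𝓡 m) (𝓡 m) (extChartAt (𝓡 m) p) x (VectorField.mlieBracket (𝓡 m) V W x) =
      fderiv ℝ (fieldChart W p) (extChartAt (𝓡 m) p x) (fieldChart V p (extChartAt (𝓡 m) p x)) -
      fderiv ℝ (fieldChart V p) (extChartAt (𝓡 m) p x)
        (fieldChart W p (extChartAt (𝓡 m) p x)) := by
  have hy := (extChartAt (𝓡 m) p).map_source hx
  have hl := (extChartAt (𝓡 m) p).left_inv hx
  have : IsManifold (𝓡 m) (minSmoothness ℝ 2) X :=
    IsManifold.of_le (n := ∞) (by simpa using two_le_infty)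
  have h1 := VectorField.mpullback_mlieBracket (I := 𝓡 m) (I' := 𝓡 m) (n := ∞)
    (f := (extChartAt (𝓡 m) p).symm) (x₀ := extChartAt (𝓡 m) p x) (V := V) (W := W)
    (by rwa [hl]) (by rwa [hl]) (contMDiffAt_chart_symm p hy) (by simpa using two_le_infty)
  rw [mpullback_chart_symm _ p hy, fieldChart_apply_chart _ p hx] at h1
  have e : ∀ U : VectField m X, @Filter.EventuallyEq (EuclideanSpace ℝ (Fin m))
      (EuclideanSpace ℝ (Fin m)) (𝓝 (extChartAt (𝓡 m) p x))
      (VectorField.mpullback (𝓡 m) (𝓡 m) (extChartAt (𝓡 m) p).symm U) (fieldChart U p) := by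
    intro U
    filter_upwards [(isOpen_extChartAt_target (I := 𝓡 m) p).mem_nhds hy] with z hz
    exact mpullback_chart_symm U p hz
  have h2 := Filter.EventuallyEq.lieBracket_vectorField_eq (𝕜 := ℝ)
    (E := EuclideanSpace ℝ (Fin m)) (e V) (e W)
  have h3 := congrFun (VectorField.mlieBracketWithin_eq_lieBracketWithin (𝕜 := ℝ)
    (E := EuclideanSpace ℝ (Fin m)) (s := univ)
    (V := VectorField.mpullback (𝓡 m) (𝓡 m) (extChartAt (𝓡 m) p).symm V)
    (W := VectorField.mpullback (𝓡 m) (𝓡 m) (extChartAt (𝓡 m) p).symm W)) (extChartAt (𝓡 m) p x)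
  have h4 := congrFun (VectorField.lieBracketWithin_univ (𝕜 := ℝ) (E := EuclideanSpace ℝ (Fin m))
    (V := VectorField.mpullback (𝓡 m) (𝓡 m) (extChartAt (𝓡 m) p).symm V)
    (W := VectorField.mpullback (𝓡 m) (𝓡 m) (extChartAt (𝓡 m) p).symm W)) (extChartAt (𝓡 m) p x)
  rw [VectorField.mlieBracketWithin_univ] at h3
  exact h1.trans (h3.trans (h4.trans h2))

end ChartFields

/-! ### Christoffel symbols and curvature of a connection in a chart -/

section ChartConnection

variable {m : ℕ} {X : Type*} [TopologicalSpace X] [ChartedSpace (EuclideanSpace ℝ (Fin m)) X]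
  [IsManifold (𝓡 m) ∞ X]

/-- The vector field around `p` with constant coefficients `w` in the chart around `p`. -/
def frameField (p : X) (w : EuclideanSpace ℝ (Fin m)) : VectField m X :=
  FiberBundle.extend (E := TangentSpace (𝓡 m)) (EuclideanSpace ℝ (Fin m)) (x := p) w

theorem fieldChart_frame (p : X) {y : EuclideanSpace ℝ (Fin m)}
    (hy : y ∈ (extChartAt (𝓡 m) p).target) (w : EuclideanSpace ℝ (Fin m)) :
    fieldChart (frameField p w) p y = w := fieldChart_frameField p hy w

theorem fieldChart_frame_eventuallyEq (p : X) {x : X} (hx : x ∈ (extChartAt (𝓡 m) p).source)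
    (w : EuclideanSpace ℝ (Fin m)) :
    fieldChart (frameField p w) p =ᶠ[𝓝 (extChartAt (𝓡 m) p x)] fun _ ↦ w := by
  filter_upwards [(isOpen_extChartAt_target (I := 𝓡 m) p).mem_nhds
    ((extChartAt (𝓡 m) p).map_source hx)] with y hy
  exact fieldChart_frame p hy w

theorem frameField_apply_symm (p : X) {y : EuclideanSpace ℝ (Fin m)}
    (hy : y ∈ (extChartAt (𝓡 m) p).target) (w : EuclideanSpace ℝ (Fin m)) :
    frameField p w ((extChartAt (𝓡 m) p).symm y) =
      mfderiv (𝓡 m) (𝓡 m) (extChartAt (𝓡 m) p).symm y w := by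
  have h := frameField_eq p ((extChartAt (𝓡 m) p).map_target hy) w
  rw [(extChartAt (𝓡 m) p).right_inv hy] at h
  exact h

theorem frameField_self (p : X) (w : EuclideanSpace ℝ (Fin m)) : frameField p w p = w :=
  FiberBundle.extend_apply_self (F := EuclideanSpace ℝ (Fin m)) (E := TangentSpace (𝓡 m))
    (x := p) w

theorem mdifferentiableAt_frameField (p : X) {x : X} (hx : x ∈ (extChartAt (𝓡 m) p).source)
    (w : EuclideanSpace ℝ (Fin m)) :
    MDifferentiableAt (𝓡 m) (𝓡 m).tangent
      (fun y ↦ (⟨y, frameField p w y⟩ : TangentBundle (𝓡 m) X)) x := by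
  rw [mdifferentiableAt_field_iff hx]
  exact (differentiableAt_const w).congr_of_eventuallyEq (fieldChart_frame_eventuallyEq p hx w)

theorem contMDiffAt_frameField (p : X) {x : X} (hx : x ∈ (extChartAt (𝓡 m) p).source)
    (w : EuclideanSpace ℝ (Fin m)) :
    ContMDiffAt (𝓡 m) (𝓡 m).tangent ∞
      (fun y ↦ (⟨y, frameField p w y⟩ : TangentBundle (𝓡 m) X)) x := by
  rw [contMDiffAt_field_iff hx]
  exact contDiffAt_const.congr_of_eventuallyEq (fieldChart_frame_eventuallyEq p hx w)

/-- The derivative of the inverse chart. -/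
def chartInv (p : X) (y : EuclideanSpace ℝ (Fin m)) :
    EuclideanSpace ℝ (Fin m) →L[ℝ] TangentSpace (𝓡 m) ((extChartAt (𝓡 m) p).symm y) :=
  mfderiv (𝓡 m) (𝓡 m) (extChartAt (𝓡 m) p).symm y

/-- The derivative of the chart. -/
def chartD (p x : X) : TangentSpace (𝓡 m) x →L[ℝ] EuclideanSpace ℝ (Fin m) :=
  mfderiv (𝓡 m) (𝓡 m) (extChartAt (𝓡 m) p) x

theorem chartD_chartInv (p : X) {y : EuclideanSpace ℝ (Fin m)}
    (hy : y ∈ (extChartAt (𝓡 m) p).target) (v : EuclideanSpace ℝ (Fin m)) :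
    chartD p _ (chartInv p y v) = v := mfderiv_chart_comp_symm p hy v

theorem chartInv_fieldChart (W : VectField m X) (p : X) {y : EuclideanSpace ℝ (Fin m)}
    (hy : y ∈ (extChartAt (𝓡 m) p).target) :
    chartInv p y (fieldChart W p y) = W ((extChartAt (𝓡 m) p).symm y) :=
  mfderiv_symm_fieldChart W p hy

theorem chartInv_apply (p : X) {y : EuclideanSpace ℝ (Fin m)}
    (hy : y ∈ (extChartAt (𝓡 m) p).target) (w : EuclideanSpace ℝ (Fin m)) :
    chartInv p y w = frameField p w ((extChartAt (𝓡 m) p).symm y) :=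
  (frameField_apply_symm p hy w).symm

omit [IsManifold (𝓡 m) ∞ X] in
theorem endoChart_apply (J : EndoField m X) (p : X) (y v : EuclideanSpace ℝ (Fin m)) :
    endoChart J p y v = chartD p _ (J ((extChartAt (𝓡 m) p).symm y) (chartInv p y v)) := rfl

theorem sum_coord_smul_single (w : EuclideanSpace ℝ (Fin m)) :
    ∑ i, w i • EuclideanSpace.single i (1 : ℝ) = w := by
  ext j
  simp [Pi.single_apply]

/-- The Christoffel symbols in the chart around `p`. -/
def christoffel (D : AffineConnection m X) (p : X) (y : EuclideanSpace ℝ (Fin m)) :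
    EuclideanSpace ℝ (Fin m) →L[ℝ] EuclideanSpace ℝ (Fin m) →L[ℝ] EuclideanSpace ℝ (Fin m) :=
  ∑ i, (ContinuousLinearMap.smulRightL ℝ (EuclideanSpace ℝ (Fin m)) (EuclideanSpace ℝ (Fin m))
    (EuclideanSpace.proj i)) ∘L endoChart (D (frameField p (EuclideanSpace.single i 1))) p y

theorem christoffel_apply (D : AffineConnection m X) (p : X) (y v w : EuclideanSpace ℝ (Fin m)) :
    christoffel D p y v w =
      ∑ i, w i • endoChart (D (frameField p (EuclideanSpace.single i 1))) p y v := by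
  simp [christoffel]

theorem cov_sum {ι : Type*} (D : AffineConnection m X) (s : Finset ι) (σ : ι → VectField m X)
    {x : X} (hσ : ∀ i ∈ s, MDifferentiableAt (𝓡 m) (𝓡 m).tangent
      (fun y ↦ (⟨y, σ i y⟩ : TangentBundle (𝓡 m) X)) x) :
    D (fun y ↦ ∑ i ∈ s, σ i y) x = ∑ i ∈ s, D (σ i) x := by
  classical
  induction s using Finset.induction_on with
  | empty =>
    simp only [Finset.sum_empty]
    exact D.isCovariantDerivativeOnUniv.zero
  | insert a s ha ih =>
    have h1 := hσ a (Finset.mem_insert_self a s)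
    have h2 : ∀ i ∈ s, MDifferentiableAt (𝓡 m) (𝓡 m).tangent
      (fun y ↦ (⟨y, σ i y⟩ : TangentBundle (𝓡 m) X)) x := fun i hi ↦
        hσ i (Finset.mem_insert_of_mem hi)
    rw [Finset.sum_insert ha, ← ih h2]
    have h3 := D.isCovariantDerivativeOnUniv.add h1 (MDifferentiableAt.sum_section h2)
    rw [← h3]
    congr 1
    funext y
    simp [Finset.sum_insert ha]

theorem mdifferentiableAt_coord {W : VectField m X} {p x : X}
    (hx : x ∈ (extChartAt (𝓡 m) p).source)
    (hW : DifferentiableAt ℝ (fieldChart W p) (extChartAt (𝓡 m) p x)) (i : Fin m) :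
    MDifferentiableAt (𝓡 m) 𝓘(ℝ, ℝ) (fun z ↦ fieldChart W p (extChartAt (𝓡 m) p z) i) x := by
  have h : DifferentiableAt ℝ (fun y ↦ fieldChart W p y i) (extChartAt (𝓡 m) p x) :=
    (EuclideanSpace.proj (𝕜 := ℝ) i).differentiableAt.comp _ hW
  exact (mdifferentiableAt_iff_differentiableAt.2 h).comp (I' := 𝓡 m) x
    (mdifferentiableAt_chart p hx)

/-- The covariant derivative in a chart: `∇ = D + Γ`. -/
theorem endoChart_cov (D : AffineConnection m X) {W : VectField m X} (p : X)
    {y : EuclideanSpace ℝ (Fin m)} (hy : y ∈ (extChartAt (𝓡 m) p).target)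
    (hW : MDifferentiableAt (𝓡 m) (𝓡 m).tangent
      (fun y ↦ (⟨y, W y⟩ : TangentBundle (𝓡 m) X)) ((extChartAt (𝓡 m) p).symm y))
    (v : EuclideanSpace ℝ (Fin m)) :
    endoChart (D W) p y v = fderiv ℝ (fieldChart W p) y v + christoffel D p y v (fieldChart W p y) := by
  set x := (extChartAt (𝓡 m) p).symm y with hxdef
  have hx : x ∈ (extChartAt (𝓡 m) p).source := (extChartAt (𝓡 m) p).map_target hy
  have hr : extChartAt (𝓡 m) p x = y := (extChartAt (𝓡 m) p).right_inv hy
  have hW' := (mdifferentiableAt_field_iff hx).1 hW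
  rw [hr] at hW'
  set f : Fin m → X → ℝ := fun i z ↦ fieldChart W p (extChartAt (𝓡 m) p z) i with hf
  set e : Fin m → VectField m X := fun i ↦ frameField p (EuclideanSpace.single i 1) with he
  have hfd : ∀ i, MDifferentiableAt (𝓡 m) 𝓘(ℝ, ℝ) (f i) x := fun i ↦
    mdifferentiableAt_coord hx (by rwa [hr]) i
  have hed : ∀ i, MDifferentiableAt (𝓡 m) (𝓡 m).tangent
      (fun y ↦ (⟨y, e i y⟩ : TangentBundle (𝓡 m) X)) x := fun i ↦ mdifferentiableAt_frameField p hx _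
  have hfe : ∀ i, MDifferentiableAt (𝓡 m) (𝓡 m).tangent
      (fun y ↦ (⟨y, (f i • e i) y⟩ : TangentBundle (𝓡 m) X)) x := fun i ↦
    (hfd i).smul_section (hed i)
  -- Near `x` the field is a combination of coordinate fields with its chart components as
  -- coefficients. Locality and the Leibniz rule reduce ∇W to the derivatives of the components and
  -- to the Christoffel symbols.
  have hexp : ∀ᶠ z in 𝓝 x, W z = ∑ i, (f i • e i) z := by
    filter_upwards [(isOpen_extChartAt_source (I := 𝓡 m) p).mem_nhds hx] with z hz
    have hz' := (extChartAt (𝓡 m) p).map_source hz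
    have h1 := chartInv_fieldChart W p hz'
    rw [← sum_coord_smul_single (fieldChart W p (extChartAt (𝓡 m) p z)), map_sum] at h1
    simp only [map_smul] at h1
    simp only [chartInv_apply p hz'] at h1
    rw [(extChartAt (𝓡 m) p).left_inv hz] at h1
    exact h1.symm
  have hD : D W x = ∑ i, D (f i • e i) x := by
    rw [← cov_sum D _ _ fun i _ ↦ hfe i]
    exact D.isCovariantDerivativeOnUniv.congr_of_eventuallyEq hW
      (MDifferentiableAt.sum_section fun i _ ↦ hfe i) univ_mem hexp
  have hL : ∀ i, D (f i • e i) x = f i x • D (e i) x + (mvfderiv (𝓡 m) (f i) x).smulRight (e i x) :=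
    fun i ↦ D.isCovariantDerivativeOnUniv.leibniz (hed i) (hfd i)
  have hfderiv : ∀ i, mvfderiv (𝓡 m) (f i) x (chartInv p y v) =
      (fderiv ℝ (fieldChart W p) y v) i := by
    intro i
    refine (mvfderiv_chart_symm hy (hfd i) v).trans ?_
    have e1 : (fun z ↦ f i ((extChartAt (𝓡 m) p).symm z)) =ᶠ[𝓝 y] fun z ↦ fieldChart W p z i := by
      filter_upwards [(isOpen_extChartAt_target (I := 𝓡 m) p).mem_nhds hy] with z hz
      simp only [hf, (extChartAt (𝓡 m) p).right_inv hz]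
    rw [e1.fderiv_eq]
    have h5 := (EuclideanSpace.proj (𝕜 := ℝ) i : EuclideanSpace ℝ (Fin m) →L[ℝ] ℝ).hasFDerivAt.comp y
      hW'.hasFDerivAt
    exact congrArg (fun A ↦ A v) h5.fderiv
  rw [endoChart_apply, christoffel_apply]
  have h6 : D W x (chartInv p y v) = ∑ i, (f i x • D (e i) x (chartInv p y v) +
      (fderiv ℝ (fieldChart W p) y v) i • e i x) := by
    rw [hD]
    simp only [hL, sum_apply, add_apply, smul_apply, ContinuousLinearMap.smulRight_apply, hfderiv]
  have h7 : ∀ i, chartD p x (e i x) = EuclideanSpace.single i 1 := by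
    intro i
    exact fieldChart_frame p hy _
  have h8 : ∀ i, f i x = fieldChart W p y i := fun i ↦ by simp only [hf, hr]
  rw [← hxdef, h6, map_sum]
  simp only [map_add, map_smul, h7, h8, Finset.sum_add_distrib]
  rw [sum_coord_smul_single, add_comm]
  rfl

/-- Smoothness of `D` is available for globally smooth fields, whereas a coordinate field is known
to be smooth only over the chart. A bump function cuts it off, and locality of `D` shows that
nothing changes near `p`. -/
theorem contDiffAt_christoffel [T2Space X] (D : AffineConnection m X)
    (hD : CovariantDerivative.ContMDiffCovariantDerivative D ∞) (p : X) :
    ContDiffAt ℝ ∞ (christoffel D p) (extChartAt (𝓡 m) p p) := by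
  have hmain : ∀ w : EuclideanSpace ℝ (Fin m),
      ContDiffAt ℝ ∞ (endoChart (D (frameField p w)) p) (extChartAt (𝓡 m) p p) := by
    intro w
    obtain ⟨ψ⟩ : Nonempty (SmoothBumpFunction (𝓡 m) p) := inferInstance
    let W : VectField m X := (ψ : X → ℝ) • frameField p w
    have hW : ContMDiff (𝓡 m) (𝓡 m).tangent ∞ (fun y ↦ (⟨y, W y⟩ : TangentBundle (𝓡 m) X)) := by
      intro x
      by_cases hx : x ∈ (extChartAt (𝓡 m) p).source
      · exact ψ.contMDiffAt.smul_section (contMDiffAt_frameField p hx w)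
      · have hx' : x ∉ tsupport ψ := fun h ↦ hx (by
          simpa using ψ.tsupport_subset_chartAt_source h)
        have h0 := (contMDiff_zeroSection ℝ (TangentSpace (𝓡 m) (M := X)) (IB := 𝓡 m) (n := ∞)
          (F := EuclideanSpace ℝ (Fin m))) x
        refine h0.congr_of_eventuallyEq ?_
        have h1 := notMem_tsupport_iff_eventuallyEq.1 hx'
        filter_upwards [h1] with z hz
        have : W z = 0 := by
          change ψ z • frameField p w z = 0
          rw [hz]
          exact zero_smul ℝ _
        rw [this]
        rfl
    have h2 := (hD.contMDiff.contMDiff (σ := W) hW.contMDiffOn).contMDiffAt (x := p) univ_mem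
    have h3 := contMDiffAt_endo_iff.1 h2
    refine h3.congr_of_eventuallyEq ?_
    have h4 : ∀ᶠ z in 𝓝 p, frameField p w z = W z := by
      filter_upwards [ψ.eventuallyEq_one] with z hz
      change _ = ψ z • frameField p w z
      rw [hz]
      exact (one_smul ℝ _).symm
    have h5 : ∀ᶠ z in 𝓝 p, D (frameField p w) z = D W z := by
      filter_upwards [h4.eventually_nhds, (isOpen_extChartAt_source (I := 𝓡 m) p).mem_nhds
        (mem_extChartAt_source p)] with z hz hzs
      exact D.isCovariantDerivativeOnUniv.congr_of_eventuallyEq (mdifferentiableAt_frameField p hzs w)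
        ((hW z).mdifferentiableAt (by simp)) univ_mem hz
    filter_upwards [(tendsto_chart_symm p (mem_extChartAt_source p)).eventually h5] with y hy
    ext1 v
    rw [endoChart_apply, endoChart_apply, hy]
  unfold christoffel
  refine ContDiffAt.sum fun i _ ↦ ?_
  exact ContDiffAt.clm_comp contDiffAt_const (hmain _)

theorem christoffel_eq (D : AffineConnection m X) (p : X) {y : EuclideanSpace ℝ (Fin m)}
    (hy : y ∈ (extChartAt (𝓡 m) p).target) (v w : EuclideanSpace ℝ (Fin m)) :
    christoffel D p y v w = endoChart (D (frameField p w)) p y v := by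
  have h := endoChart_cov D p hy
    (mdifferentiableAt_frameField p ((extChartAt (𝓡 m) p).map_target hy) w) v
  have e := fieldChart_frame_eventuallyEq p ((extChartAt (𝓡 m) p).map_target hy) w
  rw [(extChartAt (𝓡 m) p).right_inv hy] at e
  rw [e.fderiv_eq, fieldChart_frame p hy] at h
  simpa using h.symm

/-- The curvature at the centre of a chart. -/
theorem curv_eq_chartCurv (D : AffineConnection m X) (p : X)
    (hΓ : ContDiffAt ℝ ∞ (christoffel D p) (extChartAt (𝓡 m) p p)) (u v w : EuclideanSpace ℝ (Fin m)) :
    curv D p u v w = chartCurv (christoffel D p) (extChartAt (𝓡 m) p p) u v w := by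
  have hs := mem_extChartAt_source (I := 𝓡 m) p
  have ht := mem_extChartAt_target (I := 𝓡 m) p
  have hd : DifferentiableAt ℝ (christoffel D p) (extChartAt (𝓡 m) p p) :=
    hΓ.differentiableAt (by simp)
  have hl := (extChartAt (𝓡 m) p).left_inv hs
  have h1 : ∀ v w : EuclideanSpace ℝ (Fin m),
      fieldChart (fun y ↦ D (frameField p w) y (frameField p v y)) p
        =ᶠ[𝓝 (extChartAt (𝓡 m) p p)] fun y ↦ christoffel D p y v w := by
    intro v w
    filter_upwards [extChartAt_target_mem_nhds p] with y hy
    rw [christoffel_eq D p hy, endoChart_apply, chartInv_apply p hy]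
    rfl
  have h2 : ∀ v w : EuclideanSpace ℝ (Fin m), MDifferentiableAt (𝓡 m) (𝓡 m).tangent
      (fun y ↦ (⟨y, D (frameField p w) y (frameField p v y)⟩ : TangentBundle (𝓡 m) X)) p := by
    intro v w
    rw [mdifferentiableAt_field_iff hs]
    exact (differentiableAt_eval_const (differentiableAt_eval_const hd v) w).congr_of_eventuallyEq
      (h1 v w)
  have h3 : ∀ u v w : EuclideanSpace ℝ (Fin m),
      D (fun y ↦ D (frameField p w) y (frameField p v y)) p u =
        fderiv ℝ (christoffel D p) (extChartAt (𝓡 m) p p) u v w +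
        christoffel D p (extChartAt (𝓡 m) p p) u (christoffel D p (extChartAt (𝓡 m) p p) v w) := by
    intro u v w
    have h := endoChart_cov D p ht (by rw [hl]; exact h2 v w) u
    rw [(h1 v w).fderiv_eq, (h1 v w).self_of_nhds,
      fderiv_eval_const (differentiableAt_eval_const hd v), fderiv_eval_const hd] at h
    exact (endoChart_self _ p u).symm.trans h
  have h4 : ∀ u v : EuclideanSpace ℝ (Fin m),
      VectorField.mlieBracket (𝓡 m) (frameField p u) (frameField p v) p = 0 := by
    intro u v
    have h := mfderiv_chart_mlieBracket hs (mdifferentiableAt_frameField p hs u)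
      (mdifferentiableAt_frameField p hs v)
    rw [(fieldChart_frame_eventuallyEq p hs u).fderiv_eq,
      (fieldChart_frame_eventuallyEq p hs v).fderiv_eq] at h
    refine (mfderiv_chart_self p _).symm.trans (h.trans ?_)
    simp
    rfl
  -- The extensions in the definition of `curv` are the coordinate fields at `p`, and their bracket
  -- vanishes by `h4`.
  have h5 : curv D p u v w = D (fun y ↦ D (frameField p w) y (frameField p v y)) p u -
      D (fun y ↦ D (frameField p w) y (frameField p u y)) p v -
      D (frameField p w) p (VectorField.mlieBracket (𝓡 m) (frameField p u) (frameField p v) p) := rfl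
  have h6 : D (frameField p w) p
      (VectorField.mlieBracket (𝓡 m) (frameField p u) (frameField p v) p) = 0 := by
    rw [h4, map_zero]
  have h7 : ∀ a b c : EuclideanSpace ℝ (Fin m), c = 0 → a - b - c = a - b := by
    rintro a b c rfl
    exact sub_zero _
  refine h5.trans ((h7 _ _ _ h6).trans ((congrArg₂ (fun a b : EuclideanSpace ℝ (Fin m) ↦ a - b)
    (h3 u v w) (h3 v u w)).trans ?_))
  unfold chartCurv
  abel

end ChartConnection

/-! ### The metric, the Levi-Civita conditions and Lie invariance in a chart -/

section ChartMetric

variable {m : ℕ} {X : Type*} [TopologicalSpace X] [ChartedSpace (EuclideanSpace ℝ (Fin m)) X]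
  [IsManifold (𝓡 m) ∞ X]

theorem chartInv_chartD (p : X) {y : EuclideanSpace ℝ (Fin m)}
    (hy : y ∈ (extChartAt (𝓡 m) p).target)
    (a : TangentSpace (𝓡 m) ((extChartAt (𝓡 m) p).symm y)) :
    chartInv p y (chartD p _ a) = a := by
  have h := mfderiv_symm_comp_chart p ((extChartAt (𝓡 m) p).map_target hy) a
  rw [(extChartAt (𝓡 m) p).right_inv hy] at h
  exact h

theorem chartInv_christoffel (D : AffineConnection m X) (p : X) {y : EuclideanSpace ℝ (Fin m)}
    (hy : y ∈ (extChartAt (𝓡 m) p).target) (v w : EuclideanSpace ℝ (Fin m)) :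
    chartInv p y (christoffel D p y v w) =
      D (frameField p w) ((extChartAt (𝓡 m) p).symm y) (chartInv p y v) := by
  rw [christoffel_eq D p hy, endoChart_apply, chartInv_chartD p hy]

/-- Coordinate fields commute, so for them the torsion-free condition is the symmetry of Γ. -/
theorem christoffel_symm [RiemannianBundle (fun p : X ↦ TangentSpace (𝓡 m) p)]
    {D : AffineConnection m X} (hD : IsLeviCivita D) (p : X)
    {y : EuclideanSpace ℝ (Fin m)} (hy : y ∈ (extChartAt (𝓡 m) p).target)
    (v w : EuclideanSpace ℝ (Fin m)) : christoffel D p y v w = christoffel D p y w v := by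
  have hx := (extChartAt (𝓡 m) p).map_target hy
  have h1 := hD.torsion_free ((extChartAt (𝓡 m) p).symm y) (frameField p v) (frameField p w)
    (mdifferentiableAt_frameField p hx v) (mdifferentiableAt_frameField p hx w)
  have h2 := mfderiv_chart_mlieBracket hx (mdifferentiableAt_frameField p hx v)
    (mdifferentiableAt_frameField p hx w)
  rw [← h1, (fieldChart_frame_eventuallyEq p hx v).fderiv_eq,
    (fieldChart_frame_eventuallyEq p hx w).fderiv_eq] at h2
  have h3 : chartD p ((extChartAt (𝓡 m) p).symm y)
      (D (frameField p w) ((extChartAt (𝓡 m) p).symm y)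
        (frameField p v ((extChartAt (𝓡 m) p).symm y)) -
      D (frameField p v) ((extChartAt (𝓡 m) p).symm y)
        (frameField p w ((extChartAt (𝓡 m) p).symm y))) = 0 := by
    refine h2.trans ?_
    simp
    rfl
  rw [map_sub, ← chartInv_apply p hy, ← chartInv_apply p hy] at h3
  rw [christoffel_eq D p hy, christoffel_eq D p hy, endoChart_apply, endoChart_apply]
  exact sub_eq_zero.1 h3

/-- The coordinate expression of `-[Z, ∂_v]`. -/
theorem mlieBracket_frame {Z : VectField m X} (p : X) {y : EuclideanSpace ℝ (Fin m)}
    (hy : y ∈ (extChartAt (𝓡 m) p).target)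
    (hZ : DifferentiableAt ℝ (fieldChart Z p) y) (v : EuclideanSpace ℝ (Fin m)) :
    VectorField.mlieBracket (𝓡 m) Z (frameField p v) ((extChartAt (𝓡 m) p).symm y) =
      chartInv p y (-fderiv ℝ (fieldChart Z p) y v) := by
  have hx := (extChartAt (𝓡 m) p).map_target hy
  have hr := (extChartAt (𝓡 m) p).right_inv hy
  have h2 := mfderiv_chart_mlieBracket (V := Z) hx
    ((mdifferentiableAt_field_iff hx).2 (by rwa [hr])) (mdifferentiableAt_frameField p hx v)
  rw [(fieldChart_frame_eventuallyEq p hx v).fderiv_eq, hr, fieldChart_frame p hy] at h2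
  have h3 : chartD p ((extChartAt (𝓡 m) p).symm y)
      (VectorField.mlieBracket (𝓡 m) Z (frameField p v) ((extChartAt (𝓡 m) p).symm y)) =
      -fderiv ℝ (fieldChart Z p) y v := by
    refine h2.trans ?_
    simp
    rfl
  have h4 := mfderiv_symm_comp_chart p hx
    (VectorField.mlieBracket (𝓡 m) Z (frameField p v) ((extChartAt (𝓡 m) p).symm y))
  rw [hr] at h4
  rw [← h3]
  exact h4.symm

/-- Invariance of a bilinear form under the flow of `Z`, in a chart. -/
theorem IsLieInvariantOn.chart {Z : VectField m X}
    {B : Π p : X, TangentSpace (𝓡 m) p → TangentSpace (𝓡 m) p → ℝ} {U : Set X}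
    (h : IsLieInvariantOn Z B U) (p : X) {y : EuclideanSpace ℝ (Fin m)}
    (hy : y ∈ (extChartAt (𝓡 m) p).target) (hyU : (extChartAt (𝓡 m) p).symm y ∈ U)
    (hZ : DifferentiableAt ℝ (fieldChart Z p) y)
    {b : EuclideanSpace ℝ (Fin m) → EuclideanSpace ℝ (Fin m) →L[ℝ] EuclideanSpace ℝ (Fin m) →L[ℝ] ℝ}
    (hb : DifferentiableAt ℝ b y)
    (hB : ∀ z ∈ (extChartAt (𝓡 m) p).target, ∀ v w,
      B ((extChartAt (𝓡 m) p).symm z) (chartInv p z v) (chartInv p z w) = b z v w)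
    (v w : EuclideanSpace ℝ (Fin m)) :
    fderiv ℝ b y (fieldChart Z p y) v w =
      b y (-fderiv ℝ (fieldChart Z p) y v) w + b y v (-fderiv ℝ (fieldChart Z p) y w) := by
  have hx := (extChartAt (𝓡 m) p).map_target hy
  have hr := (extChartAt (𝓡 m) p).right_inv hy
  have h1 := h _ hyU (frameField p v) (frameField p w) (mdifferentiableAt_frameField p hx v)
    (mdifferentiableAt_frameField p hx w)
  rw [mlieBracket_frame p hy hZ, mlieBracket_frame p hy hZ, ← chartInv_apply p hy,
    ← chartInv_apply p hy, hB y hy, hB y hy, ← chartInv_fieldChart Z p hy] at h1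
  have e : (fun z ↦ B ((extChartAt (𝓡 m) p).symm z)
      (frameField p v ((extChartAt (𝓡 m) p).symm z))
      (frameField p w ((extChartAt (𝓡 m) p).symm z))) =ᶠ[𝓝 y] fun z ↦ b z v w := by
    filter_upwards [(isOpen_extChartAt_target (I := 𝓡 m) p).mem_nhds hy] with z hz
    rw [← hB z hz, chartInv_apply p hz, chartInv_apply p hz]
  have hbd : DifferentiableAt ℝ (fun z ↦ b z v w) y :=
    differentiableAt_eval_const (differentiableAt_eval_const hb v) w
  have hd : MDifferentiableAt (𝓡 m) 𝓘(ℝ, ℝ) (fun x ↦ B x (frameField p v x) (frameField p w x))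
      ((extChartAt (𝓡 m) p).symm y) := by
    have h2 : MDifferentiableAt (𝓡 m) 𝓘(ℝ, ℝ) (fun z ↦ b z v w)
        (extChartAt (𝓡 m) p ((extChartAt (𝓡 m) p).symm y)) := by
      rw [hr]
      exact mdifferentiableAt_iff_differentiableAt.2 hbd
    refine (h2.comp (I' := 𝓡 m) _ (mdifferentiableAt_chart p hx)).congr_of_eventuallyEq ?_
    filter_upwards [(isOpen_extChartAt_source (I := 𝓡 m) p).mem_nhds hx] with z hz
    have hz' := (extChartAt (𝓡 m) p).map_source hz
    rw [Function.comp_apply, ← hB _ hz', chartInv_apply p hz', chartInv_apply p hz',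
      (extChartAt (𝓡 m) p).left_inv hz]
  have h3 := mvfderiv_chart_symm hy hd (fieldChart Z p y)
  rw [e.fderiv_eq, fderiv_eval_const (differentiableAt_eval_const hb v), fderiv_eval_const hb] at h3
  rw [← h3]
  exact h1

variable [RiemannianBundle (fun p : X ↦ TangentSpace (𝓡 m) p)]

/-- The metric in the chart around `p`. -/
def metricChart (p : X) (y : EuclideanSpace ℝ (Fin m)) :
    EuclideanSpace ℝ (Fin m) →L[ℝ] EuclideanSpace ℝ (Fin m) →L[ℝ] ℝ :=
  (innerSL ℝ (E := TangentSpace (𝓡 m) ((extChartAt (𝓡 m) p).symm y))).bilinearComp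
    (chartInv p y) (chartInv p y)

omit [IsManifold (𝓡 m) ∞ X] in
theorem metricChart_apply (p : X) (y v w : EuclideanSpace ℝ (Fin m)) :
    metricChart p y v w = ⟪chartInv p y v, chartInv p y w⟫_ℝ := rfl

omit [IsManifold (𝓡 m) ∞ X] in
theorem metricChart_symm (p : X) (y v w : EuclideanSpace ℝ (Fin m)) :
    metricChart p y v w = metricChart p y w v := by
  rw [metricChart_apply, metricChart_apply, real_inner_comm]

theorem metricChart_eq_zero (p : X) {y : EuclideanSpace ℝ (Fin m)}
    (hy : y ∈ (extChartAt (𝓡 m) p).target) (v : EuclideanSpace ℝ (Fin m))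
    (h : metricChart p y v v = 0) : v = 0 := by
  have h1 : chartInv p y v = 0 := inner_self_eq_zero.1 h
  have h2 := chartD_chartInv p hy v
  rw [h1, map_zero] at h2
  exact h2.symm

omit [RiemannianBundle (fun p : X ↦ TangentSpace (𝓡 m) p)] in
theorem chartInv_self (p : X) (W : VectField m X) :
    chartInv p (extChartAt (𝓡 m) p p) (W p) = W ((extChartAt (𝓡 m) p).symm (extChartAt (𝓡 m) p p)) := by
  have h := chartInv_fieldChart W p (mem_extChartAt_target p)
  rw [fieldChart_self] at h
  exact h

theorem metricChart_self (p : X) (v w : TangentSpace (𝓡 m) p) :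
    metricChart p (extChartAt (𝓡 m) p p) v w = ⟪v, w⟫_ℝ := by
  have key : ∀ (V W : VectField m X) (v w : TangentSpace (𝓡 m) p), V p = v → W p = w →
      metricChart p (extChartAt (𝓡 m) p p) v w = ⟪v, w⟫_ℝ := by
    rintro V W _ _ rfl rfl
    have h := metricChart_apply p (extChartAt (𝓡 m) p p) (V p) (W p)
    rw [chartInv_self, chartInv_self, (extChartAt (𝓡 m) p).left_inv (mem_extChartAt_source p)] at h
    exact h
  exact key _ _ v w (frameField_self p v) (frameField_self p w)

variable [IsContMDiffRiemannianBundle (𝓡 m) ∞ (EuclideanSpace ℝ (Fin m))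
      (fun p : X ↦ TangentSpace (𝓡 m) p)]

theorem contDiffAt_metricChart (p : X) {y : EuclideanSpace ℝ (Fin m)}
    (hy : y ∈ (extChartAt (𝓡 m) p).target) : ContDiffAt ℝ ∞ (metricChart p) y := by
  rw [contDiffAt_clm_iff]
  intro v
  rw [contDiffAt_clm_iff]
  intro w
  have hx := (extChartAt (𝓡 m) p).map_target hy
  have h1 : ContMDiffAt (𝓡 m) 𝓘(ℝ, ℝ) ∞ (fun x ↦ ⟪frameField p v x, frameField p w x⟫_ℝ)
      ((extChartAt (𝓡 m) p).symm y) :=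
    ContMDiffAt.inner_bundle (E := TangentSpace (𝓡 m)) (b := fun x ↦ x)
      (contMDiffAt_frameField p hx v) (contMDiffAt_frameField p hx w)
  have h2 := fun_comp_chart_symm hx h1
  rw [(extChartAt (𝓡 m) p).right_inv hy] at h2
  refine h2.congr_of_eventuallyEq ?_
  filter_upwards [(isOpen_extChartAt_target (I := 𝓡 m) p).mem_nhds hy] with z hz
  rw [metricChart_apply, chartInv_apply p hz, chartInv_apply p hz]

theorem fderiv_metricChart {D : AffineConnection m X} (hD : IsLeviCivita D) (p : X)
    {y : EuclideanSpace ℝ (Fin m)} (hy : y ∈ (extChartAt (𝓡 m) p).target)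
    (u v w : EuclideanSpace ℝ (Fin m)) :
    fderiv ℝ (metricChart p) y u v w = metricChart p y (christoffel D p y u v) w +
      metricChart p y v (christoffel D p y u w) := by
  have hx := (extChartAt (𝓡 m) p).map_target hy
  have hd : DifferentiableAt ℝ (metricChart p) y := (contDiffAt_metricChart p hy).differentiableAt (by simp)
  have h1 := hD.metric _ (frameField p v) (frameField p w) (chartInv p y u)
    (mdifferentiableAt_frameField p hx v) (mdifferentiableAt_frameField p hx w)
  have h0 : ContMDiffAt (𝓡 m) 𝓘(ℝ, ℝ) ∞ (fun x ↦ ⟪frameField p v x, frameField p w x⟫_ℝ)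
      ((extChartAt (𝓡 m) p).symm y) :=
    ContMDiffAt.inner_bundle (E := TangentSpace (𝓡 m)) (b := fun x ↦ x)
      (contMDiffAt_frameField p hx v) (contMDiffAt_frameField p hx w)
  have h2 := mvfderiv_chart_symm hy (h0.mdifferentiableAt (by simp)) u
  have e : (fun z ↦ ⟪frameField p v ((extChartAt (𝓡 m) p).symm z),
      frameField p w ((extChartAt (𝓡 m) p).symm z)⟫_ℝ) =ᶠ[𝓝 y] fun z ↦ metricChart p z v w := by
    filter_upwards [(isOpen_extChartAt_target (I := 𝓡 m) p).mem_nhds hy] with z hz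
    rw [metricChart_apply, chartInv_apply p hz, chartInv_apply p hz]
  rw [e.fderiv_eq, fderiv_eval_const (differentiableAt_eval_const hd v), fderiv_eval_const hd] at h2
  rw [← chartInv_christoffel D p hy, ← chartInv_christoffel D p hy, ← chartInv_apply p hy,
    ← chartInv_apply p hy] at h1
  exact h2.symm.trans h1

end ChartMetric

/-! ### Invariance under a flow in terms of the covariant derivative ∇Z -/

section LieChart

variable {E : Type*} [NormedAddCommGroup E] [NormedSpace ℝ E]
  {Γ : E → E →L[ℝ] E →L[ℝ] E} {g : E → E →L[ℝ] E →L[ℝ] ℝ} {y : E} {Z : E → E}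

/-- For a torsion-free metric connection, (L_Z g)(v,w) = g(∇_v Z, w) + g(v, ∇_w Z). -/
theorem nablaField_skew (hsymm : ∀ v w, Γ y v w = Γ y w v)
    (hmetric : ∀ u v w, fderiv ℝ g y u v w = g y (Γ y u v) w + g y v (Γ y u w))
    (hlie : ∀ v w, fderiv ℝ g y (Z y) v w = g y (-fderiv ℝ Z y v) w + g y v (-fderiv ℝ Z y w))
    (v w : E) : g y (nablaField Γ Z y v) w + g y v (nablaField Γ Z y w) = 0 := by
  have h := hlie v w
  rw [hmetric, hsymm, hsymm (Z y) w] at h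
  simp only [nablaField_apply, map_add, map_neg, add_apply, neg_apply] at h ⊢
  linarith

/-- Without torsion L_Z J = ∇_Z J - [∇Z, J]. Both g and g(J·,·) are invariant, hence so is J, and
∇_Z J is given by the connection forms evaluated at Z. Nondegeneracy of g passes from the forms to
the endomorphisms. -/
theorem nablaField_comm {ι : Type*} [Fintype ι] {J : ι → E → E →L[ℝ] E} {c : ι → E →L[ℝ] ℝ}
    (hg : DifferentiableAt ℝ g y) {a : ι} (hJ : DifferentiableAt ℝ (J a) y)
    (hgp : ∀ v, g y v v = 0 → v = 0)
    (hsymm : ∀ v w, Γ y v w = Γ y w v)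
    (hmetric : ∀ u v w, fderiv ℝ g y u v w = g y (Γ y u v) w + g y v (Γ y u w))
    (hconn : ∀ v w, fderiv ℝ (J a) y v w =
      J a y (Γ y v w) - Γ y v (J a y w) + ∑ b, c b v • J b y w)
    (hskew : ∀ v w, g y (nablaField Γ Z y v) w + g y v (nablaField Γ Z y w) = 0)
    (hlie : ∀ v w, fderiv ℝ (fun z ↦ (g z).comp (J a z)) y (Z y) v w =
      g y (J a y (-fderiv ℝ Z y v)) w + g y (J a y v) (-fderiv ℝ Z y w)) (v : E) :
    nablaField Γ Z y (J a y v) - J a y (nablaField Γ Z y v) = ∑ b, c b (Z y) • J b y v := by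
  have hcomp : DifferentiableAt ℝ (fun z ↦ (g z).comp (J a z)) y := hg.clm_comp hJ
  have key : ∀ w, g y (nablaField Γ Z y (J a y v) - J a y (nablaField Γ Z y v)) w =
      g y (∑ b, c b (Z y) • J b y v) w := by
    intro w
    have h := hlie v w
    rw [← fderiv_eval_const hcomp, ← fderiv_eval_const (differentiableAt_eval_const hcomp v)] at h
    simp only [ContinuousLinearMap.comp_apply] at h
    have hJv := differentiableAt_eval_const hJ v
    rw [fderiv_eval_const (differentiableAt_eval hg hJv), fderiv_eval hg hJv, add_apply,
      fderiv_eval_const hJ, hconn, hmetric, hsymm (Z y) v, hsymm (Z y) w] at h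
    have h2 := hskew (J a y v) w
    simp only [nablaField_apply, map_add, map_neg, map_sub, add_apply, neg_apply, sub_apply] at h h2 ⊢
    rw [hsymm (Z y)] at h
    linarith
  have h1 : ∀ w s : E, (∀ z, g y w z = g y s z) → w = s := by
    intro w s hws
    refine sub_eq_zero.1 (hgp (w - s) ?_)
    have h2 := hws (w - s)
    have h3 : g y (w - s) (w - s) = g y w (w - s) - g y s (w - s) := by
      rw [map_sub (g y) w s, sub_apply]
    rw [h3, h2, sub_self]
  exact h1 _ _ key

end LieChart

/-! ### The matrix of connection forms of a quaternionic frame -/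

section Connection

variable {n : ℕ}
  {N : Type*} [TopologicalSpace N] [ChartedSpace (EuclideanSpace ℝ (Fin (4 * n))) N]
  [IsManifold (𝓡 (4 * n)) ∞ N]

/-- The matrix of connection forms: `∇Jₐ = ∑ c_ab ⊗ J_b`. -/
def connMat {m : ℕ} {X : Type*} [TopologicalSpace X] [ChartedSpace (EuclideanSpace ℝ (Fin m)) X]
    (β α₂ α₃ : Covect m X) : Fin 3 → Fin 3 → Covect m X :=
  ![![0, fun p ↦ -α₂ p, α₃], ![α₂, 0, β], ![fun p ↦ -α₃ p, fun p ↦ -β p, 0]]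

theorem AreConnectionForms.covEndo_eq {D : AffineConnection (4 * n) N}
    {J : Fin 3 → EndoField (4 * n) N} {β α₂ α₃ : Covect (4 * n) N} {U : Set N}
    (h : AreConnectionForms D J β α₂ α₃ U) {p : N} (hp : p ∈ U) (v : TangentSpace (𝓡 (4 * n)) p)
    {W : VectField (4 * n) N} (hW : MDifferentiableAt (𝓡 (4 * n)) (𝓡 (4 * n)).tangent
        (fun y ↦ (⟨y, W y⟩ : TangentBundle (𝓡 (4 * n)) N)) p) (a : Fin 3) :
    covEndo D (J a) p v W = ∑ b, connMat β α₂ α₃ a b p v • J b p (W p) := by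
  obtain ⟨h0, h1, h2⟩ := h p hp v W hW
  rw [Fin.sum_univ_three]
  fin_cases a
  · refine h0.trans ?_
    change _ = (0 : ℝ) • J 0 p (W p) + (-α₂ p v) • J 1 p (W p) + α₃ p v • J 2 p (W p)
    rw [zero_smul, zero_add]
  · refine h1.trans ?_
    change _ = α₂ p v • J 0 p (W p) + (0 : ℝ) • J 1 p (W p) + β p v • J 2 p (W p)
    rw [zero_smul, add_zero]
  · refine h2.trans ?_
    change _ = (-α₃ p v) • J 0 p (W p) + (-β p v) • J 1 p (W p) + (0 : ℝ) • J 2 p (W p)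
    rw [zero_smul, add_zero, neg_smul (β p v), sub_eq_add_neg]

theorem AreConnectionForms.chart {D : AffineConnection (4 * n) N}
    {J : Fin 3 → EndoField (4 * n) N} {β α₂ α₃ : Covect (4 * n) N} {U : Set N}
    (h : AreConnectionForms D J β α₂ α₃ U) (p : N) {y : EuclideanSpace ℝ (Fin (4 * n))}
    (hy : y ∈ (extChartAt (𝓡 (4 * n)) p).target) (hyU : (extChartAt (𝓡 (4 * n)) p).symm y ∈ U)
    (a : Fin 3) (hJ : DifferentiableAt ℝ (endoChart (J a) p) y)
    (v w : EuclideanSpace ℝ (Fin (4 * n))) :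
    fderiv ℝ (endoChart (J a) p) y v w = endoChart (J a) p y (christoffel D p y v w) -
      christoffel D p y v (endoChart (J a) p y w) +
      ∑ b, covChart (connMat β α₂ α₃ a b) p y v • endoChart (J b) p y w := by
  have hx := (extChartAt (𝓡 (4 * n)) p).map_target hy
  have hr := (extChartAt (𝓡 (4 * n)) p).right_inv hy
  have h1 := h.covEndo_eq hyU (chartInv p y v) (mdifferentiableAt_frameField p hx w) a
  have e : fieldChart (fun z ↦ J a z (frameField p w z)) p =ᶠ[𝓝 y] fun z ↦ endoChart (J a) p z w := by
    filter_upwards [(isOpen_extChartAt_target (I := 𝓡 (4 * n)) p).mem_nhds hy] with z hz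
    rw [fieldChart_endo _ _ _ hz, fieldChart_frame p hz]
  have hm : MDifferentiableAt (𝓡 (4 * n)) (𝓡 (4 * n)).tangent
      (fun y ↦ (⟨y, J a y (frameField p w y)⟩ : TangentBundle (𝓡 (4 * n)) N))
      ((extChartAt (𝓡 (4 * n)) p).symm y) := by
    rw [mdifferentiableAt_field_iff hx, hr]
    exact (differentiableAt_eval_const hJ w).congr_of_eventuallyEq e
  have h2 := endoChart_cov D p hy hm v
  rw [e.fderiv_eq, e.self_of_nhds, fderiv_eval_const hJ, endoChart_apply] at h2
  have h3 := congrArg (chartD p ((extChartAt (𝓡 (4 * n)) p).symm y)) h1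
  unfold covEndo at h3
  rw [map_sub, h2, ← chartInv_christoffel D p hy, map_sum] at h3
  simp only [map_smul, ← chartInv_apply p hy, ← endoChart_apply] at h3
  rw [← sub_eq_zero] at h3 ⊢
  rw [← h3]
  simp only [covChart, endoChart_apply]
  abel_nf
  rfl

theorem contDiffAt_connMat {β α₂ α₃ : Covect (4 * n) N} {p : N}
    (hβ : SmoothFormAt (toForm β) p) (hα₂ : SmoothFormAt (toForm α₂) p)
    (hα₃ : SmoothFormAt (toForm α₃) p) (a b : Fin 3) :
    ContDiffAt ℝ ∞ (covChart (connMat β α₂ α₃ a b) p) (extChartAt (𝓡 (4 * n)) p p) := by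
  rw [smoothFormAt_toForm_iff] at hβ hα₂ hα₃
  have h0 : ContDiffAt ℝ ∞ (covChart (0 : Covect (4 * n) N) p) (extChartAt (𝓡 (4 * n)) p p) := by
    have : covChart (0 : Covect (4 * n) N) p = fun _ ↦ 0 := by
      funext y
      ext v
      rfl
    rw [this]
    exact contDiffAt_const
  have hneg : ∀ {θ : Covect (4 * n) N},
      ContDiffAt ℝ ∞ (covChart θ p) (extChartAt (𝓡 (4 * n)) p p) →
      ContDiffAt ℝ ∞ (covChart (fun p ↦ -θ p) p) (extChartAt (𝓡 (4 * n)) p p) := by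
    intro θ hθ
    exact hθ.neg
  fin_cases a <;> fin_cases b
  exacts [h0, hneg hα₂, hα₃, hα₂, h0, hβ, hneg hα₃, hneg hβ, h0]

end Connection

/-! ### Linear independence of a quaternionic frame -/

section QuaternionAlgebra

variable {V : Type*} [AddCommGroup V] [TopologicalSpace V] [IsTopologicalAddGroup V] [Module ℝ V]
  {J : Fin 3 → V →L[ℝ] V}

namespace QuaternionRelations

theorem mul01 (h : QuaternionRelations J) (v : V) : J 0 (J 1 v) = J 2 v := h.mul 0 v
theorem mul12 (h : QuaternionRelations J) (v : V) : J 1 (J 2 v) = J 0 v := h.mul 1 v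
theorem mul20 (h : QuaternionRelations J) (v : V) : J 2 (J 0 v) = J 1 v := h.mul 2 v
theorem mul10 (h : QuaternionRelations J) (v : V) : J 1 (J 0 v) = -J 2 v := h.anti 0 v
theorem mul21 (h : QuaternionRelations J) (v : V) : J 2 (J 1 v) = -J 0 v := h.anti 1 v
theorem mul02 (h : QuaternionRelations J) (v : V) : J 0 (J 2 v) = -J 1 v := h.anti 2 v

/-- The square of the imaginary quaternion aJ₀ + bJ₁ + cJ₂ is -(a² + b² + c²). A single nonzero
vector therefore suffices to compare coefficients. -/
theorem coeff_eq_zero (h : QuaternionRelations J) {a b c : ℝ} {v : V} (hv : v ≠ 0)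
    (h0 : a • J 0 v + b • J 1 v + c • J 2 v = 0) : a = 0 ∧ b = 0 ∧ c = 0 := by
  have h1 : (a * a + b * b + c * c) • v = 0 := by
    have e : -((a * a + b * b + c * c) • v) =
        a • J 0 (a • J 0 v + b • J 1 v + c • J 2 v) +
        b • J 1 (a • J 0 v + b • J 1 v + c • J 2 v) +
        c • J 2 (a • J 0 v + b • J 1 v + c • J 2 v) := by
      simp only [map_add, map_smul, h.sq, h.mul01, h.mul12, h.mul20, h.mul10, h.mul21, h.mul02]
      module
    rw [h0] at e
    simpa using e
  have h2 : a * a + b * b + c * c = 0 := (smul_eq_zero.1 h1).resolve_right hv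
  refine ⟨?_, ?_, ?_⟩ <;> nlinarith [mul_self_nonneg a, mul_self_nonneg b, mul_self_nonneg c]

end QuaternionRelations

end QuaternionAlgebra

/-! ### Trace orthogonality and commutators -/

section Traces

variable {V : Type*} [NormedAddCommGroup V] [InnerProductSpace ℝ V]
  {ι : Type*} [Fintype ι] [Nonempty ι] (b : OrthonormalBasis ι ℝ V)

/-- Composing [T, J₂] with J₁ and taking traces isolates the coefficient of J₁. By cyclicity the
trace on the left is a multiple of tr(J₃T), which vanishes; likewise for [T, J₃] and tr(J₂T). -/
theorem IsQuatTriple.comm_coeff {J₁ J₂ J₃ T : V →ₗ[ℝ] V} (h : IsQuatTriple J₁ J₂ J₃)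
    (h₂ : ∑ i, ⟪T (b i), J₂ (b i)⟫_ℝ = 0) (h₃ : ∑ i, ⟪T (b i), J₃ (b i)⟫_ℝ = 0)
    {a f a' f' : ℝ} (c₂ : ∀ v, T (J₂ v) - J₂ (T v) = a • J₁ v + f • J₃ v)
    (c₃ : ∀ v, T (J₃ v) - J₃ (T v) = a' • J₁ v + f' • J₂ v) : a = 0 ∧ a' = 0 := by
  have t₂ : ∑ i, ⟪J₂ (T (b i)), b i⟫_ℝ = 0 := by
    simp only [h.skew₂, Finset.sum_neg_distrib, h₂, neg_zero]
  have t₃ : ∑ i, ⟪J₃ (T (b i)), b i⟫_ℝ = 0 := by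
    simp only [h.skew₃, Finset.sum_neg_distrib, h₃, neg_zero]
  have s : ∀ {A : V →ₗ[ℝ] V}, (∀ v w, ⟪A v, w⟫_ℝ = -⟪v, A w⟫_ℝ) → ∀ v, ⟪A v, v⟫_ℝ = 0 := by
    intro A hA v
    linarith [hA v v, real_inner_comm v (A v)]
  have hcard : (0 : ℝ) < Fintype.card ι := by exact_mod_cast Fintype.card_pos
  constructor
  · have e : ∀ i, ⟪(J₁ ∘ₗ T) (J₂ (b i)), b i⟫_ℝ - ⟪J₃ (T (b i)), b i⟫_ℝ = -a := by
      intro i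
      have := congrArg (fun w ↦ ⟪J₁ w, b i⟫_ℝ) (c₂ (b i))
      simp only [map_sub, map_add, map_smul, h.mul₁₂, h.sq₁, h.mul₁₃, inner_sub_left,
        inner_add_left, real_inner_smul_left, inner_neg_left, s h.skew₂, b.inner_eq_one] at this
      simp only [LinearMap.comp_apply]
      linarith
    have e2 := Finset.sum_congr rfl fun i (_ : i ∈ Finset.univ) ↦ e i
    rw [Finset.sum_sub_distrib, IsQuatCurvature.trace_comm b (J₁ ∘ₗ T) J₂] at e2
    simp only [LinearMap.comp_apply, h.mul₂₁, inner_neg_left, Finset.sum_neg_distrib, t₃,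
      Finset.sum_const, Finset.card_univ, nsmul_eq_mul] at e2
    nlinarith
  · have e : ∀ i, ⟪(J₁ ∘ₗ T) (J₃ (b i)), b i⟫_ℝ + ⟪J₂ (T (b i)), b i⟫_ℝ = -a' := by
      intro i
      have := congrArg (fun w ↦ ⟪J₁ w, b i⟫_ℝ) (c₃ (b i))
      simp only [map_sub, map_add, map_smul, h.mul₁₂, h.sq₁, h.mul₁₃, inner_sub_left,
        inner_add_left, real_inner_smul_left, inner_neg_left, s h.skew₃, b.inner_eq_one] at this
      simp only [LinearMap.comp_apply]
      linarith
    have e2 := Finset.sum_congr rfl fun i (_ : i ∈ Finset.univ) ↦ e i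
    rw [Finset.sum_add_distrib, IsQuatCurvature.trace_comm b (J₁ ∘ₗ T) J₃] at e2
    simp only [LinearMap.comp_apply, h.mul₃₁, t₂,
      Finset.sum_const, Finset.card_univ, nsmul_eq_mul] at e2
    nlinarith

end Traces

/-! ### Curvature forms and moment equations of a quaternion-Kähler metric in a chart -/

section QKChart

variable {E : Type*} [NormedAddCommGroup E] [NormedSpace ℝ E]

theorem chartCurv_add₁ (Γ : E → E →L[ℝ] E →L[ℝ] E) (x u v w z : E) :
    chartCurv Γ x (u + z) v w =
      chartCurv Γ x u v w + chartCurv Γ x z v w := by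
  unfold chartCurv
  generalize fderiv ℝ Γ x = A
  generalize Γ x = B
  simp only [ContinuousLinearMap.map_add, add_apply]
  abel

theorem chartCurv_smul₁ (Γ : E → E →L[ℝ] E →L[ℝ] E) (x u v w : E) (r : ℝ) :
    chartCurv Γ x (r • u) v w = r • chartCurv Γ x u v w := by
  unfold chartCurv
  generalize fderiv ℝ Γ x = A
  generalize Γ x = B
  simp only [ContinuousLinearMap.map_smul, smul_apply, smul_add, smul_sub]

theorem chartCurv_add₂ (Γ : E → E →L[ℝ] E →L[ℝ] E) (x u v w z : E) :
    chartCurv Γ x u (v + z) w =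
      chartCurv Γ x u v w + chartCurv Γ x u z w := by
  unfold chartCurv
  generalize fderiv ℝ Γ x = A
  generalize Γ x = B
  simp only [ContinuousLinearMap.map_add, add_apply]
  abel

theorem chartCurv_smul₂ (Γ : E → E →L[ℝ] E →L[ℝ] E) (x u v w : E) (r : ℝ) :
    chartCurv Γ x u (r • v) w = r • chartCurv Γ x u v w := by
  unfold chartCurv
  generalize fderiv ℝ Γ x = A
  generalize Γ x = B
  simp only [ContinuousLinearMap.map_smul, smul_apply, smul_add, smul_sub]

theorem chartCurv_add₃ (Γ : E → E →L[ℝ] E →L[ℝ] E) (x u v w z : E) :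
    chartCurv Γ x u v (w + z) =
      chartCurv Γ x u v w + chartCurv Γ x u v z := by
  unfold chartCurv
  generalize fderiv ℝ Γ x = A
  generalize Γ x = B
  simp only [ContinuousLinearMap.map_add]
  abel

theorem chartCurv_smul₃ (Γ : E → E →L[ℝ] E →L[ℝ] E) (x u v w : E) (r : ℝ) :
    chartCurv Γ x u v (r • w) = r • chartCurv Γ x u v w := by
  unfold chartCurv
  generalize fderiv ℝ Γ x = A
  generalize Γ x = B
  simp only [ContinuousLinearMap.map_smul, smul_add, smul_sub]

/-- The local data of a metric, its Levi-Civita connection and a parallel quaternionic bundle near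
a point of a vector space; `∇Jₐ = ∑ c_ab ⊗ J_b`. -/
structure IsQKChart (Γ : E → E →L[ℝ] E →L[ℝ] E) (g : E → E →L[ℝ] E →L[ℝ] ℝ)
    (J : Fin 3 → E → E →L[ℝ] E) (c : Fin 3 → Fin 3 → E → E →L[ℝ] ℝ) (x : E) : Prop where
  smooth_Γ : ContDiffAt ℝ ∞ Γ x
  smooth_g : ContDiffAt ℝ ∞ g x
  smooth_J : ∀ a, ContDiffAt ℝ ∞ (J a) x
  smooth_c : ∀ a b, ContDiffAt ℝ ∞ (c a b) x
  c_skew : ∀ a b y v, c a b y v = -c b a y v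
  symm : ∀ᶠ y in 𝓝 x, ∀ v w, Γ y v w = Γ y w v
  metric : ∀ᶠ y in 𝓝 x, ∀ u v w, fderiv ℝ g y u v w = g y (Γ y u v) w + g y v (Γ y u w)
  conn : ∀ᶠ y in 𝓝 x, ∀ a v w, fderiv ℝ (J a) y v w =
    J a y (Γ y v w) - Γ y v (J a y w) + ∑ b, c a b y v • J b y w
  quat : ∀ᶠ y in 𝓝 x, QuaternionRelations fun a ↦ J a y
  orth : ∀ᶠ y in 𝓝 x, ∀ a v w, g y (J a y v) (J a y w) = g y v w
  g_symm : ∀ v w, g x v w = g x w v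
  g_pos : ∀ v, g x v v = 0 → v = 0

/-- The curvature forms of the connection matrix `c`. -/
def curvForm (c : Fin 3 → Fin 3 → E → E →L[ℝ] ℝ) (x : E) (i j : Fin 3) (u v : E) : ℝ :=
  fderiv ℝ (c i j) x u v - fderiv ℝ (c i j) x v u +
    ∑ k, (c i k x v * c k j x u - c i k x u * c k j x v)

theorem curvForm_apply (c : Fin 3 → Fin 3 → E → E →L[ℝ] ℝ) (x : E) (i j : Fin 3) (u v : E) :
    curvForm c x i j u v = fderiv ℝ (c i j) x u v - fderiv ℝ (c i j) x v u +
      ∑ k, (c i k x v * c k j x u - c i k x u * c k j x v) := rfl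

namespace IsQKChart

variable {Γ : E → E →L[ℝ] E →L[ℝ] E} {g : E → E →L[ℝ] E →L[ℝ] ℝ}
  {J : Fin 3 → E → E →L[ℝ] E} {c : Fin 3 → Fin 3 → E → E →L[ℝ] ℝ} {x : E}

theorem curvForm_swap (c : Fin 3 → Fin 3 → E → E →L[ℝ] ℝ) (x : E) (i j : Fin 3) (u v : E) :
    curvForm c x i j u v = -curvForm c x i j v u := by
  rw [curvForm_apply, curvForm_apply, neg_add, neg_sub, ← Finset.sum_neg_distrib]
  simp only [neg_sub]

theorem curvForm_skew (h : IsQKChart Γ g J c x) (i j : Fin 3) (u v : E) :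
    curvForm c x i j u v = -curvForm c x j i u v := by
  have e : c i j = fun y ↦ -c j i y := by
    funext y
    ext v
    exact h.c_skew i j y v
  rw [curvForm_apply, curvForm_apply, e, fderiv_fun_neg, neg_add, ← Finset.sum_neg_distrib]
  congr 1
  · simp only [neg_apply]; ring
  · refine Finset.sum_congr rfl fun k _ ↦ ?_
    rw [h.c_skew i k x, h.c_skew k j x, h.c_skew i k x, h.c_skew k j x]
    ring

theorem comm (h : IsQKChart Γ g J c x) (a : Fin 3) (u v w : E) :
    chartCurv Γ x u v (J a x w) - J a x (chartCurv Γ x u v w) =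
      ∑ b, curvForm c x a b u v • J b x w := by
  rw [chartCurv_comm h.smooth_Γ h.smooth_J h.smooth_c h.conn, Finset.sum_comm, ← Finset.sum_add_distrib]
  refine Finset.sum_congr rfl fun b _ ↦ ?_
  rw [← Finset.sum_smul, ← add_smul, curvForm_apply]

theorem skewJ (h : IsQKChart Γ g J c x) (a : Fin 3) (v w : E) :
    g x (J a x v) w = -g x v (J a x w) := by
  have h1 := h.orth.self_of_nhds a v (J a x w)
  rw [h.quat.self_of_nhds.sq, map_neg] at h1
  linarith

section Curvature

variable {V : Type*} [NormedAddCommGroup V] [InnerProductSpace ℝ V] (e : V ≃ₗ[ℝ] E)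

theorem isQuatTriple (h : IsQKChart Γ g J c x) (he : ∀ v w, g x (e v) (e w) = ⟪v, w⟫_ℝ) :
    IsQuatTriple (e.symm.conj (J 0 x : E →ₗ[ℝ] E)) (e.symm.conj (J 1 x : E →ₗ[ℝ] E))
      (e.symm.conj (J 2 x : E →ₗ[ℝ] E)) := by
  have q := h.quat.self_of_nhds
  have s : ∀ a v w, ⟪e.symm (J a x (e v)), w⟫_ℝ = -⟪v, e.symm (J a x (e w))⟫_ℝ := by
    intro a v w
    rw [← he, ← he, e.apply_symm_apply, e.apply_symm_apply, h.skewJ]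
  constructor <;> intros <;> simp only [LinearEquiv.conj_apply_apply, LinearEquiv.symm_symm,
    LinearEquiv.apply_symm_apply, ContinuousLinearMap.coe_coe, q.sq, q.mul01, q.mul12, q.mul20,
    q.mul10, q.mul21, q.mul02, map_neg, LinearEquiv.symm_apply_apply, s]

variable (Γ x) in
/-- The curvature tensor, transported to `V`. -/
def curvTensor : V →ₗ[ℝ] V →ₗ[ℝ] V →ₗ[ℝ] V :=
  LinearMap.mk₂ ℝ (fun u v ↦
    { toFun := fun w ↦ e.symm (chartCurv Γ x (e u) (e v) (e w))
      map_add' := fun _ _ ↦ by rw [e.map_add, chartCurv_add₃, e.symm.map_add]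
      map_smul' := fun _ _ ↦ by
        rw [e.map_smul, chartCurv_smul₃, e.symm.map_smul, RingHom.id_apply] })
    (fun u u' v ↦ LinearMap.ext fun w ↦ by
      change e.symm (chartCurv Γ x (e (u + u')) (e v) (e w)) = e.symm _ + e.symm _
      rw [e.map_add, chartCurv_add₁, e.symm.map_add])
    (fun r u v ↦ LinearMap.ext fun w ↦ by
      change e.symm (chartCurv Γ x (e (r • u)) (e v) (e w)) = r • e.symm _
      rw [e.map_smul, chartCurv_smul₁, e.symm.map_smul])
    (fun u v v' ↦ LinearMap.ext fun w ↦ by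
      change e.symm (chartCurv Γ x (e u) (e (v + v')) (e w)) = e.symm _ + e.symm _
      rw [e.map_add, chartCurv_add₂, e.symm.map_add])
    (fun r u v ↦ LinearMap.ext fun w ↦ by
      change e.symm (chartCurv Γ x (e u) (e (r • v)) (e w)) = r • e.symm _
      rw [e.map_smul, chartCurv_smul₂, e.symm.map_smul])

theorem curvTensor_apply (u v w : V) :
    curvTensor Γ x e u v w = e.symm (chartCurv Γ x (e u) (e v) (e w)) := rfl

variable (c x) in
/-- The curvature forms, transported to `V`. -/
def curvForm' (i j : Fin 3) : V →ₗ[ℝ] V →ₗ[ℝ] ℝ :=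
  LinearMap.mk₂ ℝ (fun u v ↦ curvForm c x i j (e u) (e v))
    (fun _ _ _ ↦ by
      simp only [curvForm, map_add, add_apply, Fin.sum_univ_three]
      ring)
    (fun _ _ _ ↦ by
      simp only [curvForm, map_smul, smul_apply, smul_eq_mul, Fin.sum_univ_three]
      ring)
    (fun _ _ _ ↦ by
      simp only [curvForm, map_add, add_apply, Fin.sum_univ_three]
      ring)
    (fun _ _ _ ↦ by
      simp only [curvForm, map_smul, smul_apply, smul_eq_mul, Fin.sum_univ_three]
      ring)

theorem curvForm'_apply (i j : Fin 3) (u v : V) :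
    curvForm' c x e i j u v = curvForm c x i j (e u) (e v) := rfl

/-- The bridge from coordinates to pure algebra. The metric at `x` is only a bilinear form on `E`,
so everything is transported by `e` to a space `V` where it is the inner product. The form γₐ is the
curvature entry with the two other indices, in cyclic order. -/
theorem isQuatCurvature (h : IsQKChart Γ g J c x) (he : ∀ v w, g x (e v) (e w) = ⟪v, w⟫_ℝ) :
    IsQuatCurvature (curvTensor Γ x e) (e.symm.conj (J 0 x : E →ₗ[ℝ] E))
      (e.symm.conj (J 1 x : E →ₗ[ℝ] E)) (e.symm.conj (J 2 x : E →ₗ[ℝ] E))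
      (curvForm' c x e 1 2) (curvForm' c x e 2 0) (curvForm' c x e 0 1) := by
  have d : ∀ i u v, curvForm c x i i u v = 0 := fun i u v ↦ by
    have := h.curvForm_skew i i u v
    linarith
  have hc : ∀ (a : Fin 3) (u v w : V),
      e.symm (chartCurv Γ x (e u) (e v) (J a x (e w))) -
        e.symm (J a x (chartCurv Γ x (e u) (e v) (e w))) =
      e.symm (curvForm c x a 0 (e u) (e v) • J 0 x (e w) +
        curvForm c x a 1 (e u) (e v) • J 1 x (e w) +
        curvForm c x a 2 (e u) (e v) • J 2 x (e w)) := by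
    intro a u v w
    rw [← map_sub, h.comm, Fin.sum_univ_three]
  refine ⟨h.isQuatTriple e he, ?_, ?_, ?_, ?_, ?_, ?_, ?_, ?_, ?_⟩
  · intro u v w
    rw [curvTensor_apply, chartCurv_antisymm, map_neg]
    rfl
  · intro u v w z
    rw [curvTensor_apply, curvTensor_apply, ← he, ← he, e.apply_symm_apply, e.apply_symm_apply,
      chartCurv_skew h.smooth_Γ h.smooth_g h.metric]
  · intro u v w
    rw [curvTensor_apply, curvTensor_apply, curvTensor_apply, ← map_add, ← map_add,
      chartCurv_bianchi h.smooth_Γ h.symm, map_zero]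
  · intro u v
    exact curvForm_swap c x 1 2 _ _
  · intro u v
    exact curvForm_swap c x 2 0 _ _
  · intro u v
    exact curvForm_swap c x 0 1 _ _
  all_goals
    intro u v w
    simp only [curvTensor_apply, LinearEquiv.conj_apply_apply, LinearEquiv.symm_symm,
      LinearEquiv.apply_symm_apply, ContinuousLinearMap.coe_coe, hc, d, zero_smul, zero_add,
      add_zero, curvForm'_apply]
  · rw [h.curvForm_skew 2 0, map_add, map_smul, map_smul, neg_smul, sub_neg_eq_add]
  · rw [h.curvForm_skew 0 1, map_add, map_smul, map_smul, neg_smul, sub_neg_eq_add, add_comm]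
  · rw [h.curvForm_skew 1 2, map_add, map_smul, map_smul, neg_smul, sub_neg_eq_add]

variable {ι : Type*} [Fintype ι] (b : OrthonormalBasis ι ℝ V) {n : ℕ}

theorem curvForm_eq_of_two_le (h : IsQKChart Γ g J c x) (he : ∀ v w, g x (e v) (e w) = ⟪v, w⟫_ℝ)
    (hn : Fintype.card ι = 4 * n) (h2 : 2 ≤ n)
    (hscal : ∑ j, ∑ i, g x (chartCurv Γ x (e (b i)) (e (b j)) (e (b j))) (e (b i)) =
      -16 * (n : ℝ) * ((n : ℝ) + 2)) (a : Fin 3) (u v : E) :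
    curvForm c x (a + 1) (a + 2) u v = 4 * g x (J a x u) v := by
  have H := h.isQuatCurvature e he
  have hs : ∑ j, ∑ i, ⟪curvTensor Γ x e (b i) (b j) (b j), b i⟫_ℝ =
      -16 * (n : ℝ) * ((n : ℝ) + 2) := by
    rw [← hscal]
    simp only [curvTensor_apply, ← he, e.apply_symm_apply]
  have k1 := H.gamma_eq_of_two_le (b := b) hn h2 hs (e.symm u) (e.symm v)
  have k2 := H.cycle.gamma_eq_of_two_le (b := b) hn h2 hs (e.symm u) (e.symm v)
  have k3 := H.cycle.cycle.gamma_eq_of_two_le (b := b) hn h2 hs (e.symm u) (e.symm v)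
  simp only [curvForm'_apply, ← he, LinearEquiv.conj_apply_apply, LinearEquiv.symm_symm,
    LinearEquiv.apply_symm_apply, ContinuousLinearMap.coe_coe] at k1 k2 k3
  fin_cases a
  exacts [k1, k2, k3]

theorem curvForm_eq_of_weyl (h : IsQKChart Γ g J c x) (he : ∀ v w, g x (e v) (e w) = ⟪v, w⟫_ℝ)
    (hn : Fintype.card ι = 4 * n) (h1 : n = 1)
    (hw : ∀ a u v, ∑ i, g x (chartCurv Γ x (e (b i)) (J a x (e (b i))) u) v = 8 * g x (J a x u) v)
    (a : Fin 3) (u v : E) :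
    curvForm c x (a + 1) (a + 2) u v = 4 * g x (J a x u) v := by
  rw [h1, mul_one] at hn
  have H := h.isQuatCurvature e he
  have hs : ∀ a, ∑ i, ⟪curvTensor Γ x e (b i) (e.symm.conj (J a x : E →ₗ[ℝ] E) (b i)) (e.symm u),
      e.symm v⟫_ℝ = 8 * ⟪e.symm.conj (J a x : E →ₗ[ℝ] E) (e.symm u), e.symm v⟫_ℝ := by
    intro a
    have := hw a u v
    simp only [curvTensor_apply, ← he, LinearEquiv.conj_apply_apply, LinearEquiv.symm_symm,
      LinearEquiv.apply_symm_apply, ContinuousLinearMap.coe_coe]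
    exact this
  have k1 := H.gamma_eq_of_weyl (b := b) hn (e.symm u) (e.symm v) (hs 0)
  have k2 := H.cycle.gamma_eq_of_weyl (b := b) hn (e.symm u) (e.symm v) (hs 1)
  have k3 := H.cycle.cycle.gamma_eq_of_weyl (b := b) hn (e.symm u) (e.symm v) (hs 2)
  simp only [LinearEquiv.conj_apply_apply, LinearEquiv.symm_symm,
    LinearEquiv.apply_symm_apply, ContinuousLinearMap.coe_coe, curvForm'_apply, ← he] at k1 k2 k3
  fin_cases a
  exacts [k1, k2, k3]

end Curvature

section Killing

variable {Z : E → E}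

/-- Since J₀ = J₁J₂, the Leibniz rule for [T, ·] gives f J₂² - f J₁² = 0. -/
theorem comm_zero (hq : QuaternionRelations fun a ↦ J a x) {T : E →L[ℝ] E} {f : ℝ}
    (h1 : ∀ v, T (J 1 x v) - J 1 x (T v) = f • J 2 x v)
    (h2 : ∀ v, T (J 2 x v) - J 2 x (T v) = -f • J 1 x v) (v : E) :
    T (J 0 x v) - J 0 x (T v) = 0 := by
  have e1 := h1 (J 2 x v)
  have e2 := congrArg (J 1 x) (h2 v)
  rw [hq.mul12, hq.sq] at e1
  rw [map_sub, hq.mul12, map_smul, hq.sq] at e2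
  have : T (J 0 x v) - J 0 x (T v) =
      (T (J 0 x v) - J 1 x (T (J 2 x v))) + (J 1 x (T (J 2 x v)) - J 0 x (T v)) := by abel
  rw [this, e1, e2]
  module

/-- The source of the moment equations. With T = ∇Z and f = c₁₂(Z), the relations [T, J₁] = f J₂ and
[T, J₂] = -f J₁ are differentiated along u. Kostant's formula replaces ∇_u T by R(u, Z), whose
commutators with the Jₐ are given by the curvature forms 4g(Jₐ·,·). Comparing coefficients of J₀ and
J₂ in the first relation, and of J₀ in the second, gives the three formulas. -/
theorem killing (h : IsQKChart Γ g J c x) (hZ : ContDiffAt ℝ ∞ Z x) [Nontrivial E]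
    (hcurv : ∀ (a : Fin 3) (u v : E), curvForm c x (a + 1) (a + 2) u v = 4 * g x (J a x u) v)
    (hskew : ∀ᶠ y in 𝓝 x, ∀ v w,
      g y (nablaField Γ Z y v) w + g y v (nablaField Γ Z y w) = 0)
    (h1 : ∀ᶠ y in 𝓝 x, ∀ v, nablaField Γ Z y (J 1 y v) - J 1 y (nablaField Γ Z y v) =
      c 1 2 y (Z y) • J 2 y v)
    (h2 : ∀ᶠ y in 𝓝 x, ∀ v, nablaField Γ Z y (J 2 y v) - J 2 y (nablaField Γ Z y v) =
      -c 1 2 y (Z y) • J 1 y v) (u : E) :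
    fderiv ℝ (fun y ↦ c 1 2 y (Z y)) x u = 4 * g x (J 0 x u) (Z x) ∧
      c 1 2 x (Z x) * c 0 2 x u = 4 * g x (J 2 x u) (Z x) ∧
      c 1 2 x (Z x) * c 1 0 x u = -(4 * g x (J 1 x u) (Z x)) := by
  obtain ⟨v, hv⟩ := exists_ne (0 : E)
  have q := h.quat.self_of_nhds
  have hT : DifferentiableAt ℝ (nablaField Γ Z) x :=
    (contDiffAt_nablaField h.smooth_Γ hZ).differentiableAt (by simp)
  have hf : DifferentiableAt ℝ (fun y ↦ c 1 2 y (Z y)) x :=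
    ((h.smooth_c 1 2).clm_apply hZ).differentiableAt (by simp)
  have hJ := fun a ↦ (h.smooth_J a).differentiableAt (by simp)
  have hS := nablaEndo_killing h.smooth_Γ h.smooth_g hZ h.symm h.metric hskew h.g_symm h.g_pos
  have d : ∀ i u, c i i x u = 0 := fun i u ↦ by
    have := h.c_skew i i x u
    linarith
  have dK : ∀ i u v, curvForm c x i i u v = 0 := fun i u v ↦ by
    have := h.curvForm_skew i i u v
    linarith
  have T0 := comm_zero q h1.self_of_nhds h2.self_of_nhds v
  have T1 := h1.self_of_nhds v
  have T2 := h2.self_of_nhds v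
  have k1 := nablaEndo_comm hT hJ hf (c := fun a b ↦ c a b x) h.conn.self_of_nhds 1 2 h1 u v
  have k2 := nablaEndo_comm hT hJ hf.fun_neg (c := fun a b ↦ c a b x) h.conn.self_of_nhds 2 1 h2 u v
  rw [hS, hS, h.comm] at k1 k2
  have K0 : curvForm c x 1 2 u (Z x) = 4 * g x (J 0 x u) (Z x) := hcurv 0 u (Z x)
  have K1 : curvForm c x 2 0 u (Z x) = 4 * g x (J 1 x u) (Z x) := hcurv 1 u (Z x)
  have K2 : curvForm c x 0 1 u (Z x) = 4 * g x (J 2 x u) (Z x) := hcurv 2 u (Z x)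
  simp only [Fin.sum_univ_three, T0, T1, T2, d, dK, fderiv_fun_neg, neg_apply] at k1 k2
  rw [h.curvForm_skew 1 0, K0, K2, h.c_skew 2 1 x u, h.c_skew 2 0 x u] at k1
  rw [h.curvForm_skew 2 1, K0, K1, h.c_skew 2 1 x u, h.c_skew 2 0 x u] at k2
  -- The J₁ terms on the two sides cancel because c₂₁ = -c₁₂, hence the coefficient 0.
  obtain ⟨a1, -, a3⟩ := q.coeff_eq_zero (v := v) hv
    (a := -(4 * g x (J 2 x u) (Z x)) + c 1 2 x (Z x) * c 0 2 x u) (b := 0)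
    (c := 4 * g x (J 0 x u) (Z x) - fderiv ℝ (fun y ↦ c 1 2 y (Z y)) x u) (by
      rw [← sub_eq_zero] at k1
      rw [← k1]
      module)
  obtain ⟨b1, -, -⟩ := q.coeff_eq_zero (v := v) hv
    (a := 4 * g x (J 1 x u) (Z x) + c 1 2 x (Z x) * c 1 0 x u)
    (b := -(4 * g x (J 0 x u) (Z x)) + fderiv ℝ (fun y ↦ c 1 2 y (Z y)) x u) (c := 0) (by
      rw [← sub_eq_zero] at k2
      rw [← k2]
      module)
  exact ⟨by linarith, by linarith, by linarith⟩

end Killing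

end IsQKChart

end QKChart

/-! ### A contraction with a skew endomorphism -/

section Weyl

variable {V : Type*} [NormedAddCommGroup V] [InnerProductSpace ℝ V] {ι : Type*} [Fintype ι]
  (b : OrthonormalBasis ι ℝ V)

theorem sum_inner_skew {A : V → V} (hA : ∀ v w, ⟪A v, w⟫_ℝ = -⟪v, A w⟫_ℝ) (w z : V) :
    ∑ i, (⟪A (b i), w⟫_ℝ * ⟪b i, z⟫_ℝ - ⟪b i, w⟫_ℝ * ⟪A (b i), z⟫_ℝ) = -2 * ⟪A w, z⟫_ℝ := by
  have h1 := b.sum_inner_mul_inner (A w) z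
  have h2 := b.sum_inner_mul_inner w (A z)
  rw [Finset.sum_sub_distrib]
  have e1 : ∑ i, ⟪A (b i), w⟫_ℝ * ⟪b i, z⟫_ℝ = -⟪A w, z⟫_ℝ := by
    rw [← h1, ← Finset.sum_neg_distrib]
    refine Finset.sum_congr rfl fun i _ ↦ ?_
    rw [hA, real_inner_comm]
    ring
  have e2 : ∑ i, ⟪b i, w⟫_ℝ * ⟪A (b i), z⟫_ℝ = ⟪A w, z⟫_ℝ := by
    rw [hA w z, ← h2, ← Finset.sum_neg_distrib]
    refine Finset.sum_congr rfl fun i _ ↦ ?_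
    rw [hA, real_inner_comm w]
    ring
  rw [e1, e2]
  ring

end Weyl

/-! ### An adapted gauge in a chart and its curvature forms -/

section Adapted

variable {n : ℕ}
  {N : Type*} [TopologicalSpace N]
  [ChartedSpace (EuclideanSpace ℝ (Fin (4 * n))) N] [IsManifold (𝓡 (4 * n)) ∞ N]

theorem endoChart_comp_apply (J K : EndoField (4 * n) N) (p : N)
    {y : EuclideanSpace ℝ (Fin (4 * n))} (hy : y ∈ (extChartAt (𝓡 (4 * n)) p).target)
    (v : EuclideanSpace ℝ (Fin (4 * n))) :
    endoChart J p y (endoChart K p y v) =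
      chartD p _ (J ((extChartAt (𝓡 (4 * n)) p).symm y)
        (K ((extChartAt (𝓡 (4 * n)) p).symm y) (chartInv p y v))) := by
  rw [endoChart_apply, endoChart_apply, chartInv_chartD p hy]

theorem quaternionRelations_endoChart {J : Fin 3 → EndoField (4 * n) N} (p : N)
    {y : EuclideanSpace ℝ (Fin (4 * n))} (hy : y ∈ (extChartAt (𝓡 (4 * n)) p).target)
    (h : QuaternionRelations fun a ↦ J a ((extChartAt (𝓡 (4 * n)) p).symm y)) :
    QuaternionRelations fun a ↦ endoChart (J a) p y where
  sq a v := by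
    have e := congrArg (chartD p ((extChartAt (𝓡 (4 * n)) p).symm y)) (h.sq a (chartInv p y v))
    rw [map_neg, chartD_chartInv p hy] at e
    exact (endoChart_comp_apply _ _ p hy v).trans e
  mul a v := (endoChart_comp_apply _ _ p hy v).trans
    (congrArg (chartD p ((extChartAt (𝓡 (4 * n)) p).symm y)) (h.mul a (chartInv p y v)))
  anti a v := by
    have e := congrArg (chartD p ((extChartAt (𝓡 (4 * n)) p).symm y)) (h.anti a (chartInv p y v))
    rw [map_neg] at e
    exact (endoChart_comp_apply _ _ p hy v).trans e

variable [T2Space N] [RiemannianBundle (fun p : N ↦ TangentSpace (𝓡 (4 * n)) p)]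
  [IsContMDiffRiemannianBundle (𝓡 (4 * n)) ∞ (EuclideanSpace ℝ (Fin (4 * n)))
      (fun p : N ↦ TangentSpace (𝓡 (4 * n)) p)]
  {D : AffineConnection (4 * n) N}
  {G : Π p : N, Submodule ℝ
    (TangentSpace (𝓡 (4 * n)) p →L[ℝ] TangentSpace (𝓡 (4 * n)) p)}
  {Z : VectField (4 * n) N}
  {P : Type*} [TopologicalSpace P] [ChartedSpace (EuclideanSpace ℝ (Fin (4 * n + 1))) P]
  [MulAction Circle P] {pr : P → N} {𝔤 : Gauge n N P}

omit [T2Space N] [IsContMDiffRiemannianBundle (𝓡 (4 * n)) ∞ (EuclideanSpace ℝ (Fin (4 * n)))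
      (fun p : N ↦ TangentSpace (𝓡 (4 * n)) p)] in
theorem metricChart_endoChart (J : EndoField (4 * n) N) (p : N)
    (v w : TangentSpace (𝓡 (4 * n)) p) :
    metricChart p (extChartAt (𝓡 (4 * n)) p p) (endoChart J p (extChartAt (𝓡 (4 * n)) p p) v) w =
      ⟪J p v, w⟫_ℝ :=
  (congrArg (fun z ↦ metricChart p (extChartAt (𝓡 (4 * n)) p p) z w) (endoChart_self J p v)).trans
    (metricChart_self p (J p v) w)

omit [T2Space N] [IsContMDiffRiemannianBundle (𝓡 (4 * n)) ∞ (EuclideanSpace ℝ (Fin (4 * n)))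
      (fun p : N ↦ TangentSpace (𝓡 (4 * n)) p)] in
theorem metricChart_chartCurv (p : N)
    (hΓ : ContDiffAt ℝ ∞ (christoffel D p) (extChartAt (𝓡 (4 * n)) p p))
    (u v w z : EuclideanSpace ℝ (Fin (4 * n))) :
    metricChart p (extChartAt (𝓡 (4 * n)) p p)
      (chartCurv (christoffel D p) (extChartAt (𝓡 (4 * n)) p p) u v w) z =
      ⟪curv D p u v w, (show TangentSpace (𝓡 (4 * n)) p from z)⟫_ℝ :=
  (congrArg (fun y ↦ metricChart p (extChartAt (𝓡 (4 * n)) p p) y z)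
    (curv_eq_chartCurv D p hΓ u v w).symm).trans (metricChart_self p (curv D p u v w) z)

namespace Gauge.IsAdapted

/-- The connection matrix of an adapted gauge in the chart around `p`. -/
def connChart (𝔤 : Gauge n N P) (p : N) (a b : Fin 3) :
    EuclideanSpace ℝ (Fin (4 * n)) → EuclideanSpace ℝ (Fin (4 * n)) →L[ℝ] ℝ :=
  covChart (connMat 𝔤.β 𝔤.α₂ 𝔤.α₃ a b) p

theorem eventually_mem (h : 𝔤.IsAdapted pr D G Z) {p : N} (hp : p ∈ 𝔤.U) :
    ∀ᶠ y in 𝓝 (extChartAt (𝓡 (4 * n)) p p), y ∈ (extChartAt (𝓡 (4 * n)) p).target ∧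
      (extChartAt (𝓡 (4 * n)) p).symm y ∈ 𝔤.U :=
  (show ∀ᶠ y in 𝓝 (extChartAt (𝓡 (4 * n)) p p), y ∈ (extChartAt (𝓡 (4 * n)) p).target from
    extChartAt_target_mem_nhds p).and
    ((eventually_chart_iff p (mem_extChartAt_source p)).2 (h.isOpen.mem_nhds hp))

theorem contDiffAt_J (h : 𝔤.IsAdapted pr D G Z) {p : N} (hp : p ∈ 𝔤.U) (a : Fin 3) :
    ContDiffAt ℝ ∞ (endoChart (𝔤.J a) p) (extChartAt (𝓡 (4 * n)) p p) :=
  contMDiffAt_endo_iff.1 ((h.frame.smooth a).contMDiffAt (h.isOpen.mem_nhds hp))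

theorem contDiffAt_conn (h : 𝔤.IsAdapted pr D G Z) {p : N} (hp : p ∈ 𝔤.U) (a b : Fin 3) :
    ContDiffAt ℝ ∞ (connChart 𝔤 p a b) (extChartAt (𝓡 (4 * n)) p p) :=
  contDiffAt_connMat (h.smooth_β.smoothFormAt h.isOpen hp) (h.smooth_α₂.smoothFormAt h.isOpen hp)
    (h.smooth_α₃.smoothFormAt h.isOpen hp) a b

theorem isQKChart (h : 𝔤.IsAdapted pr D G Z) (hQK : IsNegativeQK D G) {p : N} (hp : p ∈ 𝔤.U) :
    IsQKChart (christoffel D p) (metricChart p) (fun a ↦ endoChart (𝔤.J a) p) (connChart 𝔤 p)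
      (extChartAt (𝓡 (4 * n)) p p) where
  smooth_Γ := contDiffAt_christoffel D hQK.leviCivita.smooth p
  smooth_g := contDiffAt_metricChart p (mem_extChartAt_target p)
  smooth_J := h.contDiffAt_J hp
  smooth_c := h.contDiffAt_conn hp
  c_skew a b y v := by
    fin_cases a <;> fin_cases b
    exacts [neg_zero.symm, rfl, (neg_neg _).symm, (neg_neg _).symm, neg_zero.symm,
      (neg_neg _).symm, rfl, rfl, neg_zero.symm]
  symm := by
    filter_upwards [h.eventually_mem hp] with y hy v w
    exact christoffel_symm hQK.leviCivita p hy.1 v w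
  metric := by
    filter_upwards [h.eventually_mem hp] with y hy u v w
    exact fderiv_metricChart hQK.leviCivita p hy.1 u v w
  conn := by
    have hd : ∀ a, ∀ᶠ y in 𝓝 (extChartAt (𝓡 (4 * n)) p p),
        DifferentiableAt ℝ (endoChart (𝔤.J a) p) y := fun a ↦
      (((h.contDiffAt_J hp a).of_le (m := 1) (by norm_cast)).eventually (by simp)).mono
        fun y hy ↦ hy.differentiableAt (by simp)
    filter_upwards [h.eventually_mem hp, eventually_all.2 hd] with y hy hy2 a v w
    exact h.connection.chart p hy.1 hy.2 a (hy2 a) v w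
  quat := by
    filter_upwards [h.eventually_mem hp] with y hy
    exact quaternionRelations_endoChart p hy.1 (h.frame.relations _ hy.2)
  orth := by
    filter_upwards [h.eventually_mem hp] with y hy a v w
    rw [metricChart_apply, metricChart_apply, endoChart_apply, endoChart_apply,
      chartInv_chartD p hy.1, chartInv_chartD p hy.1, h.frame.orthogonal _ hy.2]
  g_symm := metricChart_symm p _
  g_pos := metricChart_eq_zero p (mem_extChartAt_target p)

omit [IsManifold (𝓡 (4 * n)) ∞ N] [T2Space N] [RiemannianBundle (fun p : N ↦ TangentSpace (𝓡 (4 * n)) p)]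
  [IsContMDiffRiemannianBundle (𝓡 (4 * n)) ∞ (EuclideanSpace ℝ (Fin (4 * n)))
      (fun p : N ↦ TangentSpace (𝓡 (4 * n)) p)] in
theorem finrank_tangentSpace (p : N) :
    Module.finrank ℝ (TangentSpace (𝓡 (4 * n)) p) = 4 * n := by
  change Module.finrank ℝ (EuclideanSpace ℝ (Fin (4 * n))) = 4 * n
  simp

end Gauge.IsAdapted

/-- The linear equivalence of a Euclidean space given by a map and its inverse. -/
def euclideanEquiv (V : Type*) [NormedAddCommGroup V] [InnerProductSpace ℝ V] {E : Type*}
    [NormedAddCommGroup E] [NormedSpace ℝ E] (f : V → E) (g : E → V)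
    (hadd : ∀ v w, f (v + w) = f v + f w) (hsmul : ∀ (r : ℝ) v, f (r • v) = r • f v)
    (hl : ∀ v, g (f v) = v) (hr : ∀ v, f (g v) = v) : V ≃ₗ[ℝ] E where
  toFun := f
  map_add' := hadd
  map_smul' := hsmul
  invFun := g
  left_inv := hl
  right_inv := hr

/-- The identification of a tangent space with the model space. -/
def tangentId (p : N) := euclideanEquiv (TangentSpace (𝓡 (4 * n)) p)
  (E := EuclideanSpace ℝ (Fin (4 * n))) (fun v ↦ v) (fun v ↦ v) (fun _ _ ↦ rfl) (fun _ _ ↦ rfl)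
  (fun _ ↦ rfl) (fun _ ↦ rfl)

namespace Gauge.IsAdapted

/-- In dimension four scal = -48, so the Einstein constant is -12, and the Weyl tensor is R plus 4
times the constant-curvature expression. Contracted with Jₐ the Weyl tensor vanishes, and the
remaining contraction of the metric terms is -2⟨Jₐw, z⟩ by `sum_inner_skew`; thus the constant is 8.
-/
theorem sum_curv_J
    (h : 𝔤.IsAdapted pr D G Z) (hQK : IsNegativeQK D G) (hn : n = 1) {p : N} (hp : p ∈ 𝔤.U) (a : Fin 3)
    (w z : TangentSpace (𝓡 (4 * n)) p) :
    ∑ i, ⟪curv D p (onb p i) (𝔤.J a p (onb p i)) w, z⟫_ℝ = 8 * ⟪𝔤.J a p w, z⟫_ℝ := by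
  obtain ⟨⟨c, hc⟩, hw⟩ := hQK.dim_four hn
  have hsc := hQK.scal_eq p
  have hcs : scal D p = 4 * c := by
    have : ∀ i, ricci D p (onb p i) (onb p i) = c := fun i ↦ by
      rw [hc, (onb p).inner_eq_one, mul_one]
    rw [scal, Finset.sum_congr rfl fun i _ ↦ this i, Finset.sum_const, Finset.card_univ,
      Fintype.card_fin, finrank_tangentSpace, nsmul_eq_mul, hn]
    push_cast
    ring
  have hc12 : c = -12 := by
    rw [hcs, hn] at hsc
    push_cast at hsc
    linarith
  have hskew : ∀ (a : Fin 3) (v w : TangentSpace (𝓡 (4 * n)) p),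
      ⟪𝔤.J a p v, w⟫_ℝ = -⟪v, 𝔤.J a p w⟫_ℝ := by
    intro a v w
    have h1 := h.frame.orthogonal p hp a v (𝔤.J a p w)
    rw [(h.frame.relations p hp).sq, inner_neg_right] at h1
    linarith
  have h1 := hw p _ (h.frame_mem a p hp) w z
  have h2 : ∀ i, weyl₄ D p (onb p i) (𝔤.J a p (onb p i)) w z =
      ⟪curv D p (onb p i) (𝔤.J a p (onb p i)) w, z⟫_ℝ +
      4 * (⟪𝔤.J a p (onb p i), w⟫_ℝ * ⟪onb p i, z⟫_ℝ -
        ⟪onb p i, w⟫_ℝ * ⟪𝔤.J a p (onb p i), z⟫_ℝ) := by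
    intro i
    rw [weyl₄, hc, hc, hc, hc, hcs, hc12]
    ring
  rw [Finset.sum_congr rfl fun i _ ↦ h2 i, Finset.sum_add_distrib, ← Finset.mul_sum,
    sum_inner_skew (onb p) (hskew a)] at h1
  linarith

/-- The only place where the cases n = 1 and n ≥ 2 differ. The rest of the argument uses the
quaternion-Kähler condition only through this identity and the Levi-Civita connection. -/
theorem curvForm_eq (h : 𝔤.IsAdapted pr D G Z) (hQK : IsNegativeQK D G) (hn : 1 ≤ n) {p : N}
    (hp : p ∈ 𝔤.U) (a : Fin 3) (u v : EuclideanSpace ℝ (Fin (4 * n))) :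
    curvForm (connChart 𝔤 p) (extChartAt (𝓡 (4 * n)) p p) (a + 1) (a + 2) u v =
      4 * metricChart p (extChartAt (𝓡 (4 * n)) p p)
        (endoChart (𝔤.J a) p (extChartAt (𝓡 (4 * n)) p p) u) v := by
  have H := h.isQKChart hQK hp
  have hR := curv_eq_chartCurv D p H.smooth_Γ
  have he : ∀ v w : TangentSpace (𝓡 (4 * n)) p,
      metricChart p (extChartAt (𝓡 (4 * n)) p p) (tangentId p v) (tangentId p w) = ⟪v, w⟫_ℝ :=
    metricChart_self p
  rcases hn.eq_or_lt with h1 | h2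
  · have hterm : ∀ (a : Fin 3) (u v : EuclideanSpace ℝ (Fin (4 * n)))
        (i : Fin (Module.finrank ℝ (TangentSpace (𝓡 (4 * n)) p))),
        metricChart p (extChartAt (𝓡 (4 * n)) p p)
          (chartCurv (christoffel D p) (extChartAt (𝓡 (4 * n)) p p) (tangentId p (onb p i))
            (endoChart (𝔤.J a) p (extChartAt (𝓡 (4 * n)) p p) (tangentId p (onb p i))) u) v =
        ⟪curv D p (onb p i) (𝔤.J a p (onb p i)) (show TangentSpace (𝓡 (4 * n)) p from u),
          (show TangentSpace (𝓡 (4 * n)) p from v)⟫_ℝ := by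
      intro a u v i
      refine (metricChart_chartCurv p H.smooth_Γ _ _ _ _).trans ?_
      exact congrArg (fun w : TangentSpace (𝓡 (4 * n)) p ↦
        ⟪curv D p (onb p i) w u, (show TangentSpace (𝓡 (4 * n)) p from v)⟫_ℝ)
        (endoChart_self (𝔤.J a) p (onb p i))
    have hsum : ∀ (a : Fin 3) (u v : EuclideanSpace ℝ (Fin (4 * n))),
        ∑ i, metricChart p (extChartAt (𝓡 (4 * n)) p p)
          (chartCurv (christoffel D p) (extChartAt (𝓡 (4 * n)) p p) (tangentId p (onb p i))
            (endoChart (𝔤.J a) p (extChartAt (𝓡 (4 * n)) p p) (tangentId p (onb p i))) u) v =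
        8 * metricChart p (extChartAt (𝓡 (4 * n)) p p)
          (endoChart (𝔤.J a) p (extChartAt (𝓡 (4 * n)) p p) u) v := by
      intro a u v
      rw [Finset.sum_congr rfl fun i _ ↦ hterm a u v i]
      exact (h.sum_curv_J hQK h1.symm hp a u v).trans
        (congrArg (8 * ·) (metricChart_endoChart (𝔤.J a) p u v).symm)
    exact H.curvForm_eq_of_weyl (tangentId p) (onb p) he
      ((Fintype.card_fin _).trans (finrank_tangentSpace p)) h1.symm hsum a u v
  · refine H.curvForm_eq_of_two_le (tangentId p) (onb p) he
      ((Fintype.card_fin _).trans (finrank_tangentSpace p)) h2 ?_ a u v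
    rw [← hQK.scal_eq p]
    unfold scal ricci
    refine Finset.sum_congr rfl fun j _ ↦ Finset.sum_congr rfl fun i _ ↦ ?_
    rw [← metricChart_self p]
    exact congrArg (fun w ↦ metricChart p (extChartAt (𝓡 (4 * n)) p p) w (onb p i))
      (hR (onb p i) (onb p j) (onb p j)).symm

end Gauge.IsAdapted

end Adapted

/-! ### The trace lemma transported to a chart -/

section CommCoeff

variable {E : Type*} [NormedAddCommGroup E] [NormedSpace ℝ E]
  {Γ : E → E →L[ℝ] E →L[ℝ] E} {g : E → E →L[ℝ] E →L[ℝ] ℝ}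
  {J : Fin 3 → E → E →L[ℝ] E} {c : Fin 3 → Fin 3 → E → E →L[ℝ] ℝ} {x : E}
  {V : Type*} [NormedAddCommGroup V] [InnerProductSpace ℝ V] (e : V ≃ₗ[ℝ] E)
  {ι : Type*} [Fintype ι] [Nonempty ι] (b : OrthonormalBasis ι ℝ V)

theorem IsQKChart.comm_coeff (h : IsQKChart Γ g J c x)
    (he : ∀ v w, g x (e v) (e w) = ⟪v, w⟫_ℝ) {T : E →L[ℝ] E}
    (h₁ : ∑ i, g x (T (e (b i))) (J 1 x (e (b i))) = 0)
    (h₂ : ∑ i, g x (T (e (b i))) (J 2 x (e (b i))) = 0) {r s r' s' : ℝ}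
    (c₁ : ∀ v, T (J 1 x v) - J 1 x (T v) = r • J 0 x v + s • J 2 x v)
    (c₂ : ∀ v, T (J 2 x v) - J 2 x (T v) = r' • J 0 x v + s' • J 1 x v) : r = 0 ∧ r' = 0 := by
  refine IsQuatTriple.comm_coeff b (h.isQuatTriple e he) (T := e.symm.conj (T : E →ₗ[ℝ] E))
    (f := s) (f' := s') ?_ ?_ ?_ ?_
  · simpa only [← he, LinearEquiv.conj_apply_apply, LinearEquiv.symm_symm,
      LinearEquiv.apply_symm_apply, ContinuousLinearMap.coe_coe] using h₁
  · simpa only [← he, LinearEquiv.conj_apply_apply, LinearEquiv.symm_symm,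
      LinearEquiv.apply_symm_apply, ContinuousLinearMap.coe_coe] using h₂
  · intro v
    simp only [LinearEquiv.conj_apply_apply, LinearEquiv.symm_symm,
      LinearEquiv.apply_symm_apply, ContinuousLinearMap.coe_coe]
    rw [← map_sub, c₁, map_add, map_smul, map_smul]
  · intro v
    simp only [LinearEquiv.conj_apply_apply, LinearEquiv.symm_symm,
      LinearEquiv.apply_symm_apply, ContinuousLinearMap.coe_coe]
    rw [← map_sub, c₂, map_add, map_smul, map_smul]

end CommCoeff

/-! ### The Killing field: dZ♭ and vanishing of α₂(Z), α₃(Z) -/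

section Structure

variable {n : ℕ}
  {N : Type*} [TopologicalSpace N]
  [ChartedSpace (EuclideanSpace ℝ (Fin (4 * n))) N] [IsManifold (𝓡 (4 * n)) ∞ N]
  [T2Space N] [RiemannianBundle (fun p : N ↦ TangentSpace (𝓡 (4 * n)) p)]
  [IsContMDiffRiemannianBundle (𝓡 (4 * n)) ∞ (EuclideanSpace ℝ (Fin (4 * n)))
      (fun p : N ↦ TangentSpace (𝓡 (4 * n)) p)]
  {D : AffineConnection (4 * n) N}
  {G : Π p : N, Submodule ℝ
    (TangentSpace (𝓡 (4 * n)) p →L[ℝ] TangentSpace (𝓡 (4 * n)) p)}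
  {Z : VectField (4 * n) N}

theorem SmoothVectField.contDiffAt (hZ : SmoothVectField Z) (p : N) :
    ContDiffAt ℝ ∞ (fieldChart Z p) (extChartAt (𝓡 (4 * n)) p p) :=
  (contMDiffAt_field_iff (mem_extChartAt_source p)).1 hZ.contMDiffAt

theorem SmoothVectField.eventually_differentiableAt (hZ : SmoothVectField Z) (p : N) :
    ∀ᶠ y in 𝓝 (extChartAt (𝓡 (4 * n)) p p), DifferentiableAt ℝ (fieldChart Z p) y :=
  (((hZ.contDiffAt p).of_le (m := 1) (by norm_cast)).eventually (by simp)).mono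
    fun _ hy ↦ hy.differentiableAt (by simp)

/-- The endomorphism `∇Z` at `p`. -/
def nablaAt (D : AffineConnection (4 * n) N) (Z : VectField (4 * n) N) (p : N) :
    EuclideanSpace ℝ (Fin (4 * n)) →L[ℝ] EuclideanSpace ℝ (Fin (4 * n)) :=
  nablaField (christoffel D p) (fieldChart Z p) (extChartAt (𝓡 (4 * n)) p p)

theorem eventually_nablaField_skew (hD : IsLeviCivita D) (hZ : SmoothVectField Z)
    (hKilling : IsLieInvariantOn Z (fun _ v w ↦ ⟪v, w⟫_ℝ) univ) (p : N) :
    ∀ᶠ y in 𝓝 (extChartAt (𝓡 (4 * n)) p p), ∀ v w,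
      metricChart p y (nablaField (christoffel D p) (fieldChart Z p) y v) w +
        metricChart p y v (nablaField (christoffel D p) (fieldChart Z p) y w) = 0 := by
  filter_upwards [extChartAt_target_mem_nhds p, hZ.eventually_differentiableAt p] with y hy hd
  refine nablaField_skew (christoffel_symm hD p hy) (fderiv_metricChart hD p hy) ?_
  exact hKilling.chart p hy (mem_univ _) hd
    ((contDiffAt_metricChart p hy).differentiableAt (by simp)) fun z _ v w ↦ rfl

theorem covChart_flat (Z : VectField (4 * n) N) (p : N) :
    covChart (flat Z) p =ᶠ[𝓝 (extChartAt (𝓡 (4 * n)) p p)]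
      fun y ↦ metricChart p y (fieldChart Z p y) := by
  filter_upwards [extChartAt_target_mem_nhds p] with y hy
  ext w
  rw [metricChart_apply, chartInv_fieldChart Z p hy]
  rfl

/-- Without torsion dZ♭(v,w) = g(∇_v Z, w) - g(∇_w Z, v), and the two terms are equal because ∇Z is
skew. -/
theorem d_flat (hD : IsLeviCivita D) (hZ : SmoothVectField Z)
    (hKilling : IsLieInvariantOn Z (fun _ v w ↦ ⟪v, w⟫_ℝ) univ) (p : N)
    (v w : EuclideanSpace ℝ (Fin (4 * n))) :
    d (toForm (flat Z)) p ![v, w] =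
      2 * metricChart p (extChartAt (𝓡 (4 * n)) p p) (nablaAt D Z p v) w := by
  have hg := contDiffAt_metricChart p (mem_extChartAt_target (I := 𝓡 (4 * n)) p)
  have hs : ContDiffAt ℝ ∞ (covChart (flat Z) p) (extChartAt (𝓡 (4 * n)) p p) :=
    (hg.clm_apply (hZ.contDiffAt p)).congr_of_eventuallyEq (covChart_flat Z p)
  have h1 := (eventually_nablaField_skew hD hZ hKilling p).self_of_nhds v w
  have hgd : DifferentiableAt ℝ (metricChart p) (extChartAt (𝓡 (4 * n)) p p) :=
    hg.differentiableAt (by simp)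
  have hZd : DifferentiableAt ℝ (fieldChart Z p) (extChartAt (𝓡 (4 * n)) p p) :=
    (hZ.contDiffAt p).differentiableAt (by simp)
  have ht := mem_extChartAt_target (I := 𝓡 (4 * n)) p
  refine (d_toForm_apply (smoothFormAt_toForm_iff.2 hs) v w).trans ?_
  rw [(covChart_flat Z p).fderiv_eq, fderiv_eval hgd hZd, fderiv_eval hgd hZd]
  simp only [add_apply]
  rw [fderiv_metricChart hD p ht, fderiv_metricChart hD p ht, christoffel_symm hD p ht w v,
    metricChart_symm p _ v] at *
  unfold nablaAt
  simp only [nablaField_apply, map_add, add_apply] at h1 ⊢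
  linarith

variable {P : Type*} [TopologicalSpace P] [ChartedSpace (EuclideanSpace ℝ (Fin (4 * n + 1))) P]
  [MulAction Circle P] {pr : P → N} {𝔤 : Gauge n N P}

namespace Gauge.IsAdapted

theorem eventually_comm (h : 𝔤.IsAdapted pr D G Z) (hQK : IsNegativeQK D G)
    (hZ : SmoothVectField Z) (hKilling : IsLieInvariantOn Z (fun _ v w ↦ ⟪v, w⟫_ℝ) univ)
    {p : N} (hp : p ∈ 𝔤.U) {a : Fin 3}
    (ha : IsLieInvariantOn Z (fun p v w ↦ ⟪𝔤.J a p v, w⟫_ℝ) 𝔤.U) :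
    ∀ᶠ y in 𝓝 (extChartAt (𝓡 (4 * n)) p p), ∀ v,
      nablaField (christoffel D p) (fieldChart Z p) y (endoChart (𝔤.J a) p y v) -
        endoChart (𝔤.J a) p y (nablaField (christoffel D p) (fieldChart Z p) y v) =
      ∑ b, connChart 𝔤 p a b y (fieldChart Z p y) • endoChart (𝔤.J b) p y v := by
  have hD := hQK.leviCivita
  have H := h.isQKChart hQK hp
  have hJ : ∀ᶠ y in 𝓝 (extChartAt (𝓡 (4 * n)) p p),
      DifferentiableAt ℝ (endoChart (𝔤.J a) p) y :=
    (((h.contDiffAt_J hp a).of_le (m := 1) (by norm_cast)).eventually (by simp)).mono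
      fun y hy ↦ hy.differentiableAt (by simp)
  filter_upwards [h.eventually_mem hp, hZ.eventually_differentiableAt p, hJ, H.conn,
    eventually_nablaField_skew hD hZ hKilling p] with y hy hd hJ hconn hskew
  have hg : DifferentiableAt ℝ (metricChart p) y :=
    (contDiffAt_metricChart p hy.1).differentiableAt (by simp)
  refine nablaField_comm (J := fun b ↦ endoChart (𝔤.J b) p) hg hJ
    (metricChart_eq_zero p hy.1) (christoffel_symm hD p hy.1)
    (fderiv_metricChart hD p hy.1) (hconn a) hskew ?_
  refine ha.chart p hy.1 hy.2 hd (hg.clm_comp hJ) fun z hz v w ↦ ?_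
  rw [ContinuousLinearMap.comp_apply, metricChart_apply, endoChart_apply, chartInv_chartD p hz]

/-- This is where the choice of ω₁ is used. The part of dZ♭ in G being a multiple of ω₁, the
endomorphism ∇Z is trace-orthogonal to `J 1` and `J 2`. By `comm_coeff` its commutators with them
have no `J 0` component, and by invariance those components are α₂(Z) and -α₃(Z). -/
theorem alpha_Z (h : 𝔤.IsAdapted pr D G Z) (hQK : IsNegativeQK D G) (hn : 1 ≤ n)
    (hZ : SmoothVectField Z) (hKilling : IsLieInvariantOn Z (fun _ v w ↦ ⟪v, w⟫_ℝ) univ)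
    {p : N} (hp : p ∈ 𝔤.U) : 𝔤.α₂ p (Z p) = 0 ∧ 𝔤.α₃ p (Z p) = 0 := by
  have H := h.isQKChart hQK hp
  have hfin : Nonempty (Fin (4 * n)) := ⟨⟨0, by omega⟩⟩
  obtain ⟨v, hv⟩ : ∃ v : TangentSpace (𝓡 (4 * n)) p, v ≠ 0 :=
    exists_ne (0 : EuclideanSpace ℝ (Fin (4 * n)))
  obtain ⟨r, -, hr⟩ := h.normalised p hp
  have hr2 := congrArg (fun A : TangentSpace (𝓡 (4 * n)) p →L[ℝ] TangentSpace (𝓡 (4 * n)) p ↦ A v) hr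
  obtain ⟨-, c1, c2⟩ := (h.frame.relations p hp).coeff_eq_zero (v := v) hv
    (a := coeffAlong p (d (toForm (flat Z)) p) (𝔤.J 0 p) - r)
    (b := coeffAlong p (d (toForm (flat Z)) p) (𝔤.J 1 p))
    (c := coeffAlong p (d (toForm (flat Z)) p) (𝔤.J 2 p)) (by
      rw [sp1Part, Fin.sum_univ_three] at hr2
      simp only [add_apply, smul_apply] at hr2
      rw [sub_smul, ← sub_eq_zero.2 hr2]
      abel)
  have hn' : (n : ℝ) ≠ 0 := by exact_mod_cast (by omega : n ≠ 0)
  -- A coefficient of dZ♭ is, up to a nonzero factor, the trace pairing of ∇Z with `J a`.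
  have htr : ∀ a, coeffAlong p (d (toForm (flat Z)) p) (𝔤.J a p) = 0 →
      ∑ i, metricChart p (extChartAt (𝓡 (4 * n)) p p) (nablaAt D Z p (tangentId p (onb p i)))
        (endoChart (𝔤.J a) p (extChartAt (𝓡 (4 * n)) p p) (tangentId p (onb p i))) = 0 := by
    intro a ha
    have h1 : ∑ i, d (toForm (flat Z)) p ![onb p i, 𝔤.J a p (onb p i)] = 0 := by
      unfold coeffAlong at ha
      exact (mul_eq_zero.1 ha).resolve_left (by positivity)
    have h2 : ∀ i, d (toForm (flat Z)) p ![onb p i, 𝔤.J a p (onb p i)] =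
        2 * metricChart p (extChartAt (𝓡 (4 * n)) p p) (nablaAt D Z p (tangentId p (onb p i)))
        (endoChart (𝔤.J a) p (extChartAt (𝓡 (4 * n)) p p) (tangentId p (onb p i))) := by
      intro i
      refine (d_flat hQK.leviCivita hZ hKilling p (onb p i) (𝔤.J a p (onb p i))).trans ?_
      exact congrArg (fun w ↦ 2 * metricChart p (extChartAt (𝓡 (4 * n)) p p)
        (nablaAt D Z p (tangentId p (onb p i))) w) (endoChart_self (𝔤.J a) p (onb p i)).symm
    rw [Finset.sum_congr rfl fun i _ ↦ h2 i, ← Finset.mul_sum] at h1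
    linarith
  have he : ∀ v w : TangentSpace (𝓡 (4 * n)) p,
      metricChart p (extChartAt (𝓡 (4 * n)) p p) (tangentId p v) (tangentId p w) = ⟪v, w⟫_ℝ :=
    metricChart_self p
  have k1 := (h.eventually_comm hQK hZ hKilling hp h.invariant₂).self_of_nhds
  have k2 := (h.eventually_comm hQK hZ hKilling hp h.invariant₃).self_of_nhds
  have hne : Nonempty (Fin (Module.finrank ℝ (TangentSpace (𝓡 (4 * n)) p))) := by
    rw [finrank_tangentSpace]
    exact hfin
  have z : ∀ i, connChart 𝔤 p i i (extChartAt (𝓡 (4 * n)) p p)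
      (fieldChart Z p (extChartAt (𝓡 (4 * n)) p p)) = 0 := fun i ↦ by
    have := H.c_skew i i (extChartAt (𝓡 (4 * n)) p p) (fieldChart Z p (extChartAt (𝓡 (4 * n)) p p))
    linarith
  obtain ⟨e1, e2⟩ := H.comm_coeff (tangentId p) (onb p) he (htr 1 c1) (htr 2 c2)
    (fun v ↦ by rw [nablaAt, k1 v, Fin.sum_univ_three, z, zero_smul, add_zero])
    (fun v ↦ by rw [nablaAt, k2 v, Fin.sum_univ_three, z, zero_smul, add_zero])
  rw [fieldChart_self] at e1 e2
  refine ⟨(covChart_self 𝔤.α₂ p (Z p)).symm.trans e1, ?_⟩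
  have e3 : -(𝔤.α₃ p (Z p)) = 0 := (covChart_self (fun p ↦ -𝔤.α₃ p) p (Z p)).symm.trans e2
  linarith

end Gauge.IsAdapted

end Structure

theorem fderiv_neg_apply {E : Type*} [NormedAddCommGroup E] [NormedSpace ℝ E] (A : E → E →L[ℝ] ℝ)
    (x u v : E) : fderiv ℝ (fun y ↦ -A y) x u v = -fderiv ℝ A x u v := by
  rw [fderiv_fun_neg]
  rfl

/-! ### Structure and moment equations of an adapted gauge -/

section StructureEquations

variable {n : ℕ}
  {N : Type*} [TopologicalSpace N]
  [ChartedSpace (EuclideanSpace ℝ (Fin (4 * n))) N] [IsManifold (𝓡 (4 * n)) ∞ N]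
  [T2Space N] [RiemannianBundle (fun p : N ↦ TangentSpace (𝓡 (4 * n)) p)]
  [IsContMDiffRiemannianBundle (𝓡 (4 * n)) ∞ (EuclideanSpace ℝ (Fin (4 * n)))
      (fun p : N ↦ TangentSpace (𝓡 (4 * n)) p)]
  {D : AffineConnection (4 * n) N}
  {G : Π p : N, Submodule ℝ
    (TangentSpace (𝓡 (4 * n)) p →L[ℝ] TangentSpace (𝓡 (4 * n)) p)}
  {Z : VectField (4 * n) N}
  {P : Type*} [TopologicalSpace P] [ChartedSpace (EuclideanSpace ℝ (Fin (4 * n + 1))) P]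
  [MulAction Circle P] {pr : P → N} {𝔤 : Gauge n N P}

/-- The endomorphism `∇Z` of the tangent space at `p`. -/
def covDeriv (D : AffineConnection (4 * n) N) (Z : VectField (4 * n) N) (p : N) :
    TangentSpace (𝓡 (4 * n)) p →L[ℝ] TangentSpace (𝓡 (4 * n)) p :=
  nablaAt D Z p

/-- The structure equations of an adapted gauge at a point. -/
structure Gauge.StructureAt (𝔤 : Gauge n N P) (D : AffineConnection (4 * n) N)
    (Z : VectField (4 * n) N) (p : N) : Prop where
  d_β : ∀ v w, d (toForm 𝔤.β) p ![v, w] =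
    𝔤.α₂ p v * 𝔤.α₃ p w - 𝔤.α₂ p w * 𝔤.α₃ p v + 4 * ⟪𝔤.J 0 p v, w⟫_ℝ
  d_α₂ : ∀ v w, d (toForm 𝔤.α₂) p ![v, w] =
    -(𝔤.β p v * 𝔤.α₃ p w - 𝔤.β p w * 𝔤.α₃ p v) - 4 * ⟪𝔤.J 2 p v, w⟫_ℝ
  d_α₃ : ∀ v w, d (toForm 𝔤.α₃) p ![v, w] =
    𝔤.β p v * 𝔤.α₂ p w - 𝔤.β p w * 𝔤.α₂ p v - 4 * ⟪𝔤.J 1 p v, w⟫_ℝ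
  α₂_Z : 𝔤.α₂ p (Z p) = 0
  α₃_Z : 𝔤.α₃ p (Z p) = 0
  d_moment : ∀ w, mvfderiv (𝓡 (4 * n)) (fun y ↦ 𝔤.β y (Z y)) p w = -(4 * ⟪𝔤.J 0 p (Z p), w⟫_ℝ)
  moment_α₂ : ∀ w, 𝔤.β p (Z p) * 𝔤.α₂ p w = 4 * ⟪𝔤.J 1 p (Z p), w⟫_ℝ
  moment_α₃ : ∀ w, 𝔤.β p (Z p) * 𝔤.α₃ p w = -(4 * ⟪𝔤.J 2 p (Z p), w⟫_ℝ)
  comm₁ : ∀ v : TangentSpace (𝓡 (4 * n)) p, covDeriv D Z p (𝔤.J 1 p v) - 𝔤.J 1 p (covDeriv D Z p v) =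
    𝔤.β p (Z p) • 𝔤.J 2 p v
  comm₂ : ∀ v : TangentSpace (𝓡 (4 * n)) p, covDeriv D Z p (𝔤.J 2 p v) - 𝔤.J 2 p (covDeriv D Z p v) =
    -𝔤.β p (Z p) • 𝔤.J 1 p v

namespace Gauge.IsAdapted

theorem skewJ (h : 𝔤.IsAdapted pr D G Z) {p : N} (hp : p ∈ 𝔤.U) (a : Fin 3)
    (v w : TangentSpace (𝓡 (4 * n)) p) : ⟪𝔤.J a p v, w⟫_ℝ = -⟪v, 𝔤.J a p w⟫_ℝ := by
  have h1 := h.frame.orthogonal p hp a v (𝔤.J a p w)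
  rw [(h.frame.relations p hp).sq, inner_neg_right] at h1
  linarith

theorem covChart_Z (θ : Covect (4 * n) N) (p : N) :
    (fun y ↦ covChart θ p y (fieldChart Z p y)) =ᶠ[𝓝 (extChartAt (𝓡 (4 * n)) p p)]
      fun y ↦ θ ((extChartAt (𝓡 (4 * n)) p).symm y) (Z ((extChartAt (𝓡 (4 * n)) p).symm y)) := by
  filter_upwards [extChartAt_target_mem_nhds p] with y hy
  exact congrArg _ (chartInv_fieldChart Z p hy)

theorem contMDiffAt_moment (h : 𝔤.IsAdapted pr D G Z) (hZ : SmoothVectField Z) {p : N}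
    (hp : p ∈ 𝔤.U) : ContMDiffAt (𝓡 (4 * n)) 𝓘(ℝ, ℝ) ∞ (fun y ↦ 𝔤.β y (Z y)) p := by
  have h1 : ContDiffAt ℝ ∞ (fun y ↦ covChart 𝔤.β p y (fieldChart Z p y))
      (extChartAt (𝓡 (4 * n)) p p) := (h.contDiffAt_conn hp 1 2).clm_apply (hZ.contDiffAt p)
  have h2 := (h1.congr_of_eventuallyEq (covChart_Z (Z := Z) 𝔤.β p).symm).contMDiffAt
  refine (h2.comp (I' := 𝓡 (4 * n)) p (contMDiffAt_chart p (mem_extChartAt_source p))).congr_of_eventuallyEq ?_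
  filter_upwards [extChartAt_source_mem_nhds (I := 𝓡 (4 * n)) p] with y hy
  simp only [Function.comp_apply]
  rw [(extChartAt (𝓡 (4 * n)) p).left_inv hy]

theorem eventually_alpha_Z (h : 𝔤.IsAdapted pr D G Z) (hQK : IsNegativeQK D G) (hn : 1 ≤ n)
    (hZ : SmoothVectField Z) (hKilling : IsLieInvariantOn Z (fun _ v w ↦ ⟪v, w⟫_ℝ) univ)
    {p : N} (hp : p ∈ 𝔤.U) : ∀ᶠ y in 𝓝 (extChartAt (𝓡 (4 * n)) p p),
      connChart 𝔤 p 1 0 y (fieldChart Z p y) = 0 ∧ connChart 𝔤 p 0 2 y (fieldChart Z p y) = 0 := by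
  filter_upwards [h.eventually_mem hp, covChart_Z (Z := Z) 𝔤.α₂ p,
    covChart_Z (Z := Z) 𝔤.α₃ p] with y hy e1 e2
  obtain ⟨a1, a2⟩ := h.alpha_Z hQK hn hZ hKilling hy.2
  exact ⟨e1.trans a1, e2.trans a2⟩

/-- The forms β, α₂, α₃ are the entries (1,2), (1,0), (0,2) of the connection matrix, so
`curvForm_eq` unwinds to the three formulas for their differentials, and `killing` to the moment
equations. The changes of sign come from the skewness of the matrix and from moving `J a` from the
argument to Z. -/
theorem structureAt (h : 𝔤.IsAdapted pr D G Z) (hQK : IsNegativeQK D G) (hn : 1 ≤ n)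
    (hZ : SmoothVectField Z) (hKilling : IsLieInvariantOn Z (fun _ v w ↦ ⟪v, w⟫_ℝ) univ)
    {p : N} (hp : p ∈ 𝔤.U) : 𝔤.StructureAt D Z p := by
  have H := h.isQKChart hQK hp
  have hne : Nontrivial (EuclideanSpace ℝ (Fin (4 * n))) := by
    have : Nonempty (Fin (4 * n)) := ⟨⟨0, by omega⟩⟩
    infer_instance
  obtain ⟨aZ2, aZ3⟩ := h.alpha_Z hQK hn hZ hKilling hp
  have z : ∀ i y v, connChart 𝔤 p i i y v = 0 := fun i y v ↦ by
    have := H.c_skew i i y v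
    linarith
  -- The relation is needed on a neighbourhood, because `killing` differentiates it; so α₂(Z) =
  -- α₃(Z) = 0 is used at all nearby points.
  have c1 : ∀ᶠ y in 𝓝 (extChartAt (𝓡 (4 * n)) p p), ∀ v,
      nablaField (christoffel D p) (fieldChart Z p) y (endoChart (𝔤.J 1) p y v) -
        endoChart (𝔤.J 1) p y (nablaField (christoffel D p) (fieldChart Z p) y v) =
      connChart 𝔤 p 1 2 y (fieldChart Z p y) • endoChart (𝔤.J 2) p y v := by
    filter_upwards [h.eventually_comm hQK hZ hKilling hp h.invariant₂,
      h.eventually_alpha_Z hQK hn hZ hKilling hp] with y hy ha v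
    rw [hy, Fin.sum_univ_three, z, ha.1, zero_smul, zero_smul, zero_add, zero_add]
  have c2 : ∀ᶠ y in 𝓝 (extChartAt (𝓡 (4 * n)) p p), ∀ v,
      nablaField (christoffel D p) (fieldChart Z p) y (endoChart (𝔤.J 2) p y v) -
        endoChart (𝔤.J 2) p y (nablaField (christoffel D p) (fieldChart Z p) y v) =
      -connChart 𝔤 p 1 2 y (fieldChart Z p y) • endoChart (𝔤.J 1) p y v := by
    filter_upwards [h.eventually_comm hQK hZ hKilling hp h.invariant₃,
      h.eventually_alpha_Z hQK hn hZ hKilling hp] with y hy ha v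
    rw [hy, Fin.sum_univ_three, z, H.c_skew 2 0, H.c_skew 2 1, ha.2, neg_zero, zero_smul, zero_smul,
      zero_add, add_zero]
  have K := H.killing (hZ.contDiffAt p) (h.curvForm_eq hQK hn hp)
    (eventually_nablaField_skew hQK.leviCivita hZ hKilling p) c1 c2
  have C := h.curvForm_eq hQK hn hp
  have sβ : ∀ v, connChart 𝔤 p 1 2 (extChartAt (𝓡 (4 * n)) p p) v = 𝔤.β p v := covChart_self 𝔤.β p
  have sα₂ : ∀ v, connChart 𝔤 p 1 0 (extChartAt (𝓡 (4 * n)) p p) v = 𝔤.α₂ p v :=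
    covChart_self 𝔤.α₂ p
  have sα₃ : ∀ v, connChart 𝔤 p 0 2 (extChartAt (𝓡 (4 * n)) p p) v = 𝔤.α₃ p v :=
    covChart_self 𝔤.α₃ p
  have hJ : ∀ a v w, metricChart p (extChartAt (𝓡 (4 * n)) p p)
      (endoChart (𝔤.J a) p (extChartAt (𝓡 (4 * n)) p p) v) w = ⟪𝔤.J a p v, w⟫_ℝ := fun a ↦
    metricChart_endoChart (𝔤.J a) p
  have hβ := h.smooth_β.smoothFormAt h.isOpen hp
  have hα₂ := h.smooth_α₂.smoothFormAt h.isOpen hp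
  have hα₃ := h.smooth_α₃.smoothFormAt h.isOpen hp
  have Kz : ∀ a w, metricChart p (extChartAt (𝓡 (4 * n)) p p)
      (endoChart (𝔤.J a) p (extChartAt (𝓡 (4 * n)) p p) w)
      (fieldChart Z p (extChartAt (𝓡 (4 * n)) p p)) = -⟪𝔤.J a p (Z p), w⟫_ℝ := by
    intro a w
    rw [fieldChart_self]
    exact (hJ a w (Z p)).trans ((h.skewJ hp a w (Z p)).trans
      (congrArg Neg.neg (real_inner_comm _ _)))
  have uZ : connChart 𝔤 p 1 2 (extChartAt (𝓡 (4 * n)) p p)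
      (fieldChart Z p (extChartAt (𝓡 (4 * n)) p p)) = 𝔤.β p (Z p) := by
    rw [fieldChart_self]
    exact sβ (Z p)
  have neg01 : connChart 𝔤 p 0 1 = fun y ↦ -connChart 𝔤 p 1 0 y := by
    funext y
    ext v
    exact H.c_skew 0 1 y v
  have neg20 : connChart 𝔤 p 2 0 = fun y ↦ -connChart 𝔤 p 0 2 y := by
    funext y
    ext v
    exact H.c_skew 2 0 y v
  have sJ : ∀ a v, endoChart (𝔤.J a) p (extChartAt (𝓡 (4 * n)) p p) v = 𝔤.J a p v := fun a ↦
    endoChart_self (𝔤.J a) p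
  have e0 : ∀ v w : EuclideanSpace ℝ (Fin (4 * n)),
      fderiv ℝ (connChart 𝔤 p 1 2) (extChartAt (𝓡 (4 * n)) p p) v w -
      fderiv ℝ (connChart 𝔤 p 1 2) (extChartAt (𝓡 (4 * n)) p p) w v =
      𝔤.α₂ p v * 𝔤.α₃ p w - 𝔤.α₂ p w * 𝔤.α₃ p v + 4 * ⟪𝔤.J 0 p v, (show TangentSpace (𝓡 (4 * n)) p from w)⟫_ℝ := by
    intro v w
    have e : curvForm (connChart 𝔤 p) (extChartAt (𝓡 (4 * n)) p p) 1 2 v w =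
        4 * metricChart p (extChartAt (𝓡 (4 * n)) p p)
          (endoChart (𝔤.J 0) p (extChartAt (𝓡 (4 * n)) p p) v) w := C 0 v w
    rw [curvForm_apply, Fin.sum_univ_three] at e
    simp only [z, zero_mul, mul_zero, sub_zero, add_zero] at e
    rw [hJ, sα₂, sα₂, sα₃, sα₃] at e
    linarith
  have e1 : ∀ v w : EuclideanSpace ℝ (Fin (4 * n)),
      fderiv ℝ (connChart 𝔤 p 1 0) (extChartAt (𝓡 (4 * n)) p p) v w -
      fderiv ℝ (connChart 𝔤 p 1 0) (extChartAt (𝓡 (4 * n)) p p) w v =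
      -(𝔤.β p v * 𝔤.α₃ p w - 𝔤.β p w * 𝔤.α₃ p v) - 4 * ⟪𝔤.J 2 p v, (show TangentSpace (𝓡 (4 * n)) p from w)⟫_ℝ := by
    intro v w
    have e : curvForm (connChart 𝔤 p) (extChartAt (𝓡 (4 * n)) p p) 0 1 v w =
        4 * metricChart p (extChartAt (𝓡 (4 * n)) p p)
          (endoChart (𝔤.J 2) p (extChartAt (𝓡 (4 * n)) p p) v) w := C 2 v w
    rw [curvForm_apply, Fin.sum_univ_three] at e
    simp only [z, zero_mul, mul_zero, sub_zero, add_zero, zero_add] at e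
    rw [hJ, sα₃, sα₃, H.c_skew 2 1, H.c_skew 2 1, sβ, sβ, neg01,
      fderiv_neg_apply, fderiv_neg_apply] at e
    linarith
  have e2 : ∀ v w : EuclideanSpace ℝ (Fin (4 * n)),
      fderiv ℝ (connChart 𝔤 p 0 2) (extChartAt (𝓡 (4 * n)) p p) v w -
      fderiv ℝ (connChart 𝔤 p 0 2) (extChartAt (𝓡 (4 * n)) p p) w v =
      𝔤.β p v * 𝔤.α₂ p w - 𝔤.β p w * 𝔤.α₂ p v - 4 * ⟪𝔤.J 1 p v, (show TangentSpace (𝓡 (4 * n)) p from w)⟫_ℝ := by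
    intro v w
    have e : curvForm (connChart 𝔤 p) (extChartAt (𝓡 (4 * n)) p p) 2 0 v w =
        4 * metricChart p (extChartAt (𝓡 (4 * n)) p p)
          (endoChart (𝔤.J 1) p (extChartAt (𝓡 (4 * n)) p p) v) w := C 1 v w
    rw [curvForm_apply, Fin.sum_univ_three] at e
    simp only [z, zero_mul, mul_zero, sub_zero, add_zero, zero_add] at e
    rw [hJ, sα₂, sα₂, H.c_skew 2 1, H.c_skew 2 1, sβ, sβ, neg20,
      fderiv_neg_apply, fderiv_neg_apply] at e
    linarith
  refine ⟨fun v w ↦ (d_toForm_apply hβ v w).trans (e0 v w),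
    fun v w ↦ (d_toForm_apply hα₂ v w).trans (e1 v w),
    fun v w ↦ (d_toForm_apply hα₃ v w).trans (e2 v w), ?_, ?_, ?_, ?_, ?_, ?_, ?_⟩
  · exact aZ2
  · exact aZ3
  · intro w
    refine (mvfderiv_eq_fderiv_chart
      ((h.contMDiffAt_moment hZ hp).mdifferentiableAt (by simp)) w).trans ?_
    rw [← (covChart_Z (Z := Z) 𝔤.β p).fderiv_eq]
    exact ((K w).1.trans (congrArg (4 * ·) (Kz 0 w))).trans (mul_neg _ _)
  · intro w
    refine (congrArg₂ (· * ·) uZ (sα₂ w)).symm.trans ((K w).2.2.trans ?_)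
    exact (congrArg (fun t ↦ -(4 * t)) (Kz 1 w)).trans (by ring)
  · intro w
    refine (congrArg₂ (· * ·) uZ (sα₃ w)).symm.trans ((K w).2.1.trans ?_)
    exact (congrArg (4 * ·) (Kz 2 w)).trans (mul_neg _ _)
  · intro v
    have e := c1.self_of_nhds v
    rw [uZ] at e
    exact (congrArg₂ (· - ·) (congrArg (nablaAt D Z p) (sJ 1 v))
      (sJ 1 (nablaAt D Z p v))).symm.trans (e.trans (congrArg (𝔤.β p (Z p) • ·) (sJ 2 v)))
  · intro v
    have e := c2.self_of_nhds v
    rw [uZ] at e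
    exact (congrArg₂ (· - ·) (congrArg (nablaAt D Z p) (sJ 2 v))
      (sJ 2 (nablaAt D Z p v))).symm.trans (e.trans (congrArg (-𝔤.β p (Z p) • ·) (sJ 1 v)))

end Gauge.IsAdapted

end StructureEquations

/-! ### Chain rules for real functions on manifolds -/

section Calculus

variable {m m' : ℕ}
  {X : Type*} [TopologicalSpace X] [ChartedSpace (EuclideanSpace ℝ (Fin m)) X]
  [IsManifold (𝓡 m) ∞ X]
  {Y : Type*} [TopologicalSpace Y] [ChartedSpace (EuclideanSpace ℝ (Fin m')) Y]
  [IsManifold (𝓡 m') ∞ Y]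

theorem mvfderiv_comp_map {F : X → Y} {g : Y → ℝ} {p : X}
    (hg : MDifferentiableAt (𝓡 m') 𝓘(ℝ, ℝ) g (F p)) (hF : MDifferentiableAt (𝓡 m) (𝓡 m') F p)
    (v : TangentSpace (𝓡 m) p) :
    mvfderiv (𝓡 m) (fun y ↦ g (F y)) p v =
      mvfderiv (𝓡 m') g (F p) (mfderiv (𝓡 m) (𝓡 m') F p v) :=
  congrArg (fun B ↦ B v) (mfderiv_comp p hg hF)

theorem mvfderiv_comp_real {g : X → ℝ} {p : X} (hg : MDifferentiableAt (𝓡 m) 𝓘(ℝ, ℝ) g p)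
    {φ : ℝ → ℝ} {φ' : ℝ} (hφ : HasDerivAt φ φ' (g p)) (v : TangentSpace (𝓡 m) p) :
    mvfderiv (𝓡 m) (fun y ↦ φ (g y)) p v = φ' * mvfderiv (𝓡 m) g p v := by
  have h := mfderiv_comp p (g := φ) hφ.differentiableAt.mdifferentiableAt hg
  rw [mfderiv_eq_fderiv, hφ.hasFDerivAt.fderiv] at h
  refine (congrArg (fun B ↦ B v) h).trans ?_
  change mvfderiv (𝓡 m) g p v • φ' = _
  rw [smul_eq_mul, mul_comm]

theorem mvfderiv_inv {g : X → ℝ} {p : X} (hg : MDifferentiableAt (𝓡 m) 𝓘(ℝ, ℝ) g p)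
    (h0 : g p ≠ 0) (v : TangentSpace (𝓡 m) p) :
    mvfderiv (𝓡 m) (fun y ↦ (g y)⁻¹) p v = -((g p)⁻¹ ^ 2) * mvfderiv (𝓡 m) g p v := by
  rw [mvfderiv_comp_real hg (hasDerivAt_inv h0), inv_pow]

theorem contMDiffAt_inv_real {g : X → ℝ} {p : X} (hg : ContMDiffAt (𝓡 m) 𝓘(ℝ, ℝ) ∞ g p)
    (h0 : g p ≠ 0) : ContMDiffAt (𝓡 m) 𝓘(ℝ, ℝ) ∞ (fun y ↦ (g y)⁻¹) p :=
  ((contDiffAt_inv ℝ h0).contMDiffAt (n := ∞)).comp (I' := 𝓘(ℝ, ℝ)) p hg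

theorem d_const_smul (r : ℝ) {θ : Covect m X} {p : X} (hθ : SmoothFormAt (toForm θ) p)
    (v w : TangentSpace (𝓡 m) p) :
    d (toForm fun x ↦ r • θ x) p ![v, w] = r * d (toForm θ) p ![v, w] := by
  rw [d_smul (f := fun _ ↦ r) contMDiffAt_const hθ]
  have h : mvfderiv (𝓡 m) (fun _ : X ↦ r) p = 0 := mfderiv_const
  rw [h]
  simp

end Calculus

/-! ### The forms A, B, C and the rotated frame K on the circle bundle -/

section TotalSpace

variable {n : ℕ}
  {N : Type*} [TopologicalSpace N]
  [ChartedSpace (EuclideanSpace ℝ (Fin (4 * n))) N] [IsManifold (𝓡 (4 * n)) ∞ N]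
  {P : Type*} [TopologicalSpace P] [ChartedSpace (EuclideanSpace ℝ (Fin (4 * n + 1))) P]
  [IsManifold (𝓡 (4 * n + 1)) ∞ P] {pr : P → N} {𝔤 : Gauge n N P} {Z : VectField (4 * n) N}

theorem toForm_pullCovect (pr : P → N) (θ : Covect (4 * n) N) :
    toForm (pullCovect pr θ) =
      pullback (m := 4 * n + 1) (m' := 4 * n) pr (toForm θ) := by
  funext p
  ext v
  rfl

theorem smoothFormAt_pullCovect {θ : Covect (4 * n) N} {p : P}
    (hθ : SmoothFormAt (toForm θ) (pr p))
    (hpr : ContMDiffAt (𝓡 (4 * n + 1)) (𝓡 (4 * n)) ∞ pr p) :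
    SmoothFormAt (toForm (pullCovect pr θ)) p := by
  rw [toForm_pullCovect]
  exact hθ.pullback hpr

theorem d_pullCovect {θ : Covect (4 * n) N} {p : P} (hθ : SmoothFormAt (toForm θ) (pr p))
    (hpr : ContMDiffAt (𝓡 (4 * n + 1)) (𝓡 (4 * n)) ∞ pr p)
    (v w : TangentSpace (𝓡 (4 * n + 1)) p) :
    d (toForm (pullCovect pr θ)) p ![v, w] =
      d (toForm θ) (pr p) ![mfderiv (𝓡 (4 * n + 1)) (𝓡 (4 * n)) pr p v,
        mfderiv (𝓡 (4 * n + 1)) (𝓡 (4 * n)) pr p w] := by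
  rw [toForm_pullCovect, d_pullback hθ hpr, pullback_apply]
  congr 1
  funext i
  fin_cases i <;> rfl

namespace Gauge

/-- The connection-type form `2 dx - β` on the total space. -/
def A (𝔤 : Gauge n N P) (pr : P → N) : Covect (4 * n + 1) P :=
  fun p ↦ (2 : ℝ) • dAngle 𝔤.c p - pullCovect pr 𝔤.β p

/-- The form `h α₃ + f α₂` on the total space. -/
def B (𝔤 : Gauge n N P) (pr : P → N) : Covect (4 * n + 1) P :=
  fun p ↦ sinTwo (𝔤.c p) • pullCovect pr 𝔤.α₃ p + cosTwo (𝔤.c p) • pullCovect pr 𝔤.α₂ p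

/-- The form `h α₂ - f α₃` on the total space. -/
def C (𝔤 : Gauge n N P) (pr : P → N) : Covect (4 * n + 1) P :=
  fun p ↦ sinTwo (𝔤.c p) • pullCovect pr 𝔤.α₂ p - cosTwo (𝔤.c p) • pullCovect pr 𝔤.α₃ p

/-- The rotated frame `I₁, h I₂ + f I₃, h I₃ - f I₂`. -/
def K (𝔤 : Gauge n N P) (pr : P → N) (p : P) :
    Fin 3 → TangentSpace (𝓡 (4 * n)) (pr p) →L[ℝ] TangentSpace (𝓡 (4 * n)) (pr p) :=
  ![𝔤.J 0 (pr p),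
    sinTwo (𝔤.c p) • 𝔤.J 1 (pr p) + cosTwo (𝔤.c p) • 𝔤.J 2 (pr p),
    sinTwo (𝔤.c p) • 𝔤.J 2 (pr p) - cosTwo (𝔤.c p) • 𝔤.J 1 (pr p)]

theorem σ_zero (𝔤 : Gauge n N P) (pr : P → N) (Z : VectField (4 * n) N) :
    𝔤.σ pr Z 0 = -d (toForm fun p ↦ (𝔤.u pr Z p)⁻¹ • 𝔤.A pr p) := rfl

theorem σ_one (𝔤 : Gauge n N P) (pr : P → N) (Z : VectField (4 * n) N) :
    𝔤.σ pr Z 1 = -d (toForm fun p ↦ (𝔤.u pr Z p)⁻¹ • 𝔤.B pr p) := rfl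

theorem σ_two (𝔤 : Gauge n N P) (pr : P → N) (Z : VectField (4 * n) N) :
    𝔤.σ pr Z 2 = -d (toForm fun p ↦ (𝔤.u pr Z p)⁻¹ • 𝔤.C pr p) := rfl

end Gauge

end TotalSpace

/-! ### Common pointwise shape of the three forms -/

section HKForm

variable {V : Type*} [NormedAddCommGroup V] [InnerProductSpace ℝ V] {T : Type*}

/-- The pointwise expression of the forms of the correspondence. -/
def hkForm (u : ℝ) (Z : V) (K : Fin 3 → V → V) (A : T → ℝ) (ϖ : T → V) (b : Fin 3) (v w : T) : ℝ :=
  4 * u⁻¹ ^ 2 * (A v * ⟪K b Z, ϖ w⟫_ℝ - A w * ⟪K b Z, ϖ v⟫_ℝ) -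
    16 * u⁻¹ ^ 3 * (⟪K (b + 1) Z, ϖ v⟫_ℝ * ⟪K (b + 2) Z, ϖ w⟫_ℝ -
      ⟪K (b + 1) Z, ϖ w⟫_ℝ * ⟪K (b + 2) Z, ϖ v⟫_ℝ) +
    4 * u⁻¹ * ⟪K b (ϖ v), ϖ w⟫_ℝ

end HKForm

/-! ### Exterior derivatives of A, B, C -/

section Sigma

variable {n : ℕ}
  {N : Type*} [TopologicalSpace N]
  [ChartedSpace (EuclideanSpace ℝ (Fin (4 * n))) N] [IsManifold (𝓡 (4 * n)) ∞ N]
  [T2Space N] [RiemannianBundle (fun p : N ↦ TangentSpace (𝓡 (4 * n)) p)]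
  [IsContMDiffRiemannianBundle (𝓡 (4 * n)) ∞ (EuclideanSpace ℝ (Fin (4 * n)))
      (fun p : N ↦ TangentSpace (𝓡 (4 * n)) p)]
  {D : AffineConnection (4 * n) N}
  {G : Π p : N, Submodule ℝ
    (TangentSpace (𝓡 (4 * n)) p →L[ℝ] TangentSpace (𝓡 (4 * n)) p)}
  {Z : VectField (4 * n) N}
  {P : Type*} [TopologicalSpace P] [ChartedSpace (EuclideanSpace ℝ (Fin (4 * n + 1))) P]
  [IsManifold (𝓡 (4 * n + 1)) ∞ P]
  [MulAction Circle P] {pr : P → N} {𝔤 : Gauge n N P}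

/-- An adapted gauge whose structure equations hold, over a smooth circle bundle. -/
structure Gauge.IsStructured (𝔤 : Gauge n N P) (pr : P → N) (D : AffineConnection (4 * n) N)
    (G : Π p : N, Submodule ℝ
      (TangentSpace (𝓡 (4 * n)) p →L[ℝ] TangentSpace (𝓡 (4 * n)) p))
    (Z : VectField (4 * n) N) : Prop where
  smooth_pr : ContMDiff (𝓡 (4 * n + 1)) (𝓡 (4 * n)) ∞ pr
  smooth_Z : SmoothVectField Z
  leviCivita : IsLeviCivita D
  adapted : 𝔤.IsAdapted pr D G Z
  structureAt : ∀ p ∈ 𝔤.U, 𝔤.StructureAt D Z p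
  pos : ∀ p ∈ 𝔤.U, 2 * ‖Z p‖ < 𝔤.β p (Z p)

namespace Gauge.IsStructured

variable {p : P}

theorem moment_pos (h : 𝔤.IsStructured pr D G Z) (hp : pr p ∈ 𝔤.U) : 0 < 𝔤.u pr Z p :=
  lt_of_le_of_lt (by positivity) (h.pos _ hp)

theorem eventually_c (h : 𝔤.IsStructured pr D G Z) (hp : pr p ∈ 𝔤.U) :
    ∀ᶠ y in 𝓝 p, ContMDiffAt (𝓡 (4 * n + 1)) (𝓡 1) ∞ 𝔤.c y := by
  have ho := h.adapted.isOpen.preimage h.smooth_pr.continuous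
  filter_upwards [ho.mem_nhds hp] with y hy
  exact h.adapted.smooth_c.contMDiffAt (ho.mem_nhds hy)

theorem smooth_u (h : 𝔤.IsStructured pr D G Z) (hp : pr p ∈ 𝔤.U) :
    ContMDiffAt (𝓡 (4 * n + 1)) 𝓘(ℝ, ℝ) ∞ (𝔤.u pr Z) p :=
  ContMDiffAt.comp (I' := 𝓡 (4 * n)) p (h.adapted.contMDiffAt_moment h.smooth_Z hp)
    h.smooth_pr.contMDiffAt

theorem mvfderiv_u (h : 𝔤.IsStructured pr D G Z) (hp : pr p ∈ 𝔤.U)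
    (v : TangentSpace (𝓡 (4 * n + 1)) p) :
    mvfderiv (𝓡 (4 * n + 1)) (𝔤.u pr Z) p v =
      -(4 * ⟪𝔤.J 0 (pr p) (Z (pr p)), mfderiv (𝓡 (4 * n + 1)) (𝓡 (4 * n)) pr p v⟫_ℝ) := by
  rw [← (h.structureAt _ hp).d_moment]
  exact mvfderiv_comp_map (g := fun y ↦ 𝔤.β y (Z y))
    ((h.adapted.contMDiffAt_moment h.smooth_Z hp).mdifferentiableAt (by simp))
    (h.smooth_pr.mdifferentiableAt (by simp)) v

theorem smooth_β (h : 𝔤.IsStructured pr D G Z) (hp : pr p ∈ 𝔤.U) :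
    SmoothFormAt (toForm (pullCovect pr 𝔤.β)) p :=
  smoothFormAt_pullCovect (h.adapted.smooth_β.smoothFormAt h.adapted.isOpen hp)
    h.smooth_pr.contMDiffAt

theorem smooth_α₂ (h : 𝔤.IsStructured pr D G Z) (hp : pr p ∈ 𝔤.U) :
    SmoothFormAt (toForm (pullCovect pr 𝔤.α₂)) p :=
  smoothFormAt_pullCovect (h.adapted.smooth_α₂.smoothFormAt h.adapted.isOpen hp)
    h.smooth_pr.contMDiffAt

theorem smooth_α₃ (h : 𝔤.IsStructured pr D G Z) (hp : pr p ∈ 𝔤.U) :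
    SmoothFormAt (toForm (pullCovect pr 𝔤.α₃)) p :=
  smoothFormAt_pullCovect (h.adapted.smooth_α₃.smoothFormAt h.adapted.isOpen hp)
    h.smooth_pr.contMDiffAt

theorem smooth_A (h : 𝔤.IsStructured pr D G Z) (hp : pr p ∈ 𝔤.U) :
    SmoothFormAt (toForm (𝔤.A pr)) p :=
  smoothFormAt_sub (smoothFormAt_smul contMDiffAt_const (smoothFormAt_dAngle (h.eventually_c hp)))
    (h.smooth_β hp)

theorem smooth_B (h : 𝔤.IsStructured pr D G Z) (hp : pr p ∈ 𝔤.U) :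
    SmoothFormAt (toForm (𝔤.B pr)) p :=
  smoothFormAt_add
    (smoothFormAt_smul (contMDiffAt_sinTwo (h.eventually_c hp).self_of_nhds) (h.smooth_α₃ hp))
    (smoothFormAt_smul (contMDiffAt_cosTwo (h.eventually_c hp).self_of_nhds) (h.smooth_α₂ hp))

theorem smooth_C (h : 𝔤.IsStructured pr D G Z) (hp : pr p ∈ 𝔤.U) :
    SmoothFormAt (toForm (𝔤.C pr)) p :=
  smoothFormAt_sub
    (smoothFormAt_smul (contMDiffAt_sinTwo (h.eventually_c hp).self_of_nhds) (h.smooth_α₂ hp))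
    (smoothFormAt_smul (contMDiffAt_cosTwo (h.eventually_c hp).self_of_nhds) (h.smooth_α₃ hp))

theorem d_A (h : 𝔤.IsStructured pr D G Z) (hp : pr p ∈ 𝔤.U)
    (v w : TangentSpace (𝓡 (4 * n + 1)) p) :
    d (toForm (𝔤.A pr)) p ![v, w] = -(pullCovect pr 𝔤.α₂ p v * pullCovect pr 𝔤.α₃ p w -
      pullCovect pr 𝔤.α₂ p w * pullCovect pr 𝔤.α₃ p v +
      4 * ⟪𝔤.J 0 (pr p) (mfderiv (𝓡 (4 * n + 1)) (𝓡 (4 * n)) pr p v),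
        mfderiv (𝓡 (4 * n + 1)) (𝓡 (4 * n)) pr p w⟫_ℝ) := by
  have hs := smoothFormAt_dAngle (m := 4 * n + 1) (h.eventually_c hp)
  refine (d_sub (smoothFormAt_smul contMDiffAt_const hs) (h.smooth_β hp) v w).trans ?_
  rw [d_const_smul 2 hs, d_dAngle (h.eventually_c hp), mul_zero, zero_sub,
    d_pullCovect (h.adapted.smooth_β.smoothFormAt h.adapted.isOpen hp) h.smooth_pr.contMDiffAt,
    (h.structureAt _ hp).d_β]
  rfl

/-- The differentials of h and f contribute 2dx and those of α₂, α₃ contribute -β, so dx and β occur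
only through A = 2dx - β, and (B, C) rotate into each other: dB = -A∧C - 4(hω₂ + fω₃). -/
theorem d_B (h : 𝔤.IsStructured pr D G Z) (hp : pr p ∈ 𝔤.U)
    (v w : TangentSpace (𝓡 (4 * n + 1)) p) :
    d (toForm (𝔤.B pr)) p ![v, w] = -(𝔤.A pr p v * 𝔤.C pr p w - 𝔤.A pr p w * 𝔤.C pr p v) -
      4 * (sinTwo (𝔤.c p) * ⟪𝔤.J 1 (pr p) (mfderiv (𝓡 (4 * n + 1)) (𝓡 (4 * n)) pr p v),
        mfderiv (𝓡 (4 * n + 1)) (𝓡 (4 * n)) pr p w⟫_ℝ +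
      cosTwo (𝔤.c p) * ⟪𝔤.J 2 (pr p) (mfderiv (𝓡 (4 * n + 1)) (𝓡 (4 * n)) pr p v),
        mfderiv (𝓡 (4 * n + 1)) (𝓡 (4 * n)) pr p w⟫_ℝ) := by
  have hc := (h.eventually_c hp).self_of_nhds
  have hpr := h.smooth_pr.contMDiffAt (x := p)
  refine (d_add (smoothFormAt_smul (contMDiffAt_sinTwo hc) (h.smooth_α₃ hp))
    (smoothFormAt_smul (contMDiffAt_cosTwo hc) (h.smooth_α₂ hp)) v w).trans ?_
  rw [d_smul (contMDiffAt_sinTwo hc) (h.smooth_α₃ hp), d_smul (contMDiffAt_cosTwo hc) (h.smooth_α₂ hp),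
    d_pullCovect (h.adapted.smooth_α₃.smoothFormAt h.adapted.isOpen hp) hpr,
    d_pullCovect (h.adapted.smooth_α₂.smoothFormAt h.adapted.isOpen hp) hpr,
    (h.structureAt _ hp).d_α₂, (h.structureAt _ hp).d_α₃, mvfderiv_cosTwo hc, mvfderiv_sinTwo hc,
    mvfderiv_cosTwo hc, mvfderiv_sinTwo hc]
  simp only [Gauge.A, Gauge.C, pullCovect, ContinuousLinearMap.comp_apply, sub_apply, smul_apply,
    smul_eq_mul]
  ring

theorem d_C (h : 𝔤.IsStructured pr D G Z) (hp : pr p ∈ 𝔤.U)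
    (v w : TangentSpace (𝓡 (4 * n + 1)) p) :
    d (toForm (𝔤.C pr)) p ![v, w] = (𝔤.A pr p v * 𝔤.B pr p w - 𝔤.A pr p w * 𝔤.B pr p v) -
      4 * (sinTwo (𝔤.c p) * ⟪𝔤.J 2 (pr p) (mfderiv (𝓡 (4 * n + 1)) (𝓡 (4 * n)) pr p v),
        mfderiv (𝓡 (4 * n + 1)) (𝓡 (4 * n)) pr p w⟫_ℝ -
      cosTwo (𝔤.c p) * ⟪𝔤.J 1 (pr p) (mfderiv (𝓡 (4 * n + 1)) (𝓡 (4 * n)) pr p v),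
        mfderiv (𝓡 (4 * n + 1)) (𝓡 (4 * n)) pr p w⟫_ℝ) := by
  have hc := (h.eventually_c hp).self_of_nhds
  have hpr := h.smooth_pr.contMDiffAt (x := p)
  refine (d_sub (smoothFormAt_smul (contMDiffAt_sinTwo hc) (h.smooth_α₂ hp))
    (smoothFormAt_smul (contMDiffAt_cosTwo hc) (h.smooth_α₃ hp)) v w).trans ?_
  rw [d_smul (contMDiffAt_sinTwo hc) (h.smooth_α₂ hp), d_smul (contMDiffAt_cosTwo hc) (h.smooth_α₃ hp),
    d_pullCovect (h.adapted.smooth_α₃.smoothFormAt h.adapted.isOpen hp) hpr,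
    d_pullCovect (h.adapted.smooth_α₂.smoothFormAt h.adapted.isOpen hp) hpr,
    (h.structureAt _ hp).d_α₂, (h.structureAt _ hp).d_α₃, mvfderiv_cosTwo hc, mvfderiv_sinTwo hc,
    mvfderiv_cosTwo hc, mvfderiv_sinTwo hc]
  simp only [Gauge.A, Gauge.B, pullCovect, ContinuousLinearMap.comp_apply, sub_apply, add_apply,
    smul_apply, smul_eq_mul]
  ring

/-- The moment equations for α₂ and α₃, rotated by the angle 2x. Together with `C_apply` they
eliminate the connection forms other than A from σ. -/
theorem B_apply (h : 𝔤.IsStructured pr D G Z) (hp : pr p ∈ 𝔤.U)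
    (v : TangentSpace (𝓡 (4 * n + 1)) p) :
    𝔤.B pr p v = -(4 * (𝔤.u pr Z p)⁻¹ *
      ⟪𝔤.K pr p 2 (Z (pr p)), mfderiv (𝓡 (4 * n + 1)) (𝓡 (4 * n)) pr p v⟫_ℝ) := by
  have hu := (h.moment_pos hp).ne'
  have S := h.structureAt _ hp
  have e2 := S.moment_α₂ (mfderiv (𝓡 (4 * n + 1)) (𝓡 (4 * n)) pr p v)
  have e3 := S.moment_α₃ (mfderiv (𝓡 (4 * n + 1)) (𝓡 (4 * n)) pr p v)
  change 𝔤.u pr Z p * _ = _ at e2 e3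
  change sinTwo (𝔤.c p) * 𝔤.α₃ (pr p) _ + cosTwo (𝔤.c p) * 𝔤.α₂ (pr p) _ =
    -(4 * (𝔤.u pr Z p)⁻¹ * ⟪(sinTwo (𝔤.c p) • 𝔤.J 2 (pr p) - cosTwo (𝔤.c p) • 𝔤.J 1 (pr p))
      (Z (pr p)), _⟫_ℝ)
  rw [sub_apply, smul_apply, smul_apply, inner_sub_left, real_inner_smul_left,
    real_inner_smul_left]
  field_simp
  linear_combination sinTwo (𝔤.c p) * e3 + cosTwo (𝔤.c p) * e2

theorem C_apply (h : 𝔤.IsStructured pr D G Z) (hp : pr p ∈ 𝔤.U)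
    (v : TangentSpace (𝓡 (4 * n + 1)) p) :
    𝔤.C pr p v = 4 * (𝔤.u pr Z p)⁻¹ *
      ⟪𝔤.K pr p 1 (Z (pr p)), mfderiv (𝓡 (4 * n + 1)) (𝓡 (4 * n)) pr p v⟫_ℝ := by
  have hu := (h.moment_pos hp).ne'
  have S := h.structureAt _ hp
  have e2 := S.moment_α₂ (mfderiv (𝓡 (4 * n + 1)) (𝓡 (4 * n)) pr p v)
  have e3 := S.moment_α₃ (mfderiv (𝓡 (4 * n + 1)) (𝓡 (4 * n)) pr p v)
  change 𝔤.u pr Z p * _ = _ at e2 e3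
  change sinTwo (𝔤.c p) * 𝔤.α₂ (pr p) _ - cosTwo (𝔤.c p) * 𝔤.α₃ (pr p) _ =
    4 * (𝔤.u pr Z p)⁻¹ * ⟪(sinTwo (𝔤.c p) • 𝔤.J 1 (pr p) + cosTwo (𝔤.c p) • 𝔤.J 2 (pr p))
      (Z (pr p)), _⟫_ℝ
  rw [add_apply, smul_apply, smul_apply, inner_add_left, real_inner_smul_left,
    real_inner_smul_left]
  field_simp
  linear_combination sinTwo (𝔤.c p) * e2 - cosTwo (𝔤.c p) * e3

end Gauge.IsStructured

end Sigma

theorem d_neg {m k : ℕ} {X : Type*} [TopologicalSpace X]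
    [ChartedSpace (EuclideanSpace ℝ (Fin m)) X] (η : DForm m X k) (p : X) :
    d (-η) p = -d η p := by
  have h1 : inChart (-η) p = -inChart η p := rfl
  unfold d
  rw [h1]
  change (extDeriv (fun y ↦ -inChart η p y) _).compContinuousLinearMap _ = _
  unfold extDeriv
  rw [fderiv_fun_neg]
  have h2 := map_neg (ContinuousAlternatingMap.alternatizeUncurryFinCLM ℝ
    (EuclideanSpace ℝ (Fin m)) ℝ (n := k)) (fderiv ℝ (inChart η p) (extChartAt (𝓡 m) p p))
  refine (congrArg (fun B ↦ ContinuousAlternatingMap.compContinuousLinearMap B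
    (mfderiv (𝓡 m) (𝓡 m) (extChartAt (𝓡 m) p) p)) h2).trans ?_
  rfl

theorem quaternionRelations_rotate {V : Type*} [AddCommGroup V] [TopologicalSpace V]
    [IsTopologicalAddGroup V] [Module ℝ V] {J K : Fin 3 → V →L[ℝ] V} {c s : ℝ}
    (q : QuaternionRelations J) (hcs : c ^ 2 + s ^ 2 = 1) (h0 : ∀ v, K 0 v = J 0 v)
    (h1 : ∀ v, K 1 v = s • J 1 v + c • J 2 v) (h2 : ∀ v, K 2 v = s • J 2 v - c • J 1 v) :
    QuaternionRelations K := by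
  have s0 := q.sq 0
  have s1 := q.sq 1
  have s2 := q.sq 2
  have m01 := q.mul01
  have m12 := q.mul12
  have m20 := q.mul20
  have m10 := q.mul10
  have m21 := q.mul21
  have m02 := q.mul02
  have k00 : ∀ v, K 0 (K 0 v) = -v := fun v ↦ by rw [h0, h0, s0]
  have k11 : ∀ v, K 1 (K 1 v) = -v := fun v ↦ by
    simp only [h1, map_add, map_smul, s1, s2, m12, m21]
    linear_combination (norm := module) (-hcs) • v
  have k22 : ∀ v, K 2 (K 2 v) = -v := fun v ↦ by
    simp only [h2, map_sub, map_smul, s1, s2, m12, m21]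
    linear_combination (norm := module) (-hcs) • v
  have k01 : ∀ v, K 0 (K 1 v) = K 2 v := fun v ↦ by
    simp only [h0, h1, h2, map_add, map_smul, m01, m02]
    module
  have k12 : ∀ v, K 1 (K 2 v) = K 0 v := fun v ↦ by
    simp only [h0, h1, h2, map_sub, map_smul, s1, s2, m12, m21]
    linear_combination (norm := module) hcs • J 0 v
  have k20 : ∀ v, K 2 (K 0 v) = K 1 v := fun v ↦ by
    simp only [h0, h1, h2, m20, m10]
    module
  have k10 : ∀ v, K 1 (K 0 v) = -K 2 v := fun v ↦ by
    simp only [h0, h1, h2, m20, m10]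
    module
  have k21 : ∀ v, K 2 (K 1 v) = -K 0 v := fun v ↦ by
    simp only [h0, h1, h2, map_add, map_smul, s1, s2, m12, m21]
    linear_combination (norm := module) (-hcs) • J 0 v
  have k02 : ∀ v, K 0 (K 2 v) = -K 1 v := fun v ↦ by
    simp only [h0, h1, h2, map_sub, map_smul, m01, m02]
    module
  refine ⟨fun a v ↦ ?_, fun a v ↦ ?_, fun a v ↦ ?_⟩ <;> fin_cases a
  · exact k00 v
  · exact k11 v
  · exact k22 v
  · exact k01 v
  · exact k12 v
  · exact k20 v
  · exact k10 v
  · exact k21 v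
  · exact k02 v

/-! ### The explicit formula for σ, its smoothness and closedness -/

section Sigma

variable {n : ℕ}
  {N : Type*} [TopologicalSpace N]
  [ChartedSpace (EuclideanSpace ℝ (Fin (4 * n))) N] [IsManifold (𝓡 (4 * n)) ∞ N]
  [T2Space N] [RiemannianBundle (fun p : N ↦ TangentSpace (𝓡 (4 * n)) p)]
  [IsContMDiffRiemannianBundle (𝓡 (4 * n)) ∞ (EuclideanSpace ℝ (Fin (4 * n)))
      (fun p : N ↦ TangentSpace (𝓡 (4 * n)) p)]
  {D : AffineConnection (4 * n) N}
  {G : Π p : N, Submodule ℝ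
    (TangentSpace (𝓡 (4 * n)) p →L[ℝ] TangentSpace (𝓡 (4 * n)) p)}
  {Z : VectField (4 * n) N}
  {P : Type*} [TopologicalSpace P] [ChartedSpace (EuclideanSpace ℝ (Fin (4 * n + 1))) P]
  [IsManifold (𝓡 (4 * n + 1)) ∞ P]
  [MulAction Circle P] {pr : P → N} {𝔤 𝔤' : Gauge n N P}

namespace Gauge

theorem K_zero (pr : P → N) (p : P) : 𝔤.K pr p 0 = 𝔤.J 0 (pr p) := rfl

theorem K_one (pr : P → N) (p : P) (v : TangentSpace (𝓡 (4 * n)) (pr p)) :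
    𝔤.K pr p 1 v = sinTwo (𝔤.c p) • 𝔤.J 1 (pr p) v + cosTwo (𝔤.c p) • 𝔤.J 2 (pr p) v := rfl

theorem K_two (pr : P → N) (p : P) (v : TangentSpace (𝓡 (4 * n)) (pr p)) :
    𝔤.K pr p 2 v = sinTwo (𝔤.c p) • 𝔤.J 2 (pr p) v - cosTwo (𝔤.c p) • 𝔤.J 1 (pr p) v := rfl

namespace IsStructured

variable {p : P}

theorem mvfderiv_u_inv (h : 𝔤.IsStructured pr D G Z) (hp : pr p ∈ 𝔤.U)
    (v : TangentSpace (𝓡 (4 * n + 1)) p) :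
    mvfderiv (𝓡 (4 * n + 1)) (fun y ↦ (𝔤.u pr Z y)⁻¹) p v =
      4 * (𝔤.u pr Z p)⁻¹ ^ 2 *
        ⟪𝔤.J 0 (pr p) (Z (pr p)), mfderiv (𝓡 (4 * n + 1)) (𝓡 (4 * n)) pr p v⟫_ℝ := by
  rw [mvfderiv_inv ((h.smooth_u hp).mdifferentiableAt (by simp)) (h.moment_pos hp).ne',
    h.mvfderiv_u hp]
  ring

theorem smooth_u_inv (h : 𝔤.IsStructured pr D G Z) (hp : pr p ∈ 𝔤.U) :
    ContMDiffAt (𝓡 (4 * n + 1)) 𝓘(ℝ, ℝ) ∞ (fun y ↦ (𝔤.u pr Z y)⁻¹) p :=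
  contMDiffAt_inv_real (h.smooth_u hp) (h.moment_pos hp).ne'

/-- Expand -d(u⁻¹θ) = -d(u⁻¹)∧θ - u⁻¹dθ for θ = A, B, C and insert d(u⁻¹) = 4u⁻²(K₀Z)♭, B =
-4u⁻¹(K₂Z)♭, C = 4u⁻¹(K₁Z)♭. The three potentials look different, but the results are cyclic
permutations of one expression. -/
theorem σ_apply (h : 𝔤.IsStructured pr D G Z) (hp : pr p ∈ 𝔤.U) (b : Fin 3)
    (v w : TangentSpace (𝓡 (4 * n + 1)) p) :
    𝔤.σ pr Z b p ![v, w] = hkForm (𝔤.u pr Z p) (Z (pr p)) (fun b v ↦ 𝔤.K pr p b v) (𝔤.A pr p)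
      (mfderiv (𝓡 (4 * n + 1)) (𝓡 (4 * n)) pr p) b v w := by
  have hu := (h.moment_pos hp).ne'
  have hcs := cosTwo_sq_add_sinTwo_sq (𝔤.c p)
  fin_cases b
  · change -(d (toForm fun p ↦ (𝔤.u pr Z p)⁻¹ • 𝔤.A pr p) p ![v, w]) = _
    rw [d_smul (h.smooth_u_inv hp) (h.smooth_A hp), h.d_A hp, h.mvfderiv_u_inv hp,
      h.mvfderiv_u_inv hp]
    -- α₂∧α₃ = C∧B: the passage from (α₂, α₃) to (C, B) is a rotation, of determinant h² + f² = 1.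
    have e : pullCovect pr 𝔤.α₂ p v * pullCovect pr 𝔤.α₃ p w -
        pullCovect pr 𝔤.α₂ p w * pullCovect pr 𝔤.α₃ p v =
        𝔤.C pr p v * 𝔤.B pr p w - 𝔤.C pr p w * 𝔤.B pr p v := by
      simp only [Gauge.B, Gauge.C, add_apply, sub_apply, smul_apply, smul_eq_mul]
      linear_combination -(pullCovect pr 𝔤.α₂ p v * pullCovect pr 𝔤.α₃ p w -
        pullCovect pr 𝔤.α₂ p w * pullCovect pr 𝔤.α₃ p v) * hcs
    rw [e, h.B_apply hp, h.B_apply hp, h.C_apply hp, h.C_apply hp]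
    change _ = 4 * (𝔤.u pr Z p)⁻¹ ^ 2 * (𝔤.A pr p v * ⟪𝔤.K pr p 0 (Z (pr p)), _⟫_ℝ -
      𝔤.A pr p w * ⟪𝔤.K pr p 0 (Z (pr p)), _⟫_ℝ) -
      16 * (𝔤.u pr Z p)⁻¹ ^ 3 * (⟪𝔤.K pr p 1 (Z (pr p)), _⟫_ℝ * ⟪𝔤.K pr p 2 (Z (pr p)), _⟫_ℝ -
        ⟪𝔤.K pr p 1 (Z (pr p)), _⟫_ℝ * ⟪𝔤.K pr p 2 (Z (pr p)), _⟫_ℝ) +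
      4 * (𝔤.u pr Z p)⁻¹ * ⟪𝔤.K pr p 0 _, _⟫_ℝ
    rw [K_zero]
    ring
  · change -(d (toForm fun p ↦ (𝔤.u pr Z p)⁻¹ • 𝔤.B pr p) p ![v, w]) = _
    rw [d_smul (h.smooth_u_inv hp) (h.smooth_B hp), h.d_B hp, h.mvfderiv_u_inv hp,
      h.mvfderiv_u_inv hp, h.B_apply hp, h.B_apply hp, h.C_apply hp, h.C_apply hp]
    have e : sinTwo (𝔤.c p) * ⟪𝔤.J 1 (pr p) (mfderiv (𝓡 (4 * n + 1)) (𝓡 (4 * n)) pr p v),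
        mfderiv (𝓡 (4 * n + 1)) (𝓡 (4 * n)) pr p w⟫_ℝ +
        cosTwo (𝔤.c p) * ⟪𝔤.J 2 (pr p) (mfderiv (𝓡 (4 * n + 1)) (𝓡 (4 * n)) pr p v),
          mfderiv (𝓡 (4 * n + 1)) (𝓡 (4 * n)) pr p w⟫_ℝ =
        ⟪𝔤.K pr p 1 (mfderiv (𝓡 (4 * n + 1)) (𝓡 (4 * n)) pr p v),
          mfderiv (𝓡 (4 * n + 1)) (𝓡 (4 * n)) pr p w⟫_ℝ := by
      rw [K_one, inner_add_left, real_inner_smul_left, real_inner_smul_left]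
    rw [e]
    change _ = 4 * (𝔤.u pr Z p)⁻¹ ^ 2 * (𝔤.A pr p v * ⟪𝔤.K pr p 1 (Z (pr p)), _⟫_ℝ -
      𝔤.A pr p w * ⟪𝔤.K pr p 1 (Z (pr p)), _⟫_ℝ) -
      16 * (𝔤.u pr Z p)⁻¹ ^ 3 * (⟪𝔤.K pr p 2 (Z (pr p)), _⟫_ℝ * ⟪𝔤.K pr p 0 (Z (pr p)), _⟫_ℝ -
        ⟪𝔤.K pr p 2 (Z (pr p)), _⟫_ℝ * ⟪𝔤.K pr p 0 (Z (pr p)), _⟫_ℝ) +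
      4 * (𝔤.u pr Z p)⁻¹ * ⟪𝔤.K pr p 1 _, _⟫_ℝ
    rw [K_zero]
    ring
  · change -(d (toForm fun p ↦ (𝔤.u pr Z p)⁻¹ • 𝔤.C pr p) p ![v, w]) = _
    rw [d_smul (h.smooth_u_inv hp) (h.smooth_C hp), h.d_C hp, h.mvfderiv_u_inv hp,
      h.mvfderiv_u_inv hp, h.B_apply hp, h.B_apply hp, h.C_apply hp, h.C_apply hp]
    have e : sinTwo (𝔤.c p) * ⟪𝔤.J 2 (pr p) (mfderiv (𝓡 (4 * n + 1)) (𝓡 (4 * n)) pr p v),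
        mfderiv (𝓡 (4 * n + 1)) (𝓡 (4 * n)) pr p w⟫_ℝ -
        cosTwo (𝔤.c p) * ⟪𝔤.J 1 (pr p) (mfderiv (𝓡 (4 * n + 1)) (𝓡 (4 * n)) pr p v),
          mfderiv (𝓡 (4 * n + 1)) (𝓡 (4 * n)) pr p w⟫_ℝ =
        ⟪𝔤.K pr p 2 (mfderiv (𝓡 (4 * n + 1)) (𝓡 (4 * n)) pr p v),
          mfderiv (𝓡 (4 * n + 1)) (𝓡 (4 * n)) pr p w⟫_ℝ := by
      rw [K_two, inner_sub_left, real_inner_smul_left, real_inner_smul_left]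
    rw [e]
    change _ = 4 * (𝔤.u pr Z p)⁻¹ ^ 2 * (𝔤.A pr p v * ⟪𝔤.K pr p 2 (Z (pr p)), _⟫_ℝ -
      𝔤.A pr p w * ⟪𝔤.K pr p 2 (Z (pr p)), _⟫_ℝ) -
      16 * (𝔤.u pr Z p)⁻¹ ^ 3 * (⟪𝔤.K pr p 0 (Z (pr p)), _⟫_ℝ * ⟪𝔤.K pr p 1 (Z (pr p)), _⟫_ℝ -
        ⟪𝔤.K pr p 0 (Z (pr p)), _⟫_ℝ * ⟪𝔤.K pr p 1 (Z (pr p)), _⟫_ℝ) +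
      4 * (𝔤.u pr Z p)⁻¹ * ⟪𝔤.K pr p 2 _, _⟫_ℝ
    rw [K_zero]
    ring

theorem eventually_mem (h : 𝔤.IsStructured pr D G Z) (hp : pr p ∈ 𝔤.U) :
    ∀ᶠ y in 𝓝 p, pr y ∈ 𝔤.U :=
  (h.adapted.isOpen.preimage h.smooth_pr.continuous).mem_nhds hp

/-- Over U each form is exact with a smooth potential, from which smoothness and closedness follow.
-/
theorem exists_potential (h : 𝔤.IsStructured pr D G Z) (b : Fin 3) :
    ∃ θ : Covect (4 * n + 1) P, 𝔤.σ pr Z b = -d (toForm θ) ∧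
      ∀ p, pr p ∈ 𝔤.U → SmoothFormAt (toForm θ) p := by
  fin_cases b
  · exact ⟨_, σ_zero 𝔤 pr Z, fun p hp ↦ smoothFormAt_smul (h.smooth_u_inv hp) (h.smooth_A hp)⟩
  · exact ⟨_, σ_one 𝔤 pr Z, fun p hp ↦ smoothFormAt_smul (h.smooth_u_inv hp) (h.smooth_B hp)⟩
  · exact ⟨_, σ_two 𝔤 pr Z, fun p hp ↦ smoothFormAt_smul (h.smooth_u_inv hp) (h.smooth_C hp)⟩

theorem smooth_σ (h : 𝔤.IsStructured pr D G Z) (hp : pr p ∈ 𝔤.U) (b : Fin 3) :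
    SmoothFormAt (𝔤.σ pr Z b) p := by
  obtain ⟨θ, e, hθ⟩ := h.exists_potential b
  have h1 : SmoothFormAt (d (toForm θ)) p :=
    SmoothFormAt.extd ((h.eventually_mem hp).mono fun y hy ↦ hθ y hy)
  rw [e]
  exact ContDiffAt.neg h1

theorem d_σ (h : 𝔤.IsStructured pr D G Z) (hp : pr p ∈ 𝔤.U) (b : Fin 3) :
    d (𝔤.σ pr Z b) p = 0 := by
  obtain ⟨θ, e, hθ⟩ := h.exists_potential b
  have h0 : d (d (toForm θ)) p = 0 := d_d ((h.eventually_mem hp).mono fun y hy ↦ hθ y hy)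
  rw [e, d_neg, h0, neg_zero]

theorem quat (h : 𝔤.IsStructured pr D G Z) (hp : pr p ∈ 𝔤.U) :
    QuaternionRelations (𝔤.K pr p) := by
  have q := h.adapted.frame.relations _ hp
  have hcs := cosTwo_sq_add_sinTwo_sq (𝔤.c p)
  have e0 : ∀ v, 𝔤.K pr p 0 v = 𝔤.J 0 (pr p) v := fun v ↦ rfl
  have e1 := 𝔤.K_one pr p
  have e2 := 𝔤.K_two pr p
  exact quaternionRelations_rotate q hcs e0 e1 e2

theorem orth (h : 𝔤.IsStructured pr D G Z) (hp : pr p ∈ 𝔤.U) (b : Fin 3)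
    (v w : TangentSpace (𝓡 (4 * n)) (pr p)) :
    ⟪𝔤.K pr p b v, w⟫_ℝ = -⟪v, 𝔤.K pr p b w⟫_ℝ := by
  have q := h.adapted.skewJ hp
  fin_cases b
  · exact q 0 v w
  · change ⟪𝔤.K pr p 1 v, w⟫_ℝ = -⟪v, 𝔤.K pr p 1 w⟫_ℝ
    rw [K_one, K_one, inner_add_left, inner_add_right, real_inner_smul_left, real_inner_smul_left,
      real_inner_smul_right, real_inner_smul_right, q, q]
    ring
  · change ⟪𝔤.K pr p 2 v, w⟫_ℝ = -⟪v, 𝔤.K pr p 2 w⟫_ℝ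
    rw [K_two, K_two, inner_sub_left, inner_sub_right, real_inner_smul_left, real_inner_smul_left,
      real_inner_smul_right, real_inner_smul_right, q, q]
    ring

end IsStructured

end Gauge

end Sigma

theorem SmoothEndoOn.mdifferentiableAt_apply {m : ℕ} {X : Type*} [TopologicalSpace X]
    [ChartedSpace (EuclideanSpace ℝ (Fin m)) X] [IsManifold (𝓡 m) ∞ X] {J : EndoField m X}
    {U : Set X} (hJ : SmoothEndoOn J U) (hU : IsOpen U) {p : X} (hp : p ∈ U) {W : VectField m X}
    (hW : MDifferentiableAt (𝓡 m) (𝓡 m).tangent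
      (fun y ↦ (⟨y, W y⟩ : TangentBundle (𝓡 m) X)) p) :
    MDifferentiableAt (𝓡 m) (𝓡 m).tangent
      (fun y ↦ (⟨y, J y (W y)⟩ : TangentBundle (𝓡 m) X)) p := by
  have h1 := contMDiffAt_endo_iff.1 (hJ.contMDiffAt (hU.mem_nhds hp))
  have hx := mem_extChartAt_source (I := 𝓡 m) p
  rw [mdifferentiableAt_field_iff hx] at hW ⊢
  have e : fieldChart (fun z ↦ J z (W z)) p =ᶠ[𝓝 (extChartAt (𝓡 m) p p)]
      fun y ↦ endoChart J p y (fieldChart W p y) := by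
    filter_upwards [extChartAt_target_mem_nhds (I := 𝓡 m) p] with z hz
    exact fieldChart_endo _ _ _ hz
  exact ((h1.differentiableAt (by simp)).clm_apply hW).congr_of_eventuallyEq e

theorem exists_tangent_ne_zero {m : ℕ} (hm : 0 < m) {X : Type*} [TopologicalSpace X]
    [ChartedSpace (EuclideanSpace ℝ (Fin (4 * m))) X] (p : X) :
    ∃ v : TangentSpace (𝓡 (4 * m)) p, v ≠ 0 := by
  have : Nonempty (Fin (4 * m)) := ⟨⟨0, by omega⟩⟩
  have : Nontrivial (EuclideanSpace ℝ (Fin (4 * m))) := inferInstance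
  exact exists_ne (0 : EuclideanSpace ℝ (Fin (4 * m)))

/-! ### Independence of the gauge -/

section Sigma

variable {n : ℕ}
  {N : Type*} [TopologicalSpace N]
  [ChartedSpace (EuclideanSpace ℝ (Fin (4 * n))) N] [IsManifold (𝓡 (4 * n)) ∞ N]
  [T2Space N] [RiemannianBundle (fun p : N ↦ TangentSpace (𝓡 (4 * n)) p)]
  [IsContMDiffRiemannianBundle (𝓡 (4 * n)) ∞ (EuclideanSpace ℝ (Fin (4 * n)))
      (fun p : N ↦ TangentSpace (𝓡 (4 * n)) p)]
  {D : AffineConnection (4 * n) N}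
  {G : Π p : N, Submodule ℝ
    (TangentSpace (𝓡 (4 * n)) p →L[ℝ] TangentSpace (𝓡 (4 * n)) p)}
  {Z : VectField (4 * n) N}
  {P : Type*} [TopologicalSpace P] [ChartedSpace (EuclideanSpace ℝ (Fin (4 * n + 1))) P]
  [IsManifold (𝓡 (4 * n + 1)) ∞ P]
  [MulAction Circle P] {pr : P → N} {𝔤 𝔤' : Gauge n N P}

theorem mdifferentiableAt_inner {V W : VectField (4 * n) N} {p : N}
    (hV : MDifferentiableAt (𝓡 (4 * n)) (𝓡 (4 * n)).tangent
        (fun y ↦ (⟨y, V y⟩ : TangentBundle (𝓡 (4 * n)) N)) p)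
    (hW : MDifferentiableAt (𝓡 (4 * n)) (𝓡 (4 * n)).tangent
        (fun y ↦ (⟨y, W y⟩ : TangentBundle (𝓡 (4 * n)) N)) p) :
    MDifferentiableAt (𝓡 (4 * n)) 𝓘(ℝ, ℝ) (fun y ↦ ⟪V y, W y⟫_ℝ) p := by
  have : IsContMDiffRiemannianBundle (𝓡 (4 * n)) 1 (EuclideanSpace ℝ (Fin (4 * n)))
      (fun p : N ↦ TangentSpace (𝓡 (4 * n)) p) :=
    IsContMDiffRiemannianBundle.of_le (n := ∞) (n' := 1) (by norm_cast)
  exact MDifferentiableAt.inner_bundle (E := fun p : N ↦ TangentSpace (𝓡 (4 * n)) p)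
    (b := fun x ↦ x) hV hW

namespace Gauge.IsStructured

variable {p : P}

theorem mvfderiv_J (h : 𝔤.IsStructured pr D G Z) (hp : pr p ∈ 𝔤.U) (a : Fin 3)
    {V W : VectField (4 * n) N}
    (hV : MDifferentiableAt (𝓡 (4 * n)) (𝓡 (4 * n)).tangent
        (fun y ↦ (⟨y, V y⟩ : TangentBundle (𝓡 (4 * n)) N)) (pr p))
    (hW : MDifferentiableAt (𝓡 (4 * n)) (𝓡 (4 * n)).tangent
        (fun y ↦ (⟨y, W y⟩ : TangentBundle (𝓡 (4 * n)) N)) (pr p))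
    (v : TangentSpace (𝓡 (4 * n)) (pr p)) :
    mvfderiv (𝓡 (4 * n)) (fun y ↦ ⟪𝔤.J a y (W y), V y⟫_ℝ) (pr p) v =
      ⟪covEndo D (𝔤.J a) (pr p) v W, V (pr p)⟫_ℝ + ⟪𝔤.J a (pr p) (D W (pr p) v), V (pr p)⟫_ℝ +
        ⟪𝔤.J a (pr p) (W (pr p)), D V (pr p) v⟫_ℝ := by
  have hm := (h.adapted.frame.smooth a).mdifferentiableAt_apply h.adapted.isOpen hp hW
  rw [h.leviCivita.metric (pr p) (fun y ↦ 𝔤.J a y (W y)) V v hm hV]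
  unfold covEndo
  rw [inner_sub_left]
  ring

/-- Weak form of ∇K₁ = -A K₂ + C K₀ on P: differentiating h and f gives the 2dx in A, and the
connection forms on N give the rest. It characterises A by the rotated frame alone. -/
theorem mvfderiv_rotated (h : 𝔤.IsStructured pr D G Z) (hp : pr p ∈ 𝔤.U)
    {V W : VectField (4 * n) N}
    (hV : MDifferentiableAt (𝓡 (4 * n)) (𝓡 (4 * n)).tangent
        (fun y ↦ (⟨y, V y⟩ : TangentBundle (𝓡 (4 * n)) N)) (pr p))
    (hW : MDifferentiableAt (𝓡 (4 * n)) (𝓡 (4 * n)).tangent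
        (fun y ↦ (⟨y, W y⟩ : TangentBundle (𝓡 (4 * n)) N)) (pr p))
    (v : TangentSpace (𝓡 (4 * n + 1)) p) :
    mvfderiv (𝓡 (4 * n + 1)) (fun y ↦ ⟪𝔤.K pr y 1 (W (pr y)), V (pr y)⟫_ℝ) p v =
      -(𝔤.A pr p v * ⟪𝔤.K pr p 2 (W (pr p)), V (pr p)⟫_ℝ) +
        𝔤.C pr p v * ⟪𝔤.K pr p 0 (W (pr p)), V (pr p)⟫_ℝ +
        (⟪𝔤.K pr p 1 (D W (pr p) (mfderiv (𝓡 (4 * n + 1)) (𝓡 (4 * n)) pr p v)), V (pr p)⟫_ℝ +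
          ⟪𝔤.K pr p 1 (W (pr p)),
            D V (pr p) (mfderiv (𝓡 (4 * n + 1)) (𝓡 (4 * n)) pr p v)⟫_ℝ) := by
  have hc := (h.eventually_c hp).self_of_nhds
  have hm : ∀ a, MDifferentiableAt (𝓡 (4 * n)) 𝓘(ℝ, ℝ)
      (fun y ↦ ⟪𝔤.J a y (W y), V y⟫_ℝ) (pr p) := fun a ↦
    mdifferentiableAt_inner
      ((h.adapted.frame.smooth a).mdifferentiableAt_apply h.adapted.isOpen hp hW) hV
  have hprd : MDifferentiableAt (𝓡 (4 * n + 1)) (𝓡 (4 * n)) pr p :=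
    h.smooth_pr.mdifferentiableAt (by simp)
  have hm' : ∀ a, MDifferentiableAt (𝓡 (4 * n + 1)) 𝓘(ℝ, ℝ)
      (fun y ↦ ⟪𝔤.J a (pr y) (W (pr y)), V (pr y)⟫_ℝ) p := fun a ↦
    MDifferentiableAt.comp (I' := 𝓡 (4 * n)) p (hm a) hprd
  have hs := (contMDiffAt_sinTwo hc).mdifferentiableAt (by simp)
  have hcs := (contMDiffAt_cosTwo hc).mdifferentiableAt (by simp)
  have e : (fun y ↦ ⟪𝔤.K pr y 1 (W (pr y)), V (pr y)⟫_ℝ) = fun y ↦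
      sinTwo (𝔤.c y) * ⟪𝔤.J 1 (pr y) (W (pr y)), V (pr y)⟫_ℝ +
        cosTwo (𝔤.c y) * ⟪𝔤.J 2 (pr y) (W (pr y)), V (pr y)⟫_ℝ := by
    funext y
    rw [K_one, inner_add_left, real_inner_smul_left, real_inner_smul_left]
  have e1 := (mvfderiv_comp_map (hm 1) hprd v).trans (h.mvfderiv_J hp 1 hV hW _)
  have e2 := (mvfderiv_comp_map (hm 2) hprd v).trans (h.mvfderiv_J hp 2 hV hW _)
  obtain ⟨-, c1, c2⟩ := h.adapted.connection (pr p) hp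
    (mfderiv (𝓡 (4 * n + 1)) (𝓡 (4 * n)) pr p v) W hW
  rw [c1, inner_add_left, real_inner_smul_left, real_inner_smul_left] at e1
  rw [c2, inner_sub_left, real_inner_smul_left, real_inner_smul_left] at e2
  rw [e]
  have e3 : mvfderiv (𝓡 (4 * n + 1)) (fun y ↦
      sinTwo (𝔤.c y) * ⟪𝔤.J 1 (pr y) (W (pr y)), V (pr y)⟫_ℝ +
        cosTwo (𝔤.c y) * ⟪𝔤.J 2 (pr y) (W (pr y)), V (pr y)⟫_ℝ) p v =
      sinTwo (𝔤.c p) * mvfderiv (𝓡 (4 * n + 1))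
          (fun y ↦ ⟪𝔤.J 1 (pr y) (W (pr y)), V (pr y)⟫_ℝ) p v +
        ⟪𝔤.J 1 (pr p) (W (pr p)), V (pr p)⟫_ℝ *
          mvfderiv (𝓡 (4 * n + 1)) (fun y ↦ sinTwo (𝔤.c y)) p v +
      (cosTwo (𝔤.c p) * mvfderiv (𝓡 (4 * n + 1))
          (fun y ↦ ⟪𝔤.J 2 (pr y) (W (pr y)), V (pr y)⟫_ℝ) p v +
        ⟪𝔤.J 2 (pr p) (W (pr p)), V (pr p)⟫_ℝ *
          mvfderiv (𝓡 (4 * n + 1)) (fun y ↦ cosTwo (𝔤.c y)) p v) := by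
    have hf1 : MDifferentiableAt (𝓡 (4 * n + 1)) 𝓘(ℝ, ℝ)
        (fun y ↦ sinTwo (𝔤.c y) * ⟪𝔤.J 1 (pr y) (W (pr y)), V (pr y)⟫_ℝ) p := hs.mul (hm' 1)
    have hf2 : MDifferentiableAt (𝓡 (4 * n + 1)) 𝓘(ℝ, ℝ)
        (fun y ↦ cosTwo (𝔤.c y) * ⟪𝔤.J 2 (pr y) (W (pr y)), V (pr y)⟫_ℝ) p := hcs.mul (hm' 2)
    rw [mvfderiv_fun_add hf1 hf2, mvfderiv_fun_mul hs (hm' 1), mvfderiv_fun_mul hcs (hm' 2)]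
    rfl
  rw [e3, e1, e2, mvfderiv_sinTwo hc, mvfderiv_cosTwo hc, K_zero, K_one, K_one, K_two]
  simp only [inner_add_left, inner_sub_left, real_inner_smul_left]
  simp only [Gauge.A, Gauge.C, pullCovect, ContinuousLinearMap.comp_apply, sub_apply,
    smul_apply, smul_eq_mul]
  ring

/-- Compatibility is equality of K₁ and K₂; the remaining K₀ is their product. -/
theorem K_eq (h : 𝔤.IsStructured pr D G Z) (h' : 𝔤'.IsStructured pr D G Z)
    (hc : 𝔤.Compatible 𝔤' pr) (hp : pr p ∈ 𝔤.U) (hp' : pr p ∈ 𝔤'.U) (b : Fin 3) :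
    𝔤.K pr p b = 𝔤'.K pr p b := by
  have h1 : 𝔤.K pr p 1 = 𝔤'.K pr p 1 := (hc p hp hp').1
  have h2 : 𝔤.K pr p 2 = 𝔤'.K pr p 2 := (hc p hp hp').2
  fin_cases b
  · ext1 v
    change 𝔤.K pr p 0 v = 𝔤'.K pr p 0 v
    rw [← (h.quat hp).mul12, ← (h'.quat hp').mul12, h1, h2]
  · exact h1
  · exact h2

theorem covDeriv_K_one (h : 𝔤.IsStructured pr D G Z) (hp : pr p ∈ 𝔤.U)
    (v : TangentSpace (𝓡 (4 * n)) (pr p)) :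
    covDeriv D Z (pr p) (𝔤.K pr p 1 v) - 𝔤.K pr p 1 (covDeriv D Z (pr p) v) =
      𝔤.u pr Z p • 𝔤.K pr p 2 v := by
  have S := h.structureAt _ hp
  have c1 := S.comm₁ v
  have c2 := S.comm₂ v
  rw [sub_eq_iff_eq_add] at c1 c2
  rw [K_one, K_one, K_two, map_add, map_smul, map_smul, c1, c2]
  unfold Gauge.u
  module

/-- u is the factor in [∇Z, K₁] = u K₂, where ∇Z, K₁ and K₂ do not depend on the gauge, and K₂ is
injective. -/
theorem u_eq (h : 𝔤.IsStructured pr D G Z) (h' : 𝔤'.IsStructured pr D G Z) (hn : 0 < n)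
    (hc : 𝔤.Compatible 𝔤' pr) (hp : pr p ∈ 𝔤.U) (hp' : pr p ∈ 𝔤'.U) :
    𝔤.u pr Z p = 𝔤'.u pr Z p := by
  obtain ⟨v, hv⟩ := exists_tangent_ne_zero hn (pr p)
  have h1 := (h.covDeriv_K_one hp v).symm.trans
    ((congrArg (fun K : TangentSpace (𝓡 (4 * n)) (pr p) →L[ℝ] TangentSpace (𝓡 (4 * n)) (pr p) ↦
      covDeriv D Z (pr p) (K v) - K (covDeriv D Z (pr p) v)) (h.K_eq h' hc hp hp' 1)).trans
      (h'.covDeriv_K_one hp' v))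
  rw [← h.K_eq h' hc hp hp' 2] at h1
  have hK : 𝔤.K pr p 2 v ≠ 0 := by
    intro h0
    have := (h.quat hp).sq 2 v
    rw [h0, map_zero] at this
    exact hv (neg_eq_zero.1 this.symm)
  exact smul_left_injective ℝ hK h1

/-- In `mvfderiv_rotated` with W extending w and V extending K₂w, the C term drops out because K₀w
is orthogonal to K₂w. What is left besides A is the same for both gauges, and ‖K₂w‖² ≠ 0. -/
theorem A_eq (h : 𝔤.IsStructured pr D G Z) (h' : 𝔤'.IsStructured pr D G Z) (hn : 0 < n)
    (hc : 𝔤.Compatible 𝔤' pr) (hp : pr p ∈ 𝔤.U) (hp' : pr p ∈ 𝔤'.U)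
    (v : TangentSpace (𝓡 (4 * n + 1)) p) : 𝔤.A pr p v = 𝔤'.A pr p v := by
  obtain ⟨w, hw⟩ := exists_tangent_ne_zero hn (pr p)
  have q := h.quat hp
  have hs := mem_extChartAt_source (I := 𝓡 (4 * n)) (pr p)
  have hW := mdifferentiableAt_frameField (pr p) hs w
  have hV := mdifferentiableAt_frameField (pr p) hs (𝔤.K pr p 2 w)
  have e1 := h.mvfderiv_rotated hp hV hW v
  have e2 := h'.mvfderiv_rotated hp' hV hW v
  have e : (fun y ↦ ⟪𝔤.K pr y 1 (frameField (pr p) w (pr y)),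
      frameField (pr p) (𝔤.K pr p 2 w) (pr y)⟫_ℝ) =ᶠ[𝓝 p]
      fun y ↦ ⟪𝔤'.K pr y 1 (frameField (pr p) w (pr y)),
        frameField (pr p) (𝔤.K pr p 2 w) (pr y)⟫_ℝ := by
    filter_upwards [h.eventually_mem hp, h'.eventually_mem hp'] with y hy hy'
    rw [h.K_eq h' hc hy hy']
  have e0 := congrArg (fun B ↦ B v) (e.mfderiv_eq (I := 𝓡 (4 * n + 1)) (I' := 𝓘(ℝ, ℝ)))
  have e3 := e1.symm.trans (e0.trans e2)
  have f1 : frameField (pr p) w (pr p) = w := frameField_self _ _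
  have f2 : frameField (pr p) (𝔤.K pr p 2 w) (pr p) = 𝔤.K pr p 2 w := frameField_self _ _
  rw [← h.K_eq h' hc hp hp', ← h.K_eq h' hc hp hp', ← h.K_eq h' hc hp hp', f1, f2] at e3
  have i1 : ⟪𝔤.K pr p 2 w, 𝔤.K pr p 2 w⟫_ℝ ≠ 0 := by
    rw [h.orth hp, q.sq, inner_neg_right, neg_neg]
    exact inner_self_ne_zero.2 hw
  have i2 : ⟪𝔤.K pr p 0 w, 𝔤.K pr p 2 w⟫_ℝ = 0 := by
    rw [h.orth hp, q.mul02, inner_neg_right, neg_neg]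
    have := h.orth hp 1 w w
    rw [real_inner_comm] at this
    linarith
  rw [i2] at e3
  refine mul_right_cancel₀ i1 ?_
  linarith

theorem σ_eq (h : 𝔤.IsStructured pr D G Z) (h' : 𝔤'.IsStructured pr D G Z) (hn : 0 < n)
    (hc : 𝔤.Compatible 𝔤' pr) (hp : pr p ∈ 𝔤.U) (hp' : pr p ∈ 𝔤'.U) (b : Fin 3) :
    𝔤.σ pr Z b p = 𝔤'.σ pr Z b p := by
  ext v
  have e : v = ![v 0, v 1] := by
    funext i
    fin_cases i <;> rfl
  rw [e, h.σ_apply hp, h'.σ_apply hp', h.u_eq h' hn hc hp hp']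
  have e1 : (fun b v ↦ 𝔤.K pr p b v) = fun b v ↦ 𝔤'.K pr p b v := by
    funext b v
    rw [h.K_eq h' hc hp hp']
  rw [e1]
  unfold hkForm
  rw [h.A_eq h' hn hc hp hp', h.A_eq h' hn hc hp hp']

end Gauge.IsStructured

end Sigma

/-! ### Naturality of the angle form -/

section Angle

variable {m m' : ℕ}
  {X : Type*} [TopologicalSpace X] [ChartedSpace (EuclideanSpace ℝ (Fin m)) X]
  [IsManifold (𝓡 m) ∞ X]
  {Y : Type*} [TopologicalSpace Y] [ChartedSpace (EuclideanSpace ℝ (Fin m')) Y]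
  [IsManifold (𝓡 m') ∞ Y]

theorem dAngle_comp {F : X → Y} {c : Y → Circle} {p : X}
    (hc : ContMDiffAt (𝓡 m') (𝓡 1) ∞ c (F p)) (hF : MDifferentiableAt (𝓡 m) (𝓡 m') F p)
    (v : TangentSpace (𝓡 m) p) :
    dAngle (fun y ↦ c (F y)) p v = dAngle c (F p) (mfderiv (𝓡 m) (𝓡 m') F p v) := by
  have h := mfderiv_comp p (g := fun y ↦ (c y : ℂ))
    ((contMDiffAt_coe_circle hc).mdifferentiableAt (by simp)) hF
  exact congrArg (fun B : TangentSpace (𝓡 m) p →L[ℝ] ℂ ↦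
    (starRingEnd ℂ (c (F p) : ℂ) * B v).im) h

theorem dAngle_mul_left (z : Circle) {c : X → Circle} {p : X}
    (hc : ContMDiffAt (𝓡 m) (𝓡 1) ∞ c p) (v : TangentSpace (𝓡 m) p) :
    dAngle (fun y ↦ z * c y) p v = dAngle c p v := by
  have h := mvfderiv_clm_comp (ContinuousLinearMap.mul ℝ ℂ (z : ℂ))
    ((contMDiffAt_coe_circle hc).mdifferentiableAt (by simp)) v
  change (starRingEnd ℂ ((z * c p : Circle) : ℂ) *
    mvfderiv (𝓡 m) (fun y ↦ ((z * c y : Circle) : ℂ)) p v).im = (starRingEnd ℂ (c p : ℂ) *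
      mvfderiv (𝓡 m) (fun y ↦ (c y : ℂ)) p v).im
  have e : (fun y ↦ ((z * c y : Circle) : ℂ)) =
    fun y ↦ ContinuousLinearMap.mul ℝ ℂ (z : ℂ) (c y : ℂ) := rfl
  have hz : starRingEnd ℂ (z : ℂ) * (z : ℂ) = 1 := by
    rw [mul_comm, Complex.mul_conj, Circle.normSq_coe, Complex.ofReal_one]
  rw [e, h, Circle.coe_mul, map_mul, ContinuousLinearMap.mul_apply']
  congr 1
  linear_combination (starRingEnd ℂ (c p : ℂ) * mvfderiv (𝓡 m) (fun y ↦ (c y : ℂ)) p v) * hz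

theorem dAngle_congr {c c' : X → Circle} {p : X} (h : c =ᶠ[𝓝 p] c') :
    dAngle (m := m) c p = dAngle (m := m) c' p := by
  have e : (fun y ↦ (c y : ℂ)) =ᶠ[𝓝 p] fun y ↦ (c' y : ℂ) := h.fun_comp _
  have e2 : mvfderiv (𝓡 m) (fun y ↦ (c y : ℂ)) p = mvfderiv (𝓡 m) (fun y ↦ (c' y : ℂ)) p :=
    e.mfderiv_eq
  unfold dAngle
  rw [e2, h.self_of_nhds]

/-- The pullback of a field of covectors. -/
def pullCov (F : X → Y) (θ : Covect m' Y) : Covect m X :=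
  fun p ↦ (θ (F p)).comp (mfderiv (𝓡 m) (𝓡 m') F p)

theorem pullback_neg_d_toForm {F : X → Y} {θ : Covect m' Y} {p : X}
    (hθ : SmoothFormAt (toForm θ) (F p)) (hF : ContMDiffAt (𝓡 m) (𝓡 m') ∞ F p) :
    pullback (m := m) (m' := m') F (-d (toForm θ)) p = -d (toForm (pullCov F θ)) p := by
  have h := d_pullback hθ hF
  have e : toForm (pullCov F θ) = pullback (m := m) (m' := m') F (toForm θ) := by
    funext p
    ext v
    rfl
  rw [e, h]
  rfl

end Angle

/-! ### The principal circle action and its vertical vectors -/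

section Action

variable {n : ℕ}
  {N : Type*} [TopologicalSpace N]
  [ChartedSpace (EuclideanSpace ℝ (Fin (4 * n))) N] [IsManifold (𝓡 (4 * n)) ∞ N]
  {P : Type*} [TopologicalSpace P] [ChartedSpace (EuclideanSpace ℝ (Fin (4 * n + 1))) P]
  [IsManifold (𝓡 (4 * n + 1)) ∞ P]
  [MulAction Circle P] {pr : P → N}

namespace IsPrincipalCircleBundle

theorem smooth_smul (h : IsPrincipalCircleBundle n pr) (z : Circle) :
    ContMDiff (𝓡 (4 * n + 1)) (𝓡 (4 * n + 1)) ∞ (fun p : P ↦ z • p) :=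
  h.smooth_action.comp (contMDiff_const.prodMk contMDiff_id)

theorem pr_smul (h : IsPrincipalCircleBundle n pr) (z : Circle) (p : P) : pr (z • p) = pr p :=
  ((h.fibre _ _).2 ⟨z, rfl⟩).symm

theorem pullCovect_smul (h : IsPrincipalCircleBundle n pr) (θ : Covect (4 * n) N) (z : Circle)
    (p : P) (v : TangentSpace (𝓡 (4 * n + 1)) p) :
    pullCovect pr θ (z • p) (mfderiv (𝓡 (4 * n + 1)) (𝓡 (4 * n + 1)) (fun y : P ↦ z • y) p v) =
      pullCovect pr θ p v := by
  have e : (fun y ↦ pr (z • y)) = pr := funext (h.pr_smul z)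
  have h1 := mfderiv_comp p (g := pr) (f := fun y : P ↦ z • y)
    (h.smooth.mdifferentiableAt (I := 𝓡 (4 * n + 1)) (I' := 𝓡 (4 * n)) (by simp))
    ((h.smooth_smul z).mdifferentiableAt (by simp))
  have h2 : pullCovect (fun y ↦ pr (z • y)) θ p v = pullCovect pr θ p v := by rw [e]
  rw [← h2]
  exact (congrArg (fun B ↦ θ (pr (z • p)) (B v)) h1).symm

/-- The vector is the velocity at t = 0 of t ↦ e^{it}·p. Equivariance makes a fibre coordinate
restrict to e^{it}c(p) on this curve, whence dx = 1. -/
theorem exists_vertical (h : IsPrincipalCircleBundle n pr) (p : P) :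
    ∃ X : TangentSpace (𝓡 (4 * n + 1)) p, mfderiv (𝓡 (4 * n + 1)) (𝓡 (4 * n)) pr p X = 0 ∧
      ∀ c : P → Circle, ContMDiffAt (𝓡 (4 * n + 1)) (𝓡 1) ∞ c p →
        (∀ z : Circle, c (z • p) = z * c p) → dAngle c p X = 1 := by
  let γ : ℝ → P := fun t ↦ Circle.exp t • p
  have hγ : ContMDiff 𝓘(ℝ, ℝ) (𝓡 (4 * n + 1)) ∞ γ :=
    h.smooth_action.comp ((contMDiff_circleExp).prodMk contMDiff_const)
  have hd : MDifferentiableAt 𝓘(ℝ, ℝ) (𝓡 (4 * n + 1)) γ 0 := hγ.mdifferentiableAt (by simp)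
  have h0 : γ 0 = p := by
    change Circle.exp 0 • p = p
    rw [Circle.exp_zero, one_smul]
  have hγ' : ∀ t, γ t = Circle.exp t • γ 0 := fun t ↦ by rw [h0]
  -- Working at `γ 0` keeps the velocity in the right tangent space; the equality with `p` is used
  -- only once, here.
  suffices H : ∃ X : TangentSpace (𝓡 (4 * n + 1)) (γ 0),
      mfderiv (𝓡 (4 * n + 1)) (𝓡 (4 * n)) pr (γ 0) X = 0 ∧
      ∀ c : P → Circle, ContMDiffAt (𝓡 (4 * n + 1)) (𝓡 1) ∞ c (γ 0) →
        (∀ z : Circle, c (z • γ 0) = z * c (γ 0)) → dAngle c (γ 0) X = 1 by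
    rwa [h0] at H
  refine ⟨mfderiv 𝓘(ℝ, ℝ) (𝓡 (4 * n + 1)) γ 0 (1 : ℝ), ?_, fun c hc he ↦ ?_⟩
  · have h1 := mfderiv_comp (0 : ℝ) (g := pr) (f := γ)
      (h.smooth.mdifferentiableAt (I := 𝓡 (4 * n + 1)) (I' := 𝓡 (4 * n)) (by simp)) hd
    have e : pr ∘ γ = fun _ ↦ pr p := funext fun t ↦ h.pr_smul _ _
    have h2 : mfderiv 𝓘(ℝ, ℝ) (𝓡 (4 * n)) (pr ∘ γ) 0 = 0 := by
      rw [e]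
      exact mfderiv_const
    rw [h2] at h1
    exact (congrArg (fun B ↦ B (1 : ℝ)) h1).symm
  · have h1 := mfderiv_comp (0 : ℝ) (g := fun y ↦ (c y : ℂ)) (f := γ)
      ((contMDiffAt_coe_circle hc).mdifferentiableAt (by simp)) hd
    have e : (fun y ↦ (c y : ℂ)) ∘ γ = fun t : ℝ ↦ Complex.exp (t * Complex.I) * (c (γ 0) : ℂ) := by
      funext t
      change (c (γ t) : ℂ) = _
      rw [hγ', he, Circle.coe_mul, Circle.coe_exp]
    have h2 : HasDerivAt (fun t : ℝ ↦ Complex.exp (t * Complex.I) * (c (γ 0) : ℂ))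
        (Complex.I * (c (γ 0) : ℂ)) 0 := by
      have h3 : HasDerivAt (fun t : ℝ ↦ (t : ℂ) * Complex.I) Complex.I 0 := by
        simpa using (HasDerivAt.ofReal_comp (hasDerivAt_id (0 : ℝ))).mul_const Complex.I
      simpa using h3.cexp.mul_const (c (γ 0) : ℂ)
    rw [e, mfderiv_eq_fderiv, h2.hasFDerivAt.fderiv] at h1
    have h4 : mvfderiv (𝓡 (4 * n + 1)) (fun y ↦ (c y : ℂ)) (γ 0)
        (mfderiv 𝓘(ℝ, ℝ) (𝓡 (4 * n + 1)) γ 0 (1 : ℝ)) = Complex.I * (c (γ 0) : ℂ) := by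
      refine (congrArg (fun B : ℝ →L[ℝ] ℂ ↦ B (1 : ℝ)) h1).symm.trans ?_
      change (1 : ℝ) • (Complex.I * (c (γ 0) : ℂ)) = _
      rw [one_smul]
    change (starRingEnd ℂ (c (γ 0) : ℂ) * mvfderiv (𝓡 (4 * n + 1)) (fun y ↦ (c y : ℂ)) (γ 0)
        (mfderiv 𝓘(ℝ, ℝ) (𝓡 (4 * n + 1)) γ 0 (1 : ℝ))).im = 1
    rw [h4]
    have h5 := re_sq_add_im_sq (c (γ 0))
    simp only [Complex.mul_im, Complex.mul_re, Complex.conj_re, Complex.conj_im, Complex.I_re,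
      Complex.I_im]
    linear_combination h5

end IsPrincipalCircleBundle

end Action

/-! ### The circle action on the forms over one gauge -/

section Sigma

variable {n : ℕ}
  {N : Type*} [TopologicalSpace N]
  [ChartedSpace (EuclideanSpace ℝ (Fin (4 * n))) N] [IsManifold (𝓡 (4 * n)) ∞ N]
  [T2Space N] [RiemannianBundle (fun p : N ↦ TangentSpace (𝓡 (4 * n)) p)]
  [IsContMDiffRiemannianBundle (𝓡 (4 * n)) ∞ (EuclideanSpace ℝ (Fin (4 * n)))
      (fun p : N ↦ TangentSpace (𝓡 (4 * n)) p)]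
  {D : AffineConnection (4 * n) N}
  {G : Π p : N, Submodule ℝ
    (TangentSpace (𝓡 (4 * n)) p →L[ℝ] TangentSpace (𝓡 (4 * n)) p)}
  {Z : VectField (4 * n) N}
  {P : Type*} [TopologicalSpace P] [ChartedSpace (EuclideanSpace ℝ (Fin (4 * n + 1))) P]
  [IsManifold (𝓡 (4 * n + 1)) ∞ P]
  [MulAction Circle P] {pr : P → N} {𝔤 : Gauge n N P}

namespace Gauge.IsStructured

variable {p : P}

theorem dAngle_smul (h : 𝔤.IsStructured pr D G Z) (hP : IsPrincipalCircleBundle n pr)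
    (z : Circle) (hp : pr p ∈ 𝔤.U) (v : TangentSpace (𝓡 (4 * n + 1)) p) :
    dAngle 𝔤.c (z • p) (mfderiv (𝓡 (4 * n + 1)) (𝓡 (4 * n + 1)) (fun y : P ↦ z • y) p v) =
      dAngle 𝔤.c p v := by
  have hp' : pr (z • p) ∈ 𝔤.U := by rwa [hP.pr_smul]
  have hc := (h.eventually_c hp).self_of_nhds
  have e : (fun y ↦ 𝔤.c (z • y)) =ᶠ[𝓝 p] fun y ↦ z * 𝔤.c y := by
    filter_upwards [h.eventually_mem hp] with y hy
    exact h.adapted.equivariant z y hy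
  rw [← dAngle_comp (F := fun y : P ↦ z • y) (h.eventually_c hp').self_of_nhds
    ((hP.smooth_smul z).mdifferentiableAt (by simp)), dAngle_congr (m := 4 * n + 1) e, dAngle_mul_left z hc]

theorem u_smul (hP : IsPrincipalCircleBundle n pr) (z : Circle) (p : P) :
    𝔤.u pr Z (z • p) = 𝔤.u pr Z p := by
  unfold Gauge.u
  rw [hP.pr_smul]

theorem A_smul (h : 𝔤.IsStructured pr D G Z) (hP : IsPrincipalCircleBundle n pr)
    (z : Circle) (hp : pr p ∈ 𝔤.U) (v : TangentSpace (𝓡 (4 * n + 1)) p) :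
    𝔤.A pr (z • p) (mfderiv (𝓡 (4 * n + 1)) (𝓡 (4 * n + 1)) (fun y : P ↦ z • y) p v) =
      𝔤.A pr p v := by
  have h1 := h.dAngle_smul hP z hp v
  have h2 := hP.pullCovect_smul 𝔤.β z p v
  change (2 : ℝ) * dAngle 𝔤.c (z • p) _ - pullCovect pr 𝔤.β (z • p) _ =
    (2 : ℝ) * dAngle 𝔤.c p v - pullCovect pr 𝔤.β p v
  rw [← h1, ← h2]

theorem pullback_smul_σ_zero (h : 𝔤.IsStructured pr D G Z) (hP : IsPrincipalCircleBundle n pr)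
    (z : Circle) (hp : pr p ∈ 𝔤.U) :
    pullback (m := 4 * n + 1) (m' := 4 * n + 1) (fun y : P ↦ z • y) (𝔤.σ pr Z 0) p =
      𝔤.σ pr Z 0 p := by
  have hp' : pr (z • p) ∈ 𝔤.U := by rwa [hP.pr_smul]
  rw [σ_zero, pullback_neg_d_toForm (smoothFormAt_smul (h.smooth_u_inv hp') (h.smooth_A hp'))
    (hP.smooth_smul z).contMDiffAt]
  refine congrArg Neg.neg (d_congr ?_)
  filter_upwards [h.eventually_mem hp] with y hy
  ext v
  change (𝔤.u pr Z (z • y))⁻¹ * 𝔤.A pr (z • y) (mfderiv _ _ _ y (v 0)) =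
    (𝔤.u pr Z y)⁻¹ * 𝔤.A pr y (v 0)
  rw [h.A_smul hP z hy, u_smul hP]

/-- u, α₂ and α₃ come from N and are unchanged, while the pair (f, h) turns by twice the angle of z.
So B pulls back to the combination cos 2s · B - sin 2s · C already at the level of potentials. -/
theorem pullback_smul_σ_one (h : 𝔤.IsStructured pr D G Z) (hP : IsPrincipalCircleBundle n pr)
    (z : Circle) (hp : pr p ∈ 𝔤.U) :
    pullback (m := 4 * n + 1) (m' := 4 * n + 1) (fun y : P ↦ z • y) (𝔤.σ pr Z 1) p =
      cosTwo z • 𝔤.σ pr Z 1 p - sinTwo z • 𝔤.σ pr Z 2 p := by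
  have hp' : pr (z • p) ∈ 𝔤.U := by rwa [hP.pr_smul]
  have sB := smoothFormAt_smul (h.smooth_u_inv hp) (h.smooth_B hp)
  have sC := smoothFormAt_smul (h.smooth_u_inv hp) (h.smooth_C hp)
  have e : ∀ᶠ y in 𝓝 p, toForm (pullCov (m := 4 * n + 1) (m' := 4 * n + 1) (fun y : P ↦ z • y)
      (fun p ↦ (𝔤.u pr Z p)⁻¹ • 𝔤.B pr p)) y =
      toForm (fun y ↦ cosTwo z • ((𝔤.u pr Z y)⁻¹ • 𝔤.B pr y) -
        sinTwo z • ((𝔤.u pr Z y)⁻¹ • 𝔤.C pr y)) y := by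
    filter_upwards [h.eventually_mem hp] with y hy
    ext v
    have e2 := hP.pullCovect_smul 𝔤.α₂ z y (v 0)
    have e3 := hP.pullCovect_smul 𝔤.α₃ z y (v 0)
    change (𝔤.u pr Z (z • y))⁻¹ * (sinTwo (𝔤.c (z • y)) * pullCovect pr 𝔤.α₃ (z • y)
        (mfderiv (𝓡 (4 * n + 1)) (𝓡 (4 * n + 1)) (fun y : P ↦ z • y) y (v 0)) +
      cosTwo (𝔤.c (z • y)) * pullCovect pr 𝔤.α₂ (z • y)
        (mfderiv (𝓡 (4 * n + 1)) (𝓡 (4 * n + 1)) (fun y : P ↦ z • y) y (v 0))) =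
      cosTwo z * ((𝔤.u pr Z y)⁻¹ * (sinTwo (𝔤.c y) * pullCovect pr 𝔤.α₃ y (v 0) +
        cosTwo (𝔤.c y) * pullCovect pr 𝔤.α₂ y (v 0))) -
      sinTwo z * ((𝔤.u pr Z y)⁻¹ * (sinTwo (𝔤.c y) * pullCovect pr 𝔤.α₂ y (v 0) -
        cosTwo (𝔤.c y) * pullCovect pr 𝔤.α₃ y (v 0)))
    rw [u_smul hP, h.adapted.equivariant z y hy, e2, e3, sinTwo_mul, cosTwo_mul]
    ring
  rw [σ_one, σ_two, pullback_neg_d_toForm (smoothFormAt_smul (h.smooth_u_inv hp') (h.smooth_B hp'))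
    (hP.smooth_smul z).contMDiffAt, d_congr e]
  ext v
  have ev : v = ![v 0, v 1] := by
    funext i
    fin_cases i <;> rfl
  rw [ev]
  have h1 := d_sub (smoothFormAt_smul (f := fun _ ↦ cosTwo z) contMDiffAt_const sB)
    (smoothFormAt_smul (f := fun _ ↦ sinTwo z) contMDiffAt_const sC) (v 0) (v 1)
  rw [d_const_smul _ sB, d_const_smul _ sC] at h1
  change -(d _ p ![v 0, v 1]) = cosTwo z * -(d _ p ![v 0, v 1]) - sinTwo z * -(d _ p ![v 0, v 1])
  rw [h1]
  ring

theorem pullback_smul_σ_two (h : 𝔤.IsStructured pr D G Z) (hP : IsPrincipalCircleBundle n pr)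
    (z : Circle) (hp : pr p ∈ 𝔤.U) :
    pullback (m := 4 * n + 1) (m' := 4 * n + 1) (fun y : P ↦ z • y) (𝔤.σ pr Z 2) p =
      sinTwo z • 𝔤.σ pr Z 1 p + cosTwo z • 𝔤.σ pr Z 2 p := by
  have hp' : pr (z • p) ∈ 𝔤.U := by rwa [hP.pr_smul]
  have sB := smoothFormAt_smul (h.smooth_u_inv hp) (h.smooth_B hp)
  have sC := smoothFormAt_smul (h.smooth_u_inv hp) (h.smooth_C hp)
  have e : ∀ᶠ y in 𝓝 p, toForm (pullCov (m := 4 * n + 1) (m' := 4 * n + 1) (fun y : P ↦ z • y)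
      (fun p ↦ (𝔤.u pr Z p)⁻¹ • 𝔤.C pr p)) y =
      toForm (fun y ↦ sinTwo z • ((𝔤.u pr Z y)⁻¹ • 𝔤.B pr y) +
        cosTwo z • ((𝔤.u pr Z y)⁻¹ • 𝔤.C pr y)) y := by
    filter_upwards [h.eventually_mem hp] with y hy
    ext v
    have e2 := hP.pullCovect_smul 𝔤.α₂ z y (v 0)
    have e3 := hP.pullCovect_smul 𝔤.α₃ z y (v 0)
    change (𝔤.u pr Z (z • y))⁻¹ * (sinTwo (𝔤.c (z • y)) * pullCovect pr 𝔤.α₂ (z • y)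
        (mfderiv (𝓡 (4 * n + 1)) (𝓡 (4 * n + 1)) (fun y : P ↦ z • y) y (v 0)) -
      cosTwo (𝔤.c (z • y)) * pullCovect pr 𝔤.α₃ (z • y)
        (mfderiv (𝓡 (4 * n + 1)) (𝓡 (4 * n + 1)) (fun y : P ↦ z • y) y (v 0))) =
      sinTwo z * ((𝔤.u pr Z y)⁻¹ * (sinTwo (𝔤.c y) * pullCovect pr 𝔤.α₃ y (v 0) +
        cosTwo (𝔤.c y) * pullCovect pr 𝔤.α₂ y (v 0))) +
      cosTwo z * ((𝔤.u pr Z y)⁻¹ * (sinTwo (𝔤.c y) * pullCovect pr 𝔤.α₂ y (v 0) -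
        cosTwo (𝔤.c y) * pullCovect pr 𝔤.α₃ y (v 0)))
    rw [u_smul hP, h.adapted.equivariant z y hy, e2, e3, sinTwo_mul, cosTwo_mul]
    ring
  rw [σ_one, σ_two, pullback_neg_d_toForm (smoothFormAt_smul (h.smooth_u_inv hp') (h.smooth_C hp'))
    (hP.smooth_smul z).contMDiffAt, d_congr e]
  ext v
  have ev : v = ![v 0, v 1] := by
    funext i
    fin_cases i <;> rfl
  rw [ev]
  have h1 := d_add (smoothFormAt_smul (f := fun _ ↦ sinTwo z) contMDiffAt_const sB)
    (smoothFormAt_smul (f := fun _ ↦ cosTwo z) contMDiffAt_const sC) (v 0) (v 1)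
  rw [d_const_smul _ sB, d_const_smul _ sC] at h1
  change -(d _ p ![v 0, v 1]) = sinTwo z * -(d _ p ![v 0, v 1]) + cosTwo z * -(d _ p ![v 0, v 1])
  rw [h1]
  ring

end Gauge.IsStructured

end Sigma

/-! ### Orbits of a vector field and kernels of submersions -/

section Orbits

variable {m m' : ℕ}
  {X : Type*} [TopologicalSpace X] [ChartedSpace (EuclideanSpace ℝ (Fin m)) X]
  [IsManifold (𝓡 m) ∞ X]
  {Y : Type*} [TopologicalSpace Y] [ChartedSpace (EuclideanSpace ℝ (Fin m')) Y]
  [IsManifold (𝓡 m') ∞ Y]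

theorem SameOrbit.map {V : VectField m X} {V' : VectField m' Y} {F : X → Y}
    (hF : MDifferentiable (𝓡 m) (𝓡 m') F)
    (hV : ∀ p, mfderiv (𝓡 m) (𝓡 m') F p (V p) = V' (F p)) {p p' : X} (h : SameOrbit V p p') :
    SameOrbit V' (F p) (F p') := by
  obtain ⟨γ, s, hs, ho, hγ, ⟨t, ht, rfl⟩, ⟨t', ht', rfl⟩⟩ := h
  refine ⟨F ∘ γ, s, hs, ho, fun a ha ↦ ?_, ⟨t, ht, rfl⟩, ⟨t', ht', rfl⟩⟩
  have h1 := (hF (γ a)).hasMFDerivAt.comp_hasMFDerivWithinAt a (hγ a ha)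
  refine h1.congr_mfderiv (ContinuousLinearMap.ext_ring ?_)
  have h2 := hV (γ a)
  change mfderiv (𝓡 m) (𝓡 m') F (γ a) ((1 : ℝ) • V (γ a)) = (1 : ℝ) • V' (F (γ a))
  rw [map_smul, h2]

/-- Reflexivity of the orbit relation supplies an integral curve through `p`, so no existence
theorem and no regularity of V are needed; q is constant along that curve. -/
theorem mfderiv_eq_zero_of_fibres {V : VectField m X} {q : X → Y}
    (hq : MDifferentiable (𝓡 m) (𝓡 m') q) (hfib : ∀ p p', q p = q p' ↔ SameOrbit V p p') (p : X) :
    mfderiv (𝓡 m) (𝓡 m') q p (V p) = 0 := by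
  obtain ⟨γ, s, hs, ho, hγ, ⟨t, ht, rfl⟩, -⟩ := (hfib p p).1 rfl
  have hγt := (hγ t ht).hasMFDerivAt (hs.mem_nhds ht)
  have h1 := (hq (γ t)).hasMFDerivAt.comp t hγt
  have e : q ∘ γ =ᶠ[𝓝 t] fun _ ↦ q (γ t) := by
    filter_upwards [hs.mem_nhds ht] with a ha
    exact (hfib _ _).2 ⟨γ, s, hs, ho, hγ, ⟨a, ha, rfl⟩, ⟨t, ht, rfl⟩⟩
  have h2 := h1.mfderiv
  rw [e.mfderiv_eq, mfderiv_const] at h2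
  have h3 := congrArg (fun B ↦ B (1 : ℝ)) h2
  have h4 : mfderiv (𝓡 m) (𝓡 m') q (γ t) ((1 : ℝ) • V (γ t)) = 0 := h3.symm
  rwa [one_smul] at h4

theorem exists_smul_of_mem_ker {q : X → Y} {p : X} (hmm : m = m' + 1)
    (hs : Function.Surjective (mfderiv (𝓡 m) (𝓡 m') q p)) {v w : TangentSpace (𝓡 m) p}
    (hv : v ≠ 0) (hqv : mfderiv (𝓡 m) (𝓡 m') q p v = 0)
    (hqw : mfderiv (𝓡 m) (𝓡 m') q p w = 0) : ∃ a : ℝ, w = a • v := by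
  let L₀ : EuclideanSpace ℝ (Fin m) →L[ℝ] EuclideanSpace ℝ (Fin m') := mfderiv (𝓡 m) (𝓡 m') q p
  let L : EuclideanSpace ℝ (Fin m) →ₗ[ℝ] EuclideanSpace ℝ (Fin m') := L₀.toLinearMap
  have hL : LinearMap.range L = ⊤ := LinearMap.range_eq_top.2 hs
  have h1 := L.finrank_range_add_finrank_ker
  rw [hL, finrank_top, finrank_euclideanSpace_fin, finrank_euclideanSpace_fin] at h1
  have h2 : Module.finrank ℝ (LinearMap.ker L) = 1 := by omega
  have h3 := (finrank_eq_one_iff_of_nonzero' (⟨v, hqv⟩ : LinearMap.ker L)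
    (fun h ↦ hv (congrArg Subtype.val h))).1 h2 ⟨w, hqw⟩
  obtain ⟨a, ha⟩ := h3
  exact ⟨a, (congrArg Subtype.val ha).symm⟩

end Orbits

/-! ### Global forms on the circle bundle and the lift of the Killing field -/

section Correspondence

variable {n : ℕ}
  {N : Type*} [TopologicalSpace N]
  [ChartedSpace (EuclideanSpace ℝ (Fin (4 * n))) N] [IsManifold (𝓡 (4 * n)) ∞ N]
  [T2Space N] [RiemannianBundle (fun p : N ↦ TangentSpace (𝓡 (4 * n)) p)]
  [IsContMDiffRiemannianBundle (𝓡 (4 * n)) ∞ (EuclideanSpace ℝ (Fin (4 * n)))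
      (fun p : N ↦ TangentSpace (𝓡 (4 * n)) p)]
  {D : AffineConnection (4 * n) N}
  {G : Π p : N, Submodule ℝ
    (TangentSpace (𝓡 (4 * n)) p →L[ℝ] TangentSpace (𝓡 (4 * n)) p)}
  {Z : VectField (4 * n) N}
  {P : Type*} [TopologicalSpace P] [ChartedSpace (EuclideanSpace ℝ (Fin (4 * n + 1))) P]
  [IsManifold (𝓡 (4 * n + 1)) ∞ P]
  [MulAction Circle P] {pr : P → N} {ι : Type*} {𝔤 : ι → Gauge n N P}
  {Z' : VectField (4 * n + 1) P}

/-- A circle bundle with an atlas of compatible structured gauges and the horizontal lift `Z'`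
of the Killing field. -/
structure IsCorrespondence (pr : P → N) (D : AffineConnection (4 * n) N)
    (G : Π p : N, Submodule ℝ
      (TangentSpace (𝓡 (4 * n)) p →L[ℝ] TangentSpace (𝓡 (4 * n)) p))
    (Z : VectField (4 * n) N) (𝔤 : ι → Gauge n N P) (Z' : VectField (4 * n + 1) P) : Prop where
  pos_dim : 0 < n
  principal : IsPrincipalCircleBundle n pr
  structured : ∀ i, (𝔤 i).IsStructured pr D G Z
  cover : ∀ p : N, ∃ i, p ∈ (𝔤 i).U
  compatible : ∀ i j, (𝔤 i).Compatible (𝔤 j) pr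
  lift : ∀ p, mfderiv (𝓡 (4 * n + 1)) (𝓡 (4 * n)) pr p (Z' p) = Z (pr p)
  hor : ∀ i, ∀ p, pr p ∈ (𝔤 i).U → dAngle (𝔤 i).c p (Z' p) = 0

namespace IsCorrespondence

/-- The kernel of the derivative of pr is a line spanned by a vector with dx = 1. Hence the
projection together with dx determines a tangent vector, and in particular the lift of Z. -/
theorem eq_zero (h : IsCorrespondence pr D G Z 𝔤 Z') {i : ι} {p : P} (hp : pr p ∈ (𝔤 i).U)
    {v : TangentSpace (𝓡 (4 * n + 1)) p}
    (h1 : mfderiv (𝓡 (4 * n + 1)) (𝓡 (4 * n)) pr p v = 0) (h2 : dAngle (𝔤 i).c p v = 0) :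
    v = 0 := by
  obtain ⟨X, hX, hX'⟩ := h.principal.exists_vertical p
  have hX1 := hX' (𝔤 i).c ((h.structured i).eventually_c hp).self_of_nhds
    (fun z ↦ (h.structured i).adapted.equivariant z p hp)
  have hX0 : X ≠ 0 := by
    rintro rfl
    rw [map_zero] at hX1
    exact zero_ne_one hX1
  obtain ⟨a, rfl⟩ := exists_smul_of_mem_ker rfl (h.principal.submersion p) hX0 hX h1
  rw [map_smul, hX1, smul_eq_mul, mul_one] at h2
  rw [h2, zero_smul]

theorem mfderiv_pr_smul (h : IsCorrespondence pr D G Z 𝔤 Z') (z : Circle) (p : P) :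
    mfderiv (𝓡 (4 * n + 1)) (𝓡 (4 * n)) pr (z • p)
      (mfderiv (𝓡 (4 * n + 1)) (𝓡 (4 * n + 1)) (fun y : P ↦ z • y) p (Z' p)) =
      Z (pr (z • p)) := by
  have e : (fun y ↦ pr (z • y)) = pr := funext (h.principal.pr_smul z)
  have h1 := mfderiv_comp p (g := pr) (f := fun y : P ↦ z • y)
    (h.principal.smooth.mdifferentiableAt (I := 𝓡 (4 * n + 1)) (I' := 𝓡 (4 * n)) (by simp))
    ((h.principal.smooth_smul z).mdifferentiableAt (by simp))
  have h2 : ∀ f : P → N, f = pr →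
      mfderiv (𝓡 (4 * n + 1)) (𝓡 (4 * n)) f p (Z' p) = Z (f p) := by
    rintro f rfl
    exact h.lift p
  exact (congrArg (fun B ↦ B (Z' p)) h1).symm.trans (h2 _ e)

/-- The lift is determined by its projection and by dx = 0, and both conditions are preserved by the
circle action. -/
theorem mfderiv_smul_lift (h : IsCorrespondence pr D G Z 𝔤 Z') (z : Circle) (p : P) :
    mfderiv (𝓡 (4 * n + 1)) (𝓡 (4 * n + 1)) (fun y : P ↦ z • y) p (Z' p) = Z' (z • p) := by
  obtain ⟨i, hi⟩ := h.cover (pr p)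
  have hi' : pr (z • p) ∈ (𝔤 i).U := by rwa [h.principal.pr_smul]
  refine sub_eq_zero.1 (h.eq_zero hi' ?_ ?_)
  · rw [map_sub, h.mfderiv_pr_smul, h.lift, sub_self]
  · rw [map_sub, (h.structured i).dAngle_smul h.principal z hi, h.hor i p hi, h.hor i _ hi', sub_self]

theorem sameOrbit_smul (h : IsCorrespondence pr D G Z 𝔤 Z') (z : Circle) {p p' : P}
    (hpp : SameOrbit Z' p p') : SameOrbit Z' (z • p) (z • p') :=
  SameOrbit.map (F := fun y : P ↦ z • y)
    ((h.principal.smooth_smul z).mdifferentiable (by simp)) (h.mfderiv_smul_lift z) hpp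

theorem A_lift (h : IsCorrespondence pr D G Z 𝔤 Z') {i : ι} {p : P} (hp : pr p ∈ (𝔤 i).U) :
    (𝔤 i).A pr p (Z' p) = -(𝔤 i).u pr Z p := by
  change (2 : ℝ) * dAngle (𝔤 i).c p (Z' p) -
    (𝔤 i).β (pr p) (mfderiv (𝓡 (4 * n + 1)) (𝓡 (4 * n)) pr p (Z' p)) = _
  rw [h.hor i p hp, h.lift]
  unfold Gauge.u
  ring

theorem lift_ne_zero (h : IsCorrespondence pr D G Z 𝔤 Z') (p : P) : Z' p ≠ 0 := by
  obtain ⟨i, hi⟩ := h.cover (pr p)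
  intro h0
  have h1 := h.A_lift hi
  rw [h0, map_zero] at h1
  have := (h.structured i).moment_pos hi
  linarith

/-- All ⟨K_a Z, Z⟩ vanish. Since A(Z') = -u, the first term of `hkForm` becomes -4u⁻¹⟨K_b Z, ·⟩ and
cancels the last. -/
theorem σ_lift (h : IsCorrespondence pr D G Z 𝔤 Z') {i : ι} {p : P} (hp : pr p ∈ (𝔤 i).U)
    (b : Fin 3) (w : TangentSpace (𝓡 (4 * n + 1)) p) : (𝔤 i).σ pr Z b p ![Z' p, w] = 0 := by
  have hu := ((h.structured i).moment_pos hp).ne'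
  rw [(h.structured i).σ_apply hp]
  unfold hkForm
  rw [h.A_lift hp, h.lift]
  have e : ∀ a, ⟪(𝔤 i).K pr p a (Z (pr p)), Z (pr p)⟫_ℝ = 0 := fun a ↦ by
    have := (h.structured i).orth hp a (Z (pr p)) (Z (pr p))
    rw [real_inner_comm] at this
    rw [real_inner_comm]
    linarith
  rw [e, e, e]
  field_simp
  ring

/-- The forms of the correspondence on the total space. -/
def form (h : IsCorrespondence pr D G Z 𝔤 Z') (b : Fin 3) : DForm (4 * n + 1) P 2 :=
  fun p ↦ (𝔤 (h.cover (pr p)).choose).σ pr Z b p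

theorem form_eq (h : IsCorrespondence pr D G Z 𝔤 Z') {i : ι} {p : P} (hp : pr p ∈ (𝔤 i).U)
    (b : Fin 3) : h.form b p = (𝔤 i).σ pr Z b p :=
  (h.structured _).σ_eq (h.structured i) h.pos_dim (h.compatible _ _) (h.cover (pr p)).choose_spec
    hp b

theorem form_eventuallyEq (h : IsCorrespondence pr D G Z 𝔤 Z') {i : ι} {p : P}
    (hp : pr p ∈ (𝔤 i).U) (b : Fin 3) : ∀ᶠ y in 𝓝 p, (𝔤 i).σ pr Z b y = h.form b y := by
  filter_upwards [(h.structured i).eventually_mem hp] with y hy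
  exact (h.form_eq hy b).symm

theorem smooth_form (h : IsCorrespondence pr D G Z 𝔤 Z') (b : Fin 3) (p : P) :
    SmoothFormAt (h.form b) p := by
  obtain ⟨i, hi⟩ := h.cover (pr p)
  exact ((h.structured i).smooth_σ hi b).congr (h.form_eventuallyEq hi b)

theorem d_form (h : IsCorrespondence pr D G Z 𝔤 Z') (b : Fin 3) (p : P) : d (h.form b) p = 0 := by
  obtain ⟨i, hi⟩ := h.cover (pr p)
  rw [← d_congr (h.form_eventuallyEq hi b), (h.structured i).d_σ hi b]

theorem form_lift (h : IsCorrespondence pr D G Z 𝔤 Z') (b : Fin 3) (p : P)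
    (w : TangentSpace (𝓡 (4 * n + 1)) p) : h.form b p ![Z' p, w] = 0 :=
  h.σ_lift (h.cover (pr p)).choose_spec b w

theorem pullback_smul_form (h : IsCorrespondence pr D G Z 𝔤 Z') (z : Circle) :
    pullback (m := 4 * n + 1) (m' := 4 * n + 1) (fun y : P ↦ z • y) (h.form 0) = h.form 0 ∧
    pullback (m := 4 * n + 1) (m' := 4 * n + 1) (fun y : P ↦ z • y) (h.form 1) =
      cosTwo z • h.form 1 - sinTwo z • h.form 2 ∧
    pullback (m := 4 * n + 1) (m' := 4 * n + 1) (fun y : P ↦ z • y) (h.form 2) =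
      sinTwo z • h.form 1 + cosTwo z • h.form 2 := by
  have key : ∀ (b : Fin 3) {i : ι} {p : P}, pr p ∈ (𝔤 i).U →
      pullback (m := 4 * n + 1) (m' := 4 * n + 1) (fun y : P ↦ z • y) (h.form b) p =
        pullback (m := 4 * n + 1) (m' := 4 * n + 1) (fun y : P ↦ z • y) ((𝔤 i).σ pr Z b) p := by
    intro b i p hp
    have hp' : pr (z • p) ∈ (𝔤 i).U := by rwa [h.principal.pr_smul]
    exact congrArg (fun B ↦ ContinuousAlternatingMap.compContinuousLinearMap B
      (mfderiv (𝓡 (4 * n + 1)) (𝓡 (4 * n + 1)) (fun y : P ↦ z • y) p)) (h.form_eq hp' b)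
  refine ⟨funext fun p ↦ ?_, funext fun p ↦ ?_, funext fun p ↦ ?_⟩
  · obtain ⟨i, hi⟩ := h.cover (pr p)
    rw [key 0 hi, (h.structured i).pullback_smul_σ_zero h.principal z hi, h.form_eq hi]
  · obtain ⟨i, hi⟩ := h.cover (pr p)
    rw [key 1 hi, (h.structured i).pullback_smul_σ_one h.principal z hi, ← h.form_eq hi,
      ← h.form_eq hi]
    rfl
  · obtain ⟨i, hi⟩ := h.cover (pr p)
    rw [key 2 hi, (h.structured i).pullback_smul_σ_two h.principal z hi, ← h.form_eq hi,
      ← h.form_eq hi]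
    rfl

end IsCorrespondence

end Correspondence

/-! ### Closed two-forms along the fibres of a linear map -/

section Model

variable {E E' : Type*} [NormedAddCommGroup E] [NormedSpace ℝ E] [FiniteDimensional ℝ E]
  [NormedAddCommGroup E'] [NormedSpace ℝ E']

theorem extDeriv_two_apply {w : E → E [⋀^Fin 2]→L[ℝ] ℝ} {x : E} (hw : DifferentiableAt ℝ w x)
    (a b c : E) : extDeriv w x ![a, b, c] =
      fderiv ℝ (fun y ↦ w y ![b, c]) x a - fderiv ℝ (fun y ↦ w y ![a, c]) x b +
        fderiv ℝ (fun y ↦ w y ![a, b]) x c := by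
  rw [extDeriv_apply hw, Fin.sum_univ_three]
  have h0 : (0 : Fin 3).removeNth ![a, b, c] = ![b, c] := by
    funext i
    fin_cases i <;> rfl
  have h1 : (1 : Fin 3).removeNth ![a, b, c] = ![a, c] := by
    funext i
    fin_cases i <;> rfl
  have h2 : (2 : Fin 3).removeNth ![a, b, c] = ![a, b] := by
    funext i
    fin_cases i <;> rfl
  rw [h0, h1, h2]
  simp
  ring

/-- A closed `2`-form annihilating the kernel of `L` is constant along the fibres of `L`. -/
theorem eq_of_closed_of_ker {w : E → E [⋀^Fin 2]→L[ℝ] ℝ} {L : E →L[ℝ] E'} {s : Set E}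
    (hs : IsOpen s) (hc : Convex ℝ s) (hw : ∀ x ∈ s, DifferentiableAt ℝ w x)
    (hd : ∀ x ∈ s, extDeriv w x = 0)
    (hk : ∀ x ∈ s, ∀ k v, L k = 0 → w x ![k, v] = 0) {x x' : E} (hx : x ∈ s) (hx' : x' ∈ s)
    (hL : L x = L x') : w x' = w x := by
  ext v
  have ev : v = ![v 0, v 1] := by
    funext i
    fin_cases i <;> rfl
  rw [ev]
  set a := v 0
  set b := v 1
  have hk0 : L (x' - x) = 0 := by rw [map_sub, hL, sub_self]
  have hf : ∀ (a b : E), ∀ y ∈ s, DifferentiableAt ℝ (fun y ↦ w y ![a, b]) y := fun a b y hy ↦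
    (ContinuousAlternatingMap.apply ℝ E ℝ ![a, b]).differentiableAt.comp y (hw y hy)
  -- In dw(k, a, b) with k = x' - x in the kernel of L, two of the three terms differentiate
  -- contractions of w with k, which vanish on all of s. Closedness kills the third, the derivative
  -- of w(a, b) along k.
  have hder : ∀ y ∈ s, fderiv ℝ (fun y ↦ w y ![a, b]) y (x' - x) = 0 := by
    intro y hy
    have h1 := extDeriv_two_apply (hw y hy) (x' - x) a b
    have h2 : ∀ c : E, fderiv ℝ (fun y ↦ w y ![x' - x, c]) y = 0 := by
      intro c
      have : (fun y ↦ w y ![x' - x, c]) =ᶠ[𝓝 y] fun _ ↦ (0 : ℝ) := by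
        filter_upwards [hs.mem_nhds hy] with z hz
        exact hk z hz _ c hk0
      rw [this.fderiv_eq]
      simp
    rw [hd y hy, h2, h2] at h1
    simpa using h1.symm
  have hmem : ∀ t ∈ Icc (0 : ℝ) 1, x + t • (x' - x) ∈ s := fun t ht ↦
    hc.add_smul_sub_mem hx hx' ht
  have hline : ∀ t ∈ Icc (0 : ℝ) 1,
      HasDerivAt (fun t : ℝ ↦ w (x + t • (x' - x)) ![a, b]) 0 t := by
    intro t ht
    have h1 : HasDerivAt (fun t : ℝ ↦ x + t • (x' - x)) (x' - x) t := by
      simpa using ((hasDerivAt_id t).smul_const (x' - x)).const_add x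
    have h2 := (hf a b _ (hmem t ht)).hasFDerivAt.comp_hasDerivAt t h1
    rw [hder _ (hmem t ht)] at h2
    exact h2
  have h := constant_of_has_deriv_right_zero (f := fun t : ℝ ↦ w (x + t • (x' - x)) ![a, b])
    (a := 0) (b := 1) (fun t ht ↦ (hline t ht).continuousAt.continuousWithinAt)
    (fun t ht ↦ (hline t (Ico_subset_Icc_self ht)).hasDerivWithinAt) 1 (by simp)
  simpa using h

end Model

/-! ### Submersions are linear in suitable coordinates -/

section Straightening

variable {m m' : ℕ}
  {X : Type*} [TopologicalSpace X] [ChartedSpace (EuclideanSpace ℝ (Fin m)) X]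
  [IsManifold (𝓡 m) ∞ X]
  {Y : Type*} [TopologicalSpace Y] [ChartedSpace (EuclideanSpace ℝ (Fin m')) Y]
  [IsManifold (𝓡 m') ∞ Y]

/-- Local coordinates around `p₀` in which the map `q` is linear. -/
structure Straightening (q : X → Y) (p₀ : X) where
  Φ : EuclideanSpace ℝ (Fin m) → X
  H : X → EuclideanSpace ℝ (Fin m)
  L : EuclideanSpace ℝ (Fin m) →L[ℝ] EuclideanSpace ℝ (Fin m')
  S : EuclideanSpace ℝ (Fin m') →L[ℝ] EuclideanSpace ℝ (Fin m)
  L_S : ∀ y, L (S y) = y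
  Φ_H : ∀ᶠ p in 𝓝 p₀, Φ (H p) = p
  smooth_Φ : ∀ᶠ x in 𝓝 (H p₀), ContMDiffAt (𝓡 m) (𝓡 m) ∞ Φ x
  smooth_H : ∀ᶠ p in 𝓝 p₀, ContMDiffAt (𝓡 m) (𝓡 m) ∞ H p
  chart_q : ∀ᶠ x in 𝓝 (H p₀), q (Φ x) ∈ (extChartAt (𝓡 m') (q p₀)).source ∧
    extChartAt (𝓡 m') (q p₀) (q (Φ x)) = L x

theorem nonempty_straightening {q : X → Y} {p₀ : X} (hq : ContMDiff (𝓡 m) (𝓡 m') ∞ q)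
    (hs : Function.Surjective (mfderiv (𝓡 m) (𝓡 m') q p₀)) :
    Nonempty (Straightening (m := m) (m' := m') q p₀) := by
  set e := extChartAt (𝓡 m) p₀
  set e' := extChartAt (𝓡 m') (q p₀)
  set x₀ := e p₀
  let F : EuclideanSpace ℝ (Fin m) → EuclideanSpace ℝ (Fin m') := fun y ↦ e' (q (e.symm y))
  have hF : ContDiffAt ℝ ∞ F x₀ :=
    contDiffAt_writtenInCharts (mem_extChartAt_source p₀) hq.contMDiffAt (mem_extChartAt_source _)
  let L := fderiv ℝ F x₀
  have hLs : Function.Surjective L := by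
    have h1 : mfderiv (𝓡 m) (𝓡 m') q p₀ = L := by
      rw [(hq.mdifferentiableAt (x := p₀) (by simp)).mfderiv]
      have hr : range (𝓡 m) = univ := by simp
      rw [hr, fderivWithin_univ]
      rfl
    exact h1 ▸ hs
  obtain ⟨S, hS⟩ := L.exists_rightInverse_of_surjective (LinearMap.range_eq_top.2 hLs)
  have hLS : ∀ y, L (S y) = y := fun y ↦ congrArg (fun B ↦ B y) hS
  -- With S a right inverse of L = F'(x₀), this map satisfies L ∘ h = F and has derivative the
  -- identity at x₀. So its local inverse turns F into the linear map L.
  let h : EuclideanSpace ℝ (Fin m) → EuclideanSpace ℝ (Fin m) := fun y ↦ y + S (F y - L y)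
  have hLh : ∀ y, L (h y) = F y := fun y ↦ by
    change L (y + S (F y - L y)) = F y
    rw [map_add, hLS]
    abel
  have hh : ContDiffAt ℝ ∞ h x₀ :=
    contDiffAt_id.add (S.contDiff.contDiffAt.comp x₀ (hF.sub L.contDiff.contDiffAt))
  have hh' : HasFDerivAt h
      ((ContinuousLinearEquiv.refl ℝ (EuclideanSpace ℝ (Fin m)) :
        EuclideanSpace ℝ (Fin m) ≃L[ℝ] EuclideanSpace ℝ (Fin m)) :
        EuclideanSpace ℝ (Fin m) →L[ℝ] EuclideanSpace ℝ (Fin m)) x₀ := by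
    have h1 := (hF.differentiableAt (by simp)).hasFDerivAt.sub (L.hasFDerivAt (x := x₀))
    have h2 := (hasFDerivAt_id x₀).add (S.hasFDerivAt.comp x₀ h1)
    refine h2.congr_fderiv ?_
    ext1 v
    change v + S (L v - L v) = v
    rw [sub_self, map_zero, add_zero]
  have hstrict := hh.hasStrictFDerivAt' hh' (by simp)
  let Ψ := hh.localInverse hh' (by simp)
  have hΨ0 : Ψ (h x₀) = x₀ := hh.localInverse_apply_image hh' (by simp)
  have hΨs : ContDiffAt ℝ ∞ Ψ (h x₀) := hh.to_localInverse hh' (by simp)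
  have hl : ∀ᶠ y in 𝓝 x₀, Ψ (h y) = y := hstrict.eventually_left_inverse
  have hr : ∀ᶠ y in 𝓝 (h x₀), h (Ψ y) = y := hstrict.eventually_right_inverse
  have hΨc : Tendsto Ψ (𝓝 (h x₀)) (𝓝 x₀) := by
    have := hΨs.continuousAt
    rwa [ContinuousAt, hΨ0] at this
  have hec : Tendsto e (𝓝 p₀) (𝓝 x₀) :=
    (contMDiffAt_chart p₀ (mem_extChartAt_source p₀)).continuousAt
  have hes : Tendsto e.symm (𝓝 x₀) (𝓝 p₀) := tendsto_chart_symm p₀ (mem_extChartAt_source p₀)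
  have hFev : ∀ᶠ y in 𝓝 x₀, ContDiffAt ℝ ∞ F y := by
    have h1 : Tendsto (fun y ↦ q (e.symm y)) (𝓝 x₀) (𝓝 (q p₀)) :=
      hq.continuous.continuousAt.tendsto.comp hes
    filter_upwards [extChartAt_target_mem_nhds (I := 𝓡 m) p₀,
      h1.eventually (extChartAt_source_mem_nhds (I := 𝓡 m') (q p₀))] with y hy hqy
    have h2 := contDiffAt_writtenInCharts (e.map_target hy) (hq.contMDiffAt (x := e.symm y)) hqy
    rwa [e.right_inv hy] at h2
  have hhev : ∀ᶠ y in 𝓝 x₀, ContDiffAt ℝ ∞ h y := by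
    filter_upwards [hFev] with y hy
    exact contDiffAt_id.add (S.contDiff.contDiffAt.comp y (hy.sub L.contDiff.contDiffAt))
  have hinv : ∀ᶠ y in 𝓝 x₀, fderiv ℝ h y ∈ range ((↑) :
      (EuclideanSpace ℝ (Fin m) ≃L[ℝ] EuclideanSpace ℝ (Fin m)) →
        EuclideanSpace ℝ (Fin m) →L[ℝ] EuclideanSpace ℝ (Fin m)) := by
    have h1 : ContinuousAt (fderiv ℝ h) x₀ :=
      (hh.fderiv_right (m := ∞) (by simp)).continuousAt
    refine h1.eventually ?_
    rw [hh'.fderiv]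
    exact ContinuousLinearEquiv.nhds _
  -- Smoothness at h x₀ alone does not give smoothness nearby. The derivative of h stays invertible
  -- in a neighbourhood, and the inverse function theorem applies at each of those points.
  have hΨev : ∀ᶠ x in 𝓝 (h x₀), ContDiffAt ℝ ∞ Ψ x := by
    let Q := hstrict.toOpenPartialHomeomorph h
    filter_upwards [Q.open_target.mem_nhds hstrict.image_mem_toOpenPartialHomeomorph_target,
      hΨc.eventually hinv, hΨc.eventually hhev] with x h1 h2 h3
    obtain ⟨A, hA⟩ := h2
    refine Q.contDiffAt_symm h1 (f₀' := A) ?_ h3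
    rw [hA]
    exact (h3.differentiableAt (by simp)).hasFDerivAt
  refine ⟨⟨fun x ↦ e.symm (Ψ x), fun p ↦ h (e p), L, S, hLS, ?_, ?_, ?_, ?_⟩⟩
  · filter_upwards [hec.eventually hl, extChartAt_source_mem_nhds (I := 𝓡 m) p₀] with p hp hps
    rw [hp]
    exact e.left_inv hps
  · filter_upwards [hΨev, hΨc.eventually (extChartAt_target_mem_nhds (I := 𝓡 m) p₀)] with x h1 h2
    exact (contMDiffAt_chart_symm p₀ h2).comp (I' := 𝓡 m) x h1.contMDiffAt
  · filter_upwards [hec.eventually hhev, extChartAt_source_mem_nhds (I := 𝓡 m) p₀] with p h1 h2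
    exact h1.contMDiffAt.comp (I' := 𝓡 m) p (contMDiffAt_chart p₀ h2)
  · have h1 : Tendsto (fun x ↦ q (e.symm (Ψ x))) (𝓝 (h x₀)) (𝓝 (q p₀)) :=
      hq.continuous.continuousAt.tendsto.comp (hes.comp hΨc)
    filter_upwards [hr, h1.eventually (extChartAt_source_mem_nhds (I := 𝓡 m') (q p₀))] with x hx h2
    refine ⟨h2, ?_⟩
    change F (Ψ x) = L x
    rw [← hLh, hx]

/-- A submersion has smooth local sections. -/
theorem exists_local_section {q : X → Y} {p₀ : X} (hq : ContMDiff (𝓡 m) (𝓡 m') ∞ q)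
    (hs : Function.Surjective (mfderiv (𝓡 m) (𝓡 m') q p₀)) :
    ∃ s : Y → X, s (q p₀) = p₀ ∧ ContMDiffAt (𝓡 m') (𝓡 m) ∞ s (q p₀) ∧
      ∀ᶠ y in 𝓝 (q p₀), q (s y) = y := by
  obtain ⟨T⟩ := nonempty_straightening hq hs
  set e' := extChartAt (𝓡 m') (q p₀)
  let a : Y → EuclideanSpace ℝ (Fin m) := fun y ↦ T.H p₀ + T.S (e' y - e' (q p₀))
  have ha0 : a (q p₀) = T.H p₀ := by simp [a]
  have hΦ := T.Φ_H.self_of_nhds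
  have hL := T.chart_q.self_of_nhds.2
  rw [hΦ] at hL
  have ha : ContMDiffAt (𝓡 m') (𝓡 m) ∞ a (q p₀) := by
    have h1 : ContDiff ℝ ∞ fun y ↦ T.H p₀ + T.S (y - e' (q p₀)) :=
      contDiff_const.add (T.S.contDiff.comp (contDiff_id.sub contDiff_const))
    exact h1.contMDiff.contMDiffAt.comp (I' := 𝓡 m') (q p₀)
      (contMDiffAt_chart (q p₀) (mem_extChartAt_source _))
  have hac : Tendsto a (𝓝 (q p₀)) (𝓝 (T.H p₀)) := by
    have := ha.continuousAt
    rwa [ContinuousAt, ha0] at this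
  refine ⟨fun y ↦ T.Φ (a y), ?_, ?_, ?_⟩
  · change T.Φ (a (q p₀)) = p₀
    rw [ha0, hΦ]
  · have h1 := T.smooth_Φ.self_of_nhds
    rw [← ha0] at h1
    exact h1.comp (I' := 𝓡 m) (q p₀) ha
  · filter_upwards [hac.eventually T.chart_q, extChartAt_source_mem_nhds (I := 𝓡 m') (q p₀)]
      with y hy hys
    refine e'.injOn hy.1 hys ?_
    rw [hy.2]
    change T.L (T.H p₀ + T.S (e' y - e' (q p₀))) = e' y
    rw [map_add, T.L_S, ← hL]
    abel

end Straightening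

/-! ### Comparison of a closed form at the points of one fibre -/

section Descent

variable {m m' : ℕ}
  {X : Type*} [TopologicalSpace X] [ChartedSpace (EuclideanSpace ℝ (Fin m)) X]
  [IsManifold (𝓡 m) ∞ X]
  {Y : Type*} [TopologicalSpace Y] [ChartedSpace (EuclideanSpace ℝ (Fin m')) Y]
  [IsManifold (𝓡 m') ∞ Y]

theorem pullback_two_apply (F : X → Y) (η : DForm m' Y 2) (p : X) (v w : TangentSpace (𝓡 m) p) :
    pullback (m := m) (m' := m') F η p ![v, w] =
      η (F p) ![mfderiv (𝓡 m) (𝓡 m') F p v, mfderiv (𝓡 m) (𝓡 m') F p w] := by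
  rw [pullback_apply]
  congr 1
  funext i
  fin_cases i <;> rfl

theorem form_two_ext {p : X} {a b : TangentSpace (𝓡 m) p [⋀^Fin 2]→L[ℝ] ℝ}
    (h : ∀ v w, a ![v, w] = b ![v, w]) : a = b := by
  ext v
  have ev : v = ![v 0, v 1] := by
    funext i
    fin_cases i <;> rfl
  rw [ev, h]

theorem form_two_swap {p : X} (a : TangentSpace (𝓡 m) p [⋀^Fin 2]→L[ℝ] ℝ)
    (v w : TangentSpace (𝓡 m) p) : a ![v, w] = -a ![w, v] := by
  have h := a.map_swap ![w, v] (i := 0) (j := 1) (by simp)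
  refine Eq.trans ?_ h
  change a _ = a _
  congr 1
  funext i
  fin_cases i <;> rfl

theorem form_two_add_left {p : X} (a : TangentSpace (𝓡 m) p [⋀^Fin 2]→L[ℝ] ℝ)
    (v v' w : TangentSpace (𝓡 m) p) : a ![v + v', w] = a ![v, w] + a ![v', w] :=
  a.toMultilinearMap.cons_add (![w]) v v'

theorem form_two_smul_left {p : X} (a : TangentSpace (𝓡 m) p [⋀^Fin 2]→L[ℝ] ℝ) (r : ℝ)
    (v w : TangentSpace (𝓡 m) p) : a ![r • v, w] = r * a ![v, w] :=
  a.toMultilinearMap.cons_smul (![w]) r v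

theorem form_two_sub_left {p : X} (a : TangentSpace (𝓡 m) p [⋀^Fin 2]→L[ℝ] ℝ)
    (v v' w : TangentSpace (𝓡 m) p) : a ![v - v', w] = a ![v, w] - a ![v', w] := by
  rw [eq_sub_iff_add_eq, ← form_two_add_left, sub_add_cancel]

/-- The values of `η` on lifts of the same tangent vectors agree at `p` and `p'`. -/
def SameDescent (q : X → Y) (η : DForm m X 2) (p p' : X) : Prop :=
  ∀ (v w : TangentSpace (𝓡 m) p) (v' w' : TangentSpace (𝓡 m) p'),
    (mfderiv (𝓡 m) (𝓡 m') q p v : EuclideanSpace ℝ (Fin m')) = mfderiv (𝓡 m) (𝓡 m') q p' v' →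
    (mfderiv (𝓡 m) (𝓡 m') q p w : EuclideanSpace ℝ (Fin m')) = mfderiv (𝓡 m) (𝓡 m') q p' w' →
    η p ![v, w] = η p' ![v', w']

theorem SameDescent.symm {q : X → Y} {η : DForm m X 2} {p p' : X}
    (h : SameDescent (m' := m') q η p p') : SameDescent (m' := m') q η p' p :=
  fun v w v' w' h1 h2 ↦ (h v' w' v w h1.symm h2.symm).symm

theorem SameDescent.trans {q : X → Y}
    (hs : ∀ p, Function.Surjective (mfderiv (𝓡 m) (𝓡 m') q p)) {η : DForm m X 2} {p p' p'' : X}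
    (h : SameDescent (m' := m') q η p p') (h' : SameDescent (m' := m') q η p' p'') :
    SameDescent (m' := m') q η p p'' := by
  intro v w v' w' h1 h2
  obtain ⟨a, ha⟩ := hs p' (mfderiv (𝓡 m) (𝓡 m') q p v : EuclideanSpace ℝ (Fin m'))
  obtain ⟨b, hb⟩ := hs p' (mfderiv (𝓡 m) (𝓡 m') q p w : EuclideanSpace ℝ (Fin m'))
  exact (h v w a b ha.symm hb.symm).trans (h' a b v' w' (ha.trans h1) (hb.trans h2))

theorem eventually_contMDiffAt_one {F : X → Y} {p : X} (h : ContMDiffAt (𝓡 m) (𝓡 m') ∞ F p) :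
    ∀ᶠ y in 𝓝 p, ContMDiffAt (𝓡 m) (𝓡 m') 1 F y := by
  have h0 : ContMDiffAt (𝓡 m) (𝓡 m') 1 F p := h.of_le (by norm_cast)
  have i1 : IsManifold (𝓡 m) 1 X := IsManifold.of_le (n := ∞) (by norm_cast)
  have i2 : IsManifold (𝓡 m') 1 Y := IsManifold.of_le (n := ∞) (by norm_cast)
  exact (contMDiffAt_iff_contMDiffAt_nhds (by simp)).1 h0

/-- In straightened coordinates on a ball, points of one fibre differ by an element of the kernel of
L, so `eq_of_closed_of_ker` gives the form the same coefficients at both. Different lifts of a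
vector differ by an element of the kernel, which the form ignores. -/
theorem sameDescent_locally {q : X → Y} (hq : ContMDiff (𝓡 m) (𝓡 m') ∞ q)
    (hs : ∀ p, Function.Surjective (mfderiv (𝓡 m) (𝓡 m') q p)) {η : DForm m X 2}
    (hη : ∀ p, SmoothFormAt η p) (hd : ∀ p, d η p = 0)
    (hk : ∀ p v w, mfderiv (𝓡 m) (𝓡 m') q p v = 0 → η p ![v, w] = 0) (p₀ : X) :
    ∃ O ∈ 𝓝 p₀, ∀ p ∈ O, ∀ p' ∈ O, q p = q p' → SameDescent (m' := m') q η p p' := by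
  obtain ⟨T⟩ := nonempty_straightening hq (hs p₀)
  set c := extChartAt (𝓡 m') (q p₀)
  obtain ⟨r, hr, hB⟩ := Metric.eventually_nhds_iff_ball.1
    (T.smooth_Φ.and T.chart_q)
  let s := Metric.ball (T.H p₀) r
  have hso : IsOpen s := Metric.isOpen_ball
  let w : EuclideanSpace ℝ (Fin m) → EuclideanSpace ℝ (Fin m) [⋀^Fin 2]→L[ℝ] ℝ :=
    pullback (m := m) (m' := m) T.Φ η
  have hwd : ∀ x ∈ s, DifferentiableAt ℝ w x := by
    intro x hx
    have h1 : SmoothFormAt (m := m) (X := EuclideanSpace ℝ (Fin m)) w x :=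
      (hη (T.Φ x)).pullback (hB x hx).1
    unfold SmoothFormAt at h1
    rw [inChart_model, extChartAt_model_space_eq_id] at h1
    exact h1.differentiableAt (by simp)
  have hwc : ∀ x ∈ s, extDeriv w x = 0 := by
    intro x hx
    have h1 := d_pullback (hη (T.Φ x)) (hB x hx).1
    rw [d_model] at h1
    refine h1.trans ?_
    unfold pullback
    rw [hd]
    rfl
  have hdL : ∀ x ∈ s, ∀ v : EuclideanSpace ℝ (Fin m),
      (mfderiv (𝓡 m') (𝓡 m') c (q (T.Φ x))
        (mfderiv (𝓡 m) (𝓡 m') q (T.Φ x) (mfderiv (𝓡 m) (𝓡 m) T.Φ x v)) :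
          EuclideanSpace ℝ (Fin m')) = T.L v := by
    intro x hx v
    have h1 := mfderiv_comp x (g := q) (f := T.Φ) (hq.mdifferentiableAt (by simp))
      ((hB x hx).1.mdifferentiableAt (by simp))
    have h2 := mfderiv_comp x (g := c) (f := q ∘ T.Φ)
      (mdifferentiableAt_chart (q p₀) (hB x hx).2.1)
      ((hq.mdifferentiableAt (by simp)).comp x ((hB x hx).1.mdifferentiableAt (by simp)))
    have e : c ∘ (q ∘ T.Φ) =ᶠ[𝓝 x] T.L := by
      filter_upwards [hso.mem_nhds hx] with y hy
      exact (hB y hy).2.2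
    rw [e.mfderiv_eq, mfderiv_eq_fderiv, T.L.fderiv, h1] at h2
    exact (congrArg (fun B ↦ B v) h2).symm
  have hwk : ∀ x ∈ s, ∀ k v, T.L k = 0 → w x ![k, v] = 0 := by
    intro x hx k v hkk
    refine (pullback_two_apply T.Φ η x k v).trans (hk _ _ _ ?_)
    have h1 := (hdL x hx k).trans hkk
    have h2 := mfderiv_symm_comp_chart (q p₀) (hB x hx).2.1
      (mfderiv (𝓡 m) (𝓡 m') q (T.Φ x) (mfderiv (𝓡 m) (𝓡 m) T.Φ x k))
    rw [← h2]
    exact (congrArg _ h1).trans (map_zero _)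
  have hH := T.smooth_H.self_of_nhds.continuousAt
  have hO : ∀ᶠ p in 𝓝 p₀, (∀ᶠ y in 𝓝 p, T.Φ (T.H y) = y) ∧ ContMDiffAt (𝓡 m) (𝓡 m) ∞ T.H p ∧
      T.H p ∈ s :=
    T.Φ_H.eventually_nhds.and (T.smooth_H.and (hH.eventually_mem (Metric.ball_mem_nhds _ hr)))
  have hval : ∀ p, ((∀ᶠ y in 𝓝 p, T.Φ (T.H y) = y) ∧ ContMDiffAt (𝓡 m) (𝓡 m) ∞ T.H p ∧
      T.H p ∈ s) → (∀ v w' : TangentSpace (𝓡 m) p, η p ![v, w'] = w (T.H p)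
        ![mfderiv (𝓡 m) (𝓡 m) T.H p v, mfderiv (𝓡 m) (𝓡 m) T.H p w']) ∧
      c (q p) = T.L (T.H p) ∧
      ∀ v : TangentSpace (𝓡 m) p, (mfderiv (𝓡 m') (𝓡 m') c (q p) (mfderiv (𝓡 m) (𝓡 m') q p v) :
        EuclideanSpace ℝ (Fin m')) = T.L (mfderiv (𝓡 m) (𝓡 m) T.H p v) := by
    rintro p ⟨h1, h2, h3⟩
    have e0 := h1.self_of_nhds
    have h4 := mfderiv_comp p (g := T.Φ) (f := T.H) ((hB _ h3).1.mdifferentiableAt (by simp))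
      (h2.mdifferentiableAt (by simp))
    have e : T.Φ ∘ T.H =ᶠ[𝓝 p] id := h1
    rw [e.mfderiv_eq, mfderiv_id] at h4
    have h5 : ∀ v : TangentSpace (𝓡 m) p, (mfderiv (𝓡 m) (𝓡 m) T.Φ (T.H p)
        (mfderiv (𝓡 m) (𝓡 m) T.H p v) : EuclideanSpace ℝ (Fin m)) = v := fun v ↦
      (congrArg (fun B ↦ B v) h4).symm
    -- Transport along `T.Φ (T.H p) = p`: tangent vectors are compared as elements of the model
    -- space, since the tangent spaces at the two sides are different types.
    have key : ∀ x : X, x = p → (∀ v w' : EuclideanSpace ℝ (Fin m), η p ![v, w'] = η x ![v, w']) ∧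
      c (q p) = c (q x) ∧ ∀ v : EuclideanSpace ℝ (Fin m),
        (mfderiv (𝓡 m') (𝓡 m') c (q p) (mfderiv (𝓡 m) (𝓡 m') q p v) :
        EuclideanSpace ℝ (Fin m')) =
        mfderiv (𝓡 m') (𝓡 m') c (q x) (mfderiv (𝓡 m) (𝓡 m') q x v) := by
      rintro x rfl
      exact ⟨fun _ _ ↦ rfl, rfl, fun _ ↦ rfl⟩
    obtain ⟨k1, k2, k3⟩ := key _ e0
    refine ⟨fun v w' ↦ ?_, ?_, fun v ↦ ?_⟩
    · refine (k1 v w').trans ?_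
      refine Eq.trans ?_ (pullback_two_apply T.Φ η (T.H p) _ _).symm
      exact congrArg₂ (fun a b ↦ η (T.Φ (T.H p)) ![a, b]) (h5 v).symm (h5 w').symm
    · exact k2.trans (hB _ h3).2.2
    · refine (k3 v).trans ?_
      refine Eq.trans ?_ (hdL _ h3 _)
      exact congrArg (fun a ↦ mfderiv (𝓡 m') (𝓡 m') c (q (T.Φ (T.H p)))
        (mfderiv (𝓡 m) (𝓡 m') q (T.Φ (T.H p)) a)) (h5 v).symm
  refine ⟨_, hO, fun p hp p' hp' hpp v u v' u' hv hu ↦ ?_⟩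
  obtain ⟨a1, a2, a3⟩ := hval p hp
  obtain ⟨b1, b2, b3⟩ := hval p' hp'
  have hcst := eq_of_closed_of_ker hso (convex_ball _ _) hwd hwc hwk hp.2.2 hp'.2.2
    (by rw [← a2, ← b2, hpp])
  have hc' : ∀ a : EuclideanSpace ℝ (Fin m'), (mfderiv (𝓡 m') (𝓡 m') c (q p) a :
      EuclideanSpace ℝ (Fin m')) = mfderiv (𝓡 m') (𝓡 m') c (q p') a := by
    rw [hpp]
    exact fun _ ↦ rfl
  let x₁ : EuclideanSpace ℝ (Fin m) := mfderiv (𝓡 m) (𝓡 m) T.H p v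
  let x₂ : EuclideanSpace ℝ (Fin m) := mfderiv (𝓡 m) (𝓡 m) T.H p' v'
  let y₁ : EuclideanSpace ℝ (Fin m) := mfderiv (𝓡 m) (𝓡 m) T.H p u
  let y₂ : EuclideanSpace ℝ (Fin m) := mfderiv (𝓡 m) (𝓡 m) T.H p' u'
  have hLv : T.L (x₁ - x₂) = 0 := by
    rw [map_sub, sub_eq_zero]
    exact (a3 v).symm.trans ((hc' _).trans ((congrArg _ hv).trans (b3 v')))
  have hLu : T.L (y₁ - y₂) = 0 := by
    rw [map_sub, sub_eq_zero]
    exact (a3 u).symm.trans ((hc' _).trans ((congrArg _ hu).trans (b3 u')))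
  have gen : ∀ a b a' b' : EuclideanSpace ℝ (Fin m), T.L (a - a') = 0 → T.L (b - b') = 0 →
      w (T.H p) ![a, b] = w (T.H p') ![a', b'] := by
    intro a b a' b' ha hb
    rw [hcst]
    have e1 := hwk _ hp.2.2 _ b ha
    have e2 := hwk _ hp.2.2 _ a' hb
    have e1' : w (T.H p) ![a, b] - w (T.H p) ![a', b] = 0 :=
      (form_two_sub_left (X := EuclideanSpace ℝ (Fin m)) (p := T.H p) (w (T.H p)) a a' b).symm.trans e1
    have e2' : w (T.H p) ![b, a'] - w (T.H p) ![b', a'] = 0 :=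
      (form_two_sub_left (X := EuclideanSpace ℝ (Fin m)) (p := T.H p) (w (T.H p)) b b' a').symm.trans e2
    have s1 : w (T.H p) ![b, a'] = -w (T.H p) ![a', b] :=
      form_two_swap (X := EuclideanSpace ℝ (Fin m)) (p := T.H p) (w (T.H p)) b a'
    have s2 : w (T.H p) ![b', a'] = -w (T.H p) ![a', b'] :=
      form_two_swap (X := EuclideanSpace ℝ (Fin m)) (p := T.H p) (w (T.H p)) b' a'
    rw [s1, s2] at e2'
    linarith
  exact (a1 v u).trans ((gen _ _ _ _ hLv hLu).trans (b1 v' u').symm)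

/-- Two points of a fibre are joined by an integral curve that stays in the fibre and is defined on
an interval. The local comparison is transitive and symmetric, so it spreads over this connected
parameter set. -/
theorem sameDescent_of_fibres {V : VectField m X} {q : X → Y} (hq : ContMDiff (𝓡 m) (𝓡 m') ∞ q)
    (hs : ∀ p, Function.Surjective (mfderiv (𝓡 m) (𝓡 m') q p))
    (hfib : ∀ p p', q p = q p' ↔ SameOrbit V p p') {η : DForm m X 2}
    (hη : ∀ p, SmoothFormAt η p) (hd : ∀ p, d η p = 0)
    (hk : ∀ p v w, mfderiv (𝓡 m) (𝓡 m') q p v = 0 → η p ![v, w] = 0) {p p' : X}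
    (hpp : q p = q p') : SameDescent (m' := m') q η p p' := by
  obtain ⟨γ, s, hso, ho, hγ, ⟨t, ht, rfl⟩, ⟨t', ht', rfl⟩⟩ := (hfib p p').1 hpp
  have hqγ : ∀ a ∈ s, ∀ b ∈ s, q (γ a) = q (γ b) := fun a ha b hb ↦
    (hfib _ _).2 ⟨γ, s, hso, ho, hγ, ⟨a, ha, rfl⟩, ⟨b, hb, rfl⟩⟩
  refine IsPreconnected.induction₂' ho.isPreconnected
    (fun a b ↦ SameDescent (m' := m') q η (γ a) (γ b)) ?_
    (fun _ _ _ _ _ _ h h' ↦ h.trans hs h') ht ht'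
  intro a ha
  obtain ⟨O, hO, hO'⟩ := sameDescent_locally hq hs hη hd hk (γ a)
  have hc : ContinuousWithinAt γ s a := (hγ a ha).continuousWithinAt
  filter_upwards [hc hO, self_mem_nhdsWithin] with b hb hbs
  have h1 := hO' _ (mem_of_mem_nhds hO) _ hb (hqγ a ha b hbs)
  exact ⟨h1, h1.symm⟩

end Descent

/-! ### Descent of a closed form through local sections -/

section Descent

variable {m m' : ℕ}
  {X : Type*} [TopologicalSpace X] [ChartedSpace (EuclideanSpace ℝ (Fin m)) X]
  [IsManifold (𝓡 m) ∞ X]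
  {Y : Type*} [TopologicalSpace Y] [ChartedSpace (EuclideanSpace ℝ (Fin m')) Y]
  [IsManifold (𝓡 m') ∞ Y]

theorem mfderiv_section {q : X → Y} {s : Y → X} {y : Y}
    (hq : MDifferentiableAt (𝓡 m) (𝓡 m') q (s y)) (hs : MDifferentiableAt (𝓡 m') (𝓡 m) s y)
    (h : ∀ᶠ z in 𝓝 y, q (s z) = z) (v : TangentSpace (𝓡 m') y) :
    (mfderiv (𝓡 m) (𝓡 m') q (s y) (mfderiv (𝓡 m') (𝓡 m) s y v) : EuclideanSpace ℝ (Fin m')) =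
      v := by
  have h1 := mfderiv_comp y (g := q) (f := s) hq hs
  have e : q ∘ s =ᶠ[𝓝 y] id := h
  rw [e.mfderiv_eq, mfderiv_id] at h1
  exact (congrArg (fun B ↦ B v) h1).symm

theorem pullback_injective {q : X → Y} (hsurj : Function.Surjective q)
    (hs : ∀ p, Function.Surjective (mfderiv (𝓡 m) (𝓡 m') q p)) {τ τ' : DForm m' Y 2}
    (h : pullback (m := m) (m' := m') q τ = pullback (m := m) (m' := m') q τ') : τ = τ' := by
  funext y
  obtain ⟨p, rfl⟩ := hsurj y
  refine form_two_ext fun v w ↦ ?_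
  obtain ⟨a, rfl⟩ := hs p v
  obtain ⟨b, rfl⟩ := hs p w
  rw [← pullback_two_apply, ← pullback_two_apply, h]

/-- A closed `2`-form annihilating the vertical vectors of a submersion whose fibres are the orbits
of a vector field is the pullback of a closed form. -/
theorem exists_descended_form {V : VectField m X} {q : X → Y} (hq : ContMDiff (𝓡 m) (𝓡 m') ∞ q)
    (hsurj : Function.Surjective q)
    (hs : ∀ p, Function.Surjective (mfderiv (𝓡 m) (𝓡 m') q p))
    (hfib : ∀ p p', q p = q p' ↔ SameOrbit V p p') {η : DForm m X 2}
    (hη : ∀ p, SmoothFormAt η p) (hd : ∀ p, d η p = 0)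
    (hk : ∀ p v w, mfderiv (𝓡 m) (𝓡 m') q p v = 0 → η p ![v, w] = 0) :
    ∃ τ : DForm m' Y 2, pullback (m := m) (m' := m') q τ = η ∧ (∀ y, SmoothFormAt τ y) ∧
      ∀ y, d τ y = 0 := by
  have hsec : ∀ y, ∃ s : Y → X, ContMDiffAt (𝓡 m') (𝓡 m) ∞ s y ∧ ∀ᶠ z in 𝓝 y, q (s z) = z := by
    intro y
    obtain ⟨p, rfl⟩ := hsurj y
    obtain ⟨s, -, h1, h2⟩ := exists_local_section hq (hs p)
    exact ⟨s, h1, h2⟩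
  choose s hsm hsq using hsec
  have hqd : ∀ p, MDifferentiableAt (𝓡 m) (𝓡 m') q p := fun p ↦ hq.mdifferentiableAt (by simp)
  let τ : DForm m' Y 2 := fun y ↦ pullback (m := m') (m' := m) (s y) η y
  -- The value at y does not depend on the section. Hence near y the form τ, built from a different
  -- section at every point, coincides with the pullback by one smooth section.
  have key : ∀ (σ : Y → X) (y : Y), MDifferentiableAt (𝓡 m') (𝓡 m) σ y →
      (∀ᶠ z in 𝓝 y, q (σ z) = z) → τ y = pullback (m := m') (m' := m) σ η y := by
    intro σ y h1 h2
    refine form_two_ext fun v w ↦ ?_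
    have h3 := (hsm y).mdifferentiableAt (by simp)
    refine (pullback_two_apply (s y) η y v w).trans
      (Eq.trans ?_ (pullback_two_apply σ η y v w).symm)
    refine sameDescent_of_fibres hq hs hfib hη hd hk
      ((hsq y).self_of_nhds.trans h2.self_of_nhds.symm) _ _ _ _ ?_ ?_
    · exact (mfderiv_section (hqd _) h3 (hsq y) v).trans (mfderiv_section (hqd _) h1 h2 v).symm
    · exact (mfderiv_section (hqd _) h3 (hsq y) w).trans (mfderiv_section (hqd _) h1 h2 w).symm
  have hloc : ∀ y, ∀ᶠ z in 𝓝 y, pullback (m := m') (m' := m) (s y) η z = τ z := by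
    intro y
    filter_upwards [eventually_contMDiffAt_one (hsm y), (hsq y).eventually_nhds] with z h1 h2
    exact (key (s y) z (h1.mdifferentiableAt (by simp)) h2).symm
  refine ⟨τ, funext fun p ↦ form_two_ext fun v w ↦ ?_, fun y ↦ ?_, fun y ↦ ?_⟩
  · refine (pullback_two_apply q τ p v w).trans ?_
    refine (pullback_two_apply (s (q p)) η (q p) _ _).trans ?_
    have h3 := (hsm (q p)).mdifferentiableAt (by simp)
    exact sameDescent_of_fibres hq hs hfib hη hd hk (hsq (q p)).self_of_nhds _ _ _ _
      (mfderiv_section (hqd _) h3 (hsq (q p)) _) (mfderiv_section (hqd _) h3 (hsq (q p)) _)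
  · exact ((hη (s y y)).pullback (hsm y)).congr (hloc y)
  · rw [← d_congr (hloc y), d_pullback (hη (s y y)) (hsm y)]
    unfold pullback
    rw [hd]
    rfl

end Descent

/-! ### The forms and the circle action on the quotient M -/

section Correspondence

variable {n : ℕ}
  {N : Type*} [TopologicalSpace N]
  [ChartedSpace (EuclideanSpace ℝ (Fin (4 * n))) N] [IsManifold (𝓡 (4 * n)) ∞ N]
  [T2Space N] [RiemannianBundle (fun p : N ↦ TangentSpace (𝓡 (4 * n)) p)]
  [IsContMDiffRiemannianBundle (𝓡 (4 * n)) ∞ (EuclideanSpace ℝ (Fin (4 * n)))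
      (fun p : N ↦ TangentSpace (𝓡 (4 * n)) p)]
  {D : AffineConnection (4 * n) N}
  {G : Π p : N, Submodule ℝ
    (TangentSpace (𝓡 (4 * n)) p →L[ℝ] TangentSpace (𝓡 (4 * n)) p)}
  {Z : VectField (4 * n) N}
  {P : Type*} [TopologicalSpace P] [ChartedSpace (EuclideanSpace ℝ (Fin (4 * n + 1))) P]
  [IsManifold (𝓡 (4 * n + 1)) ∞ P]
  [MulAction Circle P] {pr : P → N} {ι : Type*} {𝔤 : ι → Gauge n N P}
  {Z' : VectField (4 * n + 1) P}
  {M : Type*} [TopologicalSpace M]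
  [ChartedSpace (EuclideanSpace ℝ (Fin (4 * n))) M] [IsManifold (𝓡 (4 * n)) ∞ M]

/-- `q` is the quotient of `P` by the orbits of the vector field `V`. -/
structure IsOrbitQuotient (V : VectField (4 * n + 1) P) (q : P → M) : Prop where
  smooth : ContMDiff (𝓡 (4 * n + 1)) (𝓡 (4 * n)) ∞ q
  surjective : Function.Surjective q
  submersion : ∀ p, Function.Surjective (mfderiv (𝓡 (4 * n + 1)) (𝓡 (4 * n)) q p)
  fibre : ∀ p p' : P, q p = q p' ↔ SameOrbit V p p'

namespace IsOrbitQuotient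

theorem mdifferentiableAt {V : VectField (4 * n + 1) P} {q : P → M} (hq : IsOrbitQuotient V q)
    (p : P) : MDifferentiableAt (𝓡 (4 * n + 1)) (𝓡 (4 * n)) q p :=
  hq.smooth.mdifferentiableAt (by simp)

theorem mfderiv_field {V : VectField (4 * n + 1) P} {q : P → M} (hq : IsOrbitQuotient V q)
    (p : P) : mfderiv (𝓡 (4 * n + 1)) (𝓡 (4 * n)) q p (V p) = 0 :=
  mfderiv_eq_zero_of_fibres (fun p ↦ hq.mdifferentiableAt p) hq.fibre p

theorem exists_smul {V : VectField (4 * n + 1) P} {q : P → M} (hq : IsOrbitQuotient V q)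
    {p : P} (hV : V p ≠ 0) {v : TangentSpace (𝓡 (4 * n + 1)) p}
    (hv : mfderiv (𝓡 (4 * n + 1)) (𝓡 (4 * n)) q p v = 0) : ∃ a : ℝ, v = a • V p :=
  exists_smul_of_mem_ker rfl (hq.submersion p) hV (hq.mfderiv_field p) hv

end IsOrbitQuotient

namespace IsCorrespondence

theorem form_eq_zero_of_ker (h : IsCorrespondence pr D G Z 𝔤 Z') {q : P → M}
    (hq : IsOrbitQuotient Z' q) (b : Fin 3) (p : P) (v w : TangentSpace (𝓡 (4 * n + 1)) p)
    (hv : mfderiv (𝓡 (4 * n + 1)) (𝓡 (4 * n)) q p v = 0) : h.form b p ![v, w] = 0 := by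
  obtain ⟨a, rfl⟩ := hq.exists_smul (h.lift_ne_zero p) hv
  rw [form_two_smul_left, h.form_lift, mul_zero]

theorem exists_descended (h : IsCorrespondence pr D G Z 𝔤 Z') {q : P → M}
    (hq : IsOrbitQuotient Z' q) :
    ∃ τ : Fin 3 → DForm (4 * n) M 2,
      (∀ b, pullback (m := 4 * n + 1) (m' := 4 * n) q (τ b) = h.form b) ∧
      (∀ b y, SmoothFormAt (τ b) y) ∧ ∀ b y, d (τ b) y = 0 := by
  have key : ∀ b, ∃ τ : DForm (4 * n) M 2,
      pullback (m := 4 * n + 1) (m' := 4 * n) q τ = h.form b ∧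
      (∀ y, SmoothFormAt τ y) ∧ ∀ y, d τ y = 0 := fun b ↦
    exists_descended_form hq.smooth hq.surjective hq.submersion hq.fibre (h.smooth_form b)
      (h.d_form b) (h.form_eq_zero_of_ker hq b)
  choose τ h1 h2 h3 using key
  exact ⟨τ, h1, h2, h3⟩

/-- The circle action maps orbits of Z' to orbits, so it induces maps of M, defined through an
arbitrary set-theoretic section. Smoothness holds because near each point the section may be
replaced by a smooth local one. -/
theorem exists_descended_action (h : IsCorrespondence pr D G Z 𝔤 Z') {q : P → M}
    (hq : IsOrbitQuotient Z' q) :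
    ∃ ρ : Circle → M → M, ρ 1 = id ∧ (∀ z w, ρ (z * w) = ρ z ∘ ρ w) ∧
      ContMDiff ((𝓡 1).prod (𝓡 (4 * n))) (𝓡 (4 * n)) ∞ (fun zx : Circle × M ↦ ρ zx.1 zx.2) ∧
      ∀ z p, q (z • p) = ρ z (q p) := by
  choose r hr using hq.surjective
  let ρ : Circle → M → M := fun z y ↦ q (z • r y)
  have hρ : ∀ z p, q (z • p) = ρ z (q p) := fun z p ↦
    (hq.fibre _ _).2 (h.sameOrbit_smul z ((hq.fibre _ _).1 (hr (q p)).symm))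
  refine ⟨ρ, funext fun y ↦ ?_, fun z w ↦ funext fun y ↦ ?_, fun x₀ ↦ ?_, hρ⟩
  · change q ((1 : Circle) • r y) = y
    rw [one_smul, hr]
  · change q ((z * w) • r y) = ρ z (q (w • r y))
    rw [← hρ, mul_smul]
  · obtain ⟨z₀, y₀⟩ := x₀
    obtain ⟨s, h0, h1, h2⟩ := exists_local_section hq.smooth (hq.submersion (r y₀))
    rw [hr] at h0 h1 h2
    have hs : ContMDiffAt ((𝓡 1).prod (𝓡 (4 * n))) (𝓡 (4 * n + 1)) ∞
        (fun zx : Circle × M ↦ s zx.2) (z₀, y₀) :=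
      ContMDiffAt.comp (I' := 𝓡 (4 * n)) (z₀, y₀) h1 contMDiffAt_snd
    have ha : ContMDiffAt ((𝓡 1).prod (𝓡 (4 * n))) (𝓡 (4 * n + 1)) ∞
        (fun zx : Circle × M ↦ zx.1 • s zx.2) (z₀, y₀) :=
      ContMDiffAt.comp (I' := (𝓡 1).prod (𝓡 (4 * n + 1)))
        (g := fun zp : Circle × P ↦ zp.1 • zp.2)
        (z₀, y₀) h.principal.smooth_action.contMDiffAt (contMDiffAt_fst.prodMk hs)
    have hf : ContMDiffAt ((𝓡 1).prod (𝓡 (4 * n))) (𝓡 (4 * n)) ∞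
        (fun zx : Circle × M ↦ q (zx.1 • s zx.2)) (z₀, y₀) :=
      ContMDiffAt.comp (I' := 𝓡 (4 * n + 1)) (z₀, y₀) hq.smooth.contMDiffAt ha
    refine hf.congr_of_eventuallyEq ?_
    have h3 : ∀ᶠ zx : Circle × M in 𝓝 (z₀, y₀), q (s zx.2) = zx.2 :=
      (continuous_snd.continuousAt (x := (z₀, y₀))).eventually h2
    filter_upwards [h3] with zx hzx
    rw [hρ, hzx]

/-- Pullback by the surjective submersion q is injective on two-forms and intertwines the two circle
actions, so the identities on P pass to M. -/
theorem pullback_action (h : IsCorrespondence pr D G Z 𝔤 Z') {q : P → M}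
    (hq : IsOrbitQuotient Z' q) {τ : Fin 3 → DForm (4 * n) M 2}
    (hτ : ∀ b, pullback (m := 4 * n + 1) (m' := 4 * n) q (τ b) = h.form b) {ρ : Circle → M → M}
    (hρs : ContMDiff ((𝓡 1).prod (𝓡 (4 * n))) (𝓡 (4 * n)) ∞ (fun zx : Circle × M ↦ ρ zx.1 zx.2))
    (hρ : ∀ z p, q (z • p) = ρ z (q p)) (z : Circle) :
    pullback (m := 4 * n) (m' := 4 * n) (ρ z) (τ 0) = τ 0 ∧
    pullback (m := 4 * n) (m' := 4 * n) (ρ z) (τ 1) = cosTwo z • τ 1 - sinTwo z • τ 2 ∧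
    pullback (m := 4 * n) (m' := 4 * n) (ρ z) (τ 2) = sinTwo z • τ 1 + cosTwo z • τ 2 := by
  have hz : ContMDiff (𝓡 (4 * n)) (𝓡 (4 * n)) ∞ (ρ z) :=
    hρs.comp (contMDiff_const.prodMk contMDiff_id)
  have key : ∀ b, pullback (m := 4 * n + 1) (m' := 4 * n) q
      (pullback (m := 4 * n) (m' := 4 * n) (ρ z) (τ b)) =
      pullback (m := 4 * n + 1) (m' := 4 * n + 1) (fun y : P ↦ z • y) (h.form b) := by
    intro b
    funext p
    rw [← hτ b, ← pullback_comp (τ b) (hz.mdifferentiableAt (by simp)) (hq.mdifferentiableAt p),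
      ← pullback_comp (τ b) (hq.mdifferentiableAt _)
        ((h.principal.smooth_smul z).mdifferentiableAt (by simp))]
    have e : ρ z ∘ q = q ∘ fun y : P ↦ z • y := funext fun p ↦ (hρ z p).symm
    rw [e]
  obtain ⟨h0, h1, h2⟩ := h.pullback_smul_form z
  refine ⟨pullback_injective hq.surjective hq.submersion ?_,
    pullback_injective hq.surjective hq.submersion ?_,
    pullback_injective hq.surjective hq.submersion ?_⟩
  · rw [key, h0, hτ]
  · rw [key, h1, ← hτ, ← hτ]
    rfl
  · rw [key, h2, ← hτ, ← hτ]
    rfl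

end IsCorrespondence

end Correspondence

/-! ### Linear algebra of the hyperkähler metric -/

section Algebra

variable {V : Type*} [NormedAddCommGroup V] [InnerProductSpace ℝ V]

/-- The metric of the correspondence, read on the quaternion-Kähler side. -/
def hkMetric (u : ℝ) (Z : V) (K : Fin 3 → V →ₗ[ℝ] V) (v w : V) : ℝ :=
  4 * u⁻¹ * ⟪v, w⟫_ℝ - 16 * u⁻¹ ^ 3 * (⟪Z, v⟫_ℝ * ⟪Z, w⟫_ℝ + ⟪K 0 Z, v⟫_ℝ * ⟪K 0 Z, w⟫_ℝ +
    ⟪K 1 Z, v⟫_ℝ * ⟪K 1 Z, w⟫_ℝ + ⟪K 2 Z, v⟫_ℝ * ⟪K 2 Z, w⟫_ℝ)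

/-- Skew endomorphisms satisfying the quaternion relations. -/
structure IsSkewQuaternionic (K : Fin 3 → V →ₗ[ℝ] V) : Prop where
  skew : ∀ a v w, ⟪K a v, w⟫_ℝ = -⟪v, K a w⟫_ℝ
  sq : ∀ a v, K a (K a v) = -v
  mul : ∀ a v, K a (K (a + 1) v) = K (a + 2) v
  anti : ∀ a v, K (a + 1) (K a v) = -K (a + 2) v

variable {u : ℝ} {Z : V} {K : Fin 3 → V →ₗ[ℝ] V}

theorem hkMetric_symm (v w : V) : hkMetric u Z K v w = hkMetric u Z K w v := by
  unfold hkMetric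
  rw [real_inner_comm]
  ring

theorem IsSkewQuaternionic.inner_right (h : IsSkewQuaternionic K) (a : Fin 3) (v w : V) :
    ⟪v, K a w⟫_ℝ = -⟪K a v, w⟫_ℝ := by rw [h.skew, neg_neg]

/-- The hypotheses place v and w in the hyperplane A = -4u⁻¹Z♭. There the first term of `hkForm`
turns into -16u⁻³ Z♭∧(K_b Z)♭. With the second term it forms the self-dual combination of the four
covectors Z♭, (K_a Z)♭, which is the quadratic correction in `hkMetric` evaluated with K_b in the
first slot. -/
theorem hkMetric_K (h : IsSkewQuaternionic K) {T : Type*} {A : T → ℝ} {ϖ : T → V} {v w : T}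
    (hv : A v = -(4 * u⁻¹ * ⟪Z, ϖ v⟫_ℝ)) (hw : A w = -(4 * u⁻¹ * ⟪Z, ϖ w⟫_ℝ)) (b : Fin 3) :
    hkForm u Z (fun b v ↦ K b v) A ϖ b v w = hkMetric u Z K (K b (ϖ v)) (ϖ w) := by
  have s0 := h.sq 0
  have s1 := h.sq 1
  have s2 := h.sq 2
  have m01 : ∀ v, K 0 (K 1 v) = K 2 v := h.mul 0
  have m12 : ∀ v, K 1 (K 2 v) = K 0 v := h.mul 1
  have m20 : ∀ v, K 2 (K 0 v) = K 1 v := h.mul 2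
  have m10 : ∀ v, K 1 (K 0 v) = -K 2 v := h.anti 0
  have m21 : ∀ v, K 2 (K 1 v) = -K 0 v := h.anti 1
  have m02 : ∀ v, K 0 (K 2 v) = -K 1 v := h.anti 2
  fin_cases b
  · change 4 * u⁻¹ ^ 2 * (A v * ⟪K 0 Z, ϖ w⟫_ℝ - A w * ⟪K 0 Z, ϖ v⟫_ℝ) -
      16 * u⁻¹ ^ 3 * (⟪K 1 Z, ϖ v⟫_ℝ * ⟪K 2 Z, ϖ w⟫_ℝ - ⟪K 1 Z, ϖ w⟫_ℝ * ⟪K 2 Z, ϖ v⟫_ℝ) +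
      4 * u⁻¹ * ⟪K 0 (ϖ v), ϖ w⟫_ℝ = hkMetric u Z K (K 0 (ϖ v)) (ϖ w)
    unfold hkMetric
    simp only [h.inner_right, s0, m01, m02, inner_neg_left, hv, hw]
    ring
  · change 4 * u⁻¹ ^ 2 * (A v * ⟪K 1 Z, ϖ w⟫_ℝ - A w * ⟪K 1 Z, ϖ v⟫_ℝ) -
      16 * u⁻¹ ^ 3 * (⟪K 2 Z, ϖ v⟫_ℝ * ⟪K 0 Z, ϖ w⟫_ℝ - ⟪K 2 Z, ϖ w⟫_ℝ * ⟪K 0 Z, ϖ v⟫_ℝ) +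
      4 * u⁻¹ * ⟪K 1 (ϖ v), ϖ w⟫_ℝ = hkMetric u Z K (K 1 (ϖ v)) (ϖ w)
    unfold hkMetric
    simp only [h.inner_right, s1, m12, m10, inner_neg_left, hv, hw]
    ring
  · change 4 * u⁻¹ ^ 2 * (A v * ⟪K 2 Z, ϖ w⟫_ℝ - A w * ⟪K 2 Z, ϖ v⟫_ℝ) -
      16 * u⁻¹ ^ 3 * (⟪K 0 Z, ϖ v⟫_ℝ * ⟪K 1 Z, ϖ w⟫_ℝ - ⟪K 0 Z, ϖ w⟫_ℝ * ⟪K 1 Z, ϖ v⟫_ℝ) +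
      4 * u⁻¹ * ⟪K 2 (ϖ v), ϖ w⟫_ℝ = hkMetric u Z K (K 2 (ϖ v)) (ϖ w)
    unfold hkMetric
    simp only [h.inner_right, s2, m20, m21, inner_neg_left, hv, hw]
    ring

theorem hkForm_swap {T : Type*} {A : T → ℝ} {ϖ : T → V} (h : IsSkewQuaternionic K)
    (b : Fin 3) (v w : T) : hkForm u Z (fun b v ↦ K b v) A ϖ b v w =
      -hkForm u Z (fun b v ↦ K b v) A ϖ b w v := by
  unfold hkForm
  have : ⟪K b (ϖ v), ϖ w⟫_ℝ = -⟪K b (ϖ w), ϖ v⟫_ℝ := by rw [h.skew, real_inner_comm]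
  linear_combination 4 * u⁻¹ * this

/-- The hyperplane is a copy of V, with ϖ the identity and A the prescribed covector, so this is the
skewness of `hkForm`. -/
theorem hkMetric_K_left (h : IsSkewQuaternionic K) (b : Fin 3) (v w : V) :
    hkMetric u Z K (K b v) w = -hkMetric u Z K (K b w) v := by
  have key := fun v w ↦ hkMetric_K (u := u) (Z := Z) h (A := fun v ↦ -(4 * u⁻¹ * ⟪Z, v⟫_ℝ))
    (ϖ := id) (v := v) (w := w) rfl rfl b
  have h1 := hkForm_swap (u := u) (Z := Z) (A := fun v ↦ -(4 * u⁻¹ * ⟪Z, v⟫_ℝ)) (ϖ := id) h b v w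
  rw [key, key] at h1
  exact h1

theorem hkMetric_K_K (h : IsSkewQuaternionic K) (b : Fin 3) (v w : V) :
    hkMetric u Z K (K b v) (K b w) = hkMetric u Z K v w := by
  have hneg : ∀ x y : V, hkMetric u Z K (-x) y = -hkMetric u Z K x y := fun x y ↦ by
    unfold hkMetric
    simp only [inner_neg_left, inner_neg_right]
    ring
  rw [hkMetric_K_left h, h.sq, hneg, neg_neg, hkMetric_symm]

/-- The metric on v is 4u⁻³(u²‖v‖² - 4s), where s is the sum of the squared pairings of v with Z,
K₀Z, K₁Z, K₂Z. These four vectors are orthogonal of length ‖Z‖, so Bessel's inequality bounds s by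
‖Z‖²‖v‖², and the hypothesis says 4‖Z‖² < u². -/
theorem hkMetric_pos (h : IsSkewQuaternionic K) (hu : 2 * ‖Z‖ < u) {v : V} (hv : v ≠ 0) :
    0 < hkMetric u Z K v v := by
  have hu0 : 0 < u := lt_of_le_of_lt (by positivity) hu
  have hz : ∀ a w, ⟪K a w, K a w⟫_ℝ = ⟪w, w⟫_ℝ := fun a w ↦ by
    rw [h.skew, h.sq, inner_neg_right, neg_neg]
  have m01 : ∀ v, K 0 (K 1 v) = K 2 v := h.mul 0
  have m12 : ∀ v, K 1 (K 2 v) = K 0 v := h.mul 1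
  have m20 : ∀ v, K 2 (K 0 v) = K 1 v := h.mul 2
  have o : ∀ a w, ⟪w, K a w⟫_ℝ = 0 := fun a w ↦ by
    have h1 := h.skew a w w
    rw [real_inner_comm] at h1
    linarith
  have o01 : ⟪K 0 Z, K 1 Z⟫_ℝ = 0 := by rw [h.skew, m01, o, neg_zero]
  have o12 : ⟪K 1 Z, K 2 Z⟫_ℝ = 0 := by rw [h.skew, m12, o, neg_zero]
  have o20 : ⟪K 2 Z, K 0 Z⟫_ℝ = 0 := by rw [h.skew, m20, o, neg_zero]
  set a := ⟪Z, v⟫_ℝ with ha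
  set b := ⟪K 0 Z, v⟫_ℝ with hb
  set c := ⟪K 1 Z, v⟫_ℝ with hc
  set e := ⟪K 2 Z, v⟫_ℝ with he
  set s := a ^ 2 + b ^ 2 + c ^ 2 + e ^ 2 with hs
  have hbessel : s ≤ ‖Z‖ ^ 2 * ‖v‖ ^ 2 := by
    -- Squared norm of ‖Z‖² times the component of v orthogonal to the four vectors; the scaling
    -- avoids division by ‖Z‖.
    have hw : ‖v‖ ^ 2 * (‖Z‖ ^ 2) ^ 2 - ‖Z‖ ^ 2 * s =
        ‖(‖Z‖ ^ 2) • v - (a • Z + b • K 0 Z + c • K 1 Z + e • K 2 Z)‖ ^ 2 := by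
      have p0 : ⟪Z, K 0 Z⟫_ℝ = 0 := o 0 Z
      have p1 : ⟪Z, K 1 Z⟫_ℝ = 0 := o 1 Z
      have p2 : ⟪Z, K 2 Z⟫_ℝ = 0 := o 2 Z
      have p0' : ⟪K 0 Z, Z⟫_ℝ = 0 := by rw [real_inner_comm, p0]
      have p1' : ⟪K 1 Z, Z⟫_ℝ = 0 := by rw [real_inner_comm, p1]
      have p2' : ⟪K 2 Z, Z⟫_ℝ = 0 := by rw [real_inner_comm, p2]
      have o10 : ⟪K 1 Z, K 0 Z⟫_ℝ = 0 := by rw [real_inner_comm, o01]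
      have o21 : ⟪K 2 Z, K 1 Z⟫_ℝ = 0 := by rw [real_inner_comm, o12]
      have o02 : ⟪K 0 Z, K 2 Z⟫_ℝ = 0 := by rw [real_inner_comm, o20]
      have va : ⟪v, Z⟫_ℝ = a := by rw [real_inner_comm]
      have vb : ⟪v, K 0 Z⟫_ℝ = b := by rw [real_inner_comm]
      have vc : ⟪v, K 1 Z⟫_ℝ = c := by rw [real_inner_comm]
      have ve : ⟪v, K 2 Z⟫_ℝ = e := by rw [real_inner_comm]
      have zz : ⟪Z, Z⟫_ℝ = ‖Z‖ ^ 2 := real_inner_self_eq_norm_sq Z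
      rw [norm_sub_sq_real, norm_smul, ← real_inner_self_eq_norm_sq (_ + _)]
      simp only [inner_add_left, inner_add_right, real_inner_smul_left, real_inner_smul_right, hz,
        p0, p1, p2, p0', p1', p2', o01, o12, o20, o10, o21, o02, va, vb, vc, ve,
        zz, norm_pow, norm_norm, hs]
      ring
    rcases eq_or_ne Z 0 with rfl | hZ
    · simp [hs, ha, hb, hc, he]
    · have hZp : 0 < ‖Z‖ ^ 2 := by positivity
      have h1 : 0 ≤ ‖v‖ ^ 2 * (‖Z‖ ^ 2) ^ 2 - ‖Z‖ ^ 2 * s := by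
        rw [hw]
        positivity
      nlinarith
  have hvp : 0 < ‖v‖ ^ 2 := by positivity
  have h4 : 4 * ‖Z‖ ^ 2 < u ^ 2 := by nlinarith [norm_nonneg Z]
  have e1 : hkMetric u Z K v v = 4 * u⁻¹ ^ 3 * (u ^ 2 * ‖v‖ ^ 2 - 4 * s) := by
    unfold hkMetric
    rw [real_inner_self_eq_norm_sq, hs]
    field_simp
    ring
  rw [e1]
  have : 0 < u ^ 2 * ‖v‖ ^ 2 - 4 * s := by nlinarith
  positivity

/-- The structure induced on the quotient of `T` by the line spanned by the lift `Z'` of `Z`. -/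
theorem exists_quotient_structure [FiniteDimensional ℝ V] {T W : Type*} [AddCommGroup T]
    [Module ℝ T] [AddCommGroup W] [Module ℝ W]
    [FiniteDimensional ℝ W] (h : IsSkewQuaternionic K) (hu : 2 * ‖Z‖ < u)
    (A : T →ₗ[ℝ] ℝ) (ϖ : T →ₗ[ℝ] V) (Q : T →ₗ[ℝ] W) (hϖ : Function.Surjective ϖ)
    (hVW : Module.finrank ℝ V = Module.finrank ℝ W) {X Z' : T} (hX : ϖ X = 0) (hAX : A X ≠ 0)
    (hZ : ϖ Z' = Z) (hAZ : A Z' = -u) (hQ : ∀ v, Q v = 0 → ∃ r : ℝ, v = r • Z')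
    {s : Fin 3 → W → W → ℝ}
    (hs : ∀ b v w, s b (Q v) (Q w) = hkForm u Z (fun b v ↦ K b v) A ϖ b v w) :
    ∃ (I : Fin 3 → W →ₗ[ℝ] W) (g : W →ₗ[ℝ] W →ₗ[ℝ] ℝ),
      (∀ a v, I a (I a v) = -v) ∧ (∀ a v, I a (I (a + 1) v) = I (a + 2) v) ∧
      (∀ a v, I (a + 1) (I a v) = -I (a + 2) v) ∧ (∀ v w, g v w = g w v) ∧
      (∀ v, v ≠ 0 → 0 < g v v) ∧ (∀ a v w, g (I a v) (I a w) = g v w) ∧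
      ∀ a v w, s a v w = g (I a v) w := by
  have hu0 : 0 < u := lt_of_le_of_lt (by positivity) hu
  obtain ⟨R, hR⟩ := ϖ.exists_rightInverse_of_surjective (LinearMap.range_eq_top.2 hϖ)
  have hR' : ∀ v, ϖ (R v) = v := fun v ↦ congrArg (fun B ↦ B v) hR
  -- The section of ϖ with values in the hyperplane A = -4u⁻¹Z♭: an arbitrary right inverse
  -- corrected by a multiple of the vertical vector X, on which A does not vanish.
  let ψ : V →ₗ[ℝ] T := R - (((A X)⁻¹ • (A ∘ₗ R + (4 * u⁻¹) • innerₗ V Z)).smulRight X)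
  have hψ : ∀ v, ψ v = R v - ((A X)⁻¹ * (A (R v) + 4 * u⁻¹ * ⟪Z, v⟫_ℝ)) • X := fun v ↦ rfl
  have hϖψ : ∀ v, ϖ (ψ v) = v := fun v ↦ by
    rw [hψ, map_sub, map_smul, hX, smul_zero, sub_zero, hR']
  have hAψ : ∀ v, A (ψ v) = -(4 * u⁻¹ * ⟪Z, v⟫_ℝ) := fun v ↦ by
    rw [hψ, map_sub, map_smul, smul_eq_mul]
    field_simp
    ring
  -- The lift Z', which spans the kernel of Q, is not in the hyperplane: otherwise -u = -4u⁻¹‖Z‖²,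
  -- excluded by 2‖Z‖ < u. So V and W are identified through the hyperplane, and K and `hkMetric`
  -- are carried over.
  have hinj : Function.Injective (Q ∘ₗ ψ) := by
    refine (injective_iff_map_eq_zero _).2 fun v hv ↦ ?_
    obtain ⟨r, hr⟩ := hQ (ψ v) hv
    have h1 : v = r • Z := by rw [← hϖψ v, hr, map_smul, hZ]
    have h2 := hAψ v
    rw [hr, map_smul, hAZ, h1, real_inner_smul_right, real_inner_self_eq_norm_sq] at h2
    have h3 : r * (u ^ 2 - 4 * ‖Z‖ ^ 2) = 0 := by
      field_simp at h2
      simp only [smul_eq_mul] at h2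
      linarith
    have h4 : 4 * ‖Z‖ ^ 2 < u ^ 2 := by nlinarith [norm_nonneg Z]
    rcases mul_eq_zero.1 h3 with h5 | h5
    · rw [h1, h5, zero_smul]
    · linarith
  let L : V ≃ₗ[ℝ] W := LinearEquiv.ofInjectiveOfFinrankEq (Q ∘ₗ ψ) hinj hVW
  have hL : ∀ v, L v = Q (ψ v) := fun v ↦ rfl
  let B : V →ₗ[ℝ] V →ₗ[ℝ] ℝ := LinearMap.mk₂ ℝ (hkMetric u Z K)
    (fun _ _ _ ↦ by simp only [hkMetric, inner_add_left, inner_add_right]; ring)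
    (fun _ _ _ ↦ by
      simp only [hkMetric, real_inner_smul_left, real_inner_smul_right, smul_eq_mul]; ring)
    (fun _ _ _ ↦ by simp only [hkMetric, inner_add_right]; ring)
    (fun _ _ _ ↦ by simp only [hkMetric, real_inner_smul_right, smul_eq_mul]; ring)
  have hB : ∀ v w, B v w = hkMetric u Z K v w := fun v w ↦ rfl
  refine ⟨fun a ↦ L.toLinearMap ∘ₗ K a ∘ₗ L.symm.toLinearMap,
    B.compl₁₂ L.symm.toLinearMap L.symm.toLinearMap, fun a v ↦ ?_, fun a v ↦ ?_, fun a v ↦ ?_,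
    fun v w ↦ hkMetric_symm _ _, fun v hv ↦ ?_, fun a v w ↦ ?_, fun a v w ↦ ?_⟩
  · simp [h.sq]
  · simp [h.mul]
  · simp [h.anti]
  · exact hkMetric_pos h hu fun h0 ↦ hv (by simpa using congrArg L h0)
  · have := hkMetric_K_K (u := u) (Z := Z) h a (L.symm v) (L.symm w)
    simpa [hB] using this
  · have h1 := hs a (ψ (L.symm v)) (ψ (L.symm w))
    rw [← hL, ← hL, hkMetric_K h (by rw [hAψ, hϖψ]) (by rw [hAψ, hϖψ]), hϖψ, hϖψ] at h1
    simpa [hB] using h1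

end Algebra

/-! ### The pointwise hyperkähler structure on M -/

section Correspondence

variable {n : ℕ}
  {N : Type*} [TopologicalSpace N]
  [ChartedSpace (EuclideanSpace ℝ (Fin (4 * n))) N] [IsManifold (𝓡 (4 * n)) ∞ N]
  [T2Space N] [RiemannianBundle (fun p : N ↦ TangentSpace (𝓡 (4 * n)) p)]
  [IsContMDiffRiemannianBundle (𝓡 (4 * n)) ∞ (EuclideanSpace ℝ (Fin (4 * n)))
      (fun p : N ↦ TangentSpace (𝓡 (4 * n)) p)]
  {D : AffineConnection (4 * n) N}
  {G : Π p : N, Submodule ℝ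
    (TangentSpace (𝓡 (4 * n)) p →L[ℝ] TangentSpace (𝓡 (4 * n)) p)}
  {Z : VectField (4 * n) N}
  {P : Type*} [TopologicalSpace P] [ChartedSpace (EuclideanSpace ℝ (Fin (4 * n + 1))) P]
  [IsManifold (𝓡 (4 * n + 1)) ∞ P]
  [MulAction Circle P] {pr : P → N} {ι : Type*} {𝔤 : ι → Gauge n N P}
  {Z' : VectField (4 * n + 1) P}
  {M : Type*} [TopologicalSpace M]
  [ChartedSpace (EuclideanSpace ℝ (Fin (4 * n))) M] [IsManifold (𝓡 (4 * n)) ∞ M]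

/-- The data of a hyperkähler structure on a vector space with forms `s`. -/
structure IsPointwiseHyperkahler {W : Type*} [AddCommGroup W] [Module ℝ W] (s : Fin 3 → W → W → ℝ)
    (I : Fin 3 → W →ₗ[ℝ] W) (g : W →ₗ[ℝ] W →ₗ[ℝ] ℝ) : Prop where
  sq : ∀ a v, I a (I a v) = -v
  mul : ∀ a v, I a (I (a + 1) v) = I (a + 2) v
  anti : ∀ a v, I (a + 1) (I a v) = -I (a + 2) v
  symm : ∀ v w, g v w = g w v
  pos : ∀ v, v ≠ 0 → 0 < g v v
  orth : ∀ a v w, g (I a v) (I a w) = g v w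
  form : ∀ a v w, s a v w = g (I a v) w

/-- A point of the fibre and a gauge are chosen freely for each y; no dependence on y is controlled,
since the forms alone determine the structure and its regularity. -/
theorem IsCorrespondence.exists_pointwise (h : IsCorrespondence pr D G Z 𝔤 Z') {q : P → M}
    (hq : IsOrbitQuotient Z' q) {τ : Fin 3 → DForm (4 * n) M 2}
    (hτ : ∀ b, pullback (m := 4 * n + 1) (m' := 4 * n) q (τ b) = h.form b) (y : M) :
    ∃ (I : Fin 3 → EuclideanSpace ℝ (Fin (4 * n)) →ₗ[ℝ] EuclideanSpace ℝ (Fin (4 * n)))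
      (g : EuclideanSpace ℝ (Fin (4 * n)) →ₗ[ℝ] EuclideanSpace ℝ (Fin (4 * n)) →ₗ[ℝ] ℝ),
      IsPointwiseHyperkahler (fun b v w ↦ τ b y ![v, w]) I g := by
  obtain ⟨p, rfl⟩ := hq.surjective y
  obtain ⟨i, hi⟩ := h.cover (pr p)
  have hS := h.structured i
  have hK := hS.quat hi
  obtain ⟨X, hX, hX'⟩ := h.principal.exists_vertical p
  have hX1 := hX' (𝔤 i).c (hS.eventually_c hi).self_of_nhds
    (fun z ↦ hS.adapted.equivariant z p hi)
  let V := TangentSpace (𝓡 (4 * n)) (pr p)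
  let K : Fin 3 → V →ₗ[ℝ] V := fun b ↦
    { toFun := fun v ↦ (𝔤 i).K pr p b v
      map_add' := fun v w ↦ map_add _ v w
      map_smul' := fun r v ↦ map_smul _ r v }
  have hKs : IsSkewQuaternionic K := ⟨hS.orth hi, hK.sq, hK.mul, hK.anti⟩
  let ϖ : TangentSpace (𝓡 (4 * n + 1)) p →ₗ[ℝ] V :=
    { toFun := fun v ↦ mfderiv (𝓡 (4 * n + 1)) (𝓡 (4 * n)) pr p v
      map_add' := fun v w ↦ map_add _ v w
      map_smul' := fun r v ↦ map_smul _ r v }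
  let Q : TangentSpace (𝓡 (4 * n + 1)) p →ₗ[ℝ] EuclideanSpace ℝ (Fin (4 * n)) :=
    { toFun := fun v ↦ mfderiv (𝓡 (4 * n + 1)) (𝓡 (4 * n)) q p v
      map_add' := fun v w ↦ map_add _ v w
      map_smul' := fun r v ↦ map_smul _ r v }
  let A : TangentSpace (𝓡 (4 * n + 1)) p →ₗ[ℝ] ℝ := ((𝔤 i).A pr p).toLinearMap
  have hfd : FiniteDimensional ℝ V := Module.Finite.equiv (tangentId (pr p)).symm
  have hdim : Module.finrank ℝ V = Module.finrank ℝ (EuclideanSpace ℝ (Fin (4 * n))) :=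
    (tangentId (pr p)).finrank_eq
  obtain ⟨I, g, h1, h2, h3, h4, h5, h6, h7⟩ := exists_quotient_structure (u := (𝔤 i).u pr Z p) (Z := Z (pr p)) hKs
    (hS.pos _ hi) A ϖ Q (h.principal.submersion p) hdim (X := X) (Z' := Z' p) hX
    (by
      have e : A X = 2 := by
        change (2 : ℝ) * dAngle (𝔤 i).c p X -
          (𝔤 i).β (pr p) (mfderiv (𝓡 (4 * n + 1)) (𝓡 (4 * n)) pr p X) = 2
        rw [hX, hX1, map_zero]
        norm_num
      rw [e]
      norm_num)
    (h.lift p) (h.A_lift hi) (fun v hv ↦ hq.exists_smul (h.lift_ne_zero p) hv)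
    (s := fun b v w ↦ τ b (q p) ![v, w])
    (fun b v w ↦ by
      have e1 := pullback_two_apply q (τ b) p v w
      rw [hτ b, h.form_eq hi, hS.σ_apply hi] at e1
      exact e1.symm)
  exact ⟨I, g, ⟨h1, h2, h3, h4, h5, h6, h7⟩⟩

end Correspondence

/-! ### Regularity and integrability from closed two-forms -/

section TwoForms

variable {E F : Type*} [NormedAddCommGroup E] [NormedSpace ℝ E] [FiniteDimensional ℝ E]
  [NormedAddCommGroup F] [NormedSpace ℝ F]

omit [NormedAddCommGroup E] [NormedSpace ℝ E] [FiniteDimensional ℝ E] in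
theorem update_two_zero (v w a : E) : Function.update ![v, w] 0 a = ![a, w] := by
  funext i
  fin_cases i <;> rfl

omit [NormedAddCommGroup E] [NormedSpace ℝ E] [FiniteDimensional ℝ E] in
theorem update_two_one (v w a : E) : Function.update ![v, w] 1 a = ![v, a] := by
  funext i
  fin_cases i <;> rfl

/-- The bilinear map of an alternating two-form. -/
def formBilin (a : E [⋀^Fin 2]→L[ℝ] ℝ) : E →L[ℝ] E →L[ℝ] ℝ :=
  LinearMap.toContinuousLinearMap
    { toFun := fun v ↦ LinearMap.toContinuousLinearMap
        { toFun := fun w ↦ a ![v, w]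
          map_add' := fun w w' ↦ by
            have h := a.toMultilinearMap.map_update_add ![v, w] 1 w w'
            simp only [update_two_one] at h
            exact h
          map_smul' := fun r w ↦ by
            have h := a.toMultilinearMap.map_update_smul ![v, w] 1 r w
            simp only [update_two_one] at h
            exact h }
      map_add' := fun v v' ↦ by
        ext w
        have h := a.toMultilinearMap.map_update_add ![v, w] 0 v v'
        simp only [update_two_zero] at h
        exact h
      map_smul' := fun r v ↦ by
        ext w
        have h := a.toMultilinearMap.map_update_smul ![v, w] 0 r v
        simp only [update_two_zero] at h
        exact h }

theorem formBilin_apply (a : E [⋀^Fin 2]→L[ℝ] ℝ) (v w : E) : formBilin a v w = a ![v, w] := rfl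

theorem formBilin_swap (a : E [⋀^Fin 2]→L[ℝ] ℝ) (v w : E) :
    formBilin a v w = -formBilin a w v := by
  have h := a.map_swap ![w, v] (i := 0) (j := 1) (by simp)
  refine Eq.trans ?_ h
  change a _ = a _
  congr 1
  funext i
  fin_cases i <;> rfl

theorem contDiffAt_formBilin {S : F → E [⋀^Fin 2]→L[ℝ] ℝ} {x : F} {n : WithTop ℕ∞}
    (hS : ContDiffAt ℝ n S x) : ContDiffAt ℝ n (fun y ↦ formBilin (S y)) x := by
  rw [contDiffAt_clm_iff]
  intro v
  rw [contDiffAt_clm_iff]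
  intro w
  exact contDiffAt_form_iff.1 hS ![v, w]

/-- Near x the map A is invertible and J = -A⁻¹C, so J inherits the smoothness of A and C through
smoothness of inversion. -/
theorem contDiffAt_of_comp_eq {G : Type*} [NormedAddCommGroup G] [NormedSpace ℝ G]
    {A C : F → E →L[ℝ] G} {J : F → E →L[ℝ] E} {x : F} {n : WithTop ℕ∞} (hA : ContDiffAt ℝ n A x)
    (hC : ContDiffAt ℝ n C x) (e : E ≃L[ℝ] G) (he : (e : E →L[ℝ] G) = A x)
    (h : ∀ᶠ y in 𝓝 x, ∀ v, A y (J y v) = -C y v) : ContDiffAt ℝ n J x := by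
  have hc : CompleteSpace E := FiniteDimensional.complete ℝ E
  have hi : ContDiffAt ℝ n ContinuousLinearMap.inverse (A x) := by
    rw [← he]
    exact contDiffAt_map_inverse e
  have h1 : ContDiffAt ℝ n (fun y ↦ ContinuousLinearMap.inverse (A y)) x :=
    ContDiffAt.comp x hi hA
  refine (h1.clm_comp hC).neg.congr_of_eventuallyEq ?_
  have h3 : ∀ᶠ y in 𝓝 x, A y ∈ range ((↑) : (E ≃L[ℝ] G) → E →L[ℝ] G) := by
    refine hA.continuousAt.eventually_mem ?_
    rw [← he]
    exact e.nhds
  filter_upwards [h, h3] with y hy ⟨e', he'⟩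
  ext1 v
  have h4 : C y v = -e' (J y v) := by
    have h5 := hy v
    rw [← he'] at h5
    exact (neg_eq_iff_eq_neg.2 h5).symm
  change J y v = -(ContinuousLinearMap.inverse (A y) (C y v))
  rw [h4, ← he', ContinuousLinearMap.inverse_equiv]
  change J y v = -(e'.symm (-(e' (J y v))))
  rw [map_neg, neg_neg, e'.symm_apply_apply]

/-- A field of endomorphisms which relates two smooth families of two-forms is smooth. -/
theorem contDiffAt_of_form_eq {S T : F → E [⋀^Fin 2]→L[ℝ] ℝ} {J : F → E →L[ℝ] E} {x : F}
    {n : WithTop ℕ∞} (hS : ContDiffAt ℝ n S x) (hT : ContDiffAt ℝ n T x)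
    (hx : ∀ v, (∀ w, S x ![v, w] = 0) → v = 0)
    (h : ∀ᶠ y in 𝓝 x, ∀ v w, S y ![J y v, w] = -T y ![v, w]) : ContDiffAt ℝ n J x := by
  have hinj : Function.Injective (formBilin (S x)).toLinearMap := by
    rw [← LinearMap.ker_eq_bot, LinearMap.ker_eq_bot']
    intro v hv
    exact hx v fun w ↦ congrArg (fun A : E →L[ℝ] ℝ ↦ A w) hv
  have hdim : Module.finrank ℝ E = Module.finrank ℝ (E →L[ℝ] ℝ) := by
    rw [← (LinearMap.toContinuousLinearMap (𝕜 := ℝ) (E := E) (F' := ℝ)).finrank_eq]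
    exact Subspace.dual_finrank_eq.symm
  refine contDiffAt_of_comp_eq (contDiffAt_formBilin hS) (contDiffAt_formBilin hT)
    (LinearEquiv.ofInjectiveOfFinrankEq (formBilin (S x)).toLinearMap
      hinj hdim).toContinuousLinearEquiv ?_ ?_
  · ext v w
    rfl
  · filter_upwards [h] with y hy v
    ext w
    exact hy v w

theorem fderiv_form_apply {S : E → E [⋀^Fin 2]→L[ℝ] ℝ} {x : E} (hS : DifferentiableAt ℝ S x)
    (v w u : E) : fderiv ℝ (fun y ↦ S y ![v, w]) x u =
      fderiv ℝ (fun y ↦ S y) x u ![v, w] := by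
  have h := ((ContinuousAlternatingMap.apply ℝ E ℝ ![v, w]).hasFDerivAt (x := S x)).comp x
    hS.hasFDerivAt
  exact congrArg (fun A : E →L[ℝ] ℝ ↦ A u) h.fderiv

/-- If two closed non-degenerate two-forms are related by an almost complex structure, then its
Nijenhuis tensor vanishes. -/
theorem nijenhuis_eq_zero_of_closed {S T : E → E [⋀^Fin 2]→L[ℝ] ℝ} {J : E → E →L[ℝ] E} {x : E}
    (hS : ContDiffAt ℝ 1 S x) (hT : DifferentiableAt ℝ T x) (hJ : DifferentiableAt ℝ J x)
    (hx : ∀ v, (∀ w, S x ![v, w] = 0) → v = 0)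
    (h : ∀ᶠ y in 𝓝 x, ∀ v w, S y ![J y v, w] = -T y ![v, w])
    (hJ2 : ∀ᶠ y in 𝓝 x, ∀ v, J y (J y v) = -v)
    (hdS : extDeriv S x = 0) (hdT : extDeriv T x = 0) (v w : E) :
    fderiv ℝ J x (J x v) w - fderiv ℝ J x (J x w) v + J x (fderiv ℝ J x w v) -
      J x (fderiv ℝ J x v w) = 0 := by
  have hSd : DifferentiableAt ℝ S x := hS.differentiableAt (by simp)
  have hB := (contDiffAt_formBilin hS).differentiableAt (by simp)
  let s : E → E → ℝ := fun a b ↦ formBilin (S x) a b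
  let dS : E → E → E → ℝ := fun u a b ↦ fderiv ℝ S x u ![a, b]
  let dT : E → E → E → ℝ := fun u a b ↦ fderiv ℝ T x u ![a, b]
  let j : E → E := fun a ↦ J x a
  let dj : E → E → E := fun u a ↦ fderiv ℝ J x u a
  have cS : ∀ a b c, dS a b c - dS b a c + dS c a b = 0 := by
    intro a b c
    have := extDeriv_two_apply hSd a b c
    rw [hdS, fderiv_form_apply hSd, fderiv_form_apply hSd,
      fderiv_form_apply hSd] at this
    exact this.symm
  have cT : ∀ a b c, dT a b c - dT b a c + dT c a b = 0 := by
    intro a b c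
    have := extDeriv_two_apply hT a b c
    rw [hdT, fderiv_form_apply hT, fderiv_form_apply hT,
      fderiv_form_apply hT] at this
    exact this.symm
  have aS : ∀ u a b, dS u a b = -dS u b a := fun u a b ↦ formBilin_swap (fderiv ℝ S x u) a b
  have aT : ∀ u a b, dT u a b = -dT u b a := fun u a b ↦ formBilin_swap (fderiv ℝ T x u) a b
  have as : ∀ a b, s a b = -s b a := fun a b ↦ formBilin_swap (S x) a b
  have jj : ∀ a, j (j a) = -a := hJ2.self_of_nhds
  have sj : ∀ a b, s (j a) b = -T x ![a, b] := h.self_of_nhds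
  have sj' : ∀ a b, s (j a) b = s a (j b) := by
    intro a b
    have e1 := formBilin_swap (T x) a b
    rw [formBilin_apply, formBilin_apply] at e1
    rw [as a, sj, sj, e1]
  -- Differentiating T = -S(J·,·) expresses the derivatives of T by those of S and J, so that
  -- closedness of T becomes a condition on the derivative of J.
  have eT : ∀ u a b, dT u a b = -(dS u (j a) b + s (dj u a) b) := by
    intro u a b
    have h1 : (fun y ↦ T y ![a, b]) =ᶠ[𝓝 x] fun y ↦ -(formBilin (S y) (J y a) b) := by
      filter_upwards [h] with y hy
      rw [formBilin_apply, hy, neg_neg]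
    have h0 : HasFDerivAt (fun _ : E ↦ a) (0 : E →L[ℝ] E) x := hasFDerivAt_const a x
    have h0' : HasFDerivAt (fun _ : E ↦ b) (0 : E →L[ℝ] E) x := hasFDerivAt_const b x
    have h2 := ((hB.hasFDerivAt.clm_apply (hJ.hasFDerivAt.clm_apply h0)).clm_apply h0').neg
    have h3 := (h2.congr_of_eventuallyEq h1).fderiv
    have h4 : fderiv ℝ (fun y ↦ formBilin (S y)) x u (j a) b = dS u (j a) b := by
      have e1 := (hB.hasFDerivAt.clm_apply (hasFDerivAt_const (j a) x)).clm_apply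
        (hasFDerivAt_const b x)
      have e2 := congrArg (fun A : E →L[ℝ] ℝ ↦ A u) e1.fderiv
      have e3 := fderiv_form_apply hSd (j a) b u
      refine Eq.trans ?_ (e2.symm.trans e3)
      simp
    change fderiv ℝ T x u ![a, b] = _
    rw [← h4, ← fderiv_form_apply hT, h3]
    simp [s, dj, j, add_comm]
  have ej : ∀ u a, dj u (j a) = -j (dj u a) := by
    intro u a
    have h1 : (fun y ↦ J y (J y a)) =ᶠ[𝓝 x] fun _ ↦ -a := by
      filter_upwards [hJ2] with y hy
      exact hy a
    have h0 : HasFDerivAt (fun _ : E ↦ a) (0 : E →L[ℝ] E) x := hasFDerivAt_const a x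
    have h2 := hJ.hasFDerivAt.clm_apply (hJ.hasFDerivAt.clm_apply h0)
    have h00 : HasFDerivAt (fun _ : E ↦ -a) (0 : E →L[ℝ] E) x := hasFDerivAt_const (-a) x
    have h3 := (h2.congr_of_eventuallyEq h1.symm).unique h00
    have h4 : _ = (0 : E →L[ℝ] E) u := congrArg (fun A : E →L[ℝ] E ↦ A u) h3
    have h5 : j (dj u a) + dj u (j a) = 0 := by simpa [j, dj] using h4
    exact (neg_eq_of_add_eq_zero_right h5).symm
  have sneg : ∀ a b, s (-a) b = -s a b := fun a b ↦ by simp [s]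
  have dSneg : ∀ u a b, dS u (-a) b = -dS u a b := fun u a b ↦ by
    change formBilin (fderiv ℝ S x u) (-a) b = -formBilin (fderiv ℝ S x u) a b
    simp
  -- By nondegeneracy it is enough to pair the tensor with z under S. The pairing is a combination
  -- of dT at (Jv, w, z) and (Jw, v, z) and of dS at (Jv, Jw, z) and (v, w, z), after using J² = -1,
  -- its derivative, and S(J·,·) = S(·,J·).
  refine hx _ fun z ↦ ?_
  have key : s (dj (j v) w - dj (j w) v + j (dj w v) - j (dj v w)) z =
      s (dj (j v) w) z - s (dj (j w) v) z + s (j (dj w v)) z - s (j (dj v w)) z := by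
    simp [s]
  refine Eq.trans key ?_
  have k1 := cT (j v) w z
  have k2 := cT (j w) v z
  have k3 := cS (j v) (j w) z
  have k4 := cS v w z
  have k5 := aT z (j v) w
  simp only [eT, jj, ej, dSneg, sneg] at k1 k2 k5
  have k6 : s (dj z w) (j v) = s (j (dj z w)) v := (sj' _ _).symm
  have k7 := aS z (j w) (j v)
  have k8 := aS z w v
  have k9 := as w (dj z v)
  linarith

end TwoForms

/-! ### Positive definite forms bound the topology -/

section BilinearForms

variable {E : Type*} [NormedAddCommGroup E] [NormedSpace ℝ E] [FiniteDimensional ℝ E]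

/-- A bilinear form on a finite-dimensional space as a continuous bilinear form. -/
def bilinCLM (g : E →ₗ[ℝ] E →ₗ[ℝ] ℝ) : E →L[ℝ] E →L[ℝ] ℝ :=
  LinearMap.toContinuousLinearMap
    ((LinearMap.toContinuousLinearMap (𝕜 := ℝ) (E := E) (F' := ℝ)).toLinearMap ∘ₗ g)

/-- Required of a Riemannian metric as a bundled structure. The minimum of g on the compact unit
sphere is positive and bounds the norm on the unit ball of g; the sphere may be empty when E = 0. -/
theorem isVonNBounded_bilin (g : E →L[ℝ] E →L[ℝ] ℝ) (hg : ∀ v, v ≠ 0 → 0 < g v v) :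
    Bornology.IsVonNBounded ℝ {v : E | g v v < 1} := by
  have hp : ProperSpace E := FiniteDimensional.proper_real E
  rw [NormedSpace.isVonNBounded_iff']
  rcases (Metric.sphere (0 : E) 1).eq_empty_or_nonempty with h | h
  · refine ⟨0, fun v _ ↦ ?_⟩
    by_contra! hv
    have : ‖v‖⁻¹ • v ∈ Metric.sphere (0 : E) 1 := by
      rw [mem_sphere_zero_iff_norm, norm_smul, norm_inv, norm_norm, inv_mul_cancel₀ hv.ne']
    rw [h] at this
    exact this
  · obtain ⟨v₀, hv₀, hmin⟩ := (isCompact_sphere (0 : E) 1).exists_isMinOn h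
      (f := fun v ↦ g v v) (g.continuous.clm_apply continuous_id).continuousOn
    have hv₀' : v₀ ≠ 0 := by
      rintro rfl
      simp at hv₀
    have hc := hg v₀ hv₀'
    refine ⟨Real.sqrt (g v₀ v₀)⁻¹, fun v hv ↦ Real.le_sqrt_of_sq_le ?_⟩
    rcases eq_or_ne v 0 with rfl | hv0
    · rw [norm_zero, zero_pow two_ne_zero]
      exact (inv_pos.2 hc).le
    have hn : 0 < ‖v‖ := norm_pos_iff.2 hv0
    have h1 : ‖v‖⁻¹ • v ∈ Metric.sphere (0 : E) 1 := by
      rw [mem_sphere_zero_iff_norm, norm_smul, norm_inv, norm_norm, inv_mul_cancel₀ hn.ne']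
    have h2 : g v₀ v₀ ≤ g (‖v‖⁻¹ • v) (‖v‖⁻¹ • v) := hmin h1
    rw [map_smul, map_smul, smul_apply, smul_eq_mul, smul_eq_mul] at h2
    have h3 : g v v < 1 := hv
    have h4 : g v₀ v₀ * ‖v‖ ^ 2 ≤ g v v := by
      calc g v₀ v₀ * ‖v‖ ^ 2 ≤ ‖v‖⁻¹ * (‖v‖⁻¹ * g v v) * ‖v‖ ^ 2 := by gcongr
        _ = g v v := by field_simp
    rw [← one_div, le_div_iff₀ hc]
    linarith

end BilinearForms

/-! ### From chart expressions to smooth metrics and the Nijenhuis tensor -/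

section Transfer

variable {m : ℕ} {X : Type*} [TopologicalSpace X] [ChartedSpace (EuclideanSpace ℝ (Fin m)) X]
  [IsManifold (𝓡 m) ∞ X]

/-- A field of bilinear forms is smooth at `p` if its coefficients in the chart around `p` are. -/
theorem contMDiffAt_bilin {g : Π x : X, TangentSpace (𝓡 m) x →L[ℝ] TangentSpace (𝓡 m) x →L[ℝ] ℝ}
    {p : X} {B : EuclideanSpace ℝ (Fin m) →
      EuclideanSpace ℝ (Fin m) →L[ℝ] EuclideanSpace ℝ (Fin m) →L[ℝ] ℝ}
    (hB : ContDiffAt ℝ ∞ B (extChartAt (𝓡 m) p p))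
    (h : ∀ x ∈ (extChartAt (𝓡 m) p).source, ∀ v w : EuclideanSpace ℝ (Fin m),
      g x (mfderiv (𝓡 m) (𝓡 m) (extChartAt (𝓡 m) p).symm (extChartAt (𝓡 m) p x) v)
        (mfderiv (𝓡 m) (𝓡 m) (extChartAt (𝓡 m) p).symm (extChartAt (𝓡 m) p x) w) =
      B (extChartAt (𝓡 m) p x) v w) :
    ContMDiffAt (𝓡 m)
      ((𝓡 m).prod 𝓘(ℝ, EuclideanSpace ℝ (Fin m) →L[ℝ] EuclideanSpace ℝ (Fin m) →L[ℝ] ℝ)) ∞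
      (fun x ↦ TotalSpace.mk' (EuclideanSpace ℝ (Fin m) →L[ℝ] EuclideanSpace ℝ (Fin m) →L[ℝ] ℝ)
        (E := fun x : X ↦ TangentSpace (𝓡 m) x →L[ℝ] TangentSpace (𝓡 m) x →L[ℝ] ℝ) x (g x))
      p := by
  have h4 : ContMDiffAt (𝓡 m) (𝓡 m) ∞ (fun x : X ↦ x) p := contMDiffAt_id
  have h1 := contMDiffAt_hom_bundle (IB := 𝓡 m) (n := ∞) (F₁ := EuclideanSpace ℝ (Fin m))
    (E₁ := TangentSpace (𝓡 m) (M := X)) (F₂ := EuclideanSpace ℝ (Fin m) →L[ℝ] ℝ)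
    (E₂ := fun x : X ↦ TangentSpace (𝓡 m) x →L[ℝ] Bundle.Trivial X ℝ x) (IM := 𝓡 m) (x₀ := p)
    (fun x ↦ TotalSpace.mk' (EuclideanSpace ℝ (Fin m) →L[ℝ] EuclideanSpace ℝ (Fin m) →L[ℝ] ℝ)
        (E := fun x : X ↦ TangentSpace (𝓡 m) x →L[ℝ] TangentSpace (𝓡 m) x →L[ℝ]
          Bundle.Trivial X ℝ x) x (g x))
  refine h1.2 ⟨h4, ?_⟩
  have h5 : ContMDiffAt (𝓡 m)
      𝓘(ℝ, EuclideanSpace ℝ (Fin m) →L[ℝ] EuclideanSpace ℝ (Fin m) →L[ℝ] ℝ) ∞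
      (fun x ↦ B (extChartAt (𝓡 m) p x)) p :=
    (contMDiffAt_iff_contDiffAt.2 hB).comp (I' := 𝓡 m) p
      (contMDiffAt_chart p (mem_extChartAt_source p))
  refine h5.congr_of_eventuallyEq ?_
  filter_upwards [(isOpen_extChartAt_source (I := 𝓡 m) p).mem_nhds (mem_extChartAt_source p)]
    with z hz
  have hz' : z ∈ (chartAt (EuclideanSpace ℝ (Fin m)) p).source := by simpa using hz
  have hb : z ∈ (trivializationAt (EuclideanSpace ℝ (Fin m))
    (TangentSpace (𝓡 m) (M := X)) p).baseSet := by simpa using hz'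
  have h3 := TangentBundle.symmL_trivializationAt (I := 𝓡 m) hz'
  have hr : range (𝓡 m) = univ := by simp
  rw [hr, mfderivWithin_univ] at h3
  have h6 : ∀ v : EuclideanSpace ℝ (Fin m),
      (trivializationAt (EuclideanSpace ℝ (Fin m)) (TangentSpace (𝓡 m) (M := X)) p).symm z v =
      mfderiv (𝓡 m) (𝓡 m) (extChartAt (𝓡 m) p).symm (extChartAt (𝓡 m) p z) v := fun v ↦
    ((trivializationAt (EuclideanSpace ℝ (Fin m))
      (TangentSpace (𝓡 m)) p).symmL_apply (R := ℝ) hb v).symm.trans (congrArg (fun A ↦ A v) h3)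
  ext v w
  have h7 := inCoordinates_apply_eq₂ (𝕜 := ℝ) (F₁ := EuclideanSpace ℝ (Fin m))
    (E₁ := TangentSpace (𝓡 m) (M := X)) (F₂ := EuclideanSpace ℝ (Fin m))
    (E₂ := TangentSpace (𝓡 m) (M := X)) (F₃ := ℝ) (E₃ := Bundle.Trivial X ℝ) (x₀ := p) (x := z)
    (ϕ := g z) (v := v) (w := w) hb hb (by simp)
  refine h7.trans ?_
  rw [h6, h6, ← h z hz v w]
  simp

/-- The Nijenhuis tensor in charts. -/
theorem nijenhuisVanishes_of_chart {J : EndoField m X}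
    (hJ : ∀ p, DifferentiableAt ℝ (endoChart J p) (extChartAt (𝓡 m) p p))
    (hJ2 : ∀ p, ∀ v : TangentSpace (𝓡 m) p, J p (J p v) = -v)
    (hN : ∀ p, ∀ v w : EuclideanSpace ℝ (Fin m),
      fderiv ℝ (endoChart J p) (extChartAt (𝓡 m) p p)
          (endoChart J p (extChartAt (𝓡 m) p p) v) w -
        fderiv ℝ (endoChart J p) (extChartAt (𝓡 m) p p)
          (endoChart J p (extChartAt (𝓡 m) p p) w) v +
        endoChart J p (extChartAt (𝓡 m) p p)
          (fderiv ℝ (endoChart J p) (extChartAt (𝓡 m) p p) w v) -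
        endoChart J p (extChartAt (𝓡 m) p p)
          (fderiv ℝ (endoChart J p) (extChartAt (𝓡 m) p p) v w) = 0) :
    NijenhuisVanishes J := by
  intro p V W hV hW
  have hp := mem_extChartAt_source (I := 𝓡 m) p
  have ev : ∀ V : VectField m X, fieldChart (fun z ↦ J z (V z)) p
      =ᶠ[𝓝 (extChartAt (𝓡 m) p p)] fun y ↦ endoChart J p y (fieldChart V p y) := by
    intro V
    filter_upwards [extChartAt_target_mem_nhds p] with y hy
    exact fieldChart_endo J V p hy
  have dv : ∀ {V : VectField m X}, MDifferentiableAt (𝓡 m) (𝓡 m).tangent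
      (fun y ↦ (⟨y, V y⟩ : TangentBundle (𝓡 m) X)) p →
      DifferentiableAt ℝ (fieldChart V p) (extChartAt (𝓡 m) p p) :=
    fun h ↦ (mdifferentiableAt_field_iff hp).1 h
  have sJ : ∀ {V : VectField m X}, MDifferentiableAt (𝓡 m) (𝓡 m).tangent
      (fun y ↦ (⟨y, V y⟩ : TangentBundle (𝓡 m) X)) p → MDifferentiableAt (𝓡 m) (𝓡 m).tangent
      (fun y ↦ (⟨y, J y (V y)⟩ : TangentBundle (𝓡 m) X)) p := fun {V} h ↦
    (mdifferentiableAt_field_iff (W := fun y ↦ J y (V y)) hp).2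
      (((hJ p).clm_apply (dv h)).congr_of_eventuallyEq (ev V))
  have br : ∀ {V W : VectField m X}, MDifferentiableAt (𝓡 m) (𝓡 m).tangent
      (fun y ↦ (⟨y, V y⟩ : TangentBundle (𝓡 m) X)) p → MDifferentiableAt (𝓡 m) (𝓡 m).tangent
      (fun y ↦ (⟨y, W y⟩ : TangentBundle (𝓡 m) X)) p →
      VectorField.mlieBracket (𝓡 m) V W p =
      fderiv ℝ (fieldChart W p) (extChartAt (𝓡 m) p p) (fieldChart V p (extChartAt (𝓡 m) p p)) -
      fderiv ℝ (fieldChart V p) (extChartAt (𝓡 m) p p)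
        (fieldChart W p (extChartAt (𝓡 m) p p)) := fun hV hW ↦
    (mfderiv_chart_self p _).symm.trans (mfderiv_chart_mlieBracket hp hV hW)
  let j : EuclideanSpace ℝ (Fin m) →L[ℝ] EuclideanSpace ℝ (Fin m) :=
    endoChart J p (extChartAt (𝓡 m) p p)
  let dj := fderiv ℝ (endoChart J p) (extChartAt (𝓡 m) p p)
  let v : EuclideanSpace ℝ (Fin m) := fieldChart V p (extChartAt (𝓡 m) p p)
  let w : EuclideanSpace ℝ (Fin m) := fieldChart W p (extChartAt (𝓡 m) p p)
  let DV := fderiv ℝ (fieldChart V p) (extChartAt (𝓡 m) p p)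
  let DW := fderiv ℝ (fieldChart W p) (extChartAt (𝓡 m) p p)
  have jj : ∀ a, j (j a) = -a := by
    intro a
    have e1 : ∀ a, j a = J p a := fun a ↦ endoChart_self J p a
    exact (e1 (j a)).trans ((congrArg (J p) (e1 a)).trans (hJ2 p a))
  have fJ : ∀ V : VectField m X, fieldChart (fun z ↦ J z (V z)) p (extChartAt (𝓡 m) p p) =
      j (fieldChart V p (extChartAt (𝓡 m) p p)) := fun V ↦ (ev V).self_of_nhds
  have DJ : ∀ {V : VectField m X}, DifferentiableAt ℝ (fieldChart V p) (extChartAt (𝓡 m) p p) →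
      ∀ u, fderiv ℝ (fieldChart (fun z ↦ J z (V z)) p) (extChartAt (𝓡 m) p p) u =
      j (fderiv ℝ (fieldChart V p) (extChartAt (𝓡 m) p p) u) +
        dj u (fieldChart V p (extChartAt (𝓡 m) p p)) := by
    intro V hV u
    rw [(ev V).fderiv_eq, ((hJ p).hasFDerivAt.clm_apply hV.hasFDerivAt).fderiv]
    rfl
  have b1 : VectorField.mlieBracket (𝓡 m) (fun y ↦ J y (V y)) (fun y ↦ J y (W y)) p =
      (j (DW (j v)) + dj (j v) w) - (j (DV (j w)) + dj (j w) v) := by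
    refine (br (sJ hV) (sJ hW)).trans ?_
    rw [fJ, fJ, DJ (dv hV), DJ (dv hW)]
  have b2 : VectorField.mlieBracket (𝓡 m) (fun y ↦ J y (V y)) W p =
      DW (j v) - (j (DV w) + dj w v) := by
    refine (br (sJ hV) hW).trans ?_
    rw [fJ, DJ (dv hV)]
  have b3 : VectorField.mlieBracket (𝓡 m) V (fun y ↦ J y (W y)) p =
      (j (DW v) + dj v w) - DV (j w) := by
    refine (br hV (sJ hW)).trans ?_
    rw [fJ, DJ (dv hW)]
  have b4 : VectorField.mlieBracket (𝓡 m) V W p = DW v - DV w := br hV hW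
  have eJ : ∀ a : EuclideanSpace ℝ (Fin m), J p a = j a := fun a ↦ (endoChart_self J p a).symm
  -- The derivatives of V and W cancel by j² = -1, which is the tensoriality of the Nijenhuis
  -- bracket; only the derivative of the endomorphism field survives.
  have key : ((j (DW (j v)) + dj (j v) w) - (j (DV (j w)) + dj (j w) v)) -
      j (DW (j v) - (j (DV w) + dj w v)) - j ((j (DW v) + dj v w) - DV (j w)) -
      (DW v - DV w) = 0 := by
    have h1 : dj (j v) w - dj (j w) v + j (dj w v) - j (dj v w) = 0 := hN p v w
    simp only [map_sub, map_add, jj]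
    rw [← h1]
    abel
  have c2 := (congrArg (J p) b2).trans (eJ _)
  have c3 := (congrArg (J p) b3).trans (eJ _)
  rw [b1, b4]
  refine Eq.trans ?_ key
  exact congrArg₂ (fun a b : EuclideanSpace ℝ (Fin m) ↦
    ((j (DW (j v)) + dj (j v) w) - (j (DV (j w)) + dj (j w) v)) - a - b - (DW v - DV w)) c2 c3

end Transfer

/-! ### Pointwise hyperkähler data with closed forms is hyperkähler -/

section Integrability

theorem contDiffAt_formBilin_comp {E F : Type*} [NormedAddCommGroup E] [NormedSpace ℝ E]
    [FiniteDimensional ℝ E] [NormedAddCommGroup F] [NormedSpace ℝ F]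
    {S : F → E [⋀^Fin 2]→L[ℝ] ℝ} {J : F → E →L[ℝ] E} {x : F} {n : WithTop ℕ∞}
    (hS : ContDiffAt ℝ n S x) (hJ : ContDiffAt ℝ n J x) :
    ContDiffAt ℝ n (fun y ↦ (formBilin (-S y)).comp (J y)) x :=
  (contDiffAt_formBilin hS.neg).clm_comp hJ

variable {m : ℕ} {X : Type*} [TopologicalSpace X] [ChartedSpace (EuclideanSpace ℝ (Fin m)) X]
  [IsManifold (𝓡 m) ∞ X]

theorem inChart_two_apply (η : DForm m X 2) (p : X) (z v w : EuclideanSpace ℝ (Fin m)) :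
    inChart η p z ![v, w] =
      η ((extChartAt (𝓡 m) p).symm z) ![chartInv p z v, chartInv p z w] := by
  rw [inChart_apply]
  congr 1
  funext i
  fin_cases i <;> rfl

theorem chartInv_endoChart (J : EndoField m X) (p : X) {z : EuclideanSpace ℝ (Fin m)}
    (hz : z ∈ (extChartAt (𝓡 m) p).target) (v : EuclideanSpace ℝ (Fin m)) :
    chartInv p z (endoChart J p z v) = J ((extChartAt (𝓡 m) p).symm z) (chartInv p z v) := by
  rw [endoChart_apply, chartInv_chartD p hz]

/-- Smooth closed two-forms which are pointwise the two-forms of a quaternionic structure and of a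
Euclidean metric form a hyperkähler triple. -/
theorem isHyperkahlerTriple_of_pointwise {τ : Fin 3 → DForm m X 2}
    (hs : ∀ b y, SmoothFormAt (τ b) y) (hd : ∀ b y, d (τ b) y = 0)
    (h : ∀ y, ∃ (I : Fin 3 → EuclideanSpace ℝ (Fin m) →ₗ[ℝ] EuclideanSpace ℝ (Fin m))
      (g : EuclideanSpace ℝ (Fin m) →ₗ[ℝ] EuclideanSpace ℝ (Fin m) →ₗ[ℝ] ℝ),
      IsPointwiseHyperkahler (fun b v w ↦ τ b y ![v, w]) I g) :
    IsHyperkahlerTriple τ := by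
  -- Chosen separately at every point, without any continuity. Smoothness is recovered below from
  -- the smooth forms.
  choose I₀ g₀ hI using h
  let I : Fin 3 → EndoField m X := fun a y ↦
    (LinearMap.toContinuousLinearMap (I₀ y a) :
      EuclideanSpace ℝ (Fin m) →L[ℝ] EuclideanSpace ℝ (Fin m))
  let g : Π y : X, TangentSpace (𝓡 m) y →L[ℝ] TangentSpace (𝓡 m) y →L[ℝ] ℝ := fun y ↦
    (bilinCLM (g₀ y) : EuclideanSpace ℝ (Fin m) →L[ℝ] EuclideanSpace ℝ (Fin m) →L[ℝ] ℝ)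
  have hsq : ∀ a y (v : TangentSpace (𝓡 m) y), I a y (I a y v) = -v := fun a y v ↦ (hI y).sq a v
  have hform : ∀ a y (v w : TangentSpace (𝓡 m) y), τ a y ![v, w] = g y (I a y v) w :=
    fun a y v w ↦ (hI y).form a v w
  have horth : ∀ a y (v w : TangentSpace (𝓡 m) y), g y (I a y v) (I a y w) = g y v w :=
    fun a y v w ↦ (hI y).orth a v w
  have hanti : ∀ a y (v : TangentSpace (𝓡 m) y), I (a + 1) y (I a y v) = -I (a + 2) y v :=
    fun a y v ↦ (hI y).anti a v
  have hpos : ∀ y (v : TangentSpace (𝓡 m) y), v ≠ 0 → 0 < g y v v := fun y v hv ↦ (hI y).pos v hv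
  -- From I_{a+1}Iₐ = -I_{a+2}: σ_{a+1}(Iₐ·,·) = -σ_{a+2}. As σ_{a+1} is nondegenerate, this
  -- determines Iₐ from the forms; it yields both smoothness and integrability.
  have hrel : ∀ a p, ∀ z ∈ (extChartAt (𝓡 m) p).target, ∀ v w : EuclideanSpace ℝ (Fin m),
      inChart (τ (a + 1)) p z ![endoChart (I a) p z v, w] = -inChart (τ (a + 2)) p z ![v, w] := by
    intro a p z hz v w
    rw [inChart_two_apply, inChart_two_apply, chartInv_endoChart _ p hz, hform, hform, hanti,
      map_neg, neg_apply]
  have hJsq : ∀ a p, ∀ z ∈ (extChartAt (𝓡 m) p).target, ∀ v : EuclideanSpace ℝ (Fin m),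
      endoChart (I a) p z (endoChart (I a) p z v) = -v := by
    intro a p z hz v
    rw [endoChart_apply, chartInv_endoChart _ p hz, hsq, map_neg, chartD_chartInv p hz]
  have hnd : ∀ a p, ∀ z ∈ (extChartAt (𝓡 m) p).target, ∀ v : EuclideanSpace ℝ (Fin m),
      (∀ w, inChart (τ a) p z ![v, w] = 0) → v = 0 := by
    intro a p z hz v hv
    have h1 := hv (endoChart (I a) p z v)
    rw [inChart_two_apply, chartInv_endoChart _ p hz, hform, horth] at h1
    have h2 : chartInv p z v = 0 := by
      by_contra hne
      exact (hpos _ _ hne).ne' h1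
    rw [← chartD_chartInv p hz v, h2, map_zero]
  have hS : ∀ a p, ContDiffAt ℝ ∞ (inChart (τ a) p) (extChartAt (𝓡 m) p p) := fun a p ↦ hs a p
  have htar : ∀ p : X, ∀ᶠ z in 𝓝 (extChartAt (𝓡 m) p p), z ∈ (extChartAt (𝓡 m) p).target :=
    fun p ↦ extChartAt_target_mem_nhds p
  have hrel' : ∀ a p, ∀ᶠ z in 𝓝 (extChartAt (𝓡 m) p p), ∀ v w : EuclideanSpace ℝ (Fin m),
      inChart (τ (a + 1)) p z ![endoChart (I a) p z v, w] = -inChart (τ (a + 2)) p z ![v, w] :=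
    fun a p ↦ (htar p).mono fun z hz ↦ hrel a p z hz
  have hJ : ∀ a p, ContDiffAt ℝ ∞ (endoChart (I a) p) (extChartAt (𝓡 m) p p) := fun a p ↦
    contDiffAt_of_form_eq (hS (a + 1) p) (hS (a + 2) p)
      (hnd (a + 1) p _ (mem_extChartAt_target p)) (hrel' a p)
  have hext : ∀ a p, extDeriv (inChart (τ a) p) (extChartAt (𝓡 m) p p) = 0 := by
    intro a p
    rw [← inChart_d (mem_extChartAt_source p) (hs a p)]
    have h0 : d (τ a) = 0 := funext (hd a)
    rw [h0]
    rfl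
  refine ⟨⟨g, fun y v w ↦ (hI y).symm v w, hpos, fun y ↦ ?_, fun p ↦ ?_⟩, I, fun a p _ ↦ ?_,
    fun y ↦ ⟨fun a ↦ hsq a y, fun a v ↦ (hI y).mul a v, fun a ↦ hanti a y⟩, fun a ↦ ?_,
    fun a y ↦ horth a y, fun a y ↦ hform a y, fun a ↦ smoothFormOn_univ (hs a),
    fun a ↦ funext (hd a)⟩
  · exact isVonNBounded_bilin (bilinCLM (g₀ y)) fun v hv ↦ (hI y).pos v hv
  -- The metric is smooth because it is -σ(I·,·) for the index 0, a composite of fields already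
  -- known to be smooth.
  · refine contMDiffAt_bilin (contDiffAt_formBilin_comp (hS 0 p) (hJ 0 p)) fun x hx v w ↦ ?_
    have hx' := (extChartAt (𝓡 m) p).map_source hx
    have h1 : -inChart (τ 0) p (extChartAt (𝓡 m) p x)
        ![endoChart (I 0) p (extChartAt (𝓡 m) p x) v, w] =
        g ((extChartAt (𝓡 m) p).symm (extChartAt (𝓡 m) p x))
          (chartInv p (extChartAt (𝓡 m) p x) v) (chartInv p (extChartAt (𝓡 m) p x) w) := by
      rw [inChart_two_apply, chartInv_endoChart _ p hx', hform, hsq, map_neg, neg_apply, neg_neg]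
    refine Eq.trans ?_ h1.symm
    rw [(extChartAt (𝓡 m) p).left_inv hx]
    rfl
  · exact (contMDiffAt_endo_iff.2 (hJ a p)).contMDiffWithinAt
  · refine nijenhuisVanishes_of_chart (fun p ↦ (hJ a p).differentiableAt (by simp)) (hsq a)
      fun p v w ↦ ?_
    exact nijenhuis_eq_zero_of_closed ((hS (a + 1) p).of_le (by norm_cast))
      ((hS (a + 2) p).differentiableAt (by simp)) ((hJ a p).differentiableAt (by simp))
      (hnd (a + 1) p _ (mem_extChartAt_target p)) (hrel' a p)
      ((htar p).mono fun z hz ↦ hJsq a p z hz) (hext (a + 1) p) (hext (a + 2) p) v w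

end Integrability

end HKQK

end

theorem mainTheorem4 (n : ℕ) (hn : 1 ≤ n)
    -- the quaternion-Kähler manifold `N`
    {N : Type*} [TopologicalSpace N] [T2Space N] [SecondCountableTopology N]
    [ChartedSpace (EuclideanSpace ℝ (Fin (4 * n))) N] [IsManifold (𝓡 (4 * n)) ∞ N]
    [RiemannianBundle (fun p : N ↦ TangentSpace (𝓡 (4 * n)) p)]
    [IsContMDiffRiemannianBundle (𝓡 (4 * n)) ∞ (EuclideanSpace ℝ (Fin (4 * n)))
      (fun p : N ↦ TangentSpace (𝓡 (4 * n)) p)]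
    (D : HKQK.AffineConnection (4 * n) N)
    (G : Π p : N, Submodule ℝ
      (TangentSpace (𝓡 (4 * n)) p →L[ℝ] TangentSpace (𝓡 (4 * n)) p))
    (hQK : HKQK.IsNegativeQK D G)
    -- the Killing field `Z`
    (Z : HKQK.VectField (4 * n) N) (hZ : HKQK.SmoothVectField Z)
    (hKilling : HKQK.IsLieInvariantOn Z (fun _ v w ↦ ⟪v, w⟫_ℝ) Set.univ)
    -- the circle bundle `pr : P → N` and the gauges
    {P : Type*} [TopologicalSpace P] [T2Space P] [SecondCountableTopology P]
    [ChartedSpace (EuclideanSpace ℝ (Fin (4 * n + 1))) P] [IsManifold (𝓡 (4 * n + 1)) ∞ P]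
    [MulAction Circle P] (pr : P → N) (hpr : HKQK.IsPrincipalCircleBundle n pr)
    {ι : Type*} (𝔤 : ι → HKQK.Gauge n N P)
    (hcover : ∀ p : N, ∃ i, p ∈ (𝔤 i).U)
    (hadapted : ∀ i, (𝔤 i).IsAdapted pr D G Z)
    (hcompatible : ∀ i j, (𝔤 i).Compatible (𝔤 j) pr)
    (hpos : ∀ i, ∀ p ∈ (𝔤 i).U, 2 * ‖Z p‖ < (𝔤 i).β p (Z p))
    -- the lift `Z'` of `Z` with `dx(Z') = 0`
    (Z' : HKQK.VectField (4 * n + 1) P)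
    (hlift : ∀ p, mfderiv (𝓡 (4 * n + 1)) (𝓡 (4 * n)) pr p (Z' p) = Z (pr p))
    (hhor : ∀ i, ∀ p, pr p ∈ (𝔤 i).U → HKQK.dAngle (𝔤 i).c p (Z' p) = 0)
    -- the quotient `q : P → M` by the flow of `Z'`
    {M : Type*} [TopologicalSpace M] [T2Space M] [SecondCountableTopology M]
    [ChartedSpace (EuclideanSpace ℝ (Fin (4 * n))) M] [IsManifold (𝓡 (4 * n)) ∞ M]
    (q : P → M) (hq : ContMDiff (𝓡 (4 * n + 1)) (𝓡 (4 * n)) ∞ q)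
    (hq_surj : Function.Surjective q)
    (hq_subm : ∀ p, Function.Surjective (mfderiv (𝓡 (4 * n + 1)) (𝓡 (4 * n)) q p))
    (hq_fibre : ∀ p p' : P, q p = q p' ↔ HKQK.SameOrbit Z' p p') :
    -- the forms descend to a hyperkähler triple
    ∃ τ : Fin 3 → HKQK.DForm (4 * n) M 2,
      (∀ i, ∀ p, pr p ∈ (𝔤 i).U → ∀ a, HKQK.pullback q (τ a) p = (𝔤 i).σ pr Z a p) ∧
      HKQK.IsHyperkahlerTriple τ ∧
      -- the circle action descends, fixes `σ₁` and rotates `σ₂, σ₃`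
      ∃ ρ : Circle → M → M,
        ρ 1 = id ∧ (∀ z w, ρ (z * w) = ρ z ∘ ρ w) ∧
        ContMDiff ((𝓡 1).prod (𝓡 (4 * n))) (𝓡 (4 * n)) ∞ (fun zx : Circle × M ↦ ρ zx.1 zx.2) ∧
        (∀ z p, q (z • p) = ρ z (q p)) ∧
        ∀ z : Circle,
          HKQK.pullback (ρ z) (τ 0) = τ 0 ∧
          HKQK.pullback (ρ z) (τ 1) =
            HKQK.cosTwo z • τ 1 - HKQK.sinTwo z • τ 2 ∧
          HKQK.pullback (ρ z) (τ 2) =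
            HKQK.sinTwo z • τ 1 + HKQK.cosTwo z • τ 2 := by
  have hS : ∀ i, (𝔤 i).IsStructured pr D G Z := fun i ↦
    ⟨hpr.smooth, hZ, hQK.leviCivita, hadapted i,
      fun _ hp ↦ (hadapted i).structureAt hQK hn hZ hKilling hp, hpos i⟩
  have hC : HKQK.IsCorrespondence pr D G Z 𝔤 Z' :=
    ⟨hn, hpr, hS, hcover, hcompatible, hlift, hhor⟩
  have hQ : HKQK.IsOrbitQuotient Z' q := ⟨hq, hq_surj, hq_subm, hq_fibre⟩
  obtain ⟨τ, hτ, hτs, hτd⟩ := hC.exists_descended hQ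
  obtain ⟨ρ, h1, h2, h3, h4⟩ := hC.exists_descended_action hQ
  refine ⟨τ, fun i p hp a ↦ ?_,
    HKQK.isHyperkahlerTriple_of_pointwise hτs hτd (hC.exists_pointwise hQ hτ),
    ρ, h1, h2, h3, h4, hC.pullback_action hQ hτ h3 h4⟩
  rw [hτ a, hC.form_eq hp]
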